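/- **Setting.** Let $k\ge 1$. The bow consists of $k$ intervals $I_\sigma=[p_{\sigma-1}+,p_\sigma-]$, $\sigma\in\mathbb Z/k$, of positive lengths; the point $p_\sigma$ joins the right end $p_\sigma-$ of $I_\sigma$ to the left end $p_\sigma+$ of $I_{\sigma+1}$, so that gluing gives a circle. A representation $\mathfrak R$ is a finite set $\Lambda$ of interior points of the intervals ($\lambda$-points) and a locally constant rank $R(s)\in\mathbb Z_{\ge0}$ off $\Lambda\cup\{p_\sigma\}$. Let $\Lambda^0,\Lambda^+,\Lambda^-$ be the $\lambda$-points where the rank is continuous, increases, decreases. $E$ is a collection of Hermitian bundles of rank $R$ over the closed subintervals into which the $\lambda$-points cut the $I_\sigma$, with a fixed reference Hermitian connection $\nabla^0$ and, at each $\lambda$, a fixed isometric injection of the smaller fibre into the larger one; its image is the continuing subspace, the orthogonal complement of the image the terminating subspace. Let $S=\mathbb C^2$ with imaginary quaternion units $e_1,e_2,e_3$ (acting complex linearly, $e_1e_2=e_3$), $\mathrm{Im}\,M=M-\frac12 1_S\otimes\mathrm{tr}_SM$ on $\mathrm{End}(S\otimes V)$, and for $\beta=\binom{\beta_1}{\beta_2}\in\mathrm{Hom}(A,S\otimes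 V)$ let $\beta^c=\binom{-\beta_2^*}{\beta_1^*}\in\mathrm{Hom}(V,S\otimes A)$. **Data.** Bow data consist of $Q_\lambda\in\mathrm{Hom}(\mathbb C,S\otimes E_\lambda)$ for $\lambda\in\Lambda^0$, $B_\sigma\in\mathrm{Hom}(E_{p_\sigma+},S\otimes E_{p_\sigma-})$, a Hermitian connection $\nabla=\nabla^0+\mathrm iT_0$ with $T_0\in L^2$, and Hermitian $T_1,T_2,T_3$ which are locally $L^2$ on the closed subintervals, except that at $\lambda\in\Lambda^\pm$, on the side of larger rank and in a $\nabla$-parallel frame, $T_j+\frac{\mathrm i\rho_j}{2(s-\lambda)}$ is $L^2$ near $\lambda$, where $\rho_1,\rho_2,\rho_3$ vanish on the continuing subspace and form an irreducible representation, $[\rho_i,\rho_j]=2\rho_l$ for $(i,j,l)$ cyclic, on the terminating subspace. Put $\tilde{\mathbb T}=\sum_j e_j\otimes T_j$. Fix pairwise distinct $\nu_\sigma\in\mathrm{Im}\,\mathbb H$. The data have moment map $\mathrm i\nu$, $\nu=\sum_\sigma\nu_\sigma\otimes 1_E(\delta_{p_\sigma-}-\delta_{p_\sigma+})$, if: $[\mathrm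 i\nabla_{d/ds},T_1]=[T_2,T_3]$ and cyclically on each subinterval; $\tilde{\mathbb T}(\lambda+)-\tilde{\mathbb T}(\lambda-)=\mathrm{Im}\,\mathrm iQ_\lambda Q_\lambda^\dagger$ at $\lambda\in\Lambda^0$; the block of $T_j$ on the continuing subspace is continuous across each $\lambda\in\Lambda^\pm$; and $\tilde{\mathbb T}(p_\sigma-)-\nu_\sigma=-\mathrm{Im}\,\mathrm iB_\sigma B_\sigma^\dagger$, $\tilde{\mathbb T}(p_\sigma+)-\nu_\sigma=\mathrm{Im}\,\mathrm iB_\sigma^c(B_\sigma^c)^\dagger$. The data are *without abelian factors* (WAF) if $E$ has no subbundle, of positive rank over each $I_\sigma$ and continuous through the $\lambda$-points within the continuing subspaces, that is preserved by $\nabla$ and the $T_j$ and on which the $T_j$ are $\nabla$-constant over each $I_\sigma$ and commute. The small representation $\mathfrak s$ has no $\lambda$-points and rank $1$, with line bundle $e$; let $\mu_{\mathfrak s}^{-1}(\mathrm i\nu)$ be the set of its data $(t,b)=(t_0,t_1,t_2,t_3,b)$ with moment map $\mathrm i\nu$. Let $\mathcal G^0(\mathfrak s)$ be the group of unitary $H^1$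 functions $g$ on $\bigsqcup_\sigma I_\sigma$ with $g=1$ at a fixed base point interior to one of the intervals, acting by $t_0\mapsto t_0-\mathrm ig^{-1}g'$, $t_j\mapsto t_j$ $(j=1,2,3)$, $b_\sigma\mapsto g(p_\sigma-)^{-1}b_\sigma g(p_\sigma+)$, and put $\mathrm{TN}_k^\nu=\mu_{\mathfrak s}^{-1}(\mathrm i\nu)/\mathcal G^0(\mathfrak s)$. **Operator.** For $(t,b)\in\mu_{\mathfrak s}^{-1}(\mathrm i\nu)$ let $D_{t,b}$ be defined on the $H^1$ sections $f$ of $S\otimes E\otimes e^*$ over the subintervals whose terminating components vanish and whose continuing components are continuous at the $\lambda$-points, with values in $L^2(S\otimes E\otimes e^*)\oplus\bigoplus_{\lambda\in\Lambda^0}e^*_\lambda\oplus\bigoplus_\sigma\big(E_{p_\sigma+}\otimes e^*_{p_\sigma-}\oplus E_{p_\sigma-}\otimes e^*_{p_\sigma+}\big)$, by $$D_{t,b}f=\Big(-\nabla^0_{d/ds}f-\mathrm i(T_0-t_0)f+\mathrm i\sum_{j=1}^3e_j(T_j-t_j)f,\;-Q_\lambda^\dagger f(\lambda),\;B_\sigma^\dagger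 f(p_\sigma-)-b_\sigma^\dagger f(p_\sigma+),\;(b_\sigma^c)^\dagger f(p_\sigma-)-(B_\sigma^c)^\dagger f(p_\sigma+)\Big).$$ Let $D_{t,b}^\dagger$ be its adjoint, from this target space to the dual of the space of such $f$. **Theorem.** Let data for $\mathfrak R$ have moment map $\mathrm i\nu$ and be WAF. Then for every $(t,b)\in\mu_{\mathfrak s}^{-1}(\mathrm i\nu)$ $$\dim_{\mathbb C}\ker D^\dagger_{t,b}=|\Lambda|.$$ Consequently the instanton bundle $\mathcal E\to\mathrm{TN}_k^\nu$, the descent of the $\mathcal G^0(\mathfrak s)$-equivariant family $\ker D^\dagger_{t,b}$, has rank $|\Lambda|$: every fibre of $\mathcal E$ has complex dimension $|\Lambda|$. -/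

import Mathlib

open MeasureTheory Set Filter Topology
open scoped Kronecker

noncomputable section

namespace BowIndex

/-! ### Quaternions, spinors and charge conjugation

The spin space is `S = ℂ²`, and `S ⊗ V` for `V = ℂ^ι` is `Fin 2 × ι → ℂ`. -/

/-- The imaginary quaternion units acting on the left of `S = ℂ²`
(with the identification `v = v₁ + J v₂`). -/
def quat : Fin 3 → Matrix (Fin 2) (Fin 2) ℂ :=
  ![!![Complex.I, 0; 0, -Complex.I], !![0, -1; 1, 0], !![0, -Complex.I; -Complex.I, 0]]

/-- The partial trace over the spin space. -/
def trSpin {ι : Type*} (M : Matrix (Fin 2 × ι) (Fin 2 × ι) ℂ) : Matrix ι ι ℂ :=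
  fun i j => ∑ a, M (a, i) (a, j)

/-- The (complex linear) imaginary part `Im M = M - ½ 1 ⊗ tr_S M` of an endomorphism of `S ⊗ V`. -/
def imPart {ι : Type*} (M : Matrix (Fin 2 × ι) (Fin 2 × ι) ℂ) :
    Matrix (Fin 2 × ι) (Fin 2 × ι) ℂ :=
  M - (1 / 2 : ℂ) • ((1 : Matrix (Fin 2) (Fin 2) ℂ) ⊗ₖ trSpin M)

/-- Charge conjugation `Hom(A, S ⊗ B) → Hom(B, S ⊗ A)`, `(β₁, β₂) ↦ (-β₂*, β₁*)`. -/
def chargeConj {A B : Type*} (β : Matrix (Fin 2 × B) A ℂ) : Matrix (Fin 2 × A) B ℂ :=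
  fun x y => if x.1 = 0 then -star (β (1, y) x.2) else star (β (0, y) x.2)

/-- `∑ⱼ eⱼ ⊗ Mⱼ`. -/
def imQuat {ι : Type*} (M : Fin 3 → Matrix ι ι ℂ) : Matrix (Fin 2 × ι) (Fin 2 × ι) ℂ :=
  ∑ j, quat j ⊗ₖ M j

/-! ### Sobolev functions and parallel frames on an interval -/

/-- `f` is an `H¹` function on `[a, b]` with weak derivative `f' ∈ L²`
(`f` denoting the continuous representative). -/
def IsH1 {E : Type*} [NormedAddCommGroup E] [NormedSpace ℝ E] (a b : ℝ) (f f' : ℝ → E) : Prop :=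
  MemLp f' 2 (volume.restrict (Ioc a b)) ∧ ∀ x ∈ Icc a b, f x = f a + ∫ s in a..x, f' s

/-- The columns of `Φ` are sections on `[a, b]` which are parallel for the connection
`d/ds + i T₀` (with `T₀` square integrable). -/
def IsParallel {ι κ : Type*} [Fintype ι] (T₀ : ℝ → Matrix ι ι ℂ) (a b : ℝ)
    (Φ : ℝ → Matrix ι κ ℂ) : Prop :=
  ContinuousOn Φ (Icc a b) ∧
    ∀ x ∈ Icc a b, ∀ i j, Φ x i j = Φ a i j - Complex.I * ∫ s in a..x, (T₀ s * Φ s) i j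

/-- Square integrability of a matrix valued function on a set. -/
def SqIntOn {ι κ : Type*} (F : ℝ → Matrix ι κ ℂ) (A : Set ℝ) : Prop :=
  ∀ i j, MemLp (fun s => F s i j) 2 (volume.restrict A)

/-! ### Bows and their representations -/

/-- An affine `A_{k-1}` bow: `k` intervals `I_σ = [0, len σ]`, each with its own coordinate,
cyclically ordered by `σ ↦ σ + 1`. The edge `p_σ` joins the right end `p_σ-` of `I_σ` to the left
end `p_σ+` of `I_{σ+1}`. The origin `s = 0` of the circle is an interior point of
the interval of index `0`. -/
structure Bow (k : ℕ) [NeZero k] where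
  len : Fin k → ℝ
  len_pos : ∀ σ, 0 < len σ
  origin : ℝ
  origin_mem : origin ∈ Ioo 0 (len 0)

variable {k : ℕ} [NeZero k]

/-- A bow representation together with its Hermitian bundle and the identifications of fibres at
the `λ`-points. There are `n σ` `λ`-points in the interior of `I_σ`, at increasing positions
`lam σ`, cutting `I_σ` into subintervals of index `0, …, n σ`. Over each of them the bundle is
trivialised by a unitary frame parallel for the reference connection `∇⁰`, so that its
fibre is `ℂ ^ rank σ α` and `∇⁰ = d/ds`.

`kap σ a` encodes the isometric injection `κ_λ` at the `λ`-point `a`: it is `κ_λ` when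
the rank does not decrease, and the adjoint of `κ_λ` when the rank decreases. -/
structure BowRep (B : Bow k) where
  n : Fin k → ℕ
  lam : ∀ σ, Fin (n σ) → ℝ
  lam_mono : ∀ σ, StrictMono (lam σ)
  lam_mem : ∀ σ a, lam σ a ∈ Ioo 0 (B.len σ)
  rank : ∀ σ, Fin (n σ + 1) → ℕ
  kap : ∀ σ (a : Fin (n σ)), Matrix (Fin (rank σ a.succ)) (Fin (rank σ a.castSucc)) ℂ
  kap_up : ∀ σ a, rank σ a.castSucc ≤ rank σ a.succ →
    (kap σ a).conjTranspose * kap σ a = 1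
  kap_down : ∀ σ a, rank σ a.succ ≤ rank σ a.castSucc →
    kap σ a * (kap σ a).conjTranspose = 1

namespace BowRep

variable {B : Bow k} (R : BowRep B)

/-- Left end of the subinterval `α` of `I_σ`. -/
def lo (σ : Fin k) (α : Fin (R.n σ + 1)) : ℝ :=
  Fin.cons (α := fun _ => ℝ) 0 (R.lam σ) α

/-- Right end of the subinterval `α` of `I_σ`. -/
def hi (σ : Fin k) (α : Fin (R.n σ + 1)) : ℝ :=
  Fin.snoc (α := fun _ => ℝ) (R.lam σ) (B.len σ) α

/-- The total number of `λ`-points. -/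
def numLam : ℕ := ∑ σ, R.n σ

/-- The `λ`-points of continuous rank. -/
def Lam0 : Type :=
  {a : Σ σ, Fin (R.n σ) // R.rank a.1 a.2.castSucc = R.rank a.1 a.2.succ}

instance : Fintype R.Lam0 := by unfold Lam0; infer_instance

/-- `R(p_σ-)`. -/
abbrev rankL (σ : Fin k) : ℕ := R.rank σ (Fin.last _)

/-- `R(p_σ+)`. -/
abbrev rankR (σ : Fin k) : ℕ := R.rank (σ + 1) 0

end BowRep

/-- The small representation: no `λ`-points, rank one. -/
def smallRep (B : Bow k) : BowRep B where
  n := fun _ => 0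
  lam := fun _ a => a.elim0
  lam_mono := fun _ a => a.elim0
  lam_mem := fun _ a => a.elim0
  rank := fun _ _ => 1
  kap := fun _ a => a.elim0
  kap_up := fun _ a => a.elim0
  kap_down := fun _ a => a.elim0

/-! ### Bow data -/

/-- `ρ₁, ρ₂, ρ₃` vanish on the continuing subspace `range Cᴴ` of `ℂ^ι`, and form an irreducible
representation of `su(2)` on its orthogonal complement `ker C`, the terminating subspace. -/
structure IsTermIrrep {ι κ : Type*} [Fintype ι] [Fintype κ] (C : Matrix κ ι ℂ)
    (ρ : Fin 3 → Matrix ι ι ℂ) : Prop where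
  cont : ∀ j, ρ j * C.conjTranspose = 0
  term : ∀ j, C * ρ j = 0
  comm : ∀ j, ρ j * ρ (j + 1) - ρ (j + 1) * ρ j = (2 : ℂ) • ρ (j + 2)
  irred : ∀ W : Submodule ℂ (ι → ℂ), W ≤ LinearMap.ker C.mulVecLin →
    (∀ j, ∀ v ∈ W, (ρ j).mulVec v ∈ W) → W = ⊥ ∨ W = LinearMap.ker C.mulVecLin

/-- On the bundle with connection `d/ds + i T₀` over `[a, b]`, the endomorphisms `Tⱼ` have at the
end point `x₀` a Nahm pole in the terminating block `ker C`: in the parallel frame `U` equal to the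
given frame at `x₀`, the functions `Tⱼ + i ρⱼ / (2 (s - x₀))` are `L²` on the set `A`
(a one-sided neighbourhood of `x₀`), with `ρ` an irreducible representation. -/
def HasNahmPole {ι κ : Type*} [Fintype ι] [DecidableEq ι] [Fintype κ] (C : Matrix κ ι ℂ)
    (T₀ : ℝ → Matrix ι ι ℂ) (T : Fin 3 → ℝ → Matrix ι ι ℂ) (a b x₀ : ℝ) (A : Set ℝ) : Prop :=
  ∃ (ρ : Fin 3 → Matrix ι ι ℂ) (U : ℝ → Matrix ι ι ℂ),
    IsTermIrrep C ρ ∧ IsParallel T₀ a b U ∧ U x₀ = 1 ∧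
      ∀ j, SqIntOn (fun s => (U s).conjTranspose * T j s * U s +
        (Complex.I / (2 * ((s - x₀ : ℝ) : ℂ))) • ρ j) A

/-- The data of a bow representation: Nahm data `(∇ = d/ds + i T₀, T₁, T₂, T₃)`, fundamental data
`Q` and bifundamental data `Bif`. (Over each subinterval `[lo, hi]` only the values on
the open interval matter.) -/
structure BowData {B : Bow k} (R : BowRep B) where
  T0 : ∀ σ α, ℝ → Matrix (Fin (R.rank σ α)) (Fin (R.rank σ α)) ℂ
  T : ∀ σ α, Fin 3 → ℝ → Matrix (Fin (R.rank σ α)) (Fin (R.rank σ α)) ℂ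
  Q : ∀ l : R.Lam0, Fin 2 × Fin (R.rank l.1.1 l.1.2.succ) → ℂ
  Bif : ∀ σ, Matrix (Fin 2 × Fin (R.rankL σ)) (Fin (R.rankR σ)) ℂ
  T0_herm : ∀ σ α, ∀ s ∈ Ioo (R.lo σ α) (R.hi σ α), (T0 σ α s).IsHermitian
  T_herm : ∀ σ α j, ∀ s ∈ Ioo (R.lo σ α) (R.hi σ α), (T σ α j s).IsHermitian
  T0_L2 : ∀ σ α, SqIntOn (T0 σ α) (Ioo (R.lo σ α) (R.hi σ α))
  /-- `L²` on compact subsets of the open subintervals -/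
  T_L2loc : ∀ σ α j, ∀ c d, R.lo σ α < c → d < R.hi σ α → SqIntOn (T σ α j) (Ioo c d)
  /-- `L²` up to the ends of the intervals `I_σ` -/
  T_L2_right : ∀ σ j, ∃ ε > 0, SqIntOn (T σ (Fin.last _) j) (Ioo (B.len σ - ε) (B.len σ))
  T_L2_left : ∀ σ j, ∃ ε > 0, SqIntOn (T σ 0 j) (Ioo 0 ε)
  /-- `L²` up to a `λ`-point on a side which does not have the larger rank -/
  T_L2_lam_left : ∀ σ a j, R.rank σ a.castSucc ≤ R.rank σ a.succ →
    ∃ ε > 0, SqIntOn (T σ a.castSucc j) (Ioo (R.lam σ a - ε) (R.lam σ a))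
  T_L2_lam_right : ∀ σ a j, R.rank σ a.succ ≤ R.rank σ a.castSucc →
    ∃ ε > 0, SqIntOn (T σ a.succ j) (Ioo (R.lam σ a) (R.lam σ a + ε))
  /-- Nahm pole on the right of a `λ`-point of increasing rank -/
  pole_up : ∀ σ a, R.rank σ a.castSucc < R.rank σ a.succ →
    ∃ ε > 0, HasNahmPole (R.kap σ a).conjTranspose (T0 σ a.succ) (T σ a.succ)
      (R.lo σ a.succ) (R.hi σ a.succ) (R.lam σ a) (Ioo (R.lam σ a) (R.lam σ a + ε))
  /-- Nahm pole on the left of a `λ`-point of decreasing rank -/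
  pole_down : ∀ σ a, R.rank σ a.succ < R.rank σ a.castSucc →
    ∃ ε > 0, HasNahmPole (R.kap σ a) (T0 σ a.castSucc) (T σ a.castSucc)
      (R.lo σ a.castSucc) (R.hi σ a.castSucc) (R.lam σ a) (Ioo (R.lam σ a - ε) (R.lam σ a))

namespace BowData

variable {B : Bow k} {R : BowRep B}

/-- `e₁ ⊗ T₁ + e₂ ⊗ T₂ + e₃ ⊗ T₃`. -/
def Tim (d : BowData R) (σ : Fin k) (α : Fin (R.n σ + 1)) (s : ℝ) :
    Matrix (Fin 2 × Fin (R.rank σ α)) (Fin 2 × Fin (R.rank σ α)) ℂ :=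
  imQuat fun j => d.T σ α j s

/-- The moment map equations `μ = i ν` at the level `ν = ∑_σ ν_σ ⊗ 1 (δ_{p_σ-} - δ_{p_σ+})`, where
`ν_σ = ∑ⱼ ν σ j eⱼ`, written out on and at the ends of the subintervals. -/
structure IsSolution (d : BowData R) (ν : Fin k → Fin 3 → ℝ) : Prop where
  /-- the Nahm equations `[i∇, T₁] = [T₂, T₃]` and cyclic permutations, integrated -/
  nahm : ∀ σ α j, ∀ x ∈ Ioo (R.lo σ α) (R.hi σ α), ∀ y ∈ Ioo (R.lo σ α) (R.hi σ α), ∀ i i',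
    Complex.I * (d.T σ α j y i i' - d.T σ α j x i i') =
      ∫ s in x..y, (d.T σ α (j + 1) s * d.T σ α (j + 2) s - d.T σ α (j + 2) s * d.T σ α (j + 1) s
        + (d.T0 σ α s * d.T σ α j s - d.T σ α j s * d.T0 σ α s)) i i'
  /-- the condition at `p_σ-` -/
  end_left : ∀ σ, Tendsto (d.Tim σ (Fin.last _)) (𝓝[<] (B.len σ))
    (𝓝 (imQuat (fun j => ((ν σ j : ℝ) : ℂ) • (1 : Matrix _ _ ℂ))
      - imPart (Complex.I • (d.Bif σ * (d.Bif σ).conjTranspose))))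
  /-- the condition at `p_σ+` -/
  end_right : ∀ σ, Tendsto (d.Tim (σ + 1) 0) (𝓝[>] 0)
    (𝓝 (imQuat (fun j => ((ν σ j : ℝ) : ℂ) • (1 : Matrix _ _ ℂ))
      + imPart (Complex.I • (chargeConj (d.Bif σ) * (chargeConj (d.Bif σ)).conjTranspose))))
  /-- the jump at a `λ`-point of continuous rank -/
  jump : ∀ l : R.Lam0, ∃ L, Tendsto (d.Tim l.1.1 l.1.2.castSucc) (𝓝[<] (R.lam l.1.1 l.1.2)) (𝓝 L) ∧
    Tendsto (d.Tim l.1.1 l.1.2.succ) (𝓝[>] (R.lam l.1.1 l.1.2))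
      (𝓝 (((1 : Matrix (Fin 2) (Fin 2) ℂ) ⊗ₖ R.kap l.1.1 l.1.2) * L *
          ((1 : Matrix (Fin 2) (Fin 2) ℂ) ⊗ₖ R.kap l.1.1 l.1.2).conjTranspose
        + imPart (Complex.I • Matrix.vecMulVec (d.Q l) (star (d.Q l)))))
  /-- no jump of the continuing block at a `λ`-point of increasing rank -/
  cont_up : ∀ σ a, R.rank σ a.castSucc < R.rank σ a.succ → ∀ j, ∃ L,
    Tendsto (d.T σ a.castSucc j) (𝓝[<] (R.lam σ a)) (𝓝 L) ∧
    Tendsto (fun s => (R.kap σ a).conjTranspose * d.T σ a.succ j s * R.kap σ a)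
      (𝓝[>] (R.lam σ a)) (𝓝 L)
  /-- no jump of the continuing block at a `λ`-point of decreasing rank -/
  cont_down : ∀ σ a, R.rank σ a.succ < R.rank σ a.castSucc → ∀ j, ∃ L,
    Tendsto (d.T σ a.succ j) (𝓝[>] (R.lam σ a)) (𝓝 L) ∧
    Tendsto (fun s => R.kap σ a * d.T σ a.castSucc j s * (R.kap σ a).conjTranspose)
      (𝓝[<] (R.lam σ a)) (𝓝 L)

/-- An abelian factor: a subbundle, of positive rank over each interval `I_σ`, preserved by `∇`
and by the `Tⱼ`, and on which the `Tⱼ` are constant and commute. The subbundle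
over `I_σ` is the span of a parallel frame `Φ`, continuous through the `λ`-points, and `C σ j` is
the matrix of `Tⱼ` in this frame. -/
def HasAbelianFactor (d : BowData R) : Prop :=
  ∃ (r : Fin k → ℕ) (Φ : ∀ σ α, ℝ → Matrix (Fin (R.rank σ α)) (Fin (r σ)) ℂ)
    (C : ∀ σ, Fin 3 → Matrix (Fin (r σ)) (Fin (r σ)) ℂ),
    (∀ σ, 0 < r σ) ∧
    (∀ σ α, IsParallel (d.T0 σ α) (R.lo σ α) (R.hi σ α) (Φ σ α)) ∧
    (∀ σ α, ∀ s ∈ Icc (R.lo σ α) (R.hi σ α), Function.Injective (Φ σ α s).mulVec) ∧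
    (∀ σ α j, ∀ s ∈ Ioo (R.lo σ α) (R.hi σ α), d.T σ α j s * Φ σ α s = Φ σ α s * C σ j) ∧
    (∀ σ i j, Commute (C σ i) (C σ j)) ∧
    (∀ σ a, Φ σ a.succ (R.lam σ a) = R.kap σ a * Φ σ a.castSucc (R.lam σ a) ∧
      Φ σ a.castSucc (R.lam σ a) = (R.kap σ a).conjTranspose * Φ σ a.succ (R.lam σ a))

/-- Without abelian factors. -/
def WAF (d : BowData R) : Prop := ¬ d.HasAbelianFactor

end BowData

/-- The level set of the moment map of the small representation. -/
def LevelSet (B : Bow k) (ν : Fin k → Fin 3 → ℝ) : Type :=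
  {p : BowData (smallRep B) // p.IsSolution ν}

namespace LevelSet

variable {B : Bow k} {ν : Fin k → Fin 3 → ℝ} (p : LevelSet B ν)

/-- `t₀` as a scalar function on `I_σ`. -/
def t0 (σ : Fin k) (s : ℝ) : ℂ := p.1.T0 σ (0 : Fin 1) s (0 : Fin 1) (0 : Fin 1)

/-- `tⱼ` as a scalar function on `I_σ`. -/
def t (σ : Fin k) (j : Fin 3) (s : ℝ) : ℂ := p.1.T σ (0 : Fin 1) j s (0 : Fin 1) (0 : Fin 1)

/-- `b_σ` as a vector in `S`. -/
def b (σ : Fin k) (a : Fin 2) : ℂ := p.1.Bif σ (a, (0 : Fin 1)) (0 : Fin 1)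

/-- `b_σ^c` as a vector in `S`. -/
def bc (σ : Fin k) (a : Fin 2) : ℂ := chargeConj (p.1.Bif σ) (a, (0 : Fin 1)) (0 : Fin 1)

end LevelSet

/-! ### The twisted bow Dirac operator -/

/-- An element of `H¹_term(S ⊗ E ⊗ e*)`, with its weak derivative `df`: terminating components
vanish and continuing components are continuous at the `λ`-points. -/
structure TermSection {B : Bow k} (R : BowRep B) where
  f : ∀ σ (α : Fin (R.n σ + 1)), ℝ → (Fin 2 × Fin (R.rank σ α) → ℂ)
  df : ∀ σ (α : Fin (R.n σ + 1)), ℝ → (Fin 2 × Fin (R.rank σ α) → ℂ)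
  h1 : ∀ σ α, IsH1 (R.lo σ α) (R.hi σ α) (f σ α) (df σ α)
  match_right : ∀ σ a, f σ a.succ (R.lam σ a) =
    ((1 : Matrix (Fin 2) (Fin 2) ℂ) ⊗ₖ R.kap σ a).mulVec (f σ a.castSucc (R.lam σ a))
  match_left : ∀ σ a, f σ a.castSucc (R.lam σ a) =
    ((1 : Matrix (Fin 2) (Fin 2) ℂ) ⊗ₖ (R.kap σ a).conjTranspose).mulVec
      (f σ a.succ (R.lam σ a))

/-- The space `L²(S ⊗ E ⊗ e*) ⊕ ⨁_{λ ∈ Λ⁰} W_λ ⊗ e*_λ ⊕ ⨁_σ (E_{p_σ+} ⊗ e*_{p_σ-}) ⊕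
⨁_σ (E_{p_σ-} ⊗ e*_{p_σ+})`, with elements `(χ, w, ν⁺, ν⁻)`. -/
abbrev Target {B : Bow k} (R : BowRep B) : Type :=
  (∀ σ (α : Fin (R.n σ + 1)), Lp (Fin 2 × Fin (R.rank σ α) → ℂ) 2
      (volume.restrict (Ioc (R.lo σ α) (R.hi σ α)))) ×
    (R.Lam0 → ℂ) × (∀ σ, Fin (R.rankR σ) → ℂ) × (∀ σ, Fin (R.rankL σ) → ℂ)

section Dirac

variable {B : Bow k} {R : BowRep B} {ν : Fin k → Fin 3 → ℝ}
  (d : BowData R) (p : LevelSet B ν) (f : TermSection R)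

/-- `𝕋 ⊗ 1 - 1 ⊗ 𝕥 = 1 ⊗ (T₀ - t₀) + ∑ⱼ eⱼ ⊗ (Tⱼ - tⱼ)`. -/
def twistT (σ : Fin k) (α : Fin (R.n σ + 1)) (s : ℝ) :
    Matrix (Fin 2 × Fin (R.rank σ α)) (Fin 2 × Fin (R.rank σ α)) ℂ :=
  (1 : Matrix (Fin 2) (Fin 2) ℂ) ⊗ₖ
      (d.T0 σ α s - p.t0 σ s • (1 : Matrix (Fin (R.rank σ α)) (Fin (R.rank σ α)) ℂ))
    + imQuat fun j =>
        d.T σ α j s - p.t σ j s • (1 : Matrix (Fin (R.rank σ α)) (Fin (R.rank σ α)) ℂ)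

/-- The `L²` component `-f' - i (𝕋 - 𝕥)† f` of `D_{t,b} f`. -/
def diracBulk (σ : Fin k) (α : Fin (R.n σ + 1)) (s : ℝ) : Fin 2 × Fin (R.rank σ α) → ℂ :=
  -f.df σ α s - Complex.I • (twistT d p σ α s).conjTranspose.mulVec (f.f σ α s)

/-- The `W_λ` component `-Q_λ† f(λ)` of `D_{t,b} f`. -/
def diracLam (l : R.Lam0) : ℂ :=
  -(star (d.Q l) ⬝ᵥ f.f l.1.1 l.1.2.succ (R.lam l.1.1 l.1.2))

/-- The `E_{p_σ+} ⊗ e*_{p_σ-}` component `B_σ† f(p_σ-) - b_σ† f(p_σ+)` of `D_{t,b} f`. -/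
def diracPlus (σ : Fin k) : Fin (R.rankR σ) → ℂ :=
  (d.Bif σ).conjTranspose.mulVec (f.f σ (Fin.last _) (B.len σ))
    - fun i => ∑ a, star (p.b σ a) * f.f (σ + 1) 0 0 (a, i)

/-- The `E_{p_σ-} ⊗ e*_{p_σ+}` component `(b_σ^c)† f(p_σ-) - (B_σ^c)† f(p_σ+)` of
`D_{t,b} f`. -/
def diracMinus (σ : Fin k) : Fin (R.rankL σ) → ℂ :=
  (fun i => ∑ a, star (p.bc σ a) * f.f σ (Fin.last _) (B.len σ) (a, i))
    - (chargeConj (d.Bif σ)).conjTranspose.mulVec (f.f (σ + 1) 0 0)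

/-- The pairing `⟨D_{t,b} f, (χ, w, ν⁺, ν⁻)⟩`, that is, the value on the test section `f` of the
distribution `D†_{t,b} (χ, w, ν⁺, ν⁻)`. -/
def diracPairing (Ψ : Target R) : ℂ :=
  (∑ σ, ∑ α, ∫ s in Ioc (R.lo σ α) (R.hi σ α), star (diracBulk d p f σ α s) ⬝ᵥ Ψ.1 σ α s)
    + (∑ l, star (diracLam d f l) * Ψ.2.1 l)
    + (∑ σ, star (diracPlus d p f σ) ⬝ᵥ Ψ.2.2.1 σ)
    + ∑ σ, star (diracMinus d p f σ) ⬝ᵥ Ψ.2.2.2 σ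

/-- The kernel of `D†_{t,b}`. -/
def kerDiracAdj : Submodule ℂ (Target R) where
  carrier := {Ψ | ∀ f : TermSection R,
    (∀ σ α, IntegrableOn (fun s => star (diracBulk d p f σ α s) ⬝ᵥ Ψ.1 σ α s)
      (Ioc (R.lo σ α) (R.hi σ α))) ∧ diracPairing d p f Ψ = 0}
  zero_mem' := by
    intro f
    have h : ∀ σ α, (fun s => star (diracBulk d p f σ α s) ⬝ᵥ (0 : Target R).1 σ α s)
        =ᵐ[volume.restrict (Ioc (R.lo σ α) (R.hi σ α))] fun _ => 0 := by
      intro σ α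
      filter_upwards [Lp.coeFn_zero (Fin 2 × Fin (R.rank σ α) → ℂ) 2
        (volume.restrict (Ioc (R.lo σ α) (R.hi σ α)))] with s hs
      have : (0 : Target R).1 σ α s = 0 := hs
      rw [this, dotProduct_zero]
    refine ⟨fun σ α => (integrable_zero _ _ _).congr (h σ α).symm, ?_⟩
    unfold diracPairing
    simp only [integral_congr_ae (h _ _)]
    simp
  add_mem' := by
    intro Ψ Ψ' h h' f
    have e : ∀ σ α, (fun s => star (diracBulk d p f σ α s) ⬝ᵥ (Ψ + Ψ').1 σ α s)
        =ᵐ[volume.restrict (Ioc (R.lo σ α) (R.hi σ α))] fun s =>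
          star (diracBulk d p f σ α s) ⬝ᵥ Ψ.1 σ α s
            + star (diracBulk d p f σ α s) ⬝ᵥ Ψ'.1 σ α s := by
      intro σ α
      filter_upwards [Lp.coeFn_add (Ψ.1 σ α) (Ψ'.1 σ α)] with s hs
      have : (Ψ + Ψ').1 σ α s = Ψ.1 σ α s + Ψ'.1 σ α s := hs
      rw [this, dotProduct_add]
    refine ⟨fun σ α => (((h f).1 σ α).add ((h' f).1 σ α)).congr (e σ α).symm, ?_⟩
    have h1 := (h f).2
    have h2 := (h' f).2
    have e' : ∀ σ α, (∫ s in Ioc (R.lo σ α) (R.hi σ α),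
          star (diracBulk d p f σ α s) ⬝ᵥ (Ψ + Ψ').1 σ α s) =
        (∫ s in Ioc (R.lo σ α) (R.hi σ α), star (diracBulk d p f σ α s) ⬝ᵥ Ψ.1 σ α s)
        + ∫ s in Ioc (R.lo σ α) (R.hi σ α), star (diracBulk d p f σ α s) ⬝ᵥ Ψ'.1 σ α s :=
      fun σ α => (integral_congr_ae (e σ α)).trans (integral_add ((h f).1 σ α) ((h' f).1 σ α))
    unfold diracPairing at h1 h2 ⊢
    simp only [e']
    simp only [Prod.snd_add, Prod.fst_add, Pi.add_apply, dotProduct_add, mul_add,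
      Finset.sum_add_distrib]
    linear_combination h1 + h2
  smul_mem' := by
    intro c Ψ h f
    have e : ∀ σ α, (fun s => star (diracBulk d p f σ α s) ⬝ᵥ (c • Ψ).1 σ α s)
        =ᵐ[volume.restrict (Ioc (R.lo σ α) (R.hi σ α))] fun s =>
          c * (star (diracBulk d p f σ α s) ⬝ᵥ Ψ.1 σ α s) := by
      intro σ α
      filter_upwards [Lp.coeFn_smul c (Ψ.1 σ α)] with s hs
      have : (c • Ψ).1 σ α s = c • Ψ.1 σ α s := hs
      rw [this, dotProduct_smul, smul_eq_mul]
    refine ⟨fun σ α => (((h f).1 σ α).const_mul c).congr (e σ α).symm, ?_⟩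
    have h1 := (h f).2
    have e' : ∀ σ α, (∫ s in Ioc (R.lo σ α) (R.hi σ α),
          star (diracBulk d p f σ α s) ⬝ᵥ (c • Ψ).1 σ α s) =
        c * ∫ s in Ioc (R.lo σ α) (R.hi σ α), star (diracBulk d p f σ α s) ⬝ᵥ Ψ.1 σ α s :=
      fun σ α => (integral_congr_ae (e σ α)).trans (integral_const_mul _ _)
    unfold diracPairing at h1 ⊢
    simp only [e']
    simp only [Prod.smul_snd, Prod.smul_fst, Pi.smul_apply, dotProduct_smul, smul_eq_mul,
      mul_left_comm _ c, ← Finset.mul_sum]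
    linear_combination c * h1

end Dirac

/-! ### The multi-Taub-NUT space and the instanton bundle -/

/-- The gauge group of the small representation, based at the origin: unitary `H¹` functions
`g` (with weak derivative `dg`) with `g(0) = 1`. -/
structure SmallGauge (B : Bow k) where
  g : Fin k → ℝ → ℂ
  dg : Fin k → ℝ → ℂ
  h1 : ∀ σ, IsH1 0 (B.len σ) (g σ) (dg σ)
  unitary : ∀ σ, ∀ s ∈ Icc 0 (B.len σ), ‖g σ s‖ = 1
  based : g 0 B.origin = 1

/-- `p' = g · p`, where `g · t₀ = t₀ - i g⁻¹ g'`, `g · tⱼ = tⱼ` and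
`g · b_σ = g(p_σ-)⁻¹ b_σ g(p_σ+)`. -/
def IsGaugeImage {B : Bow k} {ν : Fin k → Fin 3 → ℝ} (g : SmallGauge B) (p p' : LevelSet B ν) :
    Prop :=
  (∀ σ, ∀ᵐ s ∂(volume.restrict (Ioc 0 (B.len σ))),
      p'.t0 σ s = p.t0 σ s - Complex.I * (g.g σ s)⁻¹ * g.dg σ s) ∧
    (∀ σ j, ∀ᵐ s ∂(volume.restrict (Ioc 0 (B.len σ))), p'.t σ j s = p.t σ j s) ∧
    ∀ σ a, p'.b σ a = (g.g σ (B.len σ))⁻¹ * p.b σ a * g.g (σ + 1) 0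

/-- The quotient of the level set of the small representation by its based gauge group: the
multi-Taub-NUT space. -/
def TaubNUT (B : Bow k) (ν : Fin k → Fin 3 → ℝ) : Type :=
  Quot fun p p' : LevelSet B ν => ∃ g, IsGaugeImage g p p'

/-- `Ψ' = g · Ψ`, where the gauge transformation `g` of the small representation multiplies
sections of `e*` by `g`. -/
def IsGaugeImageOf {B : Bow k} {R : BowRep B} (g : SmallGauge B) (Ψ Ψ' : Target R) : Prop :=
  (∀ σ α, ∀ᵐ s ∂(volume.restrict (Ioc (R.lo σ α) (R.hi σ α))),
      Ψ'.1 σ α s = g.g σ s • Ψ.1 σ α s) ∧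
    (∀ l : R.Lam0, Ψ'.2.1 l = g.g l.1.1 (R.lam l.1.1 l.1.2) * Ψ.2.1 l) ∧
    (∀ σ, Ψ'.2.2.1 σ = g.g σ (B.len σ) • Ψ.2.2.1 σ) ∧
    ∀ σ, Ψ'.2.2.2 σ = g.g (σ + 1) 0 • Ψ.2.2.2 σ

/-- The fibre at `x` of the instanton bundle, the descent of `Ker D†_{t,b}` to
the quotient: the equivariant families of elements of `Ker D†_{t,b}` over the gauge orbit `x`. -/
def instantonFibre {B : Bow k} {R : BowRep B} {ν : Fin k → Fin 3 → ℝ} (d : BowData R)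
    (x : TaubNUT B ν) : Submodule ℂ ({p : LevelSet B ν // Quot.mk _ p = x} → Target R) where
  carrier := {v | (∀ p, v p ∈ kerDiracAdj d p.1) ∧
    ∀ p p' (g : SmallGauge B), IsGaugeImage g p.1 p'.1 → IsGaugeImageOf g (v p) (v p')}
  zero_mem' := by
    refine ⟨fun p => Submodule.zero_mem _, fun p p' g _ => ⟨fun σ α => ?_, ?_, ?_, ?_⟩⟩
    · filter_upwards [Lp.coeFn_zero (Fin 2 × Fin (R.rank σ α) → ℂ) 2
        (volume.restrict (Ioc (R.lo σ α) (R.hi σ α)))] with s hs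
      have : (0 : Target R).1 σ α s = 0 := hs
      simp only [Pi.zero_apply]
      rw [this, smul_zero]
    all_goals simp
  add_mem' := by
    intro v w hv hw
    refine ⟨fun p => Submodule.add_mem _ (hv.1 p) (hw.1 p), fun p p' g h => ?_⟩
    obtain ⟨a1, a2, a3, a4⟩ := hv.2 p p' g h
    obtain ⟨b1, b2, b3, b4⟩ := hw.2 p p' g h
    refine ⟨fun σ α => ?_, fun l => ?_, fun σ => ?_, fun σ => ?_⟩
    · filter_upwards [a1 σ α, b1 σ α, Lp.coeFn_add ((v p).1 σ α) ((w p).1 σ α),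
        Lp.coeFn_add ((v p').1 σ α) ((w p').1 σ α)] with s h1 h2 h3 h4
      have h3' : ((v + w) p).1 σ α s = (v p).1 σ α s + (w p).1 σ α s := h3
      have h4' : ((v + w) p').1 σ α s = (v p').1 σ α s + (w p').1 σ α s := h4
      rw [h3', h4', h1, h2, smul_add]
    · simp [a2, b2, mul_add]
    · simp [a3, b3, smul_add]
    · simp [a4, b4, smul_add]
  smul_mem' := by
    intro c v hv
    refine ⟨fun p => Submodule.smul_mem _ c (hv.1 p), fun p p' g h => ?_⟩
    obtain ⟨a1, a2, a3, a4⟩ := hv.2 p p' g h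
    refine ⟨fun σ α => ?_, fun l => ?_, fun σ => ?_, fun σ => ?_⟩
    · filter_upwards [a1 σ α, Lp.coeFn_smul c ((v p).1 σ α),
        Lp.coeFn_smul c ((v p').1 σ α)] with s h1 h3 h4
      have h3' : ((c • v) p).1 σ α s = c • (v p).1 σ α s := h3
      have h4' : ((c • v) p').1 σ α s = c • (v p').1 σ α s := h4
      rw [h3', h4', h1, smul_comm]
    · simp [a2, mul_left_comm]
    · simp [a3, smul_comm c]
    · simp [a4, smul_comm c]

end BowIndex

end

/-! The theorem combines three facts: D = D_{t,b} is injective, its index is −|Λ|, and the based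
gauge group acts freely.

Injectivity. Let Df = 0 and put G(s) = Re⟨f, i ∑ eⱼ(Tⱼ − tⱼ) f⟩. The scalars t drop out of
commutators, so T − t again satisfies the Nahm equations, and a Weitzenböck computation
(`weitzenboeck`) gives G′ = |∑ eⱼ(Tⱼ − tⱼ)f|² + ∑ⱼ |(Tⱼ − tⱼ)f|² ≥ 0. G does not decrease across the
λ-points (`gLe_lam`). In Λ⁰ the equation Q†f = 0 leaves only a non-negative jump. In Λ± Hardy's
inequality makes the part of G that sees the pole negligible along a sequence tending to λ. Across
p_σ, G increases by half a sum of squares (`edge_quad`). After one turn around the circle G must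
return to its value, so every inequality is an equality (`gLe_all`): (Tⱼ − tⱼ)f = 0, f is parallel
for T₀ − t₀, and B_σ acts on the end values of f as b_σ does. If one spinor component of f is
non-zero over every I_σ, it spans an abelian factor of rank one. Hence WAF makes each component
vanish over some interval. The vanishing passes through every edge with b_σ ≠ 0. Since t is constant
around the circle and b_σ = 0 forces t = ν_σ, at most one edge is blocked, and a cycle with one edge
removed is still connected. So f = 0 (`dirac_injective`).

Index. The kernel of D† is the annihilator of the image of D, so only the equation −f′ − Af = g in
H¹ has to be understood. At a regular end all boundary values are free. At a Nahm pole with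
terminating space of dimension m, f′ behaves like (s − λ)⁻¹ · ½ ∑ eⱼρⱼ f. The Casimir operator of
the irreducible representation shows that ½ ∑ eⱼρⱼ has eigenvalues (1 ± m)/2 with multiplicities m ∓
1 on the terminating part (`exists_isSpectral`). Solutions vanishing at λ in the terminating part
have no freedom for the exponent (1 − m)/2 ≤ 0 and one parameter per eigenvector for the exponent (1
+ m)/2 ≥ 1. Each subinterval is cut into two end pieces and a regular middle piece
(`exists_isStrip`). Sections of the domain then become pairs (parameters, g) on which a surjective
jump map J vanishes. An argument with Lagrange multipliers (`finrank_annihilator`) turns injectivity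
of D into a dimension formula for the annihilator, and the bookkeeping of `index_count` shows that
every λ-point, of whichever kind, contributes exactly one.

Descent. D at a gauge transformed point is conjugate to D. Two based gauge transformations relating
the same two points agree, again because at most one b_σ vanishes. So an equivariant family over an
orbit amounts to one vector of the kernel at one point (`instantonEval_bijective`). -/

noncomputable section

namespace BowIndex

section

/-! ### Absolutely continuous functions -/

section AbsolutelyContinuous

variable {E F G : Type*} [NormedAddCommGroup E] [NormedSpace ℝ E]
  [NormedAddCommGroup F] [NormedSpace ℝ F] [NormedAddCommGroup G] [NormedSpace ℝ G]

/-- `f` is absolutely continuous on `[a, b]` with almost everywhere derivative `f'`. -/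
def IsAC (a b : ℝ) (f f' : ℝ → E) : Prop :=
  IntegrableOn f' (Ioc a b) ∧ ∀ x ∈ Icc a b, f x = f a + ∫ s in a..x, f' s

namespace IsAC

variable {a b : ℝ} {f f' : ℝ → E}

theorem intervalIntegrable (h : IsAC a b f f') {x y : ℝ} (hx : x ∈ Icc a b) (hy : y ∈ Icc a b) :
    IntervalIntegrable f' volume x y := by
  rw [intervalIntegrable_iff]
  refine h.1.mono_set ?_
  rw [uIoc]
  exact Ioc_subset_Ioc (le_min hx.1 hy.1) (max_le hx.2 hy.2)

theorem sub_eq (h : IsAC a b f f') {x y : ℝ} (hx : x ∈ Icc a b) (hy : y ∈ Icc a b) :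
    f y - f x = ∫ s in x..y, f' s := by
  have hab := hx.1.trans hx.2
  rw [h.2 x hx, h.2 y hy, add_sub_add_left_eq_sub, intervalIntegral.integral_interval_sub_left]
  · exact h.intervalIntegrable (left_mem_Icc.2 hab) hy
  · exact h.intervalIntegrable (left_mem_Icc.2 hab) hx

theorem of_sub_eq (hi : IntegrableOn f' (Ioc a b))
    (h : ∀ x ∈ Icc a b, f x - f a = ∫ s in a..x, f' s) : IsAC a b f f' :=
  ⟨hi, fun x hx => by rw [← h x hx]; abel⟩

theorem mono (h : IsAC a b f f') {c d : ℝ} (hc : a ≤ c) (hd : d ≤ b) : IsAC c d f f' := by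
  refine of_sub_eq (h.1.mono_set (Ioc_subset_Ioc hc hd)) fun x hx => ?_
  exact h.sub_eq ⟨hc, hx.1.trans (hx.2.trans hd)⟩ ⟨hc.trans hx.1, hx.2.trans hd⟩

theorem congr (h : IsAC a b f f') {g g' : ℝ → E} (hg : ∀ x ∈ Icc a b, g x = f x)
    (hg' : ∀ᵐ x ∂volume.restrict (Ioc a b), g' x = f' x) : IsAC a b g g' := by
  refine ⟨(integrable_congr hg').2 h.1, fun x hx => ?_⟩
  rw [hg x hx, hg a (left_mem_Icc.2 (hx.1.trans hx.2)), h.2 x hx]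
  congr 1
  rw [intervalIntegral.integral_of_le hx.1, intervalIntegral.integral_of_le hx.1]
  exact (integral_congr_ae (ae_restrict_of_ae_restrict_of_subset
    (Ioc_subset_Ioc_right hx.2) hg')).symm

theorem continuousOn (h : IsAC a b f f') : ContinuousOn f (Icc a b) := by
  rcases lt_or_ge b a with hab | hab
  · simp [Icc_eq_empty (not_le.2 hab)]
  have := intervalIntegral.continuousOn_primitive_interval (a := a) (b := b) (μ := volume) (f := f')
    (by rw [uIcc_of_le hab, integrableOn_Icc_iff_integrableOn_Ioc]; exact h.1)
  rw [uIcc_of_le hab] at this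
  exact (continuousOn_const.add this).congr h.2

theorem norm_sub_le (h : IsAC a b f f') {x y : ℝ} (hx : a ≤ x) (hxy : x ≤ y) (hy : y ≤ b) :
    ‖f y - f x‖ ≤ ∫ s in x..y, ‖f' s‖ := by
  rw [h.sub_eq ⟨hx, hxy.trans hy⟩ ⟨hx.trans hxy, hy⟩]
  exact intervalIntegral.norm_integral_le_integral_norm hxy

theorem exists_bound (h : IsAC a b f f') : ∃ C, 0 ≤ C ∧ ∀ x ∈ Icc a b, ‖f x‖ ≤ C := by
  obtain ⟨C, hC⟩ := isCompact_Icc.exists_bound_of_continuousOn h.continuousOn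
  exact ⟨max C 0, le_max_right _ _, fun x hx => (hC x hx).trans (le_max_left _ _)⟩

end IsAC

/-- The increments of f are dominated by those of C ∫ w, which is absolutely continuous, so the ε–δ
condition transfers term by term. -/
theorem absolutelyContinuousOnInterval_of_norm_sub_le {E : Type*} [NormedAddCommGroup E]
    {a b C : ℝ} (hab : a ≤ b) {f : ℝ → E}
    {w : ℝ → ℝ} (hw : IntegrableOn w (Ioc a b))
    (h : ∀ x y, a ≤ x → x ≤ y → y ≤ b → ‖f y - f x‖ ≤ C * ∫ s in x..y, w s) :
    AbsolutelyContinuousOnInterval f a b := by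
  have hwi := (intervalIntegrable_iff_integrableOn_Ioc_of_le hab).2 hw
  have hW := hwi.absolutelyContinuousOnInterval_intervalIntegral (c := a) left_mem_uIcc
  have hWac : IsAC a b (fun x => ∫ v in a..x, w v) w := ⟨hw, fun x hx => by simp⟩
  have hW' := hW.const_mul (f := fun x => ∫ v in a..x, w v) C
  rw [absolutelyContinuousOnInterval_iff] at hW' ⊢
  intro ε hε
  obtain ⟨δ, hδ, H⟩ := hW' ε hε
  refine ⟨δ, hδ, fun D hD hs => lt_of_le_of_lt ?_ (H D hD hs)⟩
  refine Finset.sum_le_sum fun i hi => ?_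
  have hmem := hD.1 i hi
  rw [uIcc_of_le hab] at hmem
  have key : ∀ x ∈ Icc a b, ∀ y ∈ Icc a b, x ≤ y →
      dist (f x) (f y) ≤ dist (C * ∫ v in a..x, w v) (C * ∫ v in a..y, w v) := by
    intro x hx y hy hxy
    rw [dist_comm, dist_comm (C * _), dist_eq_norm, Real.dist_eq, ← mul_sub, hWac.sub_eq hx hy]
    exact (h x y hx.1 hxy hy.2).trans (le_abs_self _)
  rcases le_total (D.2 i).1 (D.2 i).2 with hle | hle
  · exact key _ hmem.1 _ hmem.2 hle
  · rw [dist_comm, dist_comm (C * _)]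
    exact key _ hmem.2 _ hmem.1 hle

namespace IsAC

variable {a b : ℝ} {f f' : ℝ → E}

theorem absolutelyContinuousOnInterval (h : IsAC a b f f') (hab : a ≤ b) :
    AbsolutelyContinuousOnInterval f a b :=
  absolutelyContinuousOnInterval_of_norm_sub_le hab (C := 1) h.1.norm fun x y hx hxy hy => by
    rw [one_mul]; exact h.norm_sub_le hx hxy hy

theorem ae_hasDerivAt [CompleteSpace E] (h : IsAC a b f f') :
    ∀ᵐ x, x ∈ Ioo a b → HasDerivAt f (f' x) x := by
  rcases lt_or_ge b a with hab | hab
  · exact ae_of_all _ fun x hx => absurd (hx.1.trans hx.2).le (not_le.2 hab)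
  have hi := (intervalIntegrable_iff_integrableOn_Ioc_of_le hab).2 h.1
  filter_upwards [hi.ae_hasDerivAt_integral] with x hx hxm
  rw [uIcc_of_le hab] at hx
  have h1 := (hx (Ioo_subset_Icc_self hxm) a (left_mem_Icc.2 hab)).const_add (f a)
  refine h1.congr_of_eventuallyEq ?_
  filter_upwards [Ioo_mem_nhds hxm.1 hxm.2] with y hy
  exact h.2 y (Ioo_subset_Icc_self hy)

/-- The difference of f and the primitive of f′ is absolutely continuous with derivative zero almost
everywhere, hence constant; the two end points form a null set. -/
theorem of_absolutelyContinuous [CompleteSpace E] (hab : a ≤ b)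
    (h : AbsolutelyContinuousOnInterval f a b) (hi : IntegrableOn f' (Ioc a b))
    (hd : ∀ᵐ x, x ∈ Ioo a b → HasDerivAt f (f' x) x) : IsAC a b f f' := by
  have hP : IsAC a b (fun x => ∫ v in a..x, f' v) f' := ⟨hi, fun x hx => by simp⟩
  have hP' := hP.absolutelyContinuousOnInterval hab
  have hd' : ∀ᵐ x, x ∈ uIcc a b → HasDerivAt (f - fun x => ∫ v in a..x, f' v) 0 x := by
    have h₁ : ∀ᵐ x : ℝ, x ≠ a := by simp [ae_iff, measure_singleton]
    have h₂ : ∀ᵐ x : ℝ, x ≠ b := by simp [ae_iff, measure_singleton]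
    filter_upwards [hd, hP.ae_hasDerivAt, h₁, h₂] with x h1 h2 h3 h4 hx
    rw [uIcc_of_le hab] at hx
    have hx' : x ∈ Ioo a b := ⟨lt_of_le_of_ne hx.1 (Ne.symm h3), lt_of_le_of_ne hx.2 h4⟩
    have := (h1 hx').sub (h2 hx')
    rwa [sub_self] at this
  obtain ⟨C, hC⟩ := (h.sub hP').const_of_ae_hasDerivAt_zero hd'
  rw [uIcc_of_le hab] at hC
  refine of_sub_eq hi fun x hx => ?_
  have h1 := hC x hx
  have h2 := hC a (left_mem_Icc.2 hab)
  simp only [Pi.sub_apply, intervalIntegral.integral_same, sub_zero] at h1 h2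
  rw [h2, ← h1]; abel

/-- The product rule. -/
theorem bilin [CompleteSpace E] [CompleteSpace F] [CompleteSpace G] {g g' : ℝ → F}
    (B : E →L[ℝ] F →L[ℝ] G)
    (h : IsAC a b f f') (hg : IsAC a b g g') :
    IsAC a b (fun x => B (f x) (g x)) (fun x => B (f' x) (g x) + B (f x) (g' x)) := by
  rcases lt_or_ge b a with hab | hab
  · exact ⟨by simp [Ioc_eq_empty (not_lt.2 hab.le)],
      fun x hx => absurd (hx.1.trans hx.2) (not_le.2 hab)⟩
  obtain ⟨C, hC0, hC⟩ := h.exists_bound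
  obtain ⟨D, hD0, hD⟩ := hg.exists_bound
  have hfm : AEStronglyMeasurable f (volume.restrict (Ioc a b)) :=
    (h.continuousOn.mono Ioc_subset_Icc_self).aestronglyMeasurable measurableSet_Ioc
  have hgm : AEStronglyMeasurable g (volume.restrict (Ioc a b)) :=
    (hg.continuousOn.mono Ioc_subset_Icc_self).aestronglyMeasurable measurableSet_Ioc
  have i1 : IntegrableOn (fun x => B (f' x) (g x)) (Ioc a b) := by
    refine Integrable.mono' (h.1.norm.const_mul (‖B‖ * D))
      (B.aestronglyMeasurable_comp₂ h.1.aestronglyMeasurable hgm) ?_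
    refine (ae_restrict_iff' measurableSet_Ioc).2 (ae_of_all _ fun x hx => ?_)
    calc ‖B (f' x) (g x)‖ ≤ ‖B‖ * ‖f' x‖ * ‖g x‖ := B.le_opNorm₂ _ _
      _ ≤ ‖B‖ * ‖f' x‖ * D := by gcongr; exact hD x (Ioc_subset_Icc_self hx)
      _ = _ := by ring
  have i2 : IntegrableOn (fun x => B (f x) (g' x)) (Ioc a b) := by
    refine Integrable.mono' (hg.1.norm.const_mul (‖B‖ * C))
      (B.aestronglyMeasurable_comp₂ hfm hg.1.aestronglyMeasurable) ?_
    refine (ae_restrict_iff' measurableSet_Ioc).2 (ae_of_all _ fun x hx => ?_)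
    calc ‖B (f x) (g' x)‖ ≤ ‖B‖ * ‖f x‖ * ‖g' x‖ := B.le_opNorm₂ _ _
      _ ≤ ‖B‖ * C * ‖g' x‖ := by gcongr; exact hC x (Ioc_subset_Icc_self hx)
  refine of_absolutelyContinuous hab ?_ (i1.add i2) ?_
  -- With ‖f‖ ≤ C and ‖g‖ ≤ D, the usual splitting bounds an increment of B(f, g) by ‖B‖(C + D) ∫
  -- (‖f′‖ + ‖g′‖).
  · refine absolutelyContinuousOnInterval_of_norm_sub_le hab (C := ‖B‖ * (C + D))
      (h.1.norm.add hg.1.norm) fun x y hx hxy hy => ?_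
    have hxm : x ∈ Icc a b := ⟨hx, hxy.trans hy⟩
    have hym : y ∈ Icc a b := ⟨hx.trans hxy, hy⟩
    have e : B (f y) (g y) - B (f x) (g x) = B (f y - f x) (g y) + B (f x) (g y - g x) := by
      simp
    have n1 := h.norm_sub_le hx hxy hy
    have n2 := hg.norm_sub_le hx hxy hy
    have es : (∫ s in x..y, ((fun s => ‖f' s‖) + fun s => ‖g' s‖) s)
        = (∫ s in x..y, ‖f' s‖) + ∫ s in x..y, ‖g' s‖ :=
      intervalIntegral.integral_add (h.intervalIntegrable hxm hym).norm
        (hg.intervalIntegrable hxm hym).norm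
    rw [es, e]
    have p1 := norm_nonneg (f y - f x)
    have p2 := norm_nonneg (g y - g x)
    calc _ ≤ ‖B‖ * ‖f y - f x‖ * ‖g y‖ + ‖B‖ * ‖f x‖ * ‖g y - g x‖ :=
          (norm_add_le _ _).trans (add_le_add (B.le_opNorm₂ _ _) (B.le_opNorm₂ _ _))
      _ ≤ ‖B‖ * ‖f y - f x‖ * D + ‖B‖ * C * ‖g y - g x‖ := by
          gcongr
          · exact hD y hym
          · exact hC x hxm
      _ ≤ ‖B‖ * ‖f y - f x‖ * (C + D) + ‖B‖ * (C + D) * ‖g y - g x‖ := by gcongr <;> linarith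
      _ = ‖B‖ * (C + D) * (‖f y - f x‖ + ‖g y - g x‖) := by ring
      _ ≤ _ := by gcongr
  · filter_upwards [h.ae_hasDerivAt, hg.ae_hasDerivAt] with x h1 h2 hx
    have := B.hasFDerivAt_of_bilinear (h1 hx).hasFDerivAt (h2 hx).hasFDerivAt
    have := this.hasDerivAt
    convert! this using 1
    simp [add_comm]

theorem mul {A : Type*} [NormedRing A] [NormedAlgebra ℝ A] [CompleteSpace A] {f f' g g' : ℝ → A}
    (h : IsAC a b f f') (hg : IsAC a b g g') :
    IsAC a b (fun x => f x * g x) (fun x => f' x * g x + f x * g' x) :=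
  h.bilin (ContinuousLinearMap.mul ℝ A) hg

theorem smul {A : Type*} [NormedField A] [NormedAlgebra ℝ A] [CompleteSpace A] [NormedSpace A E]
    [IsScalarTower ℝ A E] [CompleteSpace E] {g g' : ℝ → A}
    (hg : IsAC a b g g') (h : IsAC a b f f') :
    IsAC a b (fun x => g x • f x) (fun x => g' x • f x + g x • f' x) :=
  hg.bilin (ContinuousLinearMap.lsmul ℝ A) h

theorem clm [CompleteSpace E] [CompleteSpace F] (L : E →L[ℝ] F) (h : IsAC a b f f') :
    IsAC a b (fun x => L (f x)) (fun x => L (f' x)) := by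
  refine ⟨L.integrable_comp h.1, fun x hx => ?_⟩
  rw [L.intervalIntegral_comp_comm
    (h.intervalIntegrable (left_mem_Icc.2 (hx.1.trans hx.2)) hx), ← map_add, ← h.2 x hx]

theorem add {g g' : ℝ → E} (h : IsAC a b f f') (hg : IsAC a b g g') :
    IsAC a b (fun x => f x + g x) (fun x => f' x + g' x) := by
  refine of_sub_eq (h.1.add hg.1) fun x hx => ?_
  have ha := left_mem_Icc.2 (hx.1.trans hx.2)
  rw [intervalIntegral.integral_add (h.intervalIntegrable ha hx) (hg.intervalIntegrable ha hx),
    ← h.sub_eq ha hx, ← hg.sub_eq ha hx]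
  abel

theorem neg (h : IsAC a b f f') : IsAC a b (fun x => -f x) (fun x => -f' x) := by
  refine of_sub_eq h.1.neg fun x hx => ?_
  have ha := left_mem_Icc.2 (hx.1.trans hx.2)
  rw [intervalIntegral.integral_neg, ← h.sub_eq ha hx]
  abel

theorem sub {g g' : ℝ → E} (h : IsAC a b f f') (hg : IsAC a b g g') :
    IsAC a b (fun x => f x - g x) (fun x => f' x - g' x) := by
  simpa only [sub_eq_add_neg] using h.add hg.neg

theorem const (c : E) : IsAC a b (fun _ => c) (fun _ => 0) :=
  ⟨integrable_zero _ _ _, fun x _ => by simp⟩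

theorem sum {ι : Type*} (t : Finset ι) {f f' : ι → ℝ → E} (h : ∀ i ∈ t, IsAC a b (f i) (f' i)) :
    IsAC a b (fun x => ∑ i ∈ t, f i x) (fun x => ∑ i ∈ t, f' i x) := by
  classical
  induction t using Finset.induction_on with
  | empty => simpa using const (0 : E)
  | insert i t hi ih =>
    simp only [Finset.sum_insert hi]
    exact (h i (Finset.mem_insert_self _ _)).add
      (ih fun j hj => h j (Finset.mem_insert_of_mem hj))

theorem of_hasDerivAt [CompleteSpace E] (hd : ∀ x ∈ Icc a b, HasDerivAt f (f' x) x)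
    (hi : IntegrableOn f' (Ioc a b)) : IsAC a b f f' := by
  refine of_sub_eq hi fun x hx => (intervalIntegral.integral_eq_sub_of_hasDerivAt ?_ ?_).symm
  · intro y hy
    rw [uIcc_of_le hx.1] at hy
    exact hd y ⟨hy.1, hy.2.trans hx.2⟩
  · rw [intervalIntegrable_iff_integrableOn_Ioc_of_le hx.1]
    exact hi.mono_set (Ioc_subset_Ioc_right hx.2)

theorem glue {c : ℝ} (hac : a ≤ c) (hcb : c ≤ b) (h1 : IsAC a c f f') (h2 : IsAC c b f f') :
    IsAC a b f f' := by
  refine of_sub_eq ?_ fun x hx => ?_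
  · rw [← Ioc_union_Ioc_eq_Ioc hac hcb]
    exact h1.1.union h2.1
  · rcases le_total x c with hxc | hxc
    · exact h1.sub_eq (left_mem_Icc.2 hac) ⟨hx.1, hxc⟩
    · rw [← intervalIntegral.integral_add_adjacent_intervals
        (h1.intervalIntegrable (left_mem_Icc.2 hac) (right_mem_Icc.2 hac))
        (h2.intervalIntegrable (left_mem_Icc.2 hcb) ⟨hxc, hx.2⟩),
        ← h1.sub_eq (left_mem_Icc.2 hac) (right_mem_Icc.2 hac),
        ← h2.sub_eq (left_mem_Icc.2 hcb) ⟨hxc, hx.2⟩]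
      abel

theorem reflect (h : IsAC a b f f') : IsAC (-b) (-a) (fun x => f (-x)) (fun x => -f' (-x)) := by
  refine of_sub_eq ?_ fun x hx => ?_
  · have := h.1
    rw [← integrableOn_Icc_iff_integrableOn_Ioc] at this ⊢
    have h2 := (Measure.measurePreserving_neg (volume : Measure ℝ)).integrableOn_comp_preimage
      (Homeomorph.neg ℝ).measurableEmbedding (f := f') (s := Icc a b)
    have h3 := (h2.2 this).neg
    have e : Neg.neg ⁻¹' Icc a b = Icc (-b) (-a) := by simp
    rw [e] at h3
    exact h3
  · have hx' : -x ∈ Icc a b := ⟨by linarith [hx.2], by linarith [hx.1]⟩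
    rw [intervalIntegral.integral_neg, intervalIntegral.integral_comp_neg, neg_neg, ← h.sub_eq hx'
      (right_mem_Icc.2 (hx'.1.trans hx'.2))]
    abel

/-- Extension of absolute continuity to the left end point. -/
theorem of_forall_mono (hi : IntegrableOn f' (Ioc a b))
    (hc : ContinuousWithinAt f (Ioi a) a)
    (h : ∀ c, a < c → c ≤ b → IsAC c b f f') : IsAC a b f f' := by
  refine of_sub_eq hi fun x hx => ?_
  rcases hx.1.eq_or_lt with rfl | hax
  · simp
  have hI : IsAC a b (fun x => ∫ s in a..x, f' s) f' := ⟨hi, by simp⟩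
  have h1 : Tendsto (fun c => f x - f c) (𝓝[>] a) (𝓝 (f x - f a)) :=
    tendsto_const_nhds.sub hc
  have h2 : Tendsto (fun c => (∫ s in a..x, f' s) - ∫ s in a..c, f' s) (𝓝[>] a)
      (𝓝 ((∫ s in a..x, f' s) - ∫ s in a..a, f' s)) := by
    refine tendsto_const_nhds.sub ?_
    have hab : a < b := hax.trans_le hx.2
    have := hI.continuousOn a (left_mem_Icc.2 hab.le)
    refine this.mono_left ?_
    rw [← nhdsWithin_Ioo_eq_nhdsGT hab]
    exact nhdsWithin_mono _ Ioo_subset_Icc_self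
  rw [intervalIntegral.integral_same, sub_zero] at h2
  refine tendsto_nhds_unique (h1.congr' ?_) h2
  filter_upwards [Ioo_mem_nhdsGT hax] with c hc
  rw [(h c hc.1 (hc.2.le.trans hx.2)).sub_eq (left_mem_Icc.2 (hc.2.le.trans hx.2)) ⟨hc.2.le, hx.2⟩,
    hI.sub_eq ⟨hc.1.le, hc.2.le.trans hx.2⟩ hx]

end IsAC

theorem isAC_pi_iff {ι : Type*} [Fintype ι] {E : ι → Type*} [∀ i, NormedAddCommGroup (E i)]
    [∀ i, NormedSpace ℝ (E i)] [∀ i, CompleteSpace (E i)] {a b : ℝ} {f f' : ℝ → ∀ i, E i} :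
    IsAC a b f f' ↔ ∀ i, IsAC a b (fun x => f x i) (fun x => f' x i) := by
  refine ⟨fun h i => h.clm (ContinuousLinearMap.proj (R := ℝ) (φ := E) i), fun h => ?_⟩
  refine ⟨Integrable.of_eval fun i => (h i).1, fun x hx => ?_⟩
  ext i
  have ha := left_mem_Icc.2 (hx.1.trans hx.2)
  refine ((h i).2 x hx).trans ?_
  rw [Pi.add_apply, intervalIntegral.integral_of_le hx.1,
    intervalIntegral.integral_of_le hx.1, eval_integral]
  exact fun j => (h j).1.mono_set (Ioc_subset_Ioc_right hx.2)

theorem isH1_iff {a b : ℝ} {f f' : ℝ → E} :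
    IsH1 a b f f' ↔ IsAC a b f f' ∧ MemLp f' 2 (volume.restrict (Ioc a b)) :=
  ⟨fun h => ⟨⟨h.1.integrable (by norm_num), h.2⟩, h.1⟩, fun h => ⟨h.2, h.1.2⟩⟩

theorem IsH1.isAC {a b : ℝ} {f f' : ℝ → E} (h : IsH1 a b f f') : IsAC a b f f' := (isH1_iff.1 h).1

theorem IsH1.mono {a b : ℝ} {f f' : ℝ → E} (h : IsH1 a b f f') {c d : ℝ} (hc : a ≤ c)
    (hd : d ≤ b) : IsH1 c d f f' :=
  isH1_iff.2 ⟨h.isAC.mono hc hd, h.1.mono_measure (Measure.restrict_mono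
    (Ioc_subset_Ioc hc hd) le_rfl)⟩

end AbsolutelyContinuous

end

section

/-! ### Square integrable functions and Hardy's inequality -/

section Hardy

/-- Exhaust (a, b] by [c, b] with c ↓ a. This serves functions such as (s − a)⁻¹ ∫ₐˢ w, whose
behaviour at a is known only through such uniform bounds. -/
theorem memLp_two_of_integral_sq_le {a b K : ℝ} {f : ℝ → ℝ}
    (hf : ∀ c, a < c → c ≤ b → ContinuousOn f (Icc c b))
    (hK : ∀ c, a < c → c ≤ b → ∫ s in c..b, f s ^ 2 ≤ K) :
    MemLp f 2 (volume.restrict (Ioc a b)) := by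
  rcases le_or_gt b a with hab | hab
  · simp [Ioc_eq_empty (not_lt.2 hab)]
  have hc : ContinuousOn f (Ioc a b) := by
    intro x hx
    have hm : (a + x) / 2 < x := by linarith [hx.1]
    have := hf ((a + x) / 2) (by linarith [hx.1]) (by linarith [hx.1, hx.2]) x ⟨hm.le, hx.2⟩
    refine this.mono_of_mem_nhdsWithin ?_
    filter_upwards [self_mem_nhdsWithin, mem_nhdsWithin_of_mem_nhds (Ioi_mem_nhds hm)] with y h1 h2
    exact ⟨le_of_lt h2, h1.2⟩
  rw [memLp_two_iff_integrable_sq (hc.aestronglyMeasurable measurableSet_Ioc)]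
  obtain ⟨u, hu, hmem, hlim⟩ := exists_seq_strictAnti_tendsto' hab
  refine integrableOn_Ioc_of_intervalIntegral_norm_bounded_left (I := K) (l := atTop) (a := u)
    (fun i => ?_) hlim (Eventually.of_forall fun i => ?_)
  · exact ((hf _ (hmem i).1 (hmem i).2.le).pow 2).integrableOn_Icc.mono_set Ioc_subset_Icc_self
  · have := hK _ (hmem i).1 (hmem i).2.le
    rw [intervalIntegral.integral_of_le (hmem i).2.le] at this
    simpa using this

theorem sq_integral_le {a b : ℝ} (hab : a ≤ b) {w : ℝ → ℝ}
    (hw : MemLp w 2 (volume.restrict (Ioc a b))) :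
    (∫ s in a..b, w s) ^ 2 ≤ (b - a) * ∫ s in a..b, w s ^ 2 := by
  rcases hab.eq_or_lt with rfl | hlt
  · simp
  have i1 : IntervalIntegrable w volume a b :=
    (intervalIntegrable_iff_integrableOn_Ioc_of_le hab).2 (hw.integrable (by norm_num))
  have i2 : IntervalIntegrable (fun s => w s ^ 2) volume a b :=
    (intervalIntegrable_iff_integrableOn_Ioc_of_le hab).2 hw.integrable_sq
  set Y := ∫ s in a..b, w s
  set W := ∫ s in a..b, w s ^ 2
  -- Cauchy–Schwarz, read off from the variance of w.
  have h0 : 0 ≤ ∫ s in a..b, ((b - a) * w s - Y) ^ 2 :=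
    intervalIntegral.integral_nonneg hab fun s _ => sq_nonneg _
  have e : ∫ s in a..b, ((b - a) * w s - Y) ^ 2
      = (b - a) ^ 2 * W - 2 * (b - a) * Y * Y + (b - a) * Y ^ 2 := by
    have : ∀ s, ((b - a) * w s - Y) ^ 2
        = ((b - a) ^ 2 * w s ^ 2 - 2 * (b - a) * Y * w s) + Y ^ 2 := fun s => by ring
    simp only [this]
    rw [intervalIntegral.integral_add ((i2.const_mul _).sub (i1.const_mul _))
      intervalIntegrable_const, intervalIntegral.integral_sub (i2.const_mul _) (i1.const_mul _),
      intervalIntegral.integral_const_mul, intervalIntegral.integral_const_mul,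
      intervalIntegral.integral_const, smul_eq_mul]
  rw [e] at h0
  have hpos : 0 < b - a := by linarith
  nlinarith

variable {a b : ℝ} {w : ℝ → ℝ}

theorem memLp_mono_Ioc {E : Type*} [NormedAddCommGroup E] {f : ℝ → E} {c d : ℝ}
    (h : MemLp f 2 (volume.restrict (Ioc a b))) (hc : a ≤ c) (hd : d ≤ b) :
    MemLp f 2 (volume.restrict (Ioc c d)) :=
  h.mono_measure (Measure.restrict_mono (Ioc_subset_Ioc hc hd) le_rfl)

theorem integral_le_of_Icc {f : ℝ → ℝ} (hf : ∀ s, 0 ≤ f s) (hi : IntegrableOn f (Ioc a b))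
    {c d : ℝ} (hc : a ≤ c) (hcd : c ≤ d) (hd : d ≤ b) :
    ∫ s in c..d, f s ≤ ∫ s in a..b, f s := by
  refine intervalIntegral.integral_mono_interval hc hcd hd (ae_of_all _ hf) ?_
  rwa [intervalIntegrable_iff_integrableOn_Ioc_of_le (hc.trans (hcd.trans hd))]

/-- Hardy's inequality. -/
theorem hardy (hw : MemLp w 2 (volume.restrict (Ioc a b))) :
    MemLp (fun s => (s - a)⁻¹ * ∫ t in a..s, w t) 2 (volume.restrict (Ioc a b)) := by
  have hw1 : IntegrableOn w (Ioc a b) := hw.integrable (by norm_num)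
  set W := ∫ s in a..b, w s ^ 2
  set Y := fun s => ∫ t in a..s, w t
  have hY : IsAC a b Y w := ⟨hw1, fun x _ => by simp [Y]⟩
  -- With q = Y/(s − a), the derivative of Y²/(s − a) is 2wq − q² ≤ 2w² − q²/2. Integrating over [c,
  -- b] and dropping the boundary term at b gives ½ ∫ q² ≤ 2W + Y(c)²/(c − a), and the last term is
  -- at most W by Cauchy–Schwarz; this is the constant 6.
  refine memLp_two_of_integral_sq_le (K := 6 * W) (fun c hc hcb => ?_) fun c hc hcb => ?_
  · refine ContinuousOn.mul (ContinuousOn.inv₀ (by fun_prop) fun x hx => ?_)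
      (hY.continuousOn.mono (Icc_subset_Icc_left hc.le))
    have := hx.1
    intro h0
    linarith
  · set u : ℝ → ℝ := fun s => (s - a)⁻¹
    have hne : ∀ x ∈ Icc c b, x - a ≠ 0 := fun x hx h0 => by linarith [hx.1]
    have hu : IsAC c b u (fun s => -(s - a)⁻¹ ^ 2) := by
      refine IsAC.of_hasDerivAt (fun x hx => ?_) ?_
      · have := ((hasDerivAt_id x).sub_const a).inv (hne x hx)
        convert! this using 1
        simp only [id]
        field_simp [hne x hx]
      · refine (ContinuousOn.integrableOn_Icc ?_).mono_set Ioc_subset_Icc_self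
        exact ((ContinuousOn.inv₀ (by fun_prop) hne).pow 2).neg
    have hY' := hY.mono hc.le le_rfl
    have hA := (hY'.mul hY').mul hu
    have key := hA.sub_eq (left_mem_Icc.2 hcb) (right_mem_Icc.2 hcb)
    have hwc := memLp_mono_Ioc hw hc.le le_rfl
    have i2 : IntervalIntegrable (fun s => w s ^ 2) volume c b :=
      (intervalIntegrable_iff_integrableOn_Ioc_of_le hcb).2 hwc.integrable_sq
    have hq : ContinuousOn (fun s => u s * Y s) (uIcc c b) := by
      rw [uIcc_of_le hcb]; exact hu.continuousOn.mul hY'.continuousOn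
    have iq : IntervalIntegrable (fun s => (u s * Y s) ^ 2) volume c b :=
      (hq.pow 2).intervalIntegrable
    have hle : ∫ s in c..b, ((w s * Y s + Y s * w s) * u s + Y s * Y s * -(s - a)⁻¹ ^ 2)
        ≤ ∫ s in c..b, (2 * w s ^ 2 - 1 / 2 * (u s * Y s) ^ 2) := by
      refine intervalIntegral.integral_mono_on hcb ?_ ((i2.const_mul _).sub (iq.const_mul _)) ?_
      · exact hA.intervalIntegrable (left_mem_Icc.2 hcb) (right_mem_Icc.2 hcb)
      · intro s hs
        have e : (w s * Y s + Y s * w s) * u s + Y s * Y s * -(s - a)⁻¹ ^ 2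
            = 2 * w s * (u s * Y s) - (u s * Y s) ^ 2 := by simp only [u]; ring
        rw [e]
        nlinarith [sq_nonneg (2 * w s - u s * Y s)]
    rw [intervalIntegral.integral_sub (i2.const_mul _) (iq.const_mul _),
      intervalIntegral.integral_const_mul, intervalIntegral.integral_const_mul, ← key] at hle
    have hWc : ∫ s in c..b, w s ^ 2 ≤ W :=
      integral_le_of_Icc (fun s => sq_nonneg _) hw.integrable_sq hc.le hcb le_rfl
    have hWc' : ∫ s in a..c, w s ^ 2 ≤ W :=
      integral_le_of_Icc (fun s => sq_nonneg _) hw.integrable_sq le_rfl hc.le hcb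
    have hYc : Y c ^ 2 ≤ (c - a) * ∫ s in a..c, w s ^ 2 :=
      sq_integral_le hc.le (memLp_mono_Ioc hw le_rfl hcb)
    have hpos : 0 < c - a := by linarith
    have hb : Y c * Y c * u c ≤ W := by
      simp only [u]
      rw [mul_inv_le_iff₀ hpos]
      nlinarith
    have hb' : 0 ≤ Y b * Y b * u b := by
      have : 0 ≤ u b := inv_nonneg.2 (by linarith)
      exact mul_nonneg (mul_self_nonneg _) this
    change ∫ s in c..b, (u s * Y s) ^ 2 ≤ 6 * W
    linarith

/-- For Z(s) = ∫ₛᵇ w/(t − a), the derivative of (s − a)Z² is Z² − 2Zw. Young's inequality with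
weight κ gives (1 − κ)∫Z² − κ⁻¹∫w² ≤ −(c − a)Z(c)². The choice κ = 1/2 yields the L² bound, κ = 1
the pointwise one. -/
theorem dualHardy_aux (hw : MemLp w 2 (volume.restrict (Ioc a b))) {c : ℝ} (hc : a < c)
    (hcb : c ≤ b) :
    IsAC c b (fun s => ∫ t in s..b, (t - a)⁻¹ * w t) (fun s => -((s - a)⁻¹ * w s)) ∧
    (∫ s in c..b, (∫ t in s..b, (t - a)⁻¹ * w t) ^ 2) ≤ 4 * ∫ s in a..b, w s ^ 2 ∧
    (c - a) * (∫ t in c..b, (t - a)⁻¹ * w t) ^ 2 ≤ ∫ s in a..b, w s ^ 2 := by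
  have hwc := memLp_mono_Ioc hw hc.le le_rfl
  have hw1 : IntegrableOn w (Ioc c b) := hwc.integrable (by norm_num)
  set W := ∫ s in a..b, w s ^ 2
  set Z := fun s => ∫ t in s..b, (t - a)⁻¹ * w t
  have hne : ∀ x ∈ Icc c b, x - a ≠ 0 := fun x hx h0 => by linarith [hx.1]
  have hcont : ContinuousOn (fun s => (s - a)⁻¹) (Icc c b) := ContinuousOn.inv₀ (by fun_prop) hne
  have hi : IntegrableOn (fun t => (t - a)⁻¹ * w t) (Ioc c b) := by
    rw [← intervalIntegrable_iff_integrableOn_Ioc_of_le hcb] at hw1 ⊢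
    exact hw1.continuousOn_mul (by rwa [uIcc_of_le hcb])
  have hP : IsAC c b (fun s => ∫ t in c..s, (t - a)⁻¹ * w t) (fun t => (t - a)⁻¹ * w t) :=
    ⟨hi, by simp⟩
  have hZ : IsAC c b Z (fun s => -((s - a)⁻¹ * w s)) := by
    have := (IsAC.const (a := c) (b := b) (Z c)).sub hP
    refine this.congr (fun x hx => ?_) (by simp)
    have := intervalIntegral.integral_add_adjacent_intervals
      (hP.intervalIntegrable (left_mem_Icc.2 hcb) hx)
      (hP.intervalIntegrable hx (right_mem_Icc.2 hcb))
    simp only [Z]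
    linarith
  have hA := (((IsAC.of_hasDerivAt (f := fun s => s - a) (f' := fun _ => 1)
    (fun x _ => (hasDerivAt_id x).sub_const a) (by simp)).mul hZ).mul hZ : IsAC c b _ _)
  have key := hA.sub_eq (left_mem_Icc.2 hcb) (right_mem_Icc.2 hcb)
  have hZb : Z b = 0 := intervalIntegral.integral_same
  have i2 : IntervalIntegrable (fun s => w s ^ 2) volume c b :=
    (intervalIntegrable_iff_integrableOn_Ioc_of_le hcb).2 hwc.integrable_sq
  have iq : IntervalIntegrable (fun s => Z s ^ 2) volume c b := by
    refine ContinuousOn.intervalIntegrable ?_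
    rw [uIcc_of_le hcb]
    exact hZ.continuousOn.pow 2
  have hWc : ∫ s in c..b, w s ^ 2 ≤ W :=
    integral_le_of_Icc (fun s => sq_nonneg _) hw.integrable_sq hc.le hcb le_rfl
  have hpos : 0 < c - a := by linarith
  have hge : ∀ κ : ℝ, 0 < κ → ∫ s in c..b, ((1 - κ) * Z s ^ 2 - κ⁻¹ * w s ^ 2) ≤
      - ((c - a) * Z c * Z c) := by
    intro κ hκ
    have := key
    simp only [hZb, mul_zero, zero_sub] at this
    rw [this]
    refine intervalIntegral.integral_mono_on hcb ((iq.const_mul _).sub (i2.const_mul _))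
      (hA.intervalIntegrable (left_mem_Icc.2 hcb) (right_mem_Icc.2 hcb)) fun s hs => ?_
    have h1 : (s - a) * (s - a)⁻¹ = 1 := mul_inv_cancel₀ (hne s hs)
    have h2 : (1 * Z s + (s - a) * -((s - a)⁻¹ * w s)) * Z s
        + (s - a) * Z s * -((s - a)⁻¹ * w s) = Z s ^ 2 - 2 * Z s * w s := by
      linear_combination (- 2 * Z s * w s) * h1
    rw [h2]
    have h3 : 0 ≤ κ⁻¹ * (κ * Z s - w s) ^ 2 := by positivity
    have h4 : κ⁻¹ * (κ * Z s - w s) ^ 2 = κ * Z s ^ 2 - 2 * Z s * w s + κ⁻¹ * w s ^ 2 := by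
      field_simp
      ring
    linarith
  have hge' : ∀ κ : ℝ, 0 < κ → (1 - κ) * (∫ s in c..b, Z s ^ 2) - κ⁻¹ * (∫ s in c..b, w s ^ 2) ≤
      - ((c - a) * Z c * Z c) := by
    intro κ hκ
    have := hge κ hκ
    rwa [intervalIntegral.integral_sub (iq.const_mul _) (i2.const_mul _),
      intervalIntegral.integral_const_mul, intervalIntegral.integral_const_mul] at this
  have n1 := hge' (1 / 2) (by norm_num)
  have n2 := hge' 1 (by norm_num)
  have n3 : 0 ≤ (c - a) * Z c * Z c := by
    rw [mul_assoc]; exact mul_nonneg hpos.le (mul_self_nonneg _)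
  norm_num at n1 n2
  refine ⟨hZ, by linarith, ?_⟩
  change (c - a) * Z c ^ 2 ≤ W
  nlinarith

theorem dualHardy (hw : MemLp w 2 (volume.restrict (Ioc a b))) :
    MemLp (fun s => ∫ t in s..b, (t - a)⁻¹ * w t) 2 (volume.restrict (Ioc a b)) :=
  memLp_two_of_integral_sq_le (fun _ hc hcb => (dualHardy_aux hw hc hcb).1.continuousOn)
    fun _ hc hcb => (dualHardy_aux hw hc hcb).2.1

/-- Since ‖f(s)‖ ≤ ∫ₐˢ ‖f′‖, this is Hardy's inequality. It is the reason why a simple pole times a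
section vanishing at the pole is square integrable. -/
theorem IsH1.memLp_div {E : Type*} [NormedAddCommGroup E] [NormedSpace ℝ E]
    {f f' : ℝ → E} (h : IsH1 a b f f') (h0 : f a = 0) :
    MemLp (fun s => (s - a)⁻¹ • f s) 2 (volume.restrict (Ioc a b)) := by
  refine (hardy h.1.norm).of_le ?_ ?_
  · refine AEStronglyMeasurable.smul ?_ ?_
    · exact (measurable_id.sub_const a).inv.aestronglyMeasurable
    · exact (h.isAC.continuousOn.mono Ioc_subset_Icc_self).aestronglyMeasurable measurableSet_Ioc
  · refine (ae_restrict_iff' measurableSet_Ioc).2 (ae_of_all _ fun x hx => ?_)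
    rw [norm_smul, norm_mul]
    have := h.isAC.norm_sub_le le_rfl hx.1.le hx.2
    rw [h0, sub_zero] at this
    gcongr
    exact this.trans (le_abs_self _)

theorem memLp_smul_of_continuousOn {E : Type*} [NormedAddCommGroup E] [NormedSpace ℂ E]
    {A : Set ℝ} (hA : MeasurableSet A) (hAs : A ⊆ Icc a b) {g : ℝ → ℂ} {u : ℝ → E}
    (hg : ContinuousOn g (Icc a b)) (hu : MemLp u 2 (volume.restrict A)) :
    MemLp (fun s => g s • u s) 2 (volume.restrict A) := by
  obtain ⟨C, hC⟩ := isCompact_Icc.exists_bound_of_continuousOn hg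
  refine hu.of_le_mul (c := C) ?_ ?_
  · exact ((hg.mono hAs).aestronglyMeasurable hA).smul hu.1
  · refine (ae_restrict_iff' hA).2 (ae_of_all _ fun x hx => ?_)
    rw [norm_smul]
    gcongr
    exact hC x (hAs hx)

theorem memLp_smul_continuousOn {E : Type*} [NormedAddCommGroup E] [NormedSpace ℂ E]
    {A : Set ℝ} (hA : MeasurableSet A) (hAs : A ⊆ Icc a b) {g : ℝ → ℂ} {u : ℝ → E}
    (hg : MemLp g 2 (volume.restrict A)) (hu : ContinuousOn u (Icc a b)) :
    MemLp (fun s => g s • u s) 2 (volume.restrict A) := by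
  obtain ⟨C, hC⟩ := isCompact_Icc.exists_bound_of_continuousOn hu
  refine hg.of_le_mul (c := C) ?_ ?_
  · exact hg.1.smul ((hu.mono hAs).aestronglyMeasurable hA)
  · refine (ae_restrict_iff' hA).2 (ae_of_all _ fun x hx => ?_)
    rw [norm_smul, mul_comm]
    gcongr
    exact hC x (hAs hx)

end Hardy

/-! ### Matrix functions with square integrable entries -/

section SqIntOn

variable {ι κ μ : Type*} {A : Set ℝ}

theorem SqIntOn.mono {F : ℝ → Matrix ι κ ℂ} (h : SqIntOn F A) {A' : Set ℝ} (hA : A' ⊆ A) :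
    SqIntOn F A' :=
  fun i j => (h i j).mono_measure (Measure.restrict_mono hA le_rfl)

theorem SqIntOn.add {F G : ℝ → Matrix ι κ ℂ} (h : SqIntOn F A) (h' : SqIntOn G A) :
    SqIntOn (fun s => F s + G s) A := fun i j => (h i j).add (h' i j)

theorem SqIntOn.sub {F G : ℝ → Matrix ι κ ℂ} (h : SqIntOn F A) (h' : SqIntOn G A) :
    SqIntOn (fun s => F s - G s) A := fun i j => (h i j).sub (h' i j)

theorem SqIntOn.const_smul {F : ℝ → Matrix ι κ ℂ} (h : SqIntOn F A) (c : ℂ) :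
    SqIntOn (fun s => c • F s) A := fun i j => (h i j).const_mul c

theorem SqIntOn.sum {τ : Type*} (t : Finset τ) {F : τ → ℝ → Matrix ι κ ℂ}
    (h : ∀ r ∈ t, SqIntOn (F r) A) : SqIntOn (fun s => ∑ r ∈ t, F r s) A := by
  intro i j
  simp only [Matrix.sum_apply]
  exact memLp_finsetSum _ fun r hr => h r hr i j

theorem SqIntOn.conjTranspose {F : ℝ → Matrix ι κ ℂ} (h : SqIntOn F A) :
    SqIntOn (fun s => (F s).conjTranspose) A := fun i j => (h j i).star

theorem SqIntOn.congr {F G : ℝ → Matrix ι κ ℂ} (h : SqIntOn F A) (hA : MeasurableSet A)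
    (hFG : ∀ s ∈ A, G s = F s) : SqIntOn G A := fun i j =>
  (h i j).ae_eq ((ae_restrict_iff' hA).2 (ae_of_all _ fun s hs => by simp only [hFG s hs]))

theorem SqIntOn.kronecker {F : ℝ → Matrix ι κ ℂ} (h : SqIntOn F A) {α β : Type*}
    (M : Matrix α β ℂ) : SqIntOn (fun s => M ⊗ₖ F s) A := fun i j => (h i.2 j.2).const_mul _

theorem SqIntOn.mul_continuousOn [Fintype κ] {F : ℝ → Matrix ι κ ℂ} {G : ℝ → Matrix κ μ ℂ}
    (h : SqIntOn F A) (hA : MeasurableSet A) {a b : ℝ} (hAs : A ⊆ Icc a b)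
    (hG : ContinuousOn G (Icc a b)) : SqIntOn (fun s => F s * G s) A := by
  intro i j
  simp only [Matrix.mul_apply]
  refine memLp_finsetSum _ fun r _ => ?_
  refine memLp_smul_continuousOn hA hAs (h i r) ?_
  exact ((continuous_apply j).comp (continuous_apply r)).comp_continuousOn hG

theorem SqIntOn.continuousOn_mul [Fintype κ] {F : ℝ → Matrix ι κ ℂ} {G : ℝ → Matrix κ μ ℂ}
    (h : SqIntOn G A) (hA : MeasurableSet A) {a b : ℝ} (hAs : A ⊆ Icc a b)
    (hF : ContinuousOn F (Icc a b)) : SqIntOn (fun s => F s * G s) A := by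
  intro i j
  simp only [Matrix.mul_apply]
  refine memLp_finsetSum _ fun r _ => ?_
  refine memLp_smul_of_continuousOn hA hAs ?_ (h r j)
  exact ((continuous_apply r).comp (continuous_apply i)).comp_continuousOn hF

theorem SqIntOn.mulVec [Fintype ι] [Fintype κ] {F : ℝ → Matrix ι κ ℂ} (h : SqIntOn F A)
    (hA : MeasurableSet A) {a b : ℝ} (hAs : A ⊆ Icc a b) {f : ℝ → κ → ℂ}
    (hf : ContinuousOn f (Icc a b)) :
    MemLp (fun s => (F s).mulVec (f s)) 2 (volume.restrict A) := by
  refine MemLp.of_eval fun i => ?_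
  simp only [Matrix.mulVec, dotProduct]
  refine memLp_finsetSum _ fun r _ => ?_
  exact memLp_smul_continuousOn hA hAs (h i r) ((continuous_apply r).comp_continuousOn hf)

end SqIntOn

end

section

/-! ### The model equation `y' = (μ / (s - a)) y - w` -/

section Model

variable {E : Type*} [NormedAddCommGroup E] [NormedSpace ℝ E]
  {a b μ : ℝ} {y y' w : ℝ → E}

theorem continuousOn_Ioc_of_forall {X : Type*} [TopologicalSpace X] {f : ℝ → X}
    (hf : ∀ c, a < c → c ≤ b → ContinuousOn f (Icc c b)) : ContinuousOn f (Ioc a b) := by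
  intro x hx
  have hm : (a + x) / 2 < x := by linarith [hx.1]
  have := hf ((a + x) / 2) (by linarith [hx.1]) (by linarith [hx.1, hx.2]) x ⟨hm.le, hx.2⟩
  refine this.mono_of_mem_nhdsWithin ?_
  filter_upwards [self_mem_nhdsWithin, mem_nhdsWithin_of_mem_nhds (Ioi_mem_nhds hm)] with y h1 h2
  exact ⟨le_of_lt h2, h1.2⟩

theorem integrableOn_norm {E : Type*} [NormedAddCommGroup E] {A : Set ℝ} {w : ℝ → E}
    (h : IntegrableOn w A) :
    IntegrableOn (fun s => ‖w s‖) A := h.norm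

theorem isAC_rpow {c : ℝ} (hc : a < c) (μ : ℝ) :
    IsAC c b (fun s => (s - a) ^ μ) (fun s => μ * (s - a) ^ (μ - 1)) := by
  have hne : ∀ x ∈ Icc c b, x - a ≠ 0 := fun x hx h0 => by linarith [hx.1]
  refine IsAC.of_hasDerivAt (fun x hx => ?_) ?_
  · have := ((hasDerivAt_id x).sub_const a).rpow_const (p := μ) (Or.inl (hne x hx))
    simpa using this
  · refine (ContinuousOn.integrableOn_Icc ?_).mono_set Ioc_subset_Icc_self
    exact continuousOn_const.mul
      (ContinuousOn.rpow_const (by fun_prop) fun x hx => Or.inl (hne x hx))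

/-- Once y/(s − a) is dominated by a square integrable function, the equation itself bounds y′ in
L², and continuity at a extends absolute continuity to the singular end point. -/
theorem isH1_of_model (hw : MemLp w 2 (volume.restrict (Ioc a b))) {W : ℝ → ℝ}
    (hW : MemLp W 2 (volume.restrict (Ioc a b)))
    (hyW : ∀ s ∈ Ioc a b, ‖(s - a)⁻¹ • y s‖ ≤ W s)
    (hlim : ContinuousWithinAt y (Ioi a) a)
    (h : ∀ c, a < c → c ≤ b → IsAC c b y (fun s => (μ * (s - a)⁻¹) • y s - w s)) :
    IsH1 a b y (fun s => (μ * (s - a)⁻¹) • y s - w s) := by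
  have hm : AEStronglyMeasurable y (volume.restrict (Ioc a b)) :=
    (continuousOn_Ioc_of_forall fun c hc hcb => (h c hc hcb).continuousOn).aestronglyMeasurable
      measurableSet_Ioc
  have hL : MemLp (fun s => (s - a)⁻¹ • y s) 2 (volume.restrict (Ioc a b)) := by
    refine hW.of_le ?_ ?_
    · exact (measurable_id.sub_const a).inv.aestronglyMeasurable.smul hm
    · exact (ae_restrict_iff' measurableSet_Ioc).2
        (ae_of_all _ fun x hx => (hyW x hx).trans (le_abs_self _))
  have hd : MemLp (fun s => (μ * (s - a)⁻¹) • y s - w s) 2 (volume.restrict (Ioc a b)) := by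
    have := (hL.const_smul μ).sub hw
    refine this.ae_eq (ae_of_all _ fun s => ?_)
    simp [smul_smul]
  exact isH1_iff.2 ⟨IsAC.of_forall_mono (hd.integrable (by norm_num)) hlim h, hd⟩

variable [CompleteSpace E]

/-- The integrating factor (s − a)^(−μ) removes the singular term. -/
theorem model_repr (h : IsAC a b y y')
    (hy : ∀ᵐ s ∂volume.restrict (Ioc a b), y' s = (μ * (s - a)⁻¹) • y s - w s)
    {c : ℝ} (hc : a < c) :
    IsAC c b (fun s => (s - a) ^ (-μ) • y s) (fun s => -((s - a) ^ (-μ) • w s)) := by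
  refine ((isAC_rpow (b := b) hc (-μ)).smul (h.mono hc.le le_rfl)).congr (fun _ _ => rfl) ?_
  filter_upwards [ae_restrict_of_ae_restrict_of_subset (Ioc_subset_Ioc_left hc.le) hy,
    ae_restrict_mem measurableSet_Ioc] with s hs hm
  have hpos : 0 < s - a := by linarith [hm.1]
  rw [hs, Real.rpow_sub_one hpos.ne', smul_sub, smul_smul, ← sub_eq_zero]
  have : -μ * ((s - a) ^ (-μ) / (s - a)) = -((s - a) ^ (-μ) * (μ * (s - a)⁻¹)) := by
    field_simp
  rw [this, neg_smul]
  abel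

/-- For μ ≤ 0 the integrating factor increases, so integrating forward from x gives ‖y(z)‖ ≤ ‖y(x)‖
+ ∫‖w‖; then let x → a. The initial value zero leaves no freedom in this case. -/
theorem model_bound_left (hμ : μ ≤ 0) (h : IsAC a b y y') (h0 : y a = 0)
    (hw : IntegrableOn w (Ioc a b))
    (hy : ∀ᵐ s ∂volume.restrict (Ioc a b), y' s = (μ * (s - a)⁻¹) • y s - w s)
    {z : ℝ} (hz : z ∈ Icc a b) : ‖y z‖ ≤ ∫ s in a..b, ‖w s‖ := by
  have hab := hz.1.trans hz.2
  have hwz : ∀ x, a ≤ x → x ≤ z → ∫ s in x..z, ‖w s‖ ≤ ∫ s in a..b, ‖w s‖ := fun x hx hxz =>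
    integral_le_of_Icc (fun s => norm_nonneg _) hw.norm hx hxz hz.2
  rcases hz.1.eq_or_lt with rfl | haz
  · rw [h0, norm_zero]
    exact intervalIntegral.integral_nonneg hab fun _ _ => norm_nonneg _
  have key : ∀ x ∈ Ioo a z, ‖y z‖ ≤ ‖y x‖ + ∫ s in a..b, ‖w s‖ := by
    intro x hx
    have hxz := hx.2.le
    have hR := (model_repr h hy hx.1).sub_eq (left_mem_Icc.2 (hxz.trans hz.2)) ⟨hxz, hz.2⟩
    have hzp : 0 < (z - a) ^ (-μ) := Real.rpow_pos_of_pos (by linarith) _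
    have hmono : ∀ t, a < t → t ≤ z → (t - a) ^ (-μ) ≤ (z - a) ^ (-μ) := fun t ht htz =>
      Real.rpow_le_rpow (by linarith) (by linarith) (by linarith)
    have n1 : ‖∫ s in x..z, -((s - a) ^ (-μ) • w s)‖ ≤ (z - a) ^ (-μ) * ∫ s in a..b, ‖w s‖ := by
      calc _ ≤ ∫ s in x..z, (z - a) ^ (-μ) * ‖w s‖ := by
            refine intervalIntegral.norm_integral_le_of_norm_le hxz (ae_of_all _ fun t ht => ?_) ?_
            · have : 0 ≤ t - a := by linarith [hx.1, ht.1]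
              rw [norm_neg, norm_smul, Real.norm_of_nonneg (Real.rpow_nonneg this _)]
              gcongr ?_ * _
              exact hmono t (hx.1.trans ht.1) ht.2
            · refine IntervalIntegrable.const_mul ?_ _
              rw [intervalIntegrable_iff_integrableOn_Ioc_of_le hxz]
              exact (integrableOn_norm hw).mono_set (Ioc_subset_Ioc hx.1.le hz.2)
        _ ≤ _ := by
            rw [intervalIntegral.integral_const_mul]
            gcongr
            exact hwz x hx.1.le hxz
    have n2 : (z - a) ^ (-μ) * ‖y z‖ ≤ (z - a) ^ (-μ) * ‖y x‖
        + (z - a) ^ (-μ) * ∫ s in a..b, ‖w s‖ := by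
      have e : (z - a) ^ (-μ) • y z = (x - a) ^ (-μ) • y x
          + ∫ s in x..z, -((s - a) ^ (-μ) • w s) := by rw [← hR]; abel
      calc _ = ‖(z - a) ^ (-μ) • y z‖ := by rw [norm_smul, Real.norm_of_nonneg hzp.le]
        _ ≤ ‖(x - a) ^ (-μ) • y x‖ + ‖∫ s in x..z, -((s - a) ^ (-μ) • w s)‖ := by
            rw [e]; exact norm_add_le _ _
        _ ≤ _ := by
            gcongr
            have : 0 ≤ x - a := by linarith [hx.1]
            rw [norm_smul, Real.norm_of_nonneg (Real.rpow_nonneg this _)]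
            gcongr ?_ * _
            exact hmono x hx.1 hxz
    rw [← mul_add] at n2
    exact le_of_mul_le_mul_left n2 hzp
  have hlim : Tendsto (fun x => ‖y x‖ + ∫ s in a..b, ‖w s‖) (𝓝[>] a)
      (𝓝 (‖y a‖ + ∫ s in a..b, ‖w s‖)) := by
    refine Tendsto.add_const _ (Tendsto.norm ?_)
    have := h.continuousOn a (left_mem_Icc.2 hab)
    refine this.mono_left ?_
    rw [← nhdsWithin_Ioo_eq_nhdsGT (haz.trans_le hz.2)]
    exact nhdsWithin_mono _ Ioo_subset_Icc_self
  rw [h0, norm_zero, zero_add] at hlim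
  refine ge_of_tendsto hlim ?_
  filter_upwards [Ioo_mem_nhdsGT haz] with x hx using key x hx

/-- For μ ≥ 0 the integrating factor decreases, so the equation is integrated backward from b. The
value at b remains as a free parameter, since (s − a)^μ solves the homogeneous equation and, for μ >
0, vanishes at a. -/
theorem model_bound_right (hμ : 0 ≤ μ) (h : IsAC a b y y') (h0 : y a = 0)
    (hw : IntegrableOn w (Ioc a b))
    (hy : ∀ᵐ s ∂volume.restrict (Ioc a b), y' s = (μ * (s - a)⁻¹) • y s - w s)
    {x : ℝ} (hx : x ∈ Icc a b) : ‖y x‖ ≤ ‖y b‖ + ∫ s in a..b, ‖w s‖ := by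
  have hab := hx.1.trans hx.2
  have hW : 0 ≤ ∫ s in a..b, ‖w s‖ :=
    intervalIntegral.integral_nonneg hab fun _ _ => norm_nonneg _
  rcases hx.1.eq_or_lt with rfl | hax
  · rw [h0, norm_zero]; positivity
  have hR := (model_repr h hy hax).sub_eq (left_mem_Icc.2 hx.2) (right_mem_Icc.2 hx.2)
  have hxp : 0 < (x - a) ^ (-μ) := Real.rpow_pos_of_pos (by linarith) _
  have hmono : ∀ t, x ≤ t → (t - a) ^ (-μ) ≤ (x - a) ^ (-μ) := fun t ht =>
    Real.rpow_le_rpow_of_nonpos (by linarith) (by linarith) (by linarith)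
  have n1 : ‖∫ s in x..b, -((s - a) ^ (-μ) • w s)‖ ≤ (x - a) ^ (-μ) * ∫ s in a..b, ‖w s‖ := by
    calc _ ≤ ∫ s in x..b, (x - a) ^ (-μ) * ‖w s‖ := by
          refine intervalIntegral.norm_integral_le_of_norm_le hx.2 (ae_of_all _ fun t ht => ?_) ?_
          · have : 0 ≤ t - a := by linarith [hx.1, ht.1]
            rw [norm_neg, norm_smul, Real.norm_of_nonneg (Real.rpow_nonneg this _)]
            gcongr ?_ * _
            exact hmono t ht.1.le
          · refine IntervalIntegrable.const_mul ?_ _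
            rw [intervalIntegrable_iff_integrableOn_Ioc_of_le hx.2]
            exact (integrableOn_norm hw).mono_set (Ioc_subset_Ioc_left hx.1)
      _ ≤ _ := by
          rw [intervalIntegral.integral_const_mul]
          gcongr
          exact integral_le_of_Icc (fun s => norm_nonneg _) hw.norm hx.1 hx.2 le_rfl
  have n2 : (x - a) ^ (-μ) * ‖y x‖ ≤ (x - a) ^ (-μ) * ‖y b‖
      + (x - a) ^ (-μ) * ∫ s in a..b, ‖w s‖ := by
    have e : (x - a) ^ (-μ) • y x = (b - a) ^ (-μ) • y b
        - ∫ s in x..b, -((s - a) ^ (-μ) • w s) := by rw [← hR]; abel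
    calc _ = ‖(x - a) ^ (-μ) • y x‖ := by rw [norm_smul, Real.norm_of_nonneg hxp.le]
      _ ≤ ‖(b - a) ^ (-μ) • y b‖ + ‖∫ s in x..b, -((s - a) ^ (-μ) • w s)‖ := by
          rw [e]; exact norm_sub_le _ _
      _ ≤ _ := by
          gcongr
          have : 0 ≤ b - a := by linarith
          rw [norm_smul, Real.norm_of_nonneg (Real.rpow_nonneg this _)]
          gcongr ?_ * _
          exact hmono b hx.2
  rw [← mul_add] at n2
  exact le_of_mul_le_mul_left n2 hxp

/-- Take y = −(s − a)^μ ∫ₐˢ (t − a)^(−μ) w. Monotonicity of the power gives ‖y(s)‖ ≤ ∫ₐˢ ‖w‖, so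
Hardy's inequality controls y/(s − a). -/
theorem model_exists_left (hμ : μ ≤ 0) (hab : a < b)
    (hw : MemLp w 2 (volume.restrict (Ioc a b))) :
    ∃ y : ℝ → E, y a = 0 ∧ IsH1 a b y (fun s => (μ * (s - a)⁻¹) • y s - w s) := by
  have hw1 : IntegrableOn w (Ioc a b) := hw.integrable (by norm_num)
  set I : ℝ → E := fun s => ∫ t in a..s, (t - a) ^ (-μ) • w t
  have hI0 : IntegrableOn (fun t => (t - a) ^ (-μ) • w t) (Ioc a b) := by
    refine Integrable.mono' (hw1.norm.const_mul ((b - a) ^ (-μ))) ?_ ?_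
    · refine AEStronglyMeasurable.smul ?_ hw1.aestronglyMeasurable
      exact ((measurable_id.sub_const a).pow_const (-μ)).aestronglyMeasurable
    · refine (ae_restrict_iff' measurableSet_Ioc).2 (ae_of_all _ fun t ht => ?_)
      have : 0 ≤ t - a := by linarith [ht.1]
      rw [norm_smul, Real.norm_of_nonneg (Real.rpow_nonneg this _)]
      gcongr
      · linarith
      · exact ht.2
  have hI : IsAC a b I (fun t => (t - a) ^ (-μ) • w t) := ⟨hI0, by simp [I]⟩
  have hb : ∀ s ∈ Ioc a b, ‖-((s - a) ^ μ • I s)‖ ≤ ∫ t in a..s, ‖w t‖ := by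
    intro s hs
    have hpos : 0 < s - a := by linarith [hs.1]
    rw [norm_neg, norm_smul, Real.norm_of_nonneg (Real.rpow_nonneg hpos.le _)]
    have : ‖I s‖ ≤ ∫ t in a..s, (s - a) ^ (-μ) * ‖w t‖ := by
      refine intervalIntegral.norm_integral_le_of_norm_le hs.1.le (ae_of_all _ fun t ht => ?_) ?_
      · have : 0 ≤ t - a := by linarith [ht.1]
        rw [norm_smul, Real.norm_of_nonneg (Real.rpow_nonneg this _)]
        gcongr
        · linarith
        · exact ht.2
      · refine IntervalIntegrable.const_mul ?_ _
        rw [intervalIntegrable_iff_integrableOn_Ioc_of_le hs.1.le]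
        exact (integrableOn_norm hw1).mono_set (Ioc_subset_Ioc_right hs.2)
    rw [intervalIntegral.integral_const_mul] at this
    calc _ ≤ (s - a) ^ μ * ((s - a) ^ (-μ) * ∫ t in a..s, ‖w t‖) := by gcongr
      _ = _ := by rw [← mul_assoc, ← Real.rpow_add hpos]; simp
  refine ⟨fun s => -((s - a) ^ μ • I s), by simp [I], ?_⟩
  refine isH1_of_model hw (hardy hw.norm) (fun s hs => ?_) ?_ fun c hc hcb => ?_
  · have : 0 ≤ s - a := by linarith [hs.1]
    rw [norm_smul, Real.norm_of_nonneg (inv_nonneg.2 this)]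
    gcongr
    exact hb s hs
  · have h0 : -((a - a) ^ μ • I a) = 0 := by simp [I]
    rw [ContinuousWithinAt, h0]
    refine squeeze_zero_norm' (a := fun s => ∫ t in a..s, ‖w t‖) ?_ ?_
    · filter_upwards [Ioc_mem_nhdsGT hab] with s hs using hb s hs
    · have hn : IsAC a b (fun s => ∫ t in a..s, ‖w t‖) (fun t => ‖w t‖) := ⟨hw1.norm, by simp⟩
      have := hn.continuousOn a (left_mem_Icc.2 hab.le)
      rw [ContinuousWithinAt, intervalIntegral.integral_same] at this
      refine this.mono_left ?_
      rw [← nhdsWithin_Ioo_eq_nhdsGT hab]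
      exact nhdsWithin_mono _ Ioo_subset_Icc_self
  · refine ((isAC_rpow (b := b) hc μ).smul (hI.mono hc.le le_rfl)).neg.congr (fun _ _ => rfl) ?_
    filter_upwards [ae_restrict_mem measurableSet_Ioc] with s hs
    have hpos : 0 < s - a := by linarith [hs.1]
    rw [smul_smul (_ ^ μ), ← Real.rpow_add hpos, add_neg_cancel, Real.rpow_zero, one_smul,
      Real.rpow_sub_one hpos.ne', smul_neg, smul_smul, neg_add, sub_eq_add_neg]
    congr 3
    field_simp

/-- Take y = (s − a)^μ ∫ₛᵇ (t − a)^(−μ) w. For μ ≥ 1 and t ≥ s one has (t − a)^(−μ) ≤ (s − a)^(1−μ)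
(t − a)⁻¹, so y/(s − a) is dominated by the dual Hardy operator applied to ‖w‖. -/
theorem model_exists_right (hμ : 1 ≤ μ) (hab : a < b)
    (hw : MemLp w 2 (volume.restrict (Ioc a b))) :
    ∃ y : ℝ → E, y a = 0 ∧ y b = 0 ∧ IsH1 a b y (fun s => (μ * (s - a)⁻¹) • y s - w s) := by
  have hw1 : IntegrableOn w (Ioc a b) := hw.integrable (by norm_num)
  set J : ℝ → E := fun s => ∫ t in s..b, (t - a) ^ (-μ) • w t
  have hJ0 : ∀ c, a < c → c ≤ b → IntegrableOn (fun t => (t - a) ^ (-μ) • w t) (Ioc c b) := by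
    intro c hc hcb
    have := (isAC_rpow (b := b) hc (-μ)).continuousOn
    obtain ⟨C, hC⟩ := isCompact_Icc.exists_bound_of_continuousOn this
    refine Integrable.mono' (((integrableOn_norm hw1).mono_set (Ioc_subset_Ioc_left hc.le)).const_mul C) ?_ ?_
    · refine AEStronglyMeasurable.smul ?_
        (hw1.mono_set (Ioc_subset_Ioc_left hc.le)).aestronglyMeasurable
      exact ((measurable_id.sub_const a).pow_const (-μ)).aestronglyMeasurable
    · refine (ae_restrict_iff' measurableSet_Ioc).2 (ae_of_all _ fun t ht => ?_)
      rw [norm_smul]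
      gcongr
      exact hC t (Ioc_subset_Icc_self ht)
  have hJ : ∀ c, a < c → c ≤ b → IsAC c b J (fun t => -((t - a) ^ (-μ) • w t)) := by
    intro c hc hcb
    have hP : IsAC c b (fun s => ∫ t in c..s, (t - a) ^ (-μ) • w t)
      (fun t => (t - a) ^ (-μ) • w t) := ⟨hJ0 c hc hcb, by simp⟩
    refine ((IsAC.const (a := c) (b := b) (J c)).sub hP).congr (fun x hx => ?_) (by simp)
    have := intervalIntegral.integral_add_adjacent_intervals
      (hP.intervalIntegrable (left_mem_Icc.2 hcb) hx)
      (hP.intervalIntegrable hx (right_mem_Icc.2 hcb))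
    simp only [J]
    rw [← this]
    abel
  have hb : ∀ s ∈ Ioc a b, ‖(s - a) ^ μ • J s‖ ≤ (s - a) * ∫ t in s..b, (t - a)⁻¹ * ‖w t‖ := by
    intro s hs
    have hpos : 0 < s - a := by linarith [hs.1]
    rw [norm_smul, Real.norm_of_nonneg (Real.rpow_nonneg hpos.le _)]
    have : ‖J s‖ ≤ ∫ t in s..b, ((s - a) ^ (1 - μ)) * ((t - a)⁻¹ * ‖w t‖) := by
      refine intervalIntegral.norm_integral_le_of_norm_le hs.2 (ae_of_all _ fun t ht => ?_) ?_
      · have ht0 : 0 < t - a := by linarith [ht.1]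
        rw [norm_smul, Real.norm_of_nonneg (Real.rpow_nonneg ht0.le _), ← mul_assoc]
        gcongr
        rw [show -μ = (1 - μ) + -1 by ring, Real.rpow_add ht0, Real.rpow_neg_one]
        gcongr ?_ * _
        exact Real.rpow_le_rpow_of_nonpos hpos (by linarith [ht.1]) (by linarith)
      · refine IntervalIntegrable.const_mul ?_ _
        have := (dualHardy_aux hw.norm hs.1 hs.2).1.neg.1
        rw [intervalIntegrable_iff_integrableOn_Ioc_of_le hs.2]
        simpa using this
    rw [intervalIntegral.integral_const_mul] at this
    calc _ ≤ (s - a) ^ μ * ((s - a) ^ (1 - μ) * ∫ t in s..b, (t - a)⁻¹ * ‖w t‖) := by gcongr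
      _ = _ := by rw [← mul_assoc, ← Real.rpow_add hpos]; simp
  refine ⟨fun s => (s - a) ^ μ • J s, ?_, by simp [J], ?_⟩
  · simp [Real.zero_rpow (by linarith : μ ≠ 0)]
  refine isH1_of_model hw (dualHardy hw.norm) (fun s hs => ?_) ?_ fun c hc hcb => ?_
  · have hpos : 0 < s - a := by linarith [hs.1]
    rw [norm_smul, Real.norm_of_nonneg (inv_nonneg.2 hpos.le), inv_mul_le_iff₀ hpos]
    exact hb s hs
  · have h0 : (a - a) ^ μ • J a = 0 := by simp [Real.zero_rpow (by linarith : μ ≠ 0)]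
    rw [ContinuousWithinAt, h0]
    -- The pointwise estimate of `dualHardy_aux` gives ‖y(s)‖² ≤ (s − a) ∫‖w‖², so y tends to zero
    -- at a.
    refine squeeze_zero_norm' (a := fun s => √((s - a) * ∫ s in a..b, ‖w s‖ ^ 2)) ?_ ?_
    · filter_upwards [Ioc_mem_nhdsGT hab] with s hs
      refine (hb s hs).trans (Real.le_sqrt_of_sq_le ?_)
      have := (dualHardy_aux hw.norm hs.1 hs.2).2.2
      rw [mul_pow, sq, mul_assoc]
      gcongr
      linarith [hs.1]
    · have : Tendsto (fun s => √((s - a) * ∫ s in a..b, ‖w s‖ ^ 2)) (𝓝 a)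
          (𝓝 (√((a - a) * ∫ s in a..b, ‖w s‖ ^ 2))) := by
        apply Continuous.tendsto
        fun_prop
      simp only [sub_self, zero_mul, Real.sqrt_zero] at this
      exact this.mono_left nhdsWithin_le_nhds
  · refine ((isAC_rpow (b := b) hc μ).smul (hJ c hc hcb)).congr (fun _ _ => rfl) ?_
    filter_upwards [ae_restrict_mem measurableSet_Ioc] with s hs
    have hpos : 0 < s - a := by linarith [hs.1]
    rw [smul_neg, smul_smul (_ ^ μ), ← Real.rpow_add hpos, add_neg_cancel, Real.rpow_zero, one_smul,
      Real.rpow_sub_one hpos.ne', smul_smul, sub_eq_add_neg]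
    congr 2
    field_simp

end Model

end

section

/-! ### First order systems with a regular singular end point -/

section Pieces

variable {ι : Type*} [Fintype ι]

/-- Solvability of `-f' - A f = g` on `[a, b]` for `H¹` functions `f` with `f(a) ∈ Wa` and
`f(b) ∈ Wb`: the solution is determined by `g` and by `m` free parameters, which are linear
functions `ζ` of the end values. -/
def PieceSolvable (a b : ℝ) (A : ℝ → Matrix ι ι ℂ) (Wa Wb : Submodule ℂ (ι → ℂ)) (m : ℕ) : Prop :=
  (∀ f df, IsH1 a b f df → f a ∈ Wa → f b ∈ Wb →
    MemLp (fun s => (A s).mulVec (f s)) 2 (volume.restrict (Ioc a b))) ∧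
  ∃ ζ : ((ι → ℂ) × (ι → ℂ)) →ₗ[ℂ] (Fin m → ℂ),
    (∀ f df, IsH1 a b f df → f a ∈ Wa → f b ∈ Wb →
      (∀ᵐ s ∂volume.restrict (Ioc a b), df s = -(A s).mulVec (f s)) → ζ (f a, f b) = 0 →
      f a = 0 ∧ f b = 0) ∧
    ∃ C, ∀ (z : Fin m → ℂ) (g : ℝ → ι → ℂ), MemLp g 2 (volume.restrict (Ioc a b)) →
      ∃ f df, IsH1 a b f df ∧ f a ∈ Wa ∧ f b ∈ Wb ∧
        (∀ᵐ s ∂volume.restrict (Ioc a b), df s = -(A s).mulVec (f s) - g s) ∧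
        ζ (f a, f b) = z ∧ ‖f a‖ ≤ C * (‖z‖ + ∫ s in a..b, ‖g s‖) ∧
        ‖f b‖ ≤ C * (‖z‖ + ∫ s in a..b, ‖g s‖)

/-- `P₀`, `P₋` and `P₊` are the spectral projections of an operator `M` with
eigenvalues `0`, `μ₋` and `μ₊`. -/
structure IsSpectral (P₀ Pm Pp M : (ι → ℂ) →L[ℂ] (ι → ℂ)) (μm μp : ℝ) : Prop where
  sum : ∀ v, P₀ v + Pm v + Pp v = v
  zz : ∀ v, P₀ (P₀ v) = P₀ v
  zm : ∀ v, P₀ (Pm v) = 0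
  zp : ∀ v, P₀ (Pp v) = 0
  mz : ∀ v, Pm (P₀ v) = 0
  mm : ∀ v, Pm (Pm v) = Pm v
  mp : ∀ v, Pm (Pp v) = 0
  pz : ∀ v, Pp (P₀ v) = 0
  pm : ∀ v, Pp (Pm v) = 0
  pp : ∀ v, Pp (Pp v) = Pp v
  apply : ∀ v, M v = μm • Pm v + μp • Pp v

namespace IsSpectral

variable {P₀ Pm Pp M : (ι → ℂ) →L[ℂ] (ι → ℂ)} {μm μp : ℝ} {a b : ℝ} {f df w : ℝ → ι → ℂ}

theorem isAC_clm (P : (ι → ℂ) →L[ℂ] (ι → ℂ)) (h : IsAC a b f df) :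
    IsAC a b (fun s => P (f s)) (fun s => P (df s)) :=
  h.clm (P.restrictScalars ℝ)

theorem isH1_clm (P : (ι → ℂ) →L[ℂ] (ι → ℂ)) (h : IsH1 a b f df) :
    IsH1 a b (fun s => P (f s)) (fun s => P (df s)) :=
  isH1_iff.2 ⟨isAC_clm P h.isAC, P.comp_memLp' h.1⟩

theorem integral_clm_le (P : (ι → ℂ) →L[ℂ] (ι → ℂ)) (hab : a ≤ b) (hw : IntegrableOn w (Ioc a b)) :
    ∫ s in a..b, ‖P (w s)‖ ≤ ‖P‖ * ∫ s in a..b, ‖w s‖ := by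
  rw [← intervalIntegral.integral_const_mul]
  refine intervalIntegral.integral_mono_on hab ?_ ?_ fun s _ => P.le_opNorm _
  · rw [intervalIntegrable_iff_integrableOn_Ioc_of_le hab]
    exact (P.integrable_comp hw).norm
  · rw [intervalIntegrable_iff_integrableOn_Ioc_of_le hab]
    exact (integrableOn_norm hw).const_mul _

/-- Each spectral component solves a scalar model equation. The 0-component is governed by its value
at a, the μ₊-component by its value at b, and the μ₋-component by the source alone. -/
theorem bound (h : IsSpectral P₀ Pm Pp M μm μp) (hm : μm ≤ 0) (hp : 1 ≤ μp) (hab : a ≤ b)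
    (hf : IsAC a b f df) (hfa : P₀ (f a) = f a) (hw : IntegrableOn w (Ioc a b))
    (hd : ∀ᵐ s ∂volume.restrict (Ioc a b), df s = (s - a)⁻¹ • M (f s) - w s)
    {s : ℝ} (hs : s ∈ Icc a b) :
    ‖f s‖ ≤ ‖f a‖ + ‖Pp (f b)‖ + (‖P₀‖ + ‖Pm‖ + ‖Pp‖) * ∫ s in a..b, ‖w s‖ := by
  have h0 : ‖P₀ (f s) - P₀ (f a)‖ ≤ ∫ s in a..b, ‖P₀ (w s)‖ := by
    have hz := (isAC_clm P₀ hf).sub (IsAC.const (P₀ (f a)))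
    refine model_bound_left (μ := 0) le_rfl hz (sub_self _) (P₀.integrable_comp hw) ?_ hs
    filter_upwards [hd] with s hs
    rw [hs, h.apply, map_sub, P₀.map_smul_of_tower, map_add, P₀.map_smul_of_tower,
      P₀.map_smul_of_tower, h.zm, h.zp]
    simp
  have h1 : ‖Pm (f s)‖ ≤ ∫ s in a..b, ‖Pm (w s)‖ := by
    refine model_bound_left hm (isAC_clm Pm hf) ?_ (Pm.integrable_comp hw) ?_ hs
    · rw [← hfa, h.mz]
    filter_upwards [hd] with s hs
    rw [hs, h.apply, map_sub, Pm.map_smul_of_tower, map_add, Pm.map_smul_of_tower,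
      Pm.map_smul_of_tower, h.mm, h.mp, smul_zero, add_zero, smul_smul, mul_comm]
  have h2 : ‖Pp (f s)‖ ≤ ‖Pp (f b)‖ + ∫ s in a..b, ‖Pp (w s)‖ := by
    refine model_bound_right (μ := μp) (by linarith) (isAC_clm Pp hf) ?_ (Pp.integrable_comp hw) ?_ hs
    · rw [← hfa, h.pz]
    filter_upwards [hd] with s hs
    rw [hs, h.apply, map_sub, Pp.map_smul_of_tower, map_add, Pp.map_smul_of_tower,
      Pp.map_smul_of_tower, h.pm, h.pp, smul_zero, zero_add, smul_smul, mul_comm]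
  have e0 := integral_clm_le P₀ hab hw
  have e1 := integral_clm_le Pm hab hw
  have e2 := integral_clm_le Pp hab hw
  have h0' : ‖P₀ (f s)‖ ≤ ‖f a‖ + ∫ s in a..b, ‖P₀ (w s)‖ := by
    have : P₀ (f s) = f a + (P₀ (f s) - P₀ (f a)) := by rw [hfa]; abel
    rw [this]
    exact (norm_add_le _ _).trans (by gcongr)
  calc ‖f s‖ = ‖P₀ (f s) + Pm (f s) + Pp (f s)‖ := by rw [h.sum]
    _ ≤ ‖P₀ (f s)‖ + ‖Pm (f s)‖ + ‖Pp (f s)‖ :=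
      (norm_add_le _ _).trans (by gcongr; exact norm_add_le _ _)
    _ ≤ _ := by linarith

/-- Add the projections of the three model solutions, the constant z₀, and the homogeneous solution
carrying zp. -/
theorem exists_solution (h : IsSpectral P₀ Pm Pp M μm μp) (hm : μm ≤ 0) (hp : 1 ≤ μp)
    (hab : a < b) (hw : MemLp w 2 (volume.restrict (Ioc a b))) {z₀ zp : ι → ℂ}
    (hz₀ : P₀ z₀ = z₀) (hzp : Pp zp = zp) :
    ∃ f df, IsH1 a b f df ∧ f a = z₀ ∧ Pp (f b) = zp ∧
      ∀ᵐ s ∂volume.restrict (Ioc a b), df s = (s - a)⁻¹ • M (f s) - w s := by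
  obtain ⟨y0, hy0, h0⟩ := model_exists_left (μ := 0) le_rfl hab hw
  obtain ⟨y1, hy1, h1⟩ := model_exists_left hm hab hw
  obtain ⟨y2, hy2, hy2b, h2⟩ := model_exists_right hp hab hw
  -- The homogeneous solution of exponent μ₊, normalised to be 1 at b; it is continuously
  -- differentiable up to a because μ₊ ≥ 1.
  set c : ℝ → ℝ := fun s => ((b - a) ^ μp)⁻¹ * (s - a) ^ μp
  set c' : ℝ → ℝ := fun s => ((b - a) ^ μp)⁻¹ * (μp * (s - a) ^ (μp - 1))
  have hpos : 0 < b - a := by linarith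
  have hc'c : Continuous c' := by
    refine continuous_const.mul (continuous_const.mul ?_)
    exact (continuous_id.sub continuous_const).rpow_const fun x => Or.inr (by linarith)
  have hc : IsH1 a b (fun s => c s • zp) (fun s => c' s • zp) := by
    have hcont : Continuous (fun s => c' s • zp) := hc'c.smul continuous_const
    refine isH1_iff.2 ⟨IsAC.of_hasDerivAt (fun x _ => ?_)
      (hcont.integrableOn_Icc.mono_set Ioc_subset_Icc_self), ?_⟩
    · have := (((hasDerivAt_id x).sub_const a).rpow_const (p := μp) (Or.inr hp)).const_mul
        ((b - a) ^ μp)⁻¹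
      have := this.smul_const zp
      simpa [c, c'] using this
    · obtain ⟨C, hC⟩ := isCompact_Icc.exists_bound_of_continuousOn (hcont.continuousOn (s := Icc a b))
      refine MemLp.of_bound hcont.aestronglyMeasurable C ?_
      exact (ae_restrict_iff' measurableSet_Ioc).2 (ae_of_all _ fun x hx =>
        hC x (Ioc_subset_Icc_self hx))
  have hcc : ∀ s ∈ Ioc a b, c' s = (s - a)⁻¹ * (μp * c s) := by
    intro s hs
    have : 0 < s - a := by linarith [hs.1]
    simp only [c, c', Real.rpow_sub_one this.ne']
    field_simp
  have H0 := isH1_clm P₀ h0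
  have H1 := isH1_clm Pm h1
  have H2 := isH1_clm Pp h2
  refine ⟨fun s => z₀ + P₀ (y0 s) + Pm (y1 s) + Pp (y2 s) + c s • zp,
    fun s => 0 + P₀ ((0 * (s - a)⁻¹) • y0 s - w s) + Pm ((μm * (s - a)⁻¹) • y1 s - w s)
      + Pp ((μp * (s - a)⁻¹) • y2 s - w s) + c' s • zp, ?_, ?_, ?_, ?_⟩
  · refine isH1_iff.2 ⟨((((IsAC.const z₀).add H0.isAC).add H1.isAC).add H2.isAC).add hc.isAC, ?_⟩
    exact (((MemLp.zero.add H0.1).add H1.1).add H2.1).add hc.1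
  · simp [hy0, hy1, hy2, c, Real.zero_rpow (by linarith : μp ≠ 0)]
  · have : c b = 1 := inv_mul_cancel₀ (Real.rpow_pos_of_pos hpos _).ne'
    simp only [hy2b, map_add, h.pz, h.pm, this, one_smul, hzp, map_zero]
    rw [← hz₀, h.pz]
    simp
  · filter_upwards [ae_restrict_mem measurableSet_Ioc] with s hs
    have e0 : Pm z₀ = 0 := by rw [← hz₀, h.mz]
    have e1 : Pp z₀ = 0 := by rw [← hz₀, h.pz]
    have e2 : Pm zp = 0 := by rw [← hzp, h.mp]
    have hsum := h.sum (w s)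
    simp only [h.apply, map_add, map_sub, Pm.map_smul_of_tower, Pp.map_smul_of_tower,
      P₀.map_smul_of_tower, h.mz, h.mm, h.mp, h.pz, h.pm, h.pp, e0, e1, e2, hzp, hcc s hs]
    conv_rhs => rw [← hsum]
    module

end IsSpectral

theorem norm_mulVec_le_sum (B : Matrix ι ι ℂ) (v : ι → ℂ) :
    ‖B.mulVec v‖ ≤ (∑ i, ∑ j, ‖B i j‖) * ‖v‖ := by
  refine (pi_norm_le_iff_of_nonneg (by positivity)).2 fun i => ?_
  calc ‖B.mulVec v i‖ ≤ ∑ j, ‖B i j * v j‖ := norm_sum_le _ _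
    _ ≤ ∑ j, ‖B i j‖ * ‖v‖ := by
      gcongr with j
      rw [norm_mul]
      gcongr
      exact norm_le_pi_norm v j
    _ = (∑ j, ‖B i j‖) * ‖v‖ := by rw [Finset.sum_mul]
    _ ≤ _ := by
      gcongr ?_ * _
      exact Finset.single_le_sum (f := fun i => ∑ j, ‖B i j‖)
        (fun i _ => Finset.sum_nonneg fun j _ => norm_nonneg _) (Finset.mem_univ i)

theorem SqIntOn.memLp_sum_norm {A : Set ℝ} {B : ℝ → Matrix ι ι ℂ} (hB : SqIntOn B A) :
    MemLp (fun s => ∑ i, ∑ j, ‖B s i j‖) 2 (volume.restrict A) :=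
  memLp_finsetSum _ fun i _ => memLp_finsetSum _ fun j _ => (hB i j).norm

variable {P₀ Pm Pp M : (ι → ℂ) →L[ℂ] (ι → ℂ)} {μm μp : ℝ} {a b : ℝ} {A B : ℝ → Matrix ι ι ℂ}

theorem integral_mulVec_le (hab : a ≤ b) (hB : SqIntOn B (Ioc a b)) {f : ℝ → ι → ℂ} {K : ℝ}
    (hf : ContinuousOn f (Icc a b)) (hK : ∀ s ∈ Icc a b, ‖f s‖ ≤ K) :
    ∫ s in a..b, ‖(B s).mulVec (f s)‖ ≤ (∫ s in a..b, ∑ i, ∑ j, ‖B s i j‖) * K := by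
  rw [← intervalIntegral.integral_mul_const]
  refine intervalIntegral.integral_mono_on hab ?_ ?_ fun s hs => ?_
  · rw [intervalIntegrable_iff_integrableOn_Ioc_of_le hab]
    exact ((hB.mulVec measurableSet_Ioc Ioc_subset_Icc_self hf).integrable (by norm_num)).norm
  · rw [intervalIntegrable_iff_integrableOn_Ioc_of_le hab]
    exact (hB.memLp_sum_norm.integrable (by norm_num)).mul_const _
  · refine (norm_mulVec_le_sum _ _).trans ?_
    gcongr
    exact hK s hs

/-- Treat Bf as part of the source. At a point where ‖f‖ is maximal its contribution is at most half
of that maximum, by the smallness of ∫‖B‖, and is absorbed on the left; hence the factor 2. -/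
theorem perturbed_bound (h : IsSpectral P₀ Pm Pp M μm μp) (hm : μm ≤ 0) (hp : 1 ≤ μp)
    (hab : a ≤ b) (hB : SqIntOn B (Ioc a b))
    (hsmall : (‖P₀‖ + ‖Pm‖ + ‖Pp‖) * ∫ s in a..b, ∑ i, ∑ j, ‖B s i j‖ ≤ 1 / 2)
    {f df g : ℝ → ι → ℂ} (hf : IsAC a b f df) (hfa : P₀ (f a) = f a)
    (hg : IntegrableOn g (Ioc a b))
    (hd : ∀ᵐ s ∂volume.restrict (Ioc a b),
      df s = (s - a)⁻¹ • M (f s) + (B s).mulVec (f s) - g s) {s : ℝ} (hs : s ∈ Icc a b) :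
    ‖f s‖ ≤ 2 * (‖f a‖ + ‖Pp (f b)‖ + (‖P₀‖ + ‖Pm‖ + ‖Pp‖) * ∫ s in a..b, ‖g s‖) := by
  obtain ⟨x, hx, hmax⟩ := isCompact_Icc.exists_isMaxOn ⟨s, hs⟩ hf.continuousOn.norm
  have hBf := (hB.mulVec measurableSet_Ioc Ioc_subset_Icc_self hf.continuousOn).integrable
    (by norm_num : (1 : ENNReal) ≤ 2)
  have hw : IntegrableOn (fun s => g s - (B s).mulVec (f s)) (Ioc a b) := hg.sub hBf
  have key := h.bound hm hp hab hf hfa hw (by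
    filter_upwards [hd] with s hs
    rw [hs]; abel) hx
  have h1 := integral_mulVec_le hab hB hf.continuousOn (K := ‖f x‖) fun s hs => hmax hs
  have h2 : ∫ s in a..b, ‖g s - (B s).mulVec (f s)‖
      ≤ (∫ s in a..b, ‖g s‖) + ∫ s in a..b, ‖(B s).mulVec (f s)‖ := by
    have i1 : IntervalIntegrable (fun s => ‖g s‖) volume a b :=
      (intervalIntegrable_iff_integrableOn_Ioc_of_le hab).2 hg.norm
    have i2 : IntervalIntegrable (fun s => ‖(B s).mulVec (f s)‖) volume a b :=
      (intervalIntegrable_iff_integrableOn_Ioc_of_le hab).2 hBf.norm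
    rw [← intervalIntegral.integral_add i1 i2]
    refine intervalIntegral.integral_mono_on hab
      ((intervalIntegrable_iff_integrableOn_Ioc_of_le hab).2 hw.norm) (i1.add i2)
      fun s _ => norm_sub_le _ _
  have hC : 0 ≤ ‖P₀‖ + ‖Pm‖ + ‖Pp‖ := by positivity
  have h3 : (‖P₀‖ + ‖Pm‖ + ‖Pp‖) * ∫ s in a..b, ‖g s - (B s).mulVec (f s)‖
      ≤ (‖P₀‖ + ‖Pm‖ + ‖Pp‖) * (∫ s in a..b, ‖g s‖) + 1 / 2 * ‖f x‖ := by
    calc _ ≤ (‖P₀‖ + ‖Pm‖ + ‖Pp‖) * ((∫ s in a..b, ‖g s‖)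
          + (∫ s in a..b, ∑ i, ∑ j, ‖B s i j‖) * ‖f x‖) := by gcongr; linarith
      _ = (‖P₀‖ + ‖Pm‖ + ‖Pp‖) * (∫ s in a..b, ‖g s‖)
          + ((‖P₀‖ + ‖Pm‖ + ‖Pp‖) * ∫ s in a..b, ∑ i, ∑ j, ‖B s i j‖) * ‖f x‖ := by ring
      _ ≤ _ := by gcongr
  have h4 : ‖f s‖ ≤ ‖f x‖ := hmax hs
  linarith

/-- Banach's fixed point theorem on C([a, b]): freeze φ in the term Bφ and solve the unperturbed
equation with the same parameters. Differences of solutions then have zero parameters, and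
`IsSpectral.bound` together with the smallness of B gives contraction factor 1/2. -/
theorem perturbed_exists (h : IsSpectral P₀ Pm Pp M μm μp) (hm : μm ≤ 0) (hp : 1 ≤ μp)
    (hab : a < b) (hB : SqIntOn B (Ioc a b))
    (hsmall : (‖P₀‖ + ‖Pm‖ + ‖Pp‖) * ∫ s in a..b, ∑ i, ∑ j, ‖B s i j‖ ≤ 1 / 2)
    {g : ℝ → ι → ℂ} (hg : MemLp g 2 (volume.restrict (Ioc a b))) {z₀ zp : ι → ℂ}
    (hz₀ : P₀ z₀ = z₀) (hzp : Pp zp = zp) :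
    ∃ f df, IsH1 a b f df ∧ f a = z₀ ∧ Pp (f b) = zp ∧
      ∀ᵐ s ∂volume.restrict (Ioc a b),
        df s = (s - a)⁻¹ • M (f s) + (B s).mulVec (f s) - g s := by
  have hext : ∀ φ : C(Icc a b, ι → ℂ), Continuous (IccExtend hab.le φ) := fun φ =>
    φ.continuous.Icc_extend'
  have hBφ : ∀ φ : C(Icc a b, ι → ℂ), MemLp (fun s => (B s).mulVec (IccExtend hab.le φ s)) 2
      (volume.restrict (Ioc a b)) := fun φ =>
    hB.mulVec measurableSet_Ioc Ioc_subset_Icc_self (hext φ).continuousOn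
  have hex : ∀ φ : C(Icc a b, ι → ℂ), ∃ f df, IsH1 a b f df ∧ f a = z₀ ∧ Pp (f b) = zp ∧
      ∀ᵐ s ∂volume.restrict (Ioc a b),
        df s = (s - a)⁻¹ • M (f s) - (g s - (B s).mulVec (IccExtend hab.le φ s)) := fun φ =>
    h.exists_solution hm hp hab (hg.sub (hBφ φ)) hz₀ hzp
  choose F dF hF hFa hFb hFd using hex
  let T : C(Icc a b, ι → ℂ) → C(Icc a b, ι → ℂ) := fun φ =>
    ⟨fun x => F φ x, continuousOn_iff_continuous_domRestrict.1 (hF φ).isAC.continuousOn⟩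
  have hT : ContractingWith (1 / 2) T := by
    refine ⟨by rw [← NNReal.coe_lt_coe]; norm_num, LipschitzWith.of_dist_le_mul fun φ ψ => ?_⟩
    rw [ContinuousMap.dist_le (by positivity)]
    intro x
    have hd := (hF φ).isAC.sub (hF ψ).isAC
    have hw : IntegrableOn (fun s => (B s).mulVec (IccExtend hab.le ψ s - IccExtend hab.le φ s))
        (Ioc a b) :=
      (hB.mulVec measurableSet_Ioc Ioc_subset_Icc_self
        ((hext ψ).sub (hext φ)).continuousOn).integrable (by norm_num)
    have key := h.bound hm hp hab.le hd (by simp [hFa]) hw (by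
      filter_upwards [hFd φ, hFd ψ] with s h1 h2
      rw [h1, h2, Matrix.mulVec_sub, map_sub, smul_sub]
      abel) x.2
    have h1 := integral_mulVec_le hab.le hB ((hext ψ).sub (hext φ)).continuousOn
      (K := dist φ ψ) fun s hs => by
        simp only [Pi.sub_apply]
        rw [IccExtend_of_mem _ _ hs, IccExtend_of_mem _ _ hs, ← dist_eq_norm, dist_comm]
        exact ContinuousMap.dist_apply_le_dist _
    have e1 : F φ a - F ψ a = 0 := by simp [hFa]
    have e2 : Pp (F φ b - F ψ b) = 0 := by simp [hFb]
    rw [e1, e2, norm_zero, add_zero, zero_add] at key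
    have hC : 0 ≤ ‖P₀‖ + ‖Pm‖ + ‖Pp‖ := by positivity
    rw [dist_eq_norm]
    calc ‖F φ x - F ψ x‖ ≤ _ := key
      _ ≤ (‖P₀‖ + ‖Pm‖ + ‖Pp‖) * ((∫ s in a..b, ∑ i, ∑ j, ‖B s i j‖) * dist φ ψ) := by
        gcongr
        exact h1
      _ = ((‖P₀‖ + ‖Pm‖ + ‖Pp‖) * (∫ s in a..b, ∑ i, ∑ j, ‖B s i j‖)) * dist φ ψ := by ring
      _ ≤ _ := by gcongr; simpa using hsmall
  have : Nonempty C(Icc a b, ι → ℂ) := ⟨0⟩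
  set φ := hT.fixedPoint T
  have hφ : T φ = φ := hT.fixedPoint_isFixedPt
  refine ⟨F φ, dF φ, hF φ, hFa φ, hFb φ, ?_⟩
  filter_upwards [hFd φ, ae_restrict_mem measurableSet_Ioc] with s hs hm
  have e : IccExtend hab.le φ s = F φ s := by
    rw [IccExtend_of_mem _ _ (Ioc_subset_Icc_self hm)]
    exact (DFunLike.congr_fun hφ ⟨s, Ioc_subset_Icc_self hm⟩).symm
  rw [e] at hs
  rw [hs]
  abel

/-- Solvability on a short interval whose left end point is a regular singular point. -/
theorem pieceSolvable_of_small (h : IsSpectral P₀ Pm Pp M μm μp) (hm : μm ≤ 0) (hp : 1 ≤ μp)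
    (hab : a < b) (hB : SqIntOn B (Ioc a b))
    (hA : ∀ᵐ s ∂volume.restrict (Ioc a b), ∀ v,
      (A s).mulVec v = -((s - a)⁻¹ • M v) - (B s).mulVec v)
    (hsmall : (‖P₀‖ + ‖Pm‖ + ‖Pp‖) * ∫ s in a..b, ∑ i, ∑ j, ‖B s i j‖ ≤ 1 / 2)
    {m : ℕ} (hrank : m = Module.finrank ℂ P₀.range + Module.finrank ℂ Pp.range) :
    PieceSolvable a b A P₀.range ⊤ m := by
  have hrange : ∀ v ∈ P₀.range, P₀ v = v := by
    rintro _ ⟨v, rfl⟩; exact h.zz v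
  have hrange' : ∀ v ∈ Pp.range, Pp v = v := by
    rintro _ ⟨v, rfl⟩; exact h.pp v
  have hMz : ∀ v, P₀ v = v → M v = 0 := by
    intro v hv; rw [← hv, h.apply, h.mz, h.pz]; simp
  refine ⟨fun f df hf hfa _ => ?_, ?_⟩
  · have h1 : IsH1 a b (fun s => f s - f a) df := by
      refine isH1_iff.2 ⟨?_, hf.1⟩
      simpa using hf.isAC.sub (IsAC.const (f a))
    have h2 := M.comp_memLp' (h1.memLp_div (sub_self _))
    have h3 := hB.mulVec measurableSet_Ioc Ioc_subset_Icc_self hf.isAC.continuousOn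
    refine (h2.neg.sub h3).ae_eq ?_
    filter_upwards [hA] with s hs
    rw [hs]
    simp [M.map_smul_of_tower, hMz _ (hrange _ hfa)]
  -- The free parameters are the 0-component of f(a) and the μ₊-component of f(b).
  · let e : (P₀.range × Pp.range) ≃ₗ[ℂ] (Fin m → ℂ) :=
      LinearEquiv.ofFinrankEq _ _ (by simp [hrank])
    let ζ : ((ι → ℂ) × (ι → ℂ)) →ₗ[ℂ] (Fin m → ℂ) := e.toLinearMap ∘ₗ
      ((P₀ : (ι → ℂ) →ₗ[ℂ] (ι → ℂ)).rangeRestrict.prodMap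
        (Pp : (ι → ℂ) →ₗ[ℂ] (ι → ℂ)).rangeRestrict)
    refine ⟨ζ, fun f df hf hfa _ hd hz => ?_, ?_⟩
    · have hz' : ((P₀ : (ι → ℂ) →ₗ[ℂ] (ι → ℂ)).rangeRestrict (f a),
          (Pp : (ι → ℂ) →ₗ[ℂ] (ι → ℂ)).rangeRestrict (f b)) = 0 :=
        e.map_eq_zero_iff.1 hz
      have z1 : P₀ (f a) = 0 := congrArg Subtype.val (Prod.ext_iff.1 hz').1
      have z2 : Pp (f b) = 0 := congrArg Subtype.val (Prod.ext_iff.1 hz').2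
      have fa0 : f a = 0 := by rw [← hrange _ hfa, z1]
      have hb := perturbed_bound h hm hp hab.le hB hsmall (g := 0) hf.isAC (hrange _ hfa)
        (integrable_zero _ _ _) (by
          filter_upwards [hd, hA] with s h1 h2
          rw [h1, h2]; simp; abel) (right_mem_Icc.2 hab.le)
      rw [fa0, z2] at hb
      simp only [norm_zero, Pi.zero_apply, intervalIntegral.integral_zero, mul_zero,
        add_zero] at hb
      exact ⟨fa0, norm_le_zero_iff.1 hb⟩
    · let L : (Fin m → ℂ) →L[ℂ] (P₀.range × Pp.range) :=
        LinearMap.toContinuousLinearMap e.symm.toLinearMap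
      set C := ‖P₀‖ + ‖Pm‖ + ‖Pp‖
      have hC : 0 ≤ C := by positivity
      refine ⟨2 * (‖L‖ + ‖L‖ + C), fun z g hg => ?_⟩
      obtain ⟨f, df, hf, hfa, hfb, hd⟩ := perturbed_exists h hm hp hab hB hsmall hg
        (hrange _ (e.symm z).1.2) (hrange' _ (e.symm z).2.2)
      have hz : ζ (f a, f b) = z := by
        change e ((P₀ : (ι → ℂ) →ₗ[ℂ] (ι → ℂ)).rangeRestrict (f a),
          (Pp : (ι → ℂ) →ₗ[ℂ] (ι → ℂ)).rangeRestrict (f b)) = z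
        rw [← e.eq_symm_apply]
        refine Prod.ext (Subtype.ext ?_) (Subtype.ext hfb)
        change P₀ (f a) = _
        rw [hfa, hrange _ (e.symm z).1.2]
      have hb : ∀ s ∈ Icc a b, ‖f s‖ ≤ 2 * (‖L‖ + ‖L‖ + C) * (‖z‖ + ∫ s in a..b, ‖g s‖) := by
        intro s hs
        have hb := perturbed_bound h hm hp hab.le hB hsmall hf.isAC
          (by rw [hfa]; exact hrange _ (e.symm z).1.2) (hg.integrable (by norm_num)) hd hs
        rw [hfa, hfb] at hb
        have n1 : ‖((e.symm z).1 : ι → ℂ)‖ ≤ ‖L‖ * ‖z‖ :=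
          (norm_fst_le (L z)).trans (L.le_opNorm z)
        have n2 : ‖((e.symm z).2 : ι → ℂ)‖ ≤ ‖L‖ * ‖z‖ :=
          (norm_snd_le (L z)).trans (L.le_opNorm z)
        have hI : 0 ≤ ∫ s in a..b, ‖g s‖ :=
          intervalIntegral.integral_nonneg hab.le fun _ _ => norm_nonneg _
        have p1 : 0 ≤ ‖L‖ * ∫ s in a..b, ‖g s‖ := by positivity
        have p2 : 0 ≤ C * ‖z‖ := by positivity
        change _ ≤ 2 * (_ + _ + C * _) at hb
        nlinarith
      refine ⟨f, df, hf, ?_, trivial, ?_, hz, hb _ (left_mem_Icc.2 hab.le),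
        hb _ (right_mem_Icc.2 hab.le)⟩
      · rw [hfa]; exact (e.symm z).1.2
      · filter_upwards [hd, hA] with s h1 h2
        rw [h1, h2]; abel

end Pieces

end

section

/-! ### Gluing and reflection -/

section Glue

variable {a b c : ℝ}

theorem ae_Ioc_glue (hac : a ≤ c) (hcb : c ≤ b) {p : ℝ → Prop}
    (h1 : ∀ᵐ s ∂volume.restrict (Ioc a c), p s) (h2 : ∀ᵐ s ∂volume.restrict (Ioc c b), p s) :
    ∀ᵐ s ∂volume.restrict (Ioc a b), p s := by
  rw [← Ioc_union_Ioc_eq_Ioc hac hcb, ae_restrict_union_iff]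
  exact ⟨h1, h2⟩

theorem memLp_Ioc_glue {E : Type*} [NormedAddCommGroup E] {f : ℝ → E} (hac : a ≤ c) (hcb : c ≤ b)
    (h1 : MemLp f 2 (volume.restrict (Ioc a c))) (h2 : MemLp f 2 (volume.restrict (Ioc c b))) :
    MemLp f 2 (volume.restrict (Ioc a b)) := by
  have hm : AEStronglyMeasurable f (volume.restrict (Ioc a b)) := by
    rw [← Ioc_union_Ioc_eq_Ioc hac hcb]
    exact aestronglyMeasurable_union_iff.2 ⟨h1.1, h2.1⟩
  rw [memLp_two_iff_integrable_sq_norm hm]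
  rw [memLp_two_iff_integrable_sq_norm h1.1] at h1
  rw [memLp_two_iff_integrable_sq_norm h2.1] at h2
  rw [← Ioc_union_Ioc_eq_Ioc hac hcb]
  exact IntegrableOn.union h1 h2

variable {E : Type*} [NormedAddCommGroup E]

theorem exists_glue [NormedSpace ℝ E] (hac : a ≤ c) (hcb : c ≤ b) {f₁ f₂ d₁ d₂ : ℝ → E}
    (h1 : IsH1 a c f₁ d₁)
    (h2 : IsH1 c b f₂ d₂) (hc : f₁ c = f₂ c) :
    ∃ f df, IsH1 a b f df ∧ (∀ s ∈ Icc a c, f s = f₁ s) ∧ (∀ s ∈ Icc c b, f s = f₂ s) ∧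
      (∀ s ∈ Ioc a c, df s = d₁ s) ∧ ∀ s ∈ Ioc c b, df s = d₂ s := by
  classical
  set f : ℝ → E := fun s => if s ≤ c then f₁ s else f₂ s
  set df : ℝ → E := fun s => if s ≤ c then d₁ s else d₂ s
  have e1 : ∀ s ∈ Icc a c, f s = f₁ s := fun s hs => if_pos hs.2
  have e2 : ∀ s ∈ Icc c b, f s = f₂ s := by
    intro s hs
    rcases hs.1.eq_or_lt with rfl | h
    · simp [f, hc]
    · exact if_neg (not_le.2 h)
  have e3 : ∀ s ∈ Ioc a c, df s = d₁ s := fun s hs => if_pos hs.2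
  have e4 : ∀ s ∈ Ioc c b, df s = d₂ s := fun s hs => if_neg (not_le.2 hs.1)
  have a3 : ∀ᵐ s ∂volume.restrict (Ioc a c), df s = d₁ s :=
    (ae_restrict_iff' measurableSet_Ioc).2 (ae_of_all _ e3)
  have a4 : ∀ᵐ s ∂volume.restrict (Ioc c b), df s = d₂ s :=
    (ae_restrict_iff' measurableSet_Ioc).2 (ae_of_all _ e4)
  refine ⟨f, df, isH1_iff.2 ⟨?_, ?_⟩, e1, e2, e3, e4⟩
  · exact (h1.isAC.congr e1 a3).glue hac hcb (h2.isAC.congr e2 a4)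
  · exact memLp_Ioc_glue hac hcb (h1.1.ae_eq (a3.mono fun _ h => h.symm))
      (h2.1.ae_eq (a4.mono fun _ h => h.symm))

theorem measurePreserving_neg_Ioc (a b : ℝ) :
    MeasurePreserving (fun s : ℝ => -s) (volume.restrict (Ioc (-b) (-a)))
      (volume.restrict (Ioc a b)) := by
  have := (Measure.measurePreserving_neg (volume : Measure ℝ)).restrict_preimage
    (measurableSet_Ioo (a := a) (b := b))
  have e : Neg.neg ⁻¹' Ioo a b = Ioo (-b) (-a) := by simp
  rw [e, restrict_Ioo_eq_restrict_Ioc, restrict_Ioo_eq_restrict_Ioc] at this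
  exact this

theorem memLp_comp_neg {f : ℝ → E} (h : MemLp f 2 (volume.restrict (Ioc a b))) :
    MemLp (fun s => f (-s)) 2 (volume.restrict (Ioc (-b) (-a))) :=
  h.comp_measurePreserving (measurePreserving_neg_Ioc a b)

theorem memLp_comp_neg' {f : ℝ → E} (h : MemLp f 2 (volume.restrict (Ioc (-b) (-a)))) :
    MemLp (fun s => f (-s)) 2 (volume.restrict (Ioc a b)) := by
  simpa using memLp_comp_neg h

theorem ae_comp_neg {p : ℝ → Prop} (h : ∀ᵐ s ∂volume.restrict (Ioc a b), p s) :
    ∀ᵐ s ∂volume.restrict (Ioc (-b) (-a)), p (-s) :=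
  (measurePreserving_neg_Ioc a b).quasiMeasurePreserving.ae h

theorem ae_comp_neg' {p : ℝ → Prop} (h : ∀ᵐ s ∂volume.restrict (Ioc (-b) (-a)), p s) :
    ∀ᵐ s ∂volume.restrict (Ioc a b), p (-s) := by
  simpa using ae_comp_neg h

variable [NormedSpace ℝ E]

theorem IsH1.reflect {f df : ℝ → E} (h : IsH1 a b f df) :
    IsH1 (-b) (-a) (fun s => f (-s)) (fun s => -df (-s)) :=
  isH1_iff.2 ⟨h.isAC.reflect, (memLp_comp_neg h.1).neg⟩

theorem IsH1.reflect' {f df : ℝ → E} (h : IsH1 (-b) (-a) f df) :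
    IsH1 a b (fun s => f (-s)) (fun s => -df (-s)) := by
  simpa using h.reflect

end Glue

/-! ### Reflection of pieces and the regular Cauchy problem -/

section Pieces

variable {ι : Type*} [Fintype ι] {a b : ℝ} {A : ℝ → Matrix ι ι ℂ}

/-- The substitution s ↦ −s changes the sign of the derivative, hence replaces A by −A(−s) and g by
−g(−s), and exchanges the two ends. Singular right ends are thereby reduced to singular left ends.
-/
theorem PieceSolvable.reflect {Wa Wb : Submodule ℂ (ι → ℂ)} {m : ℕ}
    (h : PieceSolvable a b A Wa Wb m) :
    PieceSolvable (-b) (-a) (fun s => -A (-s)) Wb Wa m := by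
  obtain ⟨h1, ζ, h2, C, h3⟩ := h
  refine ⟨fun f df hf ha hb => ?_, ζ ∘ₗ LinearMap.prod (LinearMap.snd _ _ _) (LinearMap.fst _ _ _),
    fun f df hf ha hb hd hz => ?_, C, fun z g hg => ?_⟩
  · have := (memLp_comp_neg (h1 _ _ hf.reflect' hb ha)).neg
    refine this.ae_eq (ae_of_all _ fun s => ?_)
    simp [Matrix.neg_mulVec]
  · refine (h2 _ _ hf.reflect' hb ha ?_ hz).symm
    filter_upwards [ae_comp_neg' hd] with s hs
    rw [hs]
    simp [Matrix.neg_mulVec]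
  · obtain ⟨f, df, hf, ha, hb, hd, hz, n1, n2⟩ := h3 z (fun s => -g (-s)) (memLp_comp_neg' hg).neg
    have e : ∫ s in a..b, ‖-g (-s)‖ = ∫ s in (-b)..(-a), ‖g s‖ := by
      simp only [norm_neg]
      rw [intervalIntegral.integral_comp_neg fun s => ‖g s‖]
    rw [e] at n1 n2
    refine ⟨_, _, hf.reflect, by simpa using hb, by simpa using ha, ?_, by simpa using hz,
      by simpa using n2, by simpa using n1⟩
    filter_upwards [ae_comp_neg hd] with s hs
    rw [hs]
    simp [Matrix.neg_mulVec]
    abel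

/-- Solvability of the Cauchy problem `-f' - A f = g`, `f(a) = z`. -/
def CauchySolvable (a b : ℝ) (A : ℝ → Matrix ι ι ℂ) : Prop :=
  (∀ f df, IsH1 a b f df → (∀ᵐ s ∂volume.restrict (Ioc a b), df s = -(A s).mulVec (f s)) →
    f a = 0 → f b = 0) ∧
  ∃ C, 0 ≤ C ∧ ∀ (z : ι → ℂ) (g : ℝ → ι → ℂ), MemLp g 2 (volume.restrict (Ioc a b)) →
    ∃ f df, IsH1 a b f df ∧ f a = z ∧
      (∀ᵐ s ∂volume.restrict (Ioc a b), df s = -(A s).mulVec (f s) - g s) ∧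
      ‖f b‖ ≤ C * (‖z‖ + ∫ s in a..b, ‖g s‖)

theorem isSpectral_one {ι : Type*} : IsSpectral (ContinuousLinearMap.id ℂ (ι → ℂ)) 0 0 0 0 1 := by
  constructor <;> simp

/-- The regular case is the singular one with vanishing residue, P₀ the identity and the other two
projections zero. -/
theorem cauchySolvable_of_small (hab : a < b) (hA : SqIntOn A (Ioc a b))
    (hsmall : ∫ s in a..b, ∑ i, ∑ j, ‖A s i j‖ ≤ 1 / 2) : CauchySolvable a b A := by
  have hB : SqIntOn (fun s => -A s) (Ioc a b) := fun i j => (hA i j).neg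
  have hI : 0 ≤ ∫ s in a..b, ∑ i, ∑ j, ‖A s i j‖ :=
    intervalIntegral.integral_nonneg hab.le fun _ _ => by positivity
  have hs : (‖ContinuousLinearMap.id ℂ (ι → ℂ)‖ + ‖(0 : (ι → ℂ) →L[ℂ] (ι → ℂ))‖ +
      ‖(0 : (ι → ℂ) →L[ℂ] (ι → ℂ))‖) * ∫ s in a..b, ∑ i, ∑ j, ‖(fun s => -A s) s i j‖ ≤ 1 / 2 := by
    simp only [Matrix.neg_apply, norm_neg, norm_zero, add_zero]
    calc _ ≤ 1 * ∫ s in a..b, ∑ i, ∑ j, ‖A s i j‖ :=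
          mul_le_mul_of_nonneg_right ContinuousLinearMap.norm_id_le hI
      _ ≤ _ := by rwa [one_mul]
  refine ⟨fun f df hf hd h0 => ?_, 2, by norm_num, fun z g hg => ?_⟩
  · have := perturbed_bound isSpectral_one le_rfl le_rfl hab.le hB hs (g := 0) hf.isAC rfl
      (integrable_zero _ _ _) (by
        filter_upwards [hd] with s hs
        rw [hs]; simp [Matrix.neg_mulVec]) (right_mem_Icc.2 hab.le)
    simpa [h0] using this
  · obtain ⟨f, df, hf, ha, -, hd⟩ := perturbed_exists isSpectral_one le_rfl le_rfl hab hB hs hg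
      (z₀ := z) (zp := 0) rfl rfl
    refine ⟨f, df, hf, ha, ?_, ?_⟩
    · filter_upwards [hd] with s hs
      rw [hs]; simp [Matrix.neg_mulVec]
    · have := perturbed_bound isSpectral_one le_rfl le_rfl hab.le hB hs hf.isAC rfl
        (hg.integrable (by norm_num)) hd (right_mem_Icc.2 hab.le)
      have hG : 0 ≤ ∫ s in a..b, ‖g s‖ :=
        intervalIntegral.integral_nonneg hab.le fun _ _ => norm_nonneg _
      rw [ha] at this
      simp only [_root_.zero_apply, norm_zero, add_zero] at this
      refine this.trans ?_
      gcongr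
      calc _ ≤ 1 * ∫ s in a..b, ‖g s‖ :=
            mul_le_mul_of_nonneg_right ContinuousLinearMap.norm_id_le hG
        _ ≤ _ := by rw [one_mul]

theorem CauchySolvable.trans {c : ℝ} (hac : a ≤ c) (hcb : c ≤ b) (h1 : CauchySolvable a c A)
    (h2 : CauchySolvable c b A) : CauchySolvable a b A := by
  obtain ⟨u1, C, hC, e1⟩ := h1
  obtain ⟨u2, D, hD, e2⟩ := h2
  refine ⟨fun f df hf hd h0 => ?_, D * (C + 1), by positivity, fun z g hg => ?_⟩
  · refine u2 f df (hf.mono hac le_rfl)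
      (ae_restrict_of_ae_restrict_of_subset (Ioc_subset_Ioc_left hac) hd) ?_
    exact u1 f df (hf.mono le_rfl hcb)
      (ae_restrict_of_ae_restrict_of_subset (Ioc_subset_Ioc_right hcb) hd) h0
  · obtain ⟨f₁, d₁, hf1, ha1, hd1, n1⟩ := e1 z g (memLp_mono_Ioc hg le_rfl hcb)
    obtain ⟨f₂, d₂, hf2, ha2, hd2, n2⟩ := e2 (f₁ c) g (memLp_mono_Ioc hg hac le_rfl)
    obtain ⟨f, df, hf, q1, q2, q3, q4⟩ := exists_glue hac hcb hf1 hf2 ha2.symm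
    refine ⟨f, df, hf, by rw [q1 a (left_mem_Icc.2 hac), ha1], ae_Ioc_glue hac hcb ?_ ?_, ?_⟩
    · filter_upwards [hd1, ae_restrict_mem measurableSet_Ioc] with s hs hm
      rw [q3 s hm, hs, q1 s (Ioc_subset_Icc_self hm)]
    · filter_upwards [hd2, ae_restrict_mem measurableSet_Ioc] with s hs hm
      rw [q4 s hm, hs, q2 s (Ioc_subset_Icc_self hm)]
    · rw [q2 b (right_mem_Icc.2 hcb)]
      have hgi : IntegrableOn (fun s => ‖g s‖) (Ioc a b) := (hg.integrable (by norm_num)).norm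
      have i1 := integral_le_of_Icc (fun s => norm_nonneg (g s)) hgi le_rfl hac hcb
      have i2 := integral_le_of_Icc (fun s => norm_nonneg (g s)) hgi hac hcb le_rfl
      have hz := norm_nonneg z
      calc ‖f₂ b‖ ≤ D * (‖f₁ c‖ + ∫ s in c..b, ‖g s‖) := n2
        _ ≤ D * (C * (‖z‖ + ∫ s in a..b, ‖g s‖) + (‖z‖ + ∫ s in a..b, ‖g s‖)) := by
          gcongr
          · exact n1.trans (by gcongr)
          · linarith
        _ = _ := by ring

/-- Cut off successive intervals over which ∫‖A‖ equals 1/2 and concatenate the solutions. The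
induction runs over an integer n ≥ 2∫‖A‖, and each cut lowers this bound by one. -/
theorem cauchySolvable (hab : a < b) (hA : SqIntOn A (Ioc a b)) : CauchySolvable a b A := by
  obtain ⟨n, hn⟩ := exists_nat_ge ((∫ s in a..b, ∑ i, ∑ j, ‖A s i j‖) * 2)
  induction n generalizing a with
  | zero =>
    refine cauchySolvable_of_small hab hA ?_
    simp only [Nat.cast_zero] at hn
    linarith
  | succ n ih =>
    rcases le_or_gt (∫ s in a..b, ∑ i, ∑ j, ‖A s i j‖) (1 / 2) with hs | hs
    · exact cauchySolvable_of_small hab hA hs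
    have hi : IntegrableOn (fun s => ∑ i, ∑ j, ‖A s i j‖) (Ioc a b) :=
      hA.memLp_sum_norm.integrable (by norm_num)
    have hP : IsAC a b (fun x => ∫ s in a..x, ∑ i, ∑ j, ‖A s i j‖)
      (fun s => ∑ i, ∑ j, ‖A s i j‖) := ⟨hi, by simp⟩
    -- The point where the accumulated integral of ‖A‖ reaches exactly 1/2.
    obtain ⟨c, hc, hc2⟩ := intermediate_value_Icc hab.le hP.continuousOn
      (show (1 / 2 : ℝ) ∈ _ from ⟨by simp, hs.le⟩)
    simp only at hc2
    have hac : a < c := by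
      refine lt_of_le_of_ne hc.1 ?_
      rintro rfl
      norm_num at hc2
    have hcb : c < b := by
      refine lt_of_le_of_ne hc.2 ?_
      rintro rfl
      linarith
    refine CauchySolvable.trans hc.1 hc.2
      (cauchySolvable_of_small hac (hA.mono (Ioc_subset_Ioc_right hc.2)) hc2.le)
      (ih hcb (hA.mono (Ioc_subset_Ioc_left hc.1)) ?_)
    have := hP.sub_eq hc (right_mem_Icc.2 hab.le)
    push_cast at hn
    rw [← this, hc2]
    linarith

theorem pieceSolvable_regular (hab : a < b) (hA : SqIntOn A (Ioc a b)) :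
    PieceSolvable a b A ⊤ ⊤ (Fintype.card ι) := by
  obtain ⟨hu, C, hC, he⟩ := cauchySolvable hab hA
  let e : (ι → ℂ) ≃ₗ[ℂ] (Fin (Fintype.card ι) → ℂ) :=
    LinearEquiv.ofFinrankEq _ _ (by simp)
  let L : (Fin (Fintype.card ι) → ℂ) →L[ℂ] (ι → ℂ) :=
    LinearMap.toContinuousLinearMap e.symm.toLinearMap
  refine ⟨fun f df hf _ _ => hA.mulVec measurableSet_Ioc Ioc_subset_Icc_self hf.isAC.continuousOn,
    e.toLinearMap ∘ₗ LinearMap.fst _ _ _, fun f df hf _ _ hd hz => ?_, (C + 1) * (‖L‖ + 1),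
    fun z g hg => ?_⟩
  · have hz' : f a = 0 := e.map_eq_zero_iff.1 hz
    exact ⟨hz', hu f df hf hd hz'⟩
  · obtain ⟨f, df, hf, ha, hd, hb⟩ := he (e.symm z) g hg
    have hG : 0 ≤ ∫ s in a..b, ‖g s‖ :=
      intervalIntegral.integral_nonneg hab.le fun _ _ => norm_nonneg _
    have n1 : ‖e.symm z‖ ≤ ‖L‖ * ‖z‖ := L.le_opNorm z
    have hz := norm_nonneg z
    have hL := norm_nonneg L
    have n2 : ‖e.symm z‖ + ∫ s in a..b, ‖g s‖ ≤ (‖L‖ + 1) * (‖z‖ + ∫ s in a..b, ‖g s‖) := by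
      have : 0 ≤ ‖L‖ * ∫ s in a..b, ‖g s‖ := by positivity
      nlinarith
    refine ⟨f, df, hf, trivial, trivial, hd, ?_, ?_, ?_⟩
    · change e (f a) = z
      rw [ha, e.apply_symm_apply]
    · rw [ha]
      calc ‖e.symm z‖ ≤ 1 * ((‖L‖ + 1) * (‖z‖ + ∫ s in a..b, ‖g s‖)) := by linarith
        _ ≤ (C + 1) * ((‖L‖ + 1) * (‖z‖ + ∫ s in a..b, ‖g s‖)) := by gcongr; linarith
        _ = _ := by ring
    · calc ‖f b‖ ≤ C * ((‖L‖ + 1) * (‖z‖ + ∫ s in a..b, ‖g s‖)) := hb.trans (by gcongr)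
        _ ≤ (C + 1) * ((‖L‖ + 1) * (‖z‖ + ∫ s in a..b, ‖g s‖)) := by gcongr; linarith
        _ = _ := by ring

/-- Solvability on all sufficiently short intervals at a regular singular end point. -/
theorem eventually_pieceSolvable {P₀ Pm Pp M : (ι → ℂ) →L[ℂ] (ι → ℂ)} {μm μp : ℝ}
    {B : ℝ → Matrix ι ι ℂ} (h : IsSpectral P₀ Pm Pp M μm μp) (hm : μm ≤ 0) (hp : 1 ≤ μp)
    (hab : a < b) (hB : SqIntOn B (Ioc a b))
    (hA : ∀ᵐ s ∂volume.restrict (Ioc a b), ∀ v,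
      (A s).mulVec v = -((s - a)⁻¹ • M v) - (B s).mulVec v)
    {m : ℕ} (hrank : m = Module.finrank ℂ P₀.range + Module.finrank ℂ Pp.range) :
    ∀ᶠ c in 𝓝[>] a, PieceSolvable a c A P₀.range ⊤ m := by
  have hi : IntegrableOn (fun s => ∑ i, ∑ j, ‖B s i j‖) (Ioc a b) :=
    hB.memLp_sum_norm.integrable (by norm_num)
  have hP : IsAC a b (fun x => ∫ s in a..x, ∑ i, ∑ j, ‖B s i j‖)
    (fun s => ∑ i, ∑ j, ‖B s i j‖) := ⟨hi, by simp⟩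
  have h1 := hP.continuousOn a (left_mem_Icc.2 hab.le)
  have h2 : Tendsto (fun x => (‖P₀‖ + ‖Pm‖ + ‖Pp‖) * ∫ s in a..x, ∑ i, ∑ j, ‖B s i j‖) (𝓝[>] a)
      (𝓝 0) := by
    have h3 : Tendsto (fun x => ∫ s in a..x, ∑ i, ∑ j, ‖B s i j‖) (𝓝[>] a) (𝓝 0) := by
      rw [ContinuousWithinAt, intervalIntegral.integral_same] at h1
      refine h1.mono_left ?_
      rw [← nhdsWithin_Ioo_eq_nhdsGT hab]
      exact nhdsWithin_mono _ Ioo_subset_Icc_self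
    simpa using h3.const_mul (‖P₀‖ + ‖Pm‖ + ‖Pp‖)
  filter_upwards [h2.eventually (gt_mem_nhds (show (0 : ℝ) < 1 / 2 by norm_num)),
    Ioc_mem_nhdsGT hab] with c hc hcm
  exact pieceSolvable_of_small h hm hp hcm.1 (hB.mono (Ioc_subset_Ioc_right hcm.2))
    (ae_restrict_of_ae_restrict_of_subset (Ioc_subset_Ioc_right hcm.2) hA) hc.le hrank

end Pieces

end

section

/-! ### The solution operator on a subinterval -/

section Strip

variable {ι : Type*} [Fintype ι] {A : ℝ → Matrix ι ι ℂ}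

/-- The space `L²((a, b), ℂ^ι)`. -/
abbrev LTwo (ι : Type*) [Fintype ι] (a b : ℝ) : Type _ :=
  Lp (ι → ℂ) 2 (volume.restrict (Ioc a b))

theorem integral_norm_le_lp {a b : ℝ} (hab : a ≤ b) {c d : ℝ} (hc : a ≤ c) (hcd : c ≤ d)
    (hd : d ≤ b) (g : LTwo ι a b) : ∫ s in c..d, ‖g s‖ ≤ √(b - a) * ‖g‖ := by
  have hg := Lp.memLp g
  have h1 : ∫ s in c..d, ‖g s‖ ≤ ∫ s in a..b, ‖g s‖ :=
    integral_le_of_Icc (fun s => norm_nonneg _) (hg.integrable (by norm_num)).norm hc hcd hd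
  have h2 := sq_integral_le hab hg.norm
  have h3 : ∫ s in a..b, ‖g s‖ ^ 2 = ‖g‖ ^ 2 := by
    have := hg.eLpNorm_eq_integral_rpow_norm (by norm_num) (by norm_num)
    rw [Lp.norm_def, this, ENNReal.toReal_ofReal (by positivity), ENNReal.toReal_ofNat,
      ← one_div, ← Real.sqrt_eq_rpow, Real.sq_sqrt (by positivity), intervalIntegral.integral_of_le hab]
    · simp
  rw [h3] at h2
  refine h1.trans ?_
  rw [← Real.sqrt_sq (norm_nonneg g), ← Real.sqrt_mul (by linarith)]
  exact Real.le_sqrt_of_sq_le h2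

/-- Uniqueness of the end values makes them a linear function of (z, g), although the solutions
themselves are merely chosen, and the a priori bound makes this function continuous. Applying ζ to
the end values recovers z, which gives the last clause of the first part. -/
theorem PieceSolvable.exists_clm {a b : ℝ} {Wa Wb : Submodule ℂ (ι → ℂ)} {m : ℕ}
    (h : PieceSolvable a b A Wa Wb m) (hab : a ≤ b) {a₀ b₀ : ℝ} (ha : a₀ ≤ a) (hb : b ≤ b₀) :
    ∃ Φ : ((Fin m → ℂ) × LTwo ι a₀ b₀) →L[ℂ] ((ι → ℂ) × (ι → ℂ)),
      (∀ z g, ∃ f df, IsH1 a b f df ∧ f a ∈ Wa ∧ f b ∈ Wb ∧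
        (∀ᵐ s ∂volume.restrict (Ioc a b), df s = -(A s).mulVec (f s) - g s) ∧
        Φ (z, g) = (f a, f b) ∧ (Φ (z, g) = 0 → z = 0)) ∧
      ∀ f df, IsH1 a b f df → f a ∈ Wa → f b ∈ Wb → ∀ g : LTwo ι a₀ b₀,
        (∀ᵐ s ∂volume.restrict (Ioc a b), df s = -(A s).mulVec (f s) - g s) →
        ∃ z, Φ (z, g) = (f a, f b) := by
  obtain ⟨-, ζ, hu, C, he⟩ := h
  have hsub : Ioc a b ⊆ Ioc a₀ b₀ := Ioc_subset_Ioc ha hb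
  have hex : ∀ x : (Fin m → ℂ) × LTwo ι a₀ b₀, ∃ f df, IsH1 a b f df ∧ f a ∈ Wa ∧ f b ∈ Wb ∧
        (∀ᵐ s ∂volume.restrict (Ioc a b), df s = -(A s).mulVec (f s) - x.2 s) ∧
        ζ (f a, f b) = x.1 ∧ ‖f a‖ ≤ C * (‖x.1‖ + ∫ s in a..b, ‖x.2 s‖) ∧
        ‖f b‖ ≤ C * (‖x.1‖ + ∫ s in a..b, ‖x.2 s‖) := fun x =>
    he x.1 x.2 (memLp_mono_Ioc (Lp.memLp x.2) ha hb)
  choose F dF hF hFa hFb hFd hFz n1 n2 using hex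
  have key : ∀ (x : (Fin m → ℂ) × LTwo ι a₀ b₀) f df, IsH1 a b f df → f a ∈ Wa → f b ∈ Wb →
      (∀ᵐ s ∂volume.restrict (Ioc a b), df s = -(A s).mulVec (f s) - x.2 s) →
      ζ (f a, f b) = x.1 → (F x a, F x b) = (f a, f b) := by
    intro x f df hf h1 h2 hd hz
    have hH : IsH1 a b (fun s => F x s - f s) (fun s => dF x s - df s) :=
      isH1_iff.2 ⟨(hF x).isAC.sub hf.isAC, (hF x).1.sub hf.1⟩
    have := hu _ _ hH (Wa.sub_mem (hFa x) h1) (Wb.sub_mem (hFb x) h2) (by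
      filter_upwards [hFd x, hd] with s e1 e2
      rw [e1, e2, Matrix.mulVec_sub]; abel) (by
      rw [← Prod.mk_sub_mk, map_sub, hFz, hz, sub_self])
    exact Prod.ext (sub_eq_zero.1 this.1) (sub_eq_zero.1 this.2)
  let L : ((Fin m → ℂ) × LTwo ι a₀ b₀) →ₗ[ℂ] ((ι → ℂ) × (ι → ℂ)) :=
    { toFun := fun x => (F x a, F x b)
      map_add' := fun x y => by
        refine key (x + y) (fun s => F x s + F y s) (fun s => dF x s + dF y s)
          (isH1_iff.2 ⟨(hF x).isAC.add (hF y).isAC, (hF x).1.add (hF y).1⟩)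
          (Wa.add_mem (hFa x) (hFa y)) (Wb.add_mem (hFb x) (hFb y)) ?_ ?_
        · filter_upwards [hFd x, hFd y, ae_restrict_of_ae_restrict_of_subset hsub
            (Lp.coeFn_add x.2 y.2)] with s e1 e2 e3
          rw [e1, e2, Prod.snd_add, e3, Matrix.mulVec_add, Pi.add_apply]; abel
        · rw [← Prod.mk_add_mk, map_add, hFz, hFz, Prod.fst_add]
      map_smul' := fun c x => by
        refine key (c • x) (fun s => c • F x s) (fun s => c • dF x s)
          (isH1_iff.2 ⟨?_, (hF x).1.const_smul c⟩)
          (Wa.smul_mem c (hFa x)) (Wb.smul_mem c (hFb x)) ?_ ?_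
        · exact (hF x).isAC.clm ((c • ContinuousLinearMap.id ℂ (ι → ℂ)).restrictScalars ℝ)
        · filter_upwards [hFd x, ae_restrict_of_ae_restrict_of_subset hsub
            (Lp.coeFn_smul c x.2)] with s e1 e3
          rw [e1, Prod.smul_snd, e3, Matrix.mulVec_smul, Pi.smul_apply, smul_sub, smul_neg]
        · rw [← Prod.smul_mk, map_smul, hFz, Prod.smul_fst] }
  have hbound : ∀ x, ‖L x‖ ≤ |C| * (1 + √(b₀ - a₀)) * ‖x‖ := by
    intro x
    have h1 := integral_norm_le_lp (ha.trans (hab.trans hb)) ha hab hb x.2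
    have h2 : ‖x.1‖ + ∫ s in a..b, ‖x.2 s‖ ≤ (1 + √(b₀ - a₀)) * ‖x‖ := by
      have := norm_fst_le x
      have := norm_snd_le x
      have : √(b₀ - a₀) * ‖x.2‖ ≤ √(b₀ - a₀) * ‖x‖ := by gcongr
      linarith
    have h3 : 0 ≤ ‖x.1‖ + ∫ s in a..b, ‖x.2 s‖ :=
      add_nonneg (norm_nonneg _) (intervalIntegral.integral_nonneg hab fun _ _ => norm_nonneg _)
    have h4 : C * (‖x.1‖ + ∫ s in a..b, ‖x.2 s‖) ≤ |C| * (1 + √(b₀ - a₀)) * ‖x‖ :=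
      (mul_le_mul_of_nonneg_right (le_abs_self C) h3).trans (by
        rw [mul_assoc]; gcongr)
    exact (norm_prod_le_iff.2 ⟨(n1 x).trans h4, (n2 x).trans h4⟩)
  refine ⟨L.mkContinuous _ hbound, fun z g => ⟨F (z, g), dF (z, g), hF _, hFa _, hFb _, hFd _,
    rfl, fun h0 => ?_⟩, fun f df hf h1 h2 g hd => ⟨ζ (f a, f b), ?_⟩⟩
  · have := hFz (z, g)
    have h0' : (F (z, g) a, F (z, g) b) = 0 := h0
    rw [h0', map_zero] at this
    exact this.symm
  · exact key (ζ (f a, f b), g) f df hf h1 h2 hd rfl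

theorem isH1_affine {a b : ℝ} (hab : a < b) (v w : ι → ℂ) :
    ∃ f df : ℝ → ι → ℂ, IsH1 a b f df ∧ f a = v ∧ f b = w := by
  refine ⟨fun s => v + (s - a) • ((b - a)⁻¹ • (w - v)), fun _ => (b - a)⁻¹ • (w - v),
    isH1_iff.2 ⟨IsAC.of_hasDerivAt (fun x _ => ?_) (by simp), memLp_const _⟩, by simp, ?_⟩
  · have := (((hasDerivAt_id x).sub_const a).smul_const ((b - a)⁻¹ • (w - v))).const_add v
    simpa using this
  · have : b - a ≠ 0 := by linarith
    simp [smul_smul, this]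

/-- The parameter space of a subinterval cut in three pieces. -/
abbrev Param (m₁ m₂ m₃ : ℕ) : Type := (Fin m₁ → ℂ) × (Fin m₂ → ℂ) × (Fin m₃ → ℂ)

/-- The boundary problem `-f' - A f = g` on a subinterval is described by a map `E₀` of parameters
to end values and a map `J` to the jumps at the cuts. -/
structure IsStrip (lo hi : ℝ) (A : ℝ → Matrix ι ι ℂ) (Wlo Whi : Submodule ℂ (ι → ℂ))
    {m₁ m₂ m₃ : ℕ}
    (E₀ J : (Param m₁ m₂ m₃ × LTwo ι lo hi) →L[ℂ] ((ι → ℂ) × (ι → ℂ))) : Prop where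
  exists_section : ∀ x, J x = 0 → ∃ f df, IsH1 lo hi f df ∧ f lo ∈ Wlo ∧ f hi ∈ Whi ∧
    (∀ᵐ s ∂volume.restrict (Ioc lo hi), df s = -(A s).mulVec (f s) - x.2 s) ∧
    E₀ x = (f lo, f hi) ∧ ((∀ s ∈ Icc lo hi, f s = 0) → x.1 = 0)
  memLp : ∀ f df, IsH1 lo hi f df → f lo ∈ Wlo → f hi ∈ Whi →
    MemLp (fun s => (A s).mulVec (f s)) 2 (volume.restrict (Ioc lo hi))
  exists_param : ∀ f df, IsH1 lo hi f df → f lo ∈ Wlo → f hi ∈ Whi → ∀ g : LTwo ι lo hi,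
    (∀ᵐ s ∂volume.restrict (Ioc lo hi), df s = -(A s).mulVec (f s) - g s) →
    ∃ z, J (z, g) = 0 ∧ E₀ (z, g) = (f lo, f hi)
  surj : ∀ v ∈ Wlo, ∀ w ∈ Whi, ∀ y, ∃ x, E₀ x = (v, w) ∧ J x = y
  mem : ∀ x, (E₀ x).1 ∈ Wlo ∧ (E₀ x).2 ∈ Whi

/-- Both ends of a subinterval may be singular, and singular ends are solvable only on short pieces.
Hence two end pieces and a middle one, with J recording the failure of the three solutions to agree
at c₁ and c₂. -/
theorem exists_isStrip {lo c₁ c₂ hi : ℝ} (h01 : lo < c₁) (h12 : c₁ < c₂) (h23 : c₂ < hi)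
    {Wlo Whi : Submodule ℂ (ι → ℂ)} {m₁ m₂ m₃ : ℕ} (p₁ : PieceSolvable lo c₁ A Wlo ⊤ m₁)
    (p₂ : PieceSolvable c₁ c₂ A ⊤ ⊤ m₂) (p₃ : PieceSolvable c₂ hi A ⊤ Whi m₃) :
    ∃ E₀ J : (Param m₁ m₂ m₃ × LTwo ι lo hi) →L[ℂ] ((ι → ℂ) × (ι → ℂ)),
      IsStrip lo hi A Wlo Whi E₀ J := by
  have h02 := h01.trans h12
  have h13 := h12.trans h23
  obtain ⟨Φ₁, s₁, t₁⟩ := p₁.exists_clm h01.le le_rfl h13.le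
  obtain ⟨Φ₂, s₂, t₂⟩ := p₂.exists_clm h12.le h01.le h23.le
  obtain ⟨Φ₃, s₃, t₃⟩ := p₃.exists_clm h23.le h02.le le_rfl
  let P := Param m₁ m₂ m₃ × LTwo ι lo hi
  let snd : P →L[ℂ] LTwo ι lo hi := ContinuousLinearMap.snd ℂ _ _
  let fst : P →L[ℂ] Param m₁ m₂ m₃ := ContinuousLinearMap.fst ℂ _ _
  let Ψ₁ : P →L[ℂ] ((ι → ℂ) × (ι → ℂ)) := Φ₁.comp
    (((ContinuousLinearMap.fst ℂ _ _).comp fst).prod snd)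
  let Ψ₂ : P →L[ℂ] ((ι → ℂ) × (ι → ℂ)) := Φ₂.comp
    ((((ContinuousLinearMap.fst ℂ _ _).comp (ContinuousLinearMap.snd ℂ _ _)).comp fst).prod snd)
  let Ψ₃ : P →L[ℂ] ((ι → ℂ) × (ι → ℂ)) := Φ₃.comp
    ((((ContinuousLinearMap.snd ℂ _ _).comp (ContinuousLinearMap.snd ℂ _ _)).comp fst).prod snd)
  let pf := ContinuousLinearMap.fst ℂ (ι → ℂ) (ι → ℂ)
  let ps := ContinuousLinearMap.snd ℂ (ι → ℂ) (ι → ℂ)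
  have e₁ : ∀ x : P, Ψ₁ x = Φ₁ (x.1.1, x.2) := fun _ => rfl
  have e₂ : ∀ x : P, Ψ₂ x = Φ₂ (x.1.2.1, x.2) := fun _ => rfl
  have e₃ : ∀ x : P, Ψ₃ x = Φ₃ (x.1.2.2, x.2) := fun _ => rfl
  let E₀ := (pf.comp Ψ₁).prod (ps.comp Ψ₃)
  let J := (ps.comp Ψ₁ - pf.comp Ψ₂).prod (ps.comp Ψ₂ - pf.comp Ψ₃)
  have hE : ∀ x, E₀ x = ((Φ₁ (x.1.1, x.2)).1, (Φ₃ (x.1.2.2, x.2)).2) := fun _ => rfl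
  have hJ : ∀ x, J x = ((Φ₁ (x.1.1, x.2)).2 - (Φ₂ (x.1.2.1, x.2)).1,
    (Φ₂ (x.1.2.1, x.2)).2 - (Φ₃ (x.1.2.2, x.2)).1) := fun _ => rfl
  refine ⟨E₀, J, ?_, ?_, ?_, ?_, ?_⟩
  · rintro ⟨⟨z₁, z₂, z₃⟩, g⟩ hx
    obtain ⟨f₁, d₁, a₁, a₂, -, a₄, a₅, a₆⟩ := s₁ z₁ g
    obtain ⟨f₂, d₂, b₁, -, -, b₄, b₅, b₆⟩ := s₂ z₂ g
    obtain ⟨f₃, d₃, c₁', -, c₃, c₄, c₅, c₆⟩ := s₃ z₃ g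
    rw [hJ] at hx
    simp only at hx
    rw [a₅, b₅, c₅] at hx
    have j₁ : f₁ c₁ = f₂ c₁ := sub_eq_zero.1 (Prod.ext_iff.1 hx).1
    have j₂ : f₂ c₂ = f₃ c₂ := sub_eq_zero.1 (Prod.ext_iff.1 hx).2
    obtain ⟨f, df, hf, q1, q2, q3, q4⟩ := exists_glue h01.le h12.le a₁ b₁ j₁
    obtain ⟨F, dF, hF, r1, r2, r3, r4⟩ := exists_glue h02.le h23.le hf c₁'
      (by rw [q2 c₂ (right_mem_Icc.2 h12.le), j₂])
    have F1 : ∀ s ∈ Icc lo c₁, F s = f₁ s := fun s hs => by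
      rw [r1 s ⟨hs.1, hs.2.trans h12.le⟩, q1 s hs]
    have F2 : ∀ s ∈ Icc c₁ c₂, F s = f₂ s := fun s hs => by
      rw [r1 s ⟨h01.le.trans hs.1, hs.2⟩, q2 s hs]
    have elo := F1 lo (left_mem_Icc.2 h01.le)
    have ehi := r2 hi (right_mem_Icc.2 h23.le)
    refine ⟨F, dF, hF, by rwa [elo], by rwa [ehi], ?_, ?_, fun h0 => ?_⟩
    · refine ae_Ioc_glue h02.le h23.le (ae_Ioc_glue h01.le h12.le ?_ ?_) ?_
      · filter_upwards [a₄, ae_restrict_mem measurableSet_Ioc] with s hs hm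
        rw [r3 s ⟨hm.1, hm.2.trans h12.le⟩, q3 s hm, hs, F1 s (Ioc_subset_Icc_self hm)]
      · filter_upwards [b₄, ae_restrict_mem measurableSet_Ioc] with s hs hm
        rw [r3 s ⟨h01.trans hm.1, hm.2⟩, q4 s hm, hs, F2 s (Ioc_subset_Icc_self hm)]
      · filter_upwards [c₄, ae_restrict_mem measurableSet_Ioc] with s hs hm
        rw [r4 s hm, hs, r2 s (Ioc_subset_Icc_self hm)]
    · rw [hE]
      simp only
      rw [a₅, c₅, elo, ehi]
    -- If the glued section vanishes, all end values of the three pieces vanish, and these determine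
    -- the parameters.
    · have w₁ : f₁ lo = 0 := by rw [← elo, h0 lo ⟨le_rfl, by linarith⟩]
      have w₂ : f₁ c₁ = 0 := by
        rw [← F1 c₁ (right_mem_Icc.2 h01.le), h0 c₁ ⟨h01.le, by linarith⟩]
      have w₃ : f₂ c₂ = 0 := by
        rw [← F2 c₂ (right_mem_Icc.2 h12.le), h0 c₂ ⟨by linarith, by linarith⟩]
      have w₄ : f₃ hi = 0 := by rw [← ehi, h0 hi ⟨by linarith, le_rfl⟩]
      refine Prod.ext (a₆ ?_) (Prod.ext (b₆ ?_) (c₆ ?_))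
      · rw [a₅, w₁, w₂]; rfl
      · rw [b₅, w₃, ← j₁, w₂]; rfl
      · rw [c₅, ← j₂, w₃, w₄]; rfl
  · intro f df hf ha hb
    refine memLp_Ioc_glue h02.le h23.le (memLp_Ioc_glue h01.le h12.le ?_ ?_) ?_
    · exact p₁.1 f df (hf.mono le_rfl h13.le) ha trivial
    · exact p₂.1 f df (hf.mono h01.le h23.le) trivial trivial
    · exact p₃.1 f df (hf.mono h02.le le_rfl) trivial hb
  · intro f df hf ha hb g hg
    obtain ⟨z₁, y₁⟩ := t₁ f df (hf.mono le_rfl h13.le) ha trivial g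
      (ae_restrict_of_ae_restrict_of_subset (Ioc_subset_Ioc_right h13.le) hg)
    obtain ⟨z₂, y₂⟩ := t₂ f df (hf.mono h01.le h23.le) trivial trivial g
      (ae_restrict_of_ae_restrict_of_subset (Ioc_subset_Ioc h01.le h23.le) hg)
    obtain ⟨z₃, y₃⟩ := t₃ f df (hf.mono h02.le le_rfl) trivial hb g
      (ae_restrict_of_ae_restrict_of_subset (Ioc_subset_Ioc_left h02.le) hg)
    refine ⟨(z₁, z₂, z₃), ?_, ?_⟩
    · rw [hJ]
      simp only
      rw [y₁, y₂, y₃]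
      simp
    · rw [hE]
      simp only
      rw [y₁, y₃]
  · intro v hv w hw y
    -- Surjectivity needs no equation to be solved: affine functions with the required end values
    -- and jumps 0 − (−y.1), 0 − (−y.2) are solutions for the source g = −f′ − Af that they define,
    -- and g is square integrable by the first clause of `PieceSolvable`.
    obtain ⟨f₁, d₁, a₁, a₂, a₃⟩ := isH1_affine h01 v 0
    obtain ⟨f₂, d₂, b₁, b₂, b₃⟩ := isH1_affine h12 (-y.1) 0
    obtain ⟨f₃, d₃, c₁', c₂', c₃⟩ := isH1_affine h23 (-y.2) w
    have g₁ := a₁.1.neg.sub (p₁.1 f₁ d₁ a₁ (by rwa [a₂]) trivial)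
    have g₂ := b₁.1.neg.sub (p₂.1 f₂ d₂ b₁ trivial trivial)
    have g₃ := c₁'.1.neg.sub (p₃.1 f₃ d₃ c₁' trivial (by rwa [c₃]))
    classical
    set g : ℝ → ι → ℂ := fun s => if s ≤ c₁ then -d₁ s - (A s).mulVec (f₁ s) else
      if s ≤ c₂ then -d₂ s - (A s).mulVec (f₂ s) else -d₃ s - (A s).mulVec (f₃ s)
    have k₁ : ∀ᵐ s ∂volume.restrict (Ioc lo c₁), g s = -d₁ s - (A s).mulVec (f₁ s) := by
      filter_upwards [ae_restrict_mem measurableSet_Ioc] with s hm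
      exact if_pos hm.2
    have k₂ : ∀ᵐ s ∂volume.restrict (Ioc c₁ c₂), g s = -d₂ s - (A s).mulVec (f₂ s) := by
      filter_upwards [ae_restrict_mem measurableSet_Ioc] with s hm
      simp only [g]
      rw [if_neg (not_le.2 hm.1), if_pos hm.2]
    have k₃ : ∀ᵐ s ∂volume.restrict (Ioc c₂ hi), g s = -d₃ s - (A s).mulVec (f₃ s) := by
      filter_upwards [ae_restrict_mem measurableSet_Ioc] with s hm
      simp only [g]
      rw [if_neg (not_le.2 (h12.trans hm.1)), if_neg (not_le.2 hm.1)]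
    have hg : MemLp g 2 (volume.restrict (Ioc lo hi)) :=
      memLp_Ioc_glue h02.le h23.le (memLp_Ioc_glue h01.le h12.le
        (g₁.ae_eq (k₁.mono fun _ h => h.symm)) (g₂.ae_eq (k₂.mono fun _ h => h.symm)))
        (g₃.ae_eq (k₃.mono fun _ h => h.symm))
    have hG := hg.coeFn_toLp
    obtain ⟨z₁, y₁⟩ := t₁ f₁ d₁ a₁ (by rwa [a₂]) trivial (hg.toLp g) (by
      filter_upwards [k₁, ae_restrict_of_ae_restrict_of_subset (Ioc_subset_Ioc_right h13.le) hG]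
        with s u1 u2
      rw [u2, u1]; abel)
    obtain ⟨z₂, y₂⟩ := t₂ f₂ d₂ b₁ trivial trivial (hg.toLp g) (by
      filter_upwards [k₂, ae_restrict_of_ae_restrict_of_subset (Ioc_subset_Ioc h01.le h23.le) hG]
        with s u1 u2
      rw [u2, u1]; abel)
    obtain ⟨z₃, y₃⟩ := t₃ f₃ d₃ c₁' trivial (by rwa [c₃]) (hg.toLp g) (by
      filter_upwards [k₃, ae_restrict_of_ae_restrict_of_subset (Ioc_subset_Ioc_left h02.le) hG]
        with s u1 u2
      rw [u2, u1]; abel)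
    refine ⟨((z₁, z₂, z₃), hg.toLp g), ?_, ?_⟩
    · rw [hE]
      simp only
      rw [y₁, y₃, a₂, c₃]
    · rw [hJ]
      simp only
      rw [y₁, y₂, y₃, a₃, b₂, b₃, c₂']
      simp
  · intro x
    obtain ⟨f₁, d₁, -, a₂, -, -, a₅, -⟩ := s₁ x.1.1 x.2
    obtain ⟨f₃, d₃, -, -, c₃, -, c₅, -⟩ := s₃ x.1.2.2 x.2
    rw [hE, a₅, c₅]
    exact ⟨a₂, c₃⟩

end Strip

end

section

/-! ### Irreducible representations of `su(2)` -/

section SuTwo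

/-- The Casimir operator of an irreducible representation of `su(2)`. -/
theorem casimir_eq {V : Type*} [AddCommGroup V] [Module ℂ V] [FiniteDimensional ℂ V] [Nontrivial V]
    (r : Fin 3 → Module.End ℂ V)
    (hr : ∀ j, r j * r (j + 1) - r (j + 1) * r j = (2 : ℂ) • r (j + 2))
    (hirr : ∀ W : Submodule ℂ V, (∀ j, ∀ v ∈ W, r j v ∈ W) → W = ⊥ ∨ W = ⊤) :
    ∑ j, r j * r j = (1 - (Module.finrank ℂ V : ℂ) ^ 2) • (1 : Module.End ℂ V) := by
  have h01 : r 0 * r 1 - r 1 * r 0 = (2 : ℂ) • r 2 := hr 0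
  have h12 : r 1 * r 2 - r 2 * r 1 = (2 : ℂ) • r 0 := hr 1
  have h20 : r 2 * r 0 - r 0 * r 2 = (2 : ℂ) • r 1 := hr 2
  -- An sl₂-triple requires h ≠ 0, so the trivial representation is treated separately: every line
  -- is then invariant, the dimension is 1, and both sides vanish.
  by_cases hz : r 2 = 0
  · have z1 : r 1 = 0 := by
      rw [hz, zero_mul, mul_zero, sub_zero] at h20
      exact (smul_eq_zero.1 h20.symm).resolve_left two_ne_zero
    have z0 : r 0 = 0 := by
      rw [hz, zero_mul, mul_zero, sub_zero] at h12
      exact (smul_eq_zero.1 h12.symm).resolve_left two_ne_zero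
    obtain ⟨v, hv⟩ := exists_ne (0 : V)
    have : Submodule.span ℂ {v} = ⊤ := by
      refine (hirr _ fun j w hw => ?_).resolve_left (by simpa using hv)
      fin_cases j <;> simp [z0, z1, hz]
    have hd : Module.finrank ℂ V = 1 := by
      rw [← finrank_top, ← this, finrank_span_singleton hv]
    rw [hd, Fin.sum_univ_three, z0, z1, hz]
    simp
  · let _ : LieRing (Module.End ℂ V) := LieRing.ofAssociativeRing
    -- The Cartan element and the raising and lowering operators of the complexified representation.
    set h : Module.End ℂ V := Complex.I • r 2
    set e : Module.End ℂ V := (1 / 2 : ℂ) • (r 0 + Complex.I • r 1)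
    set f : Module.End ℂ V := (-(1 / 2) : ℂ) • (r 0 - Complex.I • r 1)
    have r0 : r 0 = e - f := by simp only [e, f]; module
    have hI : Complex.I * Complex.I = -1 := Complex.I_mul_I
    have r1 : r 1 = (-Complex.I) • (e + f) := by
      simp only [e, f]
      match_scalars
      · linear_combination hI
      · ring
    have r2 : r 2 = (-Complex.I) • h := by
      simp only [h, smul_smul]
      rw [neg_mul, hI, neg_neg, one_smul]
    have t : IsSl2Triple h e f := by
      refine ⟨?_, ?_, ?_, ?_⟩
      · intro h0
        rw [h0, smul_zero] at r2
        exact hz r2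
      · rw [LieRing.of_associative_ring_bracket]
        have : e * f - f * e = (Complex.I / 2) • (r 0 * r 1 - r 1 * r 0) := by
          simp only [e, f, smul_mul_assoc, mul_smul_comm, add_mul, mul_add, sub_mul, mul_sub]
          module
        rw [this, h01, smul_smul]
        congr 1
        ring
      · rw [LieRing.of_associative_ring_bracket]
        have : h * e - e * h = (Complex.I / 2) • ((r 2 * r 0 - r 0 * r 2)
            - Complex.I • (r 1 * r 2 - r 2 * r 1)) := by
          simp only [e, h, smul_mul_assoc, mul_smul_comm, add_mul, mul_add]
          module
        rw [this, h12, h20]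
        simp only [e]
        match_scalars
        · ring
        · linear_combination (-1 : ℂ) * hI
      · rw [LieRing.of_associative_ring_bracket]
        have : h * f - f * h = (-Complex.I / 2) • ((r 2 * r 0 - r 0 * r 2)
            + Complex.I • (r 1 * r 2 - r 2 * r 1)) := by
          simp only [f, h, smul_mul_assoc, mul_smul_comm, sub_mul, mul_sub]
          module
        rw [this, h12, h20]
        simp only [f]
        match_scalars
        · ring
        · linear_combination (-1 : ℂ) * hI
    obtain ⟨μ, v, hv, P⟩ := t.exists_hasPrimitiveVectorWith (R := ℂ) (M := V)
    obtain ⟨n, hn⟩ := P.exists_nat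
    set ψ : ℕ → V := fun i => ((LieModule.toEnd ℂ (Module.End ℂ V) V f) ^ i) v
    have hψf : ∀ i, f (ψ i) = ψ (i + 1) := P.lie_f_pow_toEnd_f
    have hψh : ∀ i, h (ψ i) = (μ - 2 * i) • ψ i := P.lie_h_pow_toEnd_f
    have hψe : ∀ i, e (ψ (i + 1)) = ((i + 1) * (μ - i)) • ψ i := P.lie_e_pow_succ_toEnd_f
    have hψ0 : e (ψ 0) = 0 := P.lie_e
    have hψn : ψ (n + 1) = 0 := P.pow_toEnd_f_eq_zero_of_eq_nat hn
    -- The string generated by a highest weight vector of weight n is invariant, so it is everything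
    -- by irreducibility. Its n + 1 vectors are non-zero with distinct weights, so the dimension is
    -- n + 1.
    set W := Submodule.span ℂ (range fun i : Fin (n + 1) => ψ i)
    have hW : ∀ i ≤ n, ψ i ∈ W := fun i hi =>
      Submodule.subset_span ⟨⟨i, by lia⟩, rfl⟩
    have inv : ∀ T : Module.End ℂ V, (∀ i ≤ n, T (ψ i) ∈ W) → ∀ w ∈ W, T w ∈ W := by
      intro T hT w hw
      have : W ≤ W.comap T := Submodule.span_le.2 (by
        rintro _ ⟨i, rfl⟩
        exact hT i (by have := i.2; lia))
      exact this hw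
    have We : ∀ w ∈ W, e w ∈ W := inv e fun i hi => by
      rcases i with _ | i
      · rw [hψ0]; exact W.zero_mem
      · rw [hψe]; exact W.smul_mem _ (hW i (by lia))
    have Wf : ∀ w ∈ W, f w ∈ W := inv f fun i hi => by
      rw [hψf]
      rcases hi.eq_or_lt with rfl | hlt
      · rw [hψn]; exact W.zero_mem
      · exact hW _ hlt
    have Wh : ∀ w ∈ W, h w ∈ W := inv h fun i hi => by
      rw [hψh]; exact W.smul_mem _ (hW i hi)
    have hWtop : W = ⊤ := by
      refine (hirr W fun j w hw => ?_).resolve_left ?_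
      · fin_cases j
        · change r 0 w ∈ W
          rw [r0]; exact W.sub_mem (We w hw) (Wf w hw)
        · change r 1 w ∈ W
          rw [r1]; exact W.smul_mem _ (W.add_mem (We w hw) (Wf w hw))
        · change r 2 w ∈ W
          rw [r2]; exact W.smul_mem _ (Wh w hw)
      · intro hb
        have := hW 0 (Nat.zero_le _)
        rw [hb, Submodule.mem_bot] at this
        exact hv this
    have hli : LinearIndependent ℂ (fun i : Fin (n + 1) => ψ i) := by
      refine Module.End.eigenvectors_linearIndependent' h (fun i : Fin (n + 1) => μ - 2 * (i : ℂ))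
        ?_ _ fun i => ?_
      · intro i j hij
        have : (i : ℂ) = j := by linear_combination (-1 / 2 : ℂ) * hij
        exact Fin.ext (by exact_mod_cast this)
      · refine ⟨Module.End.mem_eigenspace_iff.2 (hψh i), ?_⟩
        exact P.pow_toEnd_f_ne_zero_of_eq_nat hn (by have := i.2; lia)
    have hdim : Module.finrank ℂ V = n + 1 := by
      rw [← finrank_top, ← hWtop, finrank_span_eq_card hli, Fintype.card_fin]
    -- On the highest weight vector this is −(n² + 2n) = 1 − (n + 1)². Since the Casimir operator
    -- commutes with f, the same scalar occurs along the whole string.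
    have hc : ∑ j, r j * r j = -(h * h + (2 : ℂ) • h + (4 : ℂ) • (f * e)) := by
      have hef : e * f = h + f * e := by
        have := t.lie_e_f
        rw [LieRing.of_associative_ring_bracket] at this
        rw [← this]; abel
      rw [Fin.sum_univ_three, r0, r1, r2]
      simp only [smul_mul_assoc, mul_smul_comm, add_mul, mul_add, sub_mul, mul_sub, smul_smul,
        smul_add, neg_mul_neg, hI, hef]
      module
    have hcomm : (∑ j, r j * r j) * f = f * ∑ j, r j * r j := by
      have k0 : (∑ j, r j * r j) * r 0 = r 0 * ∑ j, r j * r j := by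
        rw [Fin.sum_univ_three, ← sub_eq_zero]
        have : (r 0 * r 0 + r 1 * r 1 + r 2 * r 2) * r 0 - r 0 * (r 0 * r 0 + r 1 * r 1 + r 2 * r 2)
          = -(r 1 * (r 0 * r 1 - r 1 * r 0) + (r 0 * r 1 - r 1 * r 0) * r 1)
            + (r 2 * (r 2 * r 0 - r 0 * r 2) + (r 2 * r 0 - r 0 * r 2) * r 2) := by noncomm_ring
        rw [this, h01, h20]
        simp only [smul_mul_assoc, mul_smul_comm]
        abel
      have k1 : (∑ j, r j * r j) * r 1 = r 1 * ∑ j, r j * r j := by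
        rw [Fin.sum_univ_three, ← sub_eq_zero]
        have : (r 0 * r 0 + r 1 * r 1 + r 2 * r 2) * r 1 - r 1 * (r 0 * r 0 + r 1 * r 1 + r 2 * r 2)
          = -(r 2 * (r 1 * r 2 - r 2 * r 1) + (r 1 * r 2 - r 2 * r 1) * r 2)
            + (r 0 * (r 0 * r 1 - r 1 * r 0) + (r 0 * r 1 - r 1 * r 0) * r 0) := by noncomm_ring
        rw [this, h01, h12]
        simp only [smul_mul_assoc, mul_smul_comm]
        abel
      simp only [f, mul_smul_comm, smul_mul_assoc, mul_sub, sub_mul, k0, k1]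
    have hψc : ∀ i, (∑ j, r j * r j) (ψ i) = (1 - ((n : ℂ) + 1) ^ 2) • ψ i := by
      intro i
      induction i with
      | zero =>
        rw [hc]
        simp only [LinearMap.neg_apply, LinearMap.add_apply, Module.End.mul_apply,
          LinearMap.smul_apply, hψ0, hψh, map_smul, map_zero, smul_zero, hn]
        simp only [Nat.cast_zero]
        module
      | succ i ih =>
        rw [← hψf, ← Module.End.mul_apply, hcomm, Module.End.mul_apply, ih, map_smul]
    rw [hdim]
    push_cast
    refine LinearMap.ext_on_range (v := fun i : Fin (n + 1) => ψ i) hWtop fun i => ?_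
    rw [hψc]
    simp

variable {ι κ : Type*}

theorem finrank_ker_of_mul_conjTranspose [Fintype ι] [Fintype κ] [DecidableEq κ] {C : Matrix κ ι ℂ} (hC : C * C.conjTranspose = 1) :
    Module.finrank ℂ (LinearMap.ker C.mulVecLin) + Fintype.card κ = Fintype.card ι := by
  have h1 := LinearMap.finrank_range_add_finrank_ker C.mulVecLin
  have h2 : LinearMap.range C.mulVecLin = ⊤ := by
    rw [LinearMap.range_eq_top]
    intro v
    refine ⟨C.conjTranspose.mulVec v, ?_⟩
    simp [hC]
  rw [h2, finrank_top, Module.finrank_fintype_fun_eq_card, Module.finrank_fintype_fun_eq_card] at h1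
  lia

/-- Restrict ρ to the terminating subspace ker C, of dimension m, where `casimir_eq` applies. Both
sides vanish on the continuing subspace, and 1 − CᴴC is the orthogonal projection onto ker C. -/
theorem IsTermIrrep.casimir [Fintype ι] [DecidableEq ι] [Fintype κ] [DecidableEq κ] {C : Matrix κ ι ℂ} (hC : C * C.conjTranspose = 1)
    (hlt : Fintype.card κ < Fintype.card ι) {ρ : Fin 3 → Matrix ι ι ℂ} (h : IsTermIrrep C ρ)
    {m : ℕ} (hm : m + Fintype.card κ = Fintype.card ι) :
    ∑ j, ρ j * ρ j = (1 - (m : ℂ) ^ 2) • (1 - C.conjTranspose * C) := by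
  set K := LinearMap.ker C.mulVecLin
  have hK : ∀ v, v ∈ K ↔ C.mulVec v = 0 := fun v => Iff.rfl
  have hρK : ∀ j v, (ρ j).mulVec v ∈ K := fun j v => by
    rw [hK, Matrix.mulVec_mulVec, h.term, Matrix.zero_mulVec]
  have hfin : Module.finrank ℂ K = m := by
    have : Module.finrank ℂ K + _ = _ := finrank_ker_of_mul_conjTranspose hC
    lia
  have : Nontrivial K := Module.nontrivial_of_finrank_pos (R := ℂ) (by lia)
  let r : Fin 3 → Module.End ℂ K := fun j => (ρ j).mulVecLin.restrict fun v _ => hρK j v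
  have hr : ∀ j (v : K), ((r j v : K) : ι → ℂ) = (ρ j).mulVec v := fun j v => rfl
  have key := casimir_eq r (fun j => by
      ext v : 2
      have := congrArg (fun M => M.mulVec (v : ι → ℂ)) (h.comm j)
      simp only [Matrix.sub_mulVec, ← Matrix.mulVec_mulVec, Matrix.smul_mulVec] at this
      exact this) fun W hW => by
    have i1 : W.map K.subtype ≤ K := by
      rintro _ ⟨w, -, rfl⟩
      exact w.2
    have i2 : ∀ j, ∀ v ∈ W.map K.subtype, (ρ j).mulVec v ∈ W.map K.subtype := by
      rintro j _ ⟨w, hw, rfl⟩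
      exact ⟨r j w, hW j w hw, rfl⟩
    rcases h.irred (W.map K.subtype) i1 i2 with h0 | h0
    · left
      refine Submodule.map_injective_of_injective K.injective_subtype ?_
      rw [h0, Submodule.map_bot]
    · right
      refine Submodule.map_injective_of_injective K.injective_subtype ?_
      rw [h0, Submodule.map_top, Submodule.range_subtype]
  rw [hfin] at key
  have hQ : ∀ v, (1 - C.conjTranspose * C).mulVec v ∈ K := fun v => by
    rw [hK, Matrix.mulVec_mulVec, Matrix.mul_sub, ← Matrix.mul_assoc, hC, Matrix.mul_one,
      Matrix.one_mul, sub_self,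
      Matrix.zero_mulVec]
  have hρQ : ∀ j, ρ j * (1 - C.conjTranspose * C) = ρ j := fun j => by
    rw [Matrix.mul_sub, ← Matrix.mul_assoc, h.cont, Matrix.zero_mul, Matrix.mul_one, sub_zero]
  have e1 : (∑ j, ρ j * ρ j) = (∑ j, ρ j * ρ j) * (1 - C.conjTranspose * C) := by
    simp only [Finset.sum_mul, mul_assoc, hρQ]
  rw [e1]
  refine Matrix.ext_of_mulVec_single fun i => ?_
  have := congrArg Subtype.val (LinearMap.congr_fun key ⟨_, hQ (Pi.single i 1)⟩)
  simp only [LinearMap.sum_apply, Module.End.mul_apply, LinearMap.smul_apply, Module.End.one_apply,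
    Submodule.coe_sum, Submodule.coe_smul, hr] at this
  rw [← Matrix.mulVec_mulVec, Matrix.sum_mulVec, Matrix.smul_mulVec]
  simpa only [Matrix.mulVec_mulVec, mul_assoc] using this

theorem quat_sq (j : Fin 3) : quat j * quat j = -1 := by
  fin_cases j <;> ext a b <;> fin_cases a <;> fin_cases b <;> simp [quat, Matrix.mul_apply]

theorem quat_mul (j : Fin 3) : quat j * quat (j + 1) = quat (j + 2) := by
  fin_cases j <;> ext a b <;> fin_cases a <;> fin_cases b <;> simp [quat, Matrix.mul_apply]

theorem quat_mul' (j : Fin 3) : quat (j + 1) * quat j = -quat (j + 2) := by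
  fin_cases j <;> ext a b <;> fin_cases a <;> fin_cases b <;> simp [quat, Matrix.mul_apply]

theorem quat_conjTranspose (j : Fin 3) : (quat j).conjTranspose = -quat j := by
  fin_cases j <;> ext a b <;> fin_cases a <;> fin_cases b <;> simp [quat]

theorem quat_trace (j : Fin 3) : (quat j).trace = 0 := by
  fin_cases j <;> simp [quat, Matrix.trace]

/-- Quaternion multiplication: the diagonal terms use eⱼ² = −1, and the anticommuting off-diagonal
terms pair up to commutators. The spectrum at a Nahm pole and the Weitzenböck identity both rest on
this formula. -/
theorem imQuat_sq [Fintype ι] (M : Fin 3 → Matrix ι ι ℂ) : imQuat M * imQuat M =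
    -((1 : Matrix (Fin 2) (Fin 2) ℂ) ⊗ₖ ∑ j, M j * M j)
      + imQuat fun j => M (j + 1) * M (j + 2) - M (j + 2) * M (j + 1) := by
  have h01 : quat 0 * quat 1 = quat 2 := quat_mul 0
  have h12 : quat 1 * quat 2 = quat 0 := quat_mul 1
  have h20 : quat 2 * quat 0 = quat 1 := quat_mul 2
  have h10 : quat 1 * quat 0 = -quat 2 := quat_mul' 0
  have h21 : quat 2 * quat 1 = -quat 0 := quat_mul' 1
  have h02 : quat 0 * quat 2 = -quat 1 := quat_mul' 2
  have f1 : (0 : Fin 3) + 1 = 1 := rfl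
  have f2 : (0 : Fin 3) + 2 = 2 := rfl
  have f3 : (1 : Fin 3) + 1 = 2 := rfl
  have f4 : (1 : Fin 3) + 2 = 0 := rfl
  have f5 : (2 : Fin 3) + 1 = 0 := rfl
  have f6 : (2 : Fin 3) + 2 = 1 := rfl
  have hneg : ∀ (A : Matrix (Fin 2) (Fin 2) ℂ) (B : Matrix ι ι ℂ), (-A) ⊗ₖ B = -(A ⊗ₖ B) := by
    intro A B; ext i j; simp
  have hsub : ∀ (A : Matrix (Fin 2) (Fin 2) ℂ) (B C : Matrix ι ι ℂ),
      A ⊗ₖ (B - C) = A ⊗ₖ B - A ⊗ₖ C := by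
    intro A B C; ext i j; simp [mul_sub]
  simp only [imQuat, Fin.sum_univ_three, add_mul, mul_add, ← Matrix.mul_kronecker_mul, quat_sq, h01,
    h12, h20, h10, h21, h02, f1, f2, f3, f4, f5, f6, hneg, hsub, Matrix.kronecker_add]
  abel

theorem imQuat_mul_kronecker [Fintype ι] (M : Fin 3 → Matrix ι ι ℂ) (N : Matrix ι ι ℂ) :
    imQuat M * ((1 : Matrix (Fin 2) (Fin 2) ℂ) ⊗ₖ N) = imQuat fun j => M j * N := by
  simp only [imQuat, Finset.sum_mul, ← Matrix.mul_kronecker_mul, mul_one]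

theorem kronecker_mul_imQuat [Fintype ι] (M : Fin 3 → Matrix ι ι ℂ) (N : Matrix ι ι ℂ) :
    ((1 : Matrix (Fin 2) (Fin 2) ℂ) ⊗ₖ N) * imQuat M = imQuat fun j => N * M j := by
  simp only [imQuat, Finset.mul_sum, ← Matrix.mul_kronecker_mul, one_mul]

theorem imQuat_smul (c : ℂ) (M : Fin 3 → Matrix ι ι ℂ) :
    imQuat (fun j => c • M j) = c • imQuat M := by
  simp only [imQuat, Matrix.kronecker_smul, Finset.smul_sum]

/-- The operator of multiplication by a matrix. -/
def mulCLM {α β : Type*} [Fintype α] [Fintype β] (N : Matrix α β ℂ) : (β → ℂ) →L[ℂ] (α → ℂ) :=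
  LinearMap.toContinuousLinearMap N.mulVecLin

@[simp] theorem mulCLM_apply {α β : Type*} [Fintype α] [Fintype β] (N : Matrix α β ℂ) (v : β → ℂ) :
    mulCLM N v = N.mulVec v := rfl

theorem finrank_range_mulCLM {α : Type*} [Fintype α] [DecidableEq α] {N : Matrix α α ℂ}
    (h : N * N = N) : (Module.finrank ℂ (mulCLM N).range : ℂ) = N.trace := by
  have hi : IsIdempotentElem N.mulVecLin := by
    change N.mulVecLin ∘ₗ N.mulVecLin = _
    rw [← Matrix.mulVecLin_mul, h]
  have := (LinearMap.IsIdempotentElem.isProj_range _ hi).trace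
  rw [← Matrix.toLin'_apply', Matrix.trace_toLin'_eq] at this
  rw [this]
  rfl

/-- The spectral decomposition of the residue of the Dirac operator at a Nahm pole. -/
theorem exists_isSpectral [Fintype ι] [DecidableEq ι] [Fintype κ] [DecidableEq κ] {C : Matrix κ ι ℂ} (hC : C * C.conjTranspose = 1)
    (hlt : Fintype.card κ < Fintype.card ι) {ρ : Fin 3 → Matrix ι ι ℂ} (h : IsTermIrrep C ρ) :
    ∃ (P₀ Pm Pp M : (Fin 2 × ι → ℂ) →L[ℂ] (Fin 2 × ι → ℂ)) (μm μp : ℝ),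
      IsSpectral P₀ Pm Pp M μm μp ∧ μm ≤ 0 ∧ 1 ≤ μp ∧
      (∀ v, M v = (1 / 2 : ℂ) • (imQuat ρ).mulVec v) ∧
      P₀.range = LinearMap.range ((1 : Matrix (Fin 2) (Fin 2) ℂ) ⊗ₖ C.conjTranspose).mulVecLin ∧
      Fintype.card ι + Fintype.card κ - 1
        = Module.finrank ℂ P₀.range + Module.finrank ℂ Pp.range := by
  obtain ⟨m, hm⟩ : ∃ m, m + Fintype.card κ = Fintype.card ι := ⟨_, Nat.sub_add_cancel hlt.le⟩
  have hm1 : 1 ≤ m := by lia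
  have hm0 : (m : ℂ) ≠ 0 := by exact_mod_cast (by lia : m ≠ 0)
  set X := imQuat ρ
  set P : Matrix (Fin 2 × ι) (Fin 2 × ι) ℂ := 1 ⊗ₖ (C.conjTranspose * C)
  set Q : Matrix (Fin 2 × ι) (Fin 2 × ι) ℂ := 1 - P
  have hQ' : Q = 1 ⊗ₖ (1 - C.conjTranspose * C) := by
    ext i j
    simp only [Q, P, Matrix.one_apply, mul_sub, Prod.ext_iff, Matrix.sub_apply,
      Matrix.kroneckerMap_apply, mul_ite, mul_one, mul_zero, ite_and]
    congr 1
    split_ifs <;> rfl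
  have hPX : P * X = 0 := by
    simp only [P, X, kronecker_mul_imQuat, Matrix.mul_assoc, h.term, Matrix.mul_zero]
    simp [imQuat]
  have hXP : X * P = 0 := by
    simp only [P, X, imQuat_mul_kronecker, ← Matrix.mul_assoc, h.cont, Matrix.zero_mul]
    simp [imQuat]
  have hPP : P * P = P := by
    simp only [P, ← Matrix.mul_kronecker_mul, one_mul]
    rw [Matrix.mul_assoc, ← Matrix.mul_assoc C, hC, Matrix.one_mul]
  -- The commutation relations contribute 2X and the Casimir operator (m² − 1)Q. On the range of Q
  -- this reads (X − 1 − m)(X − 1 + m) = 0, so ½X has the eigenvalues (1 ± m)/2 there.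
  have hXX : X * X = (2 : ℂ) • X + ((m : ℂ) ^ 2 - 1) • Q := by
    rw [imQuat_sq, h.casimir hC hlt hm, hQ', Matrix.kronecker_smul]
    have : (fun j => ρ (j + 1) * ρ (j + 2) - ρ (j + 2) * ρ (j + 1)) = fun j => (2 : ℂ) • ρ j := by
      funext j
      have := h.comm (j + 1)
      rw [add_assoc, add_assoc] at this
      have e1 : (1 : Fin 3) + 1 = 2 := rfl
      have e2 : (1 : Fin 3) + 2 = 0 := rfl
      rwa [e1, e2, add_zero] at this
    rw [this, imQuat_smul]
    module
  have hPQ : P * Q = 0 := by simp [Q, mul_sub, hPP]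
  have hQP : Q * P = 0 := by simp [Q, sub_mul, hPP]
  have hQQ : Q * Q = Q := by
    have : Q * Q = Q - Q * P := by
      conv_lhs => rw [show Q * Q = Q * (1 - P) from rfl, mul_sub, mul_one]
    rw [this, hQP, sub_zero]
  have hQX : Q * X = X := by simp [Q, sub_mul, hPX]
  have hXQ : X * Q = X := by simp [Q, mul_sub, hXP]
  -- The spectral projections are the interpolation polynomials in X for the eigenvalues 1 + m and 1
  -- − m.
  set Pp := (1 / (2 * (m : ℂ))) • (((m : ℂ) - 1) • Q + X)
  set Pm := (1 / (2 * (m : ℂ))) • (((m : ℂ) + 1) • Q - X)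
  have sq1 : Pp * Pp = Pp := by
    simp only [Pp, smul_mul_assoc, mul_smul_comm, add_mul, mul_add, hQQ, hQX, hXQ, hXX]
    match_scalars <;> field_simp <;> ring
  have sq2 : Pm * Pm = Pm := by
    simp only [Pm, smul_mul_assoc, mul_smul_comm, sub_mul, mul_sub, hQQ, hQX, hXQ, hXX]
    match_scalars <;> field_simp <;> ring
  have pm1 : Pp * Pm = 0 := by
    simp only [Pm, Pp, smul_mul_assoc, mul_smul_comm, add_mul, mul_sub, hQQ, hQX, hXQ, hXX]
    match_scalars <;> field_simp <;> ring
  have mp1 : Pm * Pp = 0 := by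
    simp only [Pm, Pp, smul_mul_assoc, mul_smul_comm, sub_mul, mul_add, hQQ, hQX, hXQ, hXX]
    match_scalars <;> field_simp <;> ring
  refine ⟨mulCLM P, mulCLM Pm, mulCLM Pp, mulCLM ((1 / 2 : ℂ) • X), (1 - m) / 2, (1 + m) / 2,
    ⟨?_, ?_, ?_, ?_, ?_, ?_, ?_, ?_, ?_, ?_, ?_⟩, ?_, ?_, ?_, ?_, ?_⟩
  · intro v
    simp only [mulCLM_apply, ← Matrix.add_mulVec]
    have : P + Pm + Pp = 1 := by
      have : Pm + Pp = Q := by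
        simp only [Pm, Pp]
        match_scalars <;> field_simp <;> ring
      rw [add_assoc, this]
      simp [Q]
    rw [this, Matrix.one_mulVec]
  · intro v; simp only [mulCLM_apply, Matrix.mulVec_mulVec, hPP]
  · intro v
    have : P * Pm = 0 := by simp [Pm, mul_sub, hPQ, hPX]
    simp only [mulCLM_apply, Matrix.mulVec_mulVec, this, Matrix.zero_mulVec]
  · intro v
    have : P * Pp = 0 := by simp [Pp, mul_add, hPQ, hPX]
    simp only [mulCLM_apply, Matrix.mulVec_mulVec, this, Matrix.zero_mulVec]
  · intro v
    have : Pm * P = 0 := by simp [Pm, sub_mul, hQP, hXP]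
    simp only [mulCLM_apply, Matrix.mulVec_mulVec, this, Matrix.zero_mulVec]
  · intro v; simp only [mulCLM_apply, Matrix.mulVec_mulVec, sq2]
  · intro v; simp only [mulCLM_apply, Matrix.mulVec_mulVec, mp1, Matrix.zero_mulVec]
  · intro v
    have : Pp * P = 0 := by simp [Pp, add_mul, hQP, hXP]
    simp only [mulCLM_apply, Matrix.mulVec_mulVec, this, Matrix.zero_mulVec]
  · intro v; simp only [mulCLM_apply, Matrix.mulVec_mulVec, pm1, Matrix.zero_mulVec]
  · intro v; simp only [mulCLM_apply, Matrix.mulVec_mulVec, sq1]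
  · intro v
    have : (1 / 2 : ℂ) • X = ((1 - m) / 2 : ℂ) • Pm + ((1 + m) / 2 : ℂ) • Pp := by
      simp only [Pm, Pp]
      match_scalars <;> field_simp <;> ring
    simp only [mulCLM_apply]
    rw [this, Matrix.add_mulVec, Matrix.smul_mulVec _ Pm, Matrix.smul_mulVec _ Pp,
      ← Complex.coe_smul, ← Complex.coe_smul]
    push_cast
    rfl
  · have : (1 : ℝ) ≤ m := by exact_mod_cast hm1
    linarith
  · have : (1 : ℝ) ≤ m := by exact_mod_cast hm1
    linarith
  · intro v; simp only [mulCLM_apply, Matrix.smul_mulVec]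
  · have hPf : P = ((1 : Matrix (Fin 2) (Fin 2) ℂ) ⊗ₖ C.conjTranspose) *
        ((1 : Matrix (Fin 2) (Fin 2) ℂ) ⊗ₖ C) := by
      rw [← Matrix.mul_kronecker_mul, one_mul]
    apply le_antisymm
    · rintro _ ⟨v, rfl⟩
      refine ⟨((1 : Matrix (Fin 2) (Fin 2) ℂ) ⊗ₖ C).mulVec v, ?_⟩
      change _ = P.mulVec v
      rw [hPf, Matrix.mulVecLin_apply, Matrix.mulVec_mulVec]
    · rintro _ ⟨v, rfl⟩
      refine ⟨((1 : Matrix (Fin 2) (Fin 2) ℂ) ⊗ₖ C.conjTranspose).mulVec v, ?_⟩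
      change P.mulVec _ = _
      rw [hPf, Matrix.mulVecLin_apply, Matrix.mulVec_mulVec, Matrix.mul_assoc,
        ← Matrix.mul_kronecker_mul, hC, one_mul, Matrix.one_kronecker_one, Matrix.mul_one]
  -- Ranks of idempotents are traces. As X is traceless, Pp has rank m − 1, and with the 2|κ|
  -- continuing directions the total is 2|κ| + m − 1 = |ι| + |κ| − 1.
  · have t1 := finrank_range_mulCLM hPP
    have t2 := finrank_range_mulCLM sq1
    have tX : X.trace = 0 := by
      simp only [X, imQuat, Matrix.trace_sum, Matrix.trace_kronecker, quat_trace, zero_mul,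
        Finset.sum_const_zero]
    have tP : P.trace = 2 * Fintype.card κ := by
      simp only [P, Matrix.trace_kronecker, Matrix.trace_one, Fintype.card_fin]
      rw [Matrix.trace_mul_comm, hC, Matrix.trace_one]
      norm_num
    have tQ : Q.trace = 2 * m := by
      simp only [Q, Matrix.trace_sub, Matrix.trace_one, tP, Fintype.card_prod, Fintype.card_fin]
      rw [← hm]
      push_cast
      ring
    have tPp : Pp.trace = m - 1 := by
      simp only [Pp, Matrix.trace_smul, Matrix.trace_add, tX, tQ, smul_eq_mul]
      field_simp
      ring
    rw [tP] at t1
    rw [tPp] at t2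
    have t1' : Module.finrank ℂ (mulCLM P).range = 2 * Fintype.card κ := by exact_mod_cast t1
    have t2' : Module.finrank ℂ (mulCLM Pp).range + 1 = m := by
      have : (Module.finrank ℂ (mulCLM Pp).range : ℂ) + 1 = m := by rw [t2]; ring
      exact_mod_cast this
    lia

end SuTwo

end

section

/-! ### Nahm poles in the given frame -/

section Poles

variable {ι κ μ : Type*} {a b : ℝ}

theorem sqIntOn_Ioc_of_Ioo {F : ℝ → Matrix ι κ ℂ} (h : SqIntOn F (Ioo a b)) :
    SqIntOn F (Ioc a b) := fun i j => by
  rw [← Measure.restrict_congr_set (Ioo_ae_eq_Ioc (a := a) (b := b))]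
  exact h i j

theorem ae_Ioc_of_forall_Ioo {p : ℝ → Prop} (h : ∀ s ∈ Ioo a b, p s) :
    ∀ᵐ s ∂volume.restrict (Ioc a b), p s := by
  rw [← Measure.restrict_congr_set (Ioo_ae_eq_Ioc (a := a) (b := b))]
  exact (ae_restrict_iff' measurableSet_Ioo).2 (ae_of_all _ h)

theorem IsH1.mul {f f' g g' : ℝ → ℂ} (hf : IsH1 a b f f') (hg : IsH1 a b g g') :
    IsH1 a b (fun s => f s * g s) (fun s => f' s * g s + f s * g' s) :=
  isH1_iff.2 ⟨hf.isAC.mul hg.isAC,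
    (memLp_smul_continuousOn measurableSet_Ioc Ioc_subset_Icc_self hf.1 hg.isAC.continuousOn).add
      (memLp_smul_of_continuousOn measurableSet_Ioc Ioc_subset_Icc_self hf.isAC.continuousOn hg.1)⟩

theorem IsH1.sum {τ : Type*} (t : Finset τ) {f f' : τ → ℝ → ℂ} (h : ∀ i, IsH1 a b (f i) (f' i)) :
    IsH1 a b (fun s => ∑ i ∈ t, f i s) (fun s => ∑ i ∈ t, f' i s) :=
  isH1_iff.2 ⟨IsAC.sum t fun i _ => (h i).isAC, memLp_finsetSum t fun i _ => (h i).1⟩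

/-- Matrix valued `H¹` functions. -/
def MatH1 (a b : ℝ) (U U' : ℝ → Matrix ι κ ℂ) : Prop :=
  ∀ i j, IsH1 a b (fun s => U s i j) (fun s => U' s i j)

theorem MatH1.mul [Fintype κ] {U U' : ℝ → Matrix ι κ ℂ} {V V' : ℝ → Matrix κ μ ℂ}
    (hU : MatH1 a b U U') (hV : MatH1 a b V V') :
    MatH1 a b (fun s => U s * V s) (fun s => U' s * V s + U s * V' s) := fun i j => by
  simp only [Matrix.mul_apply, Matrix.add_apply, ← Finset.sum_add_distrib]
  exact IsH1.sum _ fun l => (hU i l).mul (hV l j)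

theorem MatH1.conjTranspose {U U' : ℝ → Matrix ι κ ℂ} (hU : MatH1 a b U U') :
    MatH1 a b (fun s => (U s).conjTranspose) (fun s => (U' s).conjTranspose) := fun i j =>
  isH1_iff.2 ⟨(hU j i).isAC.clm (Complex.conjCLE : ℂ →L[ℝ] ℂ), (hU j i).1.star⟩

theorem MatH1.const (M : Matrix ι κ ℂ) : MatH1 a b (fun _ => M) (fun _ => 0) := fun _ _ =>
  isH1_iff.2 ⟨IsAC.const _, MemLp.zero'⟩

theorem MatH1.sub {U U' V V' : ℝ → Matrix ι κ ℂ} (hU : MatH1 a b U U') (hV : MatH1 a b V V') :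
    MatH1 a b (fun s => U s - V s) (fun s => U' s - V' s) := fun i j =>
  isH1_iff.2 ⟨(hU i j).isAC.sub (hV i j).isAC, (hU i j).1.sub (hV i j).1⟩

theorem MatH1.continuousOn {U U' : ℝ → Matrix ι κ ℂ} (hU : MatH1 a b U U') :
    ContinuousOn U (Icc a b) :=
  continuousOn_pi.2 fun i => continuousOn_pi.2 fun j => (hU i j).isAC.continuousOn

theorem MatH1.eq_of_ae_zero {U U' : ℝ → Matrix ι κ ℂ} (hU : MatH1 a b U U')
    (h : ∀ᵐ s ∂volume.restrict (Ioc a b), U' s = 0) {x y : ℝ} (hx : x ∈ Icc a b)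
    (hy : y ∈ Icc a b) : U y = U x := by
  ext i j
  rw [← sub_eq_zero, (hU i j).isAC.sub_eq hx hy]
  refine intervalIntegral.integral_zero_ae ?_
  rw [ae_restrict_iff' measurableSet_Ioc] at h
  filter_upwards [h] with s hs hm
  rw [hs ?_, Matrix.zero_apply]
  exact ⟨(le_min hx.1 hy.1).trans_lt hm.1, hm.2.trans (max_le hx.2 hy.2)⟩

theorem IsParallel.matH1 [Fintype ι] {T₀ : ℝ → Matrix ι ι ℂ} {Φ : ℝ → Matrix ι κ ℂ}
    (h : IsParallel T₀ a b Φ) (hT : SqIntOn T₀ (Ioc a b)) :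
    MatH1 a b Φ fun s => -(Complex.I • (T₀ s * Φ s)) := fun i j => by
  refine ⟨(((hT.mul_continuousOn measurableSet_Ioc Ioc_subset_Icc_self h.1) i j).const_mul
    Complex.I).neg, fun x hx => ?_⟩
  refine (h.2 x hx i j).trans ?_
  rw [sub_eq_add_neg]
  simp only [Matrix.neg_apply, Matrix.smul_apply, smul_eq_mul]
  rw [intervalIntegral.integral_neg, intervalIntegral.integral_const_mul]

/-- The connection d/ds + iT₀ is unitary because T₀ is Hermitian, so the two terms in the derivative
of the Gram matrix cancel. -/
theorem IsParallel.conjTranspose_mul_self [Fintype ι] {T₀ : ℝ → Matrix ι ι ℂ}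
    {Φ : ℝ → Matrix ι κ ℂ} (h : IsParallel T₀ a b Φ) (hT : SqIntOn T₀ (Ioc a b))
    (hh : ∀ s ∈ Ioo a b, (T₀ s).IsHermitian) {x y : ℝ} (hx : x ∈ Icc a b) (hy : y ∈ Icc a b) :
    (Φ y).conjTranspose * Φ y = (Φ x).conjTranspose * Φ x := by
  have h1 := h.matH1 hT
  refine (h1.conjTranspose.mul h1).eq_of_ae_zero (ae_Ioc_of_forall_Ioo fun s hs => ?_) hx hy
  simp only [Matrix.conjTranspose_neg, Matrix.conjTranspose_smul, Matrix.conjTranspose_mul,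
    (hh s hs).eq, Matrix.neg_mul, Matrix.mul_neg, Matrix.smul_mul, Matrix.mul_smul,
    Matrix.mul_assoc, Complex.star_def, Complex.conj_I]
  module

theorem IsH1.memLp_div_right {E : Type*} [NormedAddCommGroup E] [NormedSpace ℝ E]
    {f f' : ℝ → E} (h : IsH1 a b f f') (h0 : f b = 0) :
    MemLp (fun s => (s - b)⁻¹ • f s) 2 (volume.restrict (Ioc a b)) := by
  have h1 := h.reflect.memLp_div (by rw [neg_neg, h0])
  have h2 := (memLp_comp_neg' h1).neg
  refine h2.ae_eq (ae_of_all _ fun s => ?_)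
  simp only [Pi.neg_apply, neg_neg]
  rw [← neg_smul, ← inv_neg]
  congr 2
  ring

/-- Passing from the parallel frame U back to the given one replaces ρ by UρUᴴ in the polar part.
The difference UρUᴴ − ρ is H¹ and vanishes at x₀, so by Hardy's inequality the change of frame costs
only a square integrable term. -/
theorem HasNahmPole.exists_sqIntOn [Fintype ι] [DecidableEq ι] [Fintype κ] {C : Matrix κ ι ℂ}
    {T₀ : ℝ → Matrix ι ι ℂ} {T : Fin 3 → ℝ → Matrix ι ι ℂ} {x₀ : ℝ} {A : Set ℝ}
    (h : HasNahmPole C T₀ T a b x₀ A) (hT : SqIntOn T₀ (Ioc a b))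
    (hh : ∀ s ∈ Ioo a b, (T₀ s).IsHermitian) (hab : a < b) (hx : x₀ = a ∨ x₀ = b)
    {A' : Set ℝ} (hA : MeasurableSet A') (hA' : A' ⊆ A) (hAb : A' ⊆ Ioc a b) :
    ∃ ρ, IsTermIrrep C ρ ∧
      ∀ j, SqIntOn (fun s => T j s + (Complex.I / (2 * ((s - x₀ : ℝ) : ℂ))) • ρ j) A' := by
  obtain ⟨ρ, U, hρ, hU, hU0, hF⟩ := h
  have hx₀ : x₀ ∈ Icc a b := by
    rcases hx with rfl | rfl
    · exact left_mem_Icc.2 hab.le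
    · exact right_mem_Icc.2 hab.le
  refine ⟨ρ, hρ, fun j => ?_⟩
  have h1 := hU.matH1 hT
  have hs : ∀ s ∈ Icc a b, U s * (U s).conjTranspose = 1 := fun s hs => by
    rw [mul_eq_one_comm, hU.conjTranspose_mul_self hT hh hx₀ hs, hU0]
    simp
  have h2 := ((h1.mul (MatH1.const (ρ j))).mul h1.conjTranspose).sub (MatH1.const (ρ j))
  have h3 : SqIntOn (fun s => (((s - x₀ : ℝ) : ℂ)⁻¹) •
      (U s * ρ j * (U s).conjTranspose - ρ j)) (Ioc a b) := by
    intro i i'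
    have hz : (U x₀ * ρ j * (U x₀).conjTranspose - ρ j) i i' = 0 := by simp [hU0]
    have : MemLp (fun s => (s - x₀)⁻¹ • (U s * ρ j * (U s).conjTranspose - ρ j) i i') 2
        (volume.restrict (Ioc a b)) := by
      rcases hx with rfl | rfl
      · exact (h2 i i').memLp_div hz
      · exact (h2 i i').memLp_div_right hz
    refine this.ae_eq (ae_of_all _ fun s => ?_)
    simp [Matrix.smul_apply]
  have hAs := hAb.trans Ioc_subset_Icc_self
  have h4 := (((hF j).mono hA').continuousOn_mul hA hAs hU.1).mul_continuousOn hA hAs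
    h1.conjTranspose.continuousOn
  refine (h4.sub ((h3.mono hAb).const_smul (Complex.I / 2))).congr hA fun s hsA => ?_
  have e := hs s (hAs hsA)
  have e1 : U s * ((U s).conjTranspose * T j s * U s) * (U s).conjTranspose = T j s := by
    rw [← mul_assoc, ← mul_assoc, e, one_mul, mul_assoc, e, mul_one]
  rw [mul_add, add_mul, e1, Matrix.mul_smul, Matrix.smul_mul, smul_smul, smul_sub]
  have : Complex.I / 2 * ((s - x₀ : ℝ) : ℂ)⁻¹ = Complex.I / (2 * ((s - x₀ : ℝ) : ℂ)) := by
    rw [div_eq_mul_inv, div_eq_mul_inv, mul_inv, mul_assoc]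
  rw [this]
  abel

theorem imQuat_conjTranspose (M : Fin 3 → Matrix ι ι ℂ) :
    (imQuat M).conjTranspose = -imQuat fun j => (M j).conjTranspose := by
  simp only [imQuat, Matrix.conjTranspose_sum, Matrix.conjTranspose_kronecker, quat_conjTranspose]
  rw [← Finset.sum_neg_distrib]
  refine Finset.sum_congr rfl fun j _ => ?_
  ext i i'
  simp

theorem imQuat_add (M N : Fin 3 → Matrix ι ι ℂ) :
    imQuat (fun j => M j + N j) = imQuat M + imQuat N := by
  simp only [imQuat, Matrix.kronecker_add, Finset.sum_add_distrib]

theorem SqIntOn.imQuat {A : Set ℝ} {M : Fin 3 → ℝ → Matrix ι ι ℂ} (h : ∀ j, SqIntOn (M j) A) :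
    SqIntOn (fun s => imQuat fun j => M j s) A :=
  SqIntOn.sum _ fun j _ => (h j).kronecker _

/-- The zeroth order term `-i 1 ⊗ T₀ + i ∑ eⱼ ⊗ Tⱼ` of the Dirac operator, up to sign. -/
def diracMat (T₀ : Matrix ι ι ℂ) (T : Fin 3 → Matrix ι ι ℂ) : Matrix (Fin 2 × ι) (Fin 2 × ι) ℂ :=
  Complex.I • ((1 : Matrix (Fin 2) (Fin 2) ℂ) ⊗ₖ T₀ + imQuat T).conjTranspose

/-- The units eⱼ are anti-Hermitian, so the adjoint reverses the sign of the imaginary part only. -/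
theorem diracMat_eq {T₀ : Matrix ι ι ℂ} {T : Fin 3 → Matrix ι ι ℂ} (h₀ : T₀.IsHermitian)
    (h : ∀ j, (T j).IsHermitian) :
    diracMat T₀ T = Complex.I • ((1 : Matrix (Fin 2) (Fin 2) ℂ) ⊗ₖ T₀ - imQuat T) := by
  simp only [diracMat, Matrix.conjTranspose_add, imQuat_conjTranspose,
    Matrix.conjTranspose_kronecker, h₀.eq, fun j => (h j).eq, Matrix.conjTranspose_one,
    sub_eq_add_neg]

theorem sqIntOn_diracMat {A : Set ℝ} {T₀ : ℝ → Matrix ι ι ℂ} {T : Fin 3 → ℝ → Matrix ι ι ℂ}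
    (h₀ : SqIntOn T₀ A) (h : ∀ j, SqIntOn (T j) A) :
    SqIntOn (fun s => diracMat (T₀ s) fun j => T j s) A :=
  ((h₀.kronecker _).add (SqIntOn.imQuat h)).conjTranspose.const_smul _

theorem SqIntOn.comp_neg {F : ℝ → Matrix ι κ ℂ} (h : SqIntOn F (Ioc a b)) :
    SqIntOn (fun s => F (-s)) (Ioc (-b) (-a)) := fun i j => memLp_comp_neg (h i j)

theorem eventually_pieceSolvable_regular [Fintype ι] {N : ℝ → Matrix ι ι ℂ} (hab : a < b)
    (hN : SqIntOn N (Ioc a b)) :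
    ∀ᶠ c in 𝓝[>] a, PieceSolvable a c N ⊤ ⊤ (Fintype.card ι) := by
  filter_upwards [Ioc_mem_nhdsGT hab] with c hc
  exact pieceSolvable_regular hc.1 (hN.mono (Ioc_subset_Ioc_right hc.2))

theorem eventually_pieceSolvable_of_reflect [Fintype ι] {N : ℝ → Matrix ι ι ℂ} {W : Submodule ℂ (ι → ℂ)} {m : ℕ}
    (h : ∀ᶠ c in 𝓝[>] (-b), PieceSolvable (-b) c (fun s => -N (-s)) W ⊤ m) :
    ∀ᶠ c in 𝓝[<] b, PieceSolvable c b N ⊤ W m := by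
  have h1 : Tendsto (fun c : ℝ => -c) (𝓝[<] b) (𝓝[>] (-b)) := tendsto_neg_nhdsLT
  filter_upwards [h1.eventually h] with c hc
  have := hc.reflect
  simpa using this

theorem eventually_pieceSolvable_regular_right [Fintype ι] {N : ℝ → Matrix ι ι ℂ} (hab : a < b)
    (hN : SqIntOn N (Ioc a b)) :
    ∀ᶠ c in 𝓝[<] b, PieceSolvable c b N ⊤ ⊤ (Fintype.card ι) := by
  refine eventually_pieceSolvable_of_reflect (eventually_pieceSolvable_regular (b := -a)
    (neg_lt_neg hab) ?_)
  simpa using (hN.comp_neg.const_smul (-1))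

variable [Fintype ι] [DecidableEq ι] [Fintype κ] [DecidableEq κ]

/-- Solvability at the left end of a subinterval with a Nahm pole. -/
theorem eventually_pieceSolvable_pole {C : Matrix κ ι ℂ} (hC : C * C.conjTranspose = 1)
    (hlt : Fintype.card κ < Fintype.card ι) {ρ : Fin 3 → Matrix ι ι ℂ} (hρ : IsTermIrrep C ρ)
    {N : ℝ → Matrix (Fin 2 × ι) (Fin 2 × ι) ℂ} (hab : a < b)
    (hN : SqIntOn (fun s => N s + (2 * ((s - a : ℝ) : ℂ))⁻¹ • imQuat ρ) (Ioc a b)) :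
    ∀ᶠ c in 𝓝[>] a, PieceSolvable a c N
      (LinearMap.range ((1 : Matrix (Fin 2) (Fin 2) ℂ) ⊗ₖ C.conjTranspose).mulVecLin) ⊤
      (Fintype.card ι + Fintype.card κ - 1) := by
  obtain ⟨P₀, Pm, Pp, M, μm, μp, hS, hm, hp, hM, hr, hrank⟩ := exists_isSpectral hC hlt hρ
  rw [← hr]
  refine eventually_pieceSolvable hS hm hp hab (hN.const_smul (-1)) (ae_of_all _ fun s v => ?_)
    hrank
  rw [hM, Matrix.smul_mulVec, Matrix.add_mulVec, Matrix.smul_mulVec]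
  match_scalars
  · ring
  · simp

/-- Under reflection both the matrix N and the factor s − b change sign, so the polar part keeps its
form with the same ρ, and the spectral data of the left end apply. -/
theorem eventually_pieceSolvable_pole_right {C : Matrix κ ι ℂ} (hC : C * C.conjTranspose = 1)
    (hlt : Fintype.card κ < Fintype.card ι) {ρ : Fin 3 → Matrix ι ι ℂ} (hρ : IsTermIrrep C ρ)
    {N : ℝ → Matrix (Fin 2 × ι) (Fin 2 × ι) ℂ} (hab : a < b)
    (hN : SqIntOn (fun s => N s + (2 * ((s - b : ℝ) : ℂ))⁻¹ • imQuat ρ) (Ioc a b)) :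
    ∀ᶠ c in 𝓝[<] b, PieceSolvable c b N ⊤
      (LinearMap.range ((1 : Matrix (Fin 2) (Fin 2) ℂ) ⊗ₖ C.conjTranspose).mulVecLin)
      (Fintype.card ι + Fintype.card κ - 1) := by
  refine eventually_pieceSolvable_of_reflect (eventually_pieceSolvable_pole hC hlt hρ (b := -a)
    (neg_lt_neg hab) ?_)
  refine (hN.comp_neg.const_smul (-1)).congr measurableSet_Ioc fun s _ => ?_
  have : (2 * ((s - -b : ℝ) : ℂ))⁻¹ = -(2 * ((-s - b : ℝ) : ℂ))⁻¹ := by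
    rw [← inv_neg]
    push_cast
    ring_nf
  rw [this]
  module

end Poles

end

section

/-! ### The boundary problem on the subintervals of a bow -/

/-- Inserting Tⱼ ∼ −iρⱼ/(2(s − x₀)) in −i ∑ eⱼTⱼ gives the polar part −½(s − x₀)⁻¹ ∑ eⱼρⱼ. Thus f′ =
−Nf has the eigenvalues of ½ ∑ eⱼρⱼ as exponents. -/
theorem sqIntOn_diracMat_pole {ι : Type*} {T₀ : ℝ → Matrix ι ι ℂ} {T : Fin 3 → ℝ → Matrix ι ι ℂ}
    {ρ : Fin 3 → Matrix ι ι ℂ} {A : Set ℝ} {x₀ : ℝ} (hA : MeasurableSet A) (h₀ : SqIntOn T₀ A)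
    (hT : ∀ j, SqIntOn (fun s => T j s + (Complex.I / (2 * ((s - x₀ : ℝ) : ℂ))) • ρ j) A)
    (hh₀ : ∀ s ∈ A, (T₀ s).IsHermitian) (hh : ∀ j, ∀ s ∈ A, (T j s).IsHermitian) :
    SqIntOn (fun s => diracMat (T₀ s) (fun j => T j s)
      + (2 * ((s - x₀ : ℝ) : ℂ))⁻¹ • imQuat ρ) A := by
  refine (((h₀.kronecker (1 : Matrix (Fin 2) (Fin 2) ℂ)).sub (SqIntOn.imQuat hT)).const_smul
    Complex.I).congr hA fun s hs => ?_
  rw [diracMat_eq (hh₀ s hs) fun j => hh j s hs, imQuat_add, imQuat_smul, div_eq_mul_inv]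
  generalize (2 * ((s - x₀ : ℝ) : ℂ))⁻¹ = z
  match_scalars
  · rfl
  · rfl
  · linear_combination z * Complex.I_mul_I

variable {k : ℕ} [NeZero k] {B : Bow k}

namespace BowRep

variable (R : BowRep B)

@[simp] theorem lo_zero (σ : Fin k) : R.lo σ 0 = 0 := rfl

@[simp] theorem lo_succ (σ : Fin k) (a : Fin (R.n σ)) : R.lo σ a.succ = R.lam σ a := rfl

@[simp] theorem hi_last (σ : Fin k) : R.hi σ (Fin.last _) = B.len σ :=
  Fin.snoc_last (α := fun _ => ℝ) _ _

@[simp] theorem hi_castSucc (σ : Fin k) (a : Fin (R.n σ)) : R.hi σ a.castSucc = R.lam σ a :=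
  Fin.snoc_castSucc (α := fun _ => ℝ) _ _ _

theorem lo_nonneg (σ : Fin k) (α : Fin (R.n σ + 1)) : 0 ≤ R.lo σ α := by
  refine Fin.cases le_rfl (fun a => ?_) α
  exact (R.lam_mem σ a).1.le

theorem hi_le (σ : Fin k) (α : Fin (R.n σ + 1)) : R.hi σ α ≤ B.len σ := by
  refine Fin.lastCases (R.hi_last σ).le (fun a => ?_) α
  rw [hi_castSucc]
  exact (R.lam_mem σ a).2.le

theorem lo_lt_hi (σ : Fin k) (α : Fin (R.n σ + 1)) : R.lo σ α < R.hi σ α := by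
  rcases Fin.eq_castSucc_or_eq_last α with ⟨a, ha⟩ | ha
  · have h1 : R.hi σ α = R.lam σ a := by rw [ha, hi_castSucc]
    rw [h1]
    rcases Fin.eq_zero_or_eq_succ α with h | ⟨b, hb⟩
    · rw [h]
      exact (R.lam_mem σ a).1
    · rw [hb, lo_succ]
      refine R.lam_mono σ ?_
      have := congrArg Fin.val (hb.symm.trans ha)
      simp at this
      exact Fin.lt_def.2 (by lia)
  · have h1 : R.hi σ α = B.len σ := by rw [ha, hi_last]
    rw [h1]
    rcases Fin.eq_zero_or_eq_succ α with h | ⟨b, hb⟩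
    · rw [h]
      exact B.len_pos σ
    · rw [hb, lo_succ]
      exact (R.lam_mem σ b).2

/-- The values at the left end of a subinterval allowed for a section of the domain. -/
def Wlo (σ : Fin k) (α : Fin (R.n σ + 1)) : Submodule ℂ (Fin 2 × Fin (R.rank σ α) → ℂ) :=
  Fin.cases (motive := fun α => Submodule ℂ (Fin 2 × Fin (R.rank σ α) → ℂ)) ⊤
    (fun a => LinearMap.range ((1 : Matrix (Fin 2) (Fin 2) ℂ) ⊗ₖ R.kap σ a).mulVecLin) α

/-- The values at the right end of a subinterval allowed for a section of the domain. -/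
def Whi (σ : Fin k) (α : Fin (R.n σ + 1)) : Submodule ℂ (Fin 2 × Fin (R.rank σ α) → ℂ) :=
  Fin.lastCases (motive := fun α => Submodule ℂ (Fin 2 × Fin (R.rank σ α) → ℂ)) ⊤
    (fun a => LinearMap.range
      ((1 : Matrix (Fin 2) (Fin 2) ℂ) ⊗ₖ (R.kap σ a).conjTranspose).mulVecLin) α

/-- The number of parameters of the boundary problem near the left end of a subinterval. -/
def mlo (σ : Fin k) (α : Fin (R.n σ + 1)) : ℕ :=
  Fin.cases (motive := fun _ => ℕ) (2 * R.rank σ 0)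
    (fun a => if R.rank σ a.castSucc < R.rank σ a.succ
      then R.rank σ a.succ + R.rank σ a.castSucc - 1 else 2 * R.rank σ a.succ) α

/-- The number of parameters of the boundary problem near the right end of a subinterval. -/
def mhi (σ : Fin k) (α : Fin (R.n σ + 1)) : ℕ :=
  Fin.lastCases (motive := fun _ => ℕ) (2 * R.rank σ (Fin.last _))
    (fun a => if R.rank σ a.succ < R.rank σ a.castSucc
      then R.rank σ a.castSucc + R.rank σ a.succ - 1 else 2 * R.rank σ a.castSucc) α

@[simp] theorem Wlo_succ (σ : Fin k) (a : Fin (R.n σ)) : R.Wlo σ a.succ =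
  LinearMap.range ((1 : Matrix (Fin 2) (Fin 2) ℂ) ⊗ₖ R.kap σ a).mulVecLin := rfl

@[simp] theorem Whi_last (σ : Fin k) : R.Whi σ (Fin.last _) = ⊤ := by
  simp only [Whi, Fin.lastCases_last]

@[simp] theorem Whi_castSucc (σ : Fin k) (a : Fin (R.n σ)) : R.Whi σ a.castSucc =
    LinearMap.range
      ((1 : Matrix (Fin 2) (Fin 2) ℂ) ⊗ₖ (R.kap σ a).conjTranspose).mulVecLin := by
  simp only [Whi, Fin.lastCases_castSucc]

@[simp] theorem mlo_zero (σ : Fin k) : R.mlo σ 0 = 2 * R.rank σ 0 := rfl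

@[simp] theorem mlo_succ (σ : Fin k) (a : Fin (R.n σ)) : R.mlo σ a.succ =
  if R.rank σ a.castSucc < R.rank σ a.succ
      then R.rank σ a.succ + R.rank σ a.castSucc - 1 else 2 * R.rank σ a.succ := rfl

@[simp] theorem mhi_last (σ : Fin k) : R.mhi σ (Fin.last _) = 2 * R.rank σ (Fin.last _) := by
  simp only [mhi, Fin.lastCases_last]

@[simp] theorem mhi_castSucc (σ : Fin k) (a : Fin (R.n σ)) : R.mhi σ a.castSucc =
    if R.rank σ a.succ < R.rank σ a.castSucc
      then R.rank σ a.castSucc + R.rank σ a.succ - 1 else 2 * R.rank σ a.castSucc := by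
  simp only [mhi, Fin.lastCases_castSucc]

end BowRep

theorem range_kronecker_eq_top {ι κ : Type*} [Fintype ι] [Fintype κ] [DecidableEq κ]
    {C : Matrix κ ι ℂ} (h : C * C.conjTranspose = 1) :
    LinearMap.range ((1 : Matrix (Fin 2) (Fin 2) ℂ) ⊗ₖ C).mulVecLin = ⊤ := by
  rw [LinearMap.range_eq_top]
  intro v
  refine ⟨((1 : Matrix (Fin 2) (Fin 2) ℂ) ⊗ₖ C.conjTranspose).mulVec v, ?_⟩
  rw [Matrix.mulVecLin_apply, Matrix.mulVec_mulVec, ← Matrix.mul_kronecker_mul, h, one_mul,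
    Matrix.one_kronecker_one, Matrix.one_mulVec]

namespace LevelSet

variable {ν : Fin k → Fin 3 → ℝ} (p : LevelSet B ν)

theorem t0_memLp (σ : Fin k) : MemLp (p.t0 σ) 2 (volume.restrict (Ioc 0 (B.len σ))) := by
  have := sqIntOn_Ioc_of_Ioo (p.1.T0_L2 σ (0 : Fin 1)) (0 : Fin 1) (0 : Fin 1)
  exact this

/-- In rank one all commutators in the Nahm equations vanish. -/
theorem t_eq (σ : Fin k) (j : Fin 3) {x y : ℝ} (hx : x ∈ Ioo 0 (B.len σ))
    (hy : y ∈ Ioo 0 (B.len σ)) : p.t σ j y = p.t σ j x := by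
  have h := p.2.nahm σ (0 : Fin 1) j x hx y hy (0 : Fin 1) (0 : Fin 1)
  have h0 : ∀ M N : Matrix (Fin 1) (Fin 1) ℂ, (M * N) - N * M = 0 := fun M N => by
    ext i i'
    simp [Matrix.mul_apply, Subsingleton.elim i 0, Subsingleton.elim i' 0, mul_comm]
  have h1 : ∀ s, (p.1.T σ (0 : Fin 1) (j + 1) s * p.1.T σ (0 : Fin 1) (j + 2) s
      - p.1.T σ (0 : Fin 1) (j + 2) s * p.1.T σ (0 : Fin 1) (j + 1) s
        + (p.1.T0 σ (0 : Fin 1) s * p.1.T σ (0 : Fin 1) j s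
        - p.1.T σ (0 : Fin 1) j s * p.1.T0 σ (0 : Fin 1) s))
        (0 : Fin 1) (0 : Fin 1) = 0 := fun s => by
    have e1 := h0 (p.1.T σ (0 : Fin 1) (j + 1) s) (p.1.T σ (0 : Fin 1) (j + 2) s)
    have e2 := h0 (p.1.T0 σ (0 : Fin 1) s) (p.1.T σ (0 : Fin 1) j s)
    exact congrFun (congrFun ((congrArg₂ (· + ·) e1 e2).trans (add_zero _)) 0) 0
  simp only [h1] at h
  rw [intervalIntegral.integral_zero] at h
  exact sub_eq_zero.1 ((mul_eq_zero.1 h).resolve_left Complex.I_ne_zero)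

theorem star_t0 (σ : Fin k) {s : ℝ} (hs : s ∈ Ioo 0 (B.len σ)) : star (p.t0 σ s) = p.t0 σ s :=
  (p.1.T0_herm σ (0 : Fin 1) s hs).apply (0 : Fin 1) (0 : Fin 1)

theorem star_t (σ : Fin k) (j : Fin 3) {s : ℝ} (hs : s ∈ Ioo 0 (B.len σ)) :
    star (p.t σ j s) = p.t σ j s :=
  (p.1.T_herm σ (0 : Fin 1) j s hs).apply (0 : Fin 1) (0 : Fin 1)

end LevelSet

theorem sqIntOn_smul_one {ι : Type*} [DecidableEq ι] {f : ℝ → ℂ} {A : Set ℝ}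
    (h : MemLp f 2 (volume.restrict A)) : SqIntOn (fun s => f s • (1 : Matrix ι ι ℂ)) A :=
  fun _ _ => h.mul_const _

theorem isHermitian_smul_one {ι : Type*} [DecidableEq ι] {z : ℂ} (h : star z = z) :
    (z • (1 : Matrix ι ι ℂ)).IsHermitian := by
  rw [Matrix.IsHermitian, Matrix.conjTranspose_smul, h, Matrix.conjTranspose_one]

section Strips

variable {R : BowRep B} {ν : Fin k → Fin 3 → ℝ} (d : BowData R) (p : LevelSet B ν)

/-- `T₀ - t₀`. -/
def relT0 (σ : Fin k) (α : Fin (R.n σ + 1)) (s : ℝ) :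
    Matrix (Fin (R.rank σ α)) (Fin (R.rank σ α)) ℂ := d.T0 σ α s - p.t0 σ s • 1

/-- `Tⱼ - tⱼ`. -/
def relT (σ : Fin k) (α : Fin (R.n σ + 1)) (j : Fin 3) (s : ℝ) :
    Matrix (Fin (R.rank σ α)) (Fin (R.rank σ α)) ℂ := d.T σ α j s - p.t σ j s • 1

/-- The zeroth order part of the twisted Dirac operator, up to sign. -/
def opMat (σ : Fin k) (α : Fin (R.n σ + 1)) (s : ℝ) :
    Matrix (Fin 2 × Fin (R.rank σ α)) (Fin 2 × Fin (R.rank σ α)) ℂ :=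
  diracMat (relT0 d p σ α s) fun j => relT d p σ α j s

theorem diracBulk_eq (f : TermSection R) (σ : Fin k) (α : Fin (R.n σ + 1)) (s : ℝ) :
    diracBulk d p f σ α s = -f.df σ α s - (opMat d p σ α s).mulVec (f.f σ α s) := by
  rw [diracBulk, opMat, diracMat, Matrix.smul_mulVec]
  rfl

theorem mem_Ioo_len {σ : Fin k} {α : Fin (R.n σ + 1)} {s : ℝ}
    (hs : s ∈ Ioo (R.lo σ α) (R.hi σ α)) : s ∈ Ioo 0 (B.len σ) :=
  ⟨(R.lo_nonneg σ α).trans_lt hs.1, hs.2.trans_le (R.hi_le σ α)⟩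

theorem sqIntOn_relT0 (σ : Fin k) (α : Fin (R.n σ + 1)) :
    SqIntOn (relT0 d p σ α) (Ioc (R.lo σ α) (R.hi σ α)) :=
  (sqIntOn_Ioc_of_Ioo (d.T0_L2 σ α)).sub (sqIntOn_smul_one (memLp_mono_Ioc (p.t0_memLp σ)
    (R.lo_nonneg σ α) (R.hi_le σ α)))

theorem relT0_isHermitian {σ : Fin k} {α : Fin (R.n σ + 1)} {s : ℝ}
    (hs : s ∈ Ioo (R.lo σ α) (R.hi σ α)) : (relT0 d p σ α s).IsHermitian :=
  (d.T0_herm σ α s hs).sub (isHermitian_smul_one (p.star_t0 σ (mem_Ioo_len hs)))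

theorem relT_isHermitian {σ : Fin k} {α : Fin (R.n σ + 1)} (j : Fin 3) {s : ℝ}
    (hs : s ∈ Ioo (R.lo σ α) (R.hi σ α)) : (relT d p σ α j s).IsHermitian :=
  (d.T_herm σ α j s hs).sub (isHermitian_smul_one (p.star_t σ j (mem_Ioo_len hs)))

/-- The tⱼ are constant, so subtracting them affects neither square integrability nor a pole, here
represented by the correction G. -/
theorem sqIntOn_add_relT {σ : Fin k} {α : Fin (R.n σ + 1)} {j : Fin 3} {c e : ℝ}
    (hc : R.lo σ α ≤ c) (he : e ≤ R.hi σ α)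
    {G : ℝ → Matrix (Fin (R.rank σ α)) (Fin (R.rank σ α)) ℂ}
    (h : SqIntOn (fun s => d.T σ α j s + G s) (Ioo c e)) :
    SqIntOn (fun s => relT d p σ α j s + G s) (Ioo c e) := by
  set x := (R.lo σ α + R.hi σ α) / 2
  have hlt := R.lo_lt_hi σ α
  have hx : x ∈ Ioo (R.lo σ α) (R.hi σ α) := ⟨by simp only [x]; linarith, by simp only [x]; linarith⟩
  refine (h.sub (G := fun _ => p.t σ j x • 1) (sqIntOn_smul_one (memLp_const _))).congr
    measurableSet_Ioo fun s hs => ?_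
  rw [relT, p.t_eq σ j (mem_Ioo_len hx) (mem_Ioo_len ⟨hc.trans_lt hs.1, hs.2.trans_le he⟩)]
  abel

theorem sqIntOn_relT {σ : Fin k} {α : Fin (R.n σ + 1)} {j : Fin 3} {c e : ℝ}
    (hc : R.lo σ α ≤ c) (he : e ≤ R.hi σ α)
    (h : SqIntOn (d.T σ α j) (Ioo c e)) : SqIntOn (relT d p σ α j) (Ioo c e) := by
  have := sqIntOn_add_relT d p hc he (G := fun _ => 0) (by simpa using h)
  simpa using this

theorem sqIntOn_opMat {σ : Fin k} {α : Fin (R.n σ + 1)} {c e : ℝ}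
    (hc : R.lo σ α ≤ c) (he : e ≤ R.hi σ α) (h : ∀ j, SqIntOn (d.T σ α j) (Ioo c e)) :
    SqIntOn (opMat d p σ α) (Ioc c e) :=
  sqIntOn_diracMat ((sqIntOn_relT0 d p σ α).mono (Ioc_subset_Ioc hc he)) fun j =>
    sqIntOn_Ioc_of_Ioo (sqIntOn_relT d p hc he (h j))

theorem exists_common_eps {P : Fin 3 → ℝ → Prop}
    (hP : ∀ j ε ε', 0 < ε' → ε' ≤ ε → P j ε → P j ε')
    (h : ∀ j, ∃ ε > 0, P j ε) : ∃ ε > 0, ∀ j, P j ε := by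
  choose ε h0 h1 using h
  refine ⟨min (ε 0) (min (ε 1) (ε 2)), lt_min (h0 0) (lt_min (h0 1) (h0 2)), fun j => ?_⟩
  refine hP j (ε j) _ (lt_min (h0 0) (lt_min (h0 1) (h0 2))) ?_ (h1 j)
  fin_cases j
  · exact min_le_left _ _
  · exact (min_le_right _ _).trans (min_le_left _ _)
  · exact (min_le_right _ _).trans (min_le_right _ _)

theorem eventually_left_regular {σ : Fin k} {α : Fin (R.n σ + 1)}
    (h : ∀ j, ∃ ε > 0, SqIntOn (d.T σ α j) (Ioo (R.lo σ α) (R.lo σ α + ε))) :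
    ∀ᶠ c in 𝓝[>] (R.lo σ α), PieceSolvable (R.lo σ α) c (opMat d p σ α) ⊤ ⊤
      (2 * R.rank σ α) := by
  obtain ⟨ε, h0, hε⟩ := exists_common_eps (fun j ε ε' _ hle h =>
    h.mono (Ioo_subset_Ioo_right (by linarith))) h
  have hlt := R.lo_lt_hi σ α
  have := eventually_pieceSolvable_regular (b := min (R.lo σ α + ε) (R.hi σ α))
    (lt_min (by linarith) hlt) (sqIntOn_opMat d p le_rfl (min_le_right _ _) fun j =>
      (hε j).mono (Ioo_subset_Ioo_right (min_le_left _ _)))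
  simpa using this

theorem eventually_right_regular {σ : Fin k} {α : Fin (R.n σ + 1)}
    (h : ∀ j, ∃ ε > 0, SqIntOn (d.T σ α j) (Ioo (R.hi σ α - ε) (R.hi σ α))) :
    ∀ᶠ c in 𝓝[<] (R.hi σ α), PieceSolvable c (R.hi σ α) (opMat d p σ α) ⊤ ⊤
      (2 * R.rank σ α) := by
  obtain ⟨ε, h0, hε⟩ := exists_common_eps (fun j ε ε' _ hle h =>
    h.mono (Ioo_subset_Ioo_left (by linarith))) h
  have hlt := R.lo_lt_hi σ α
  have := eventually_pieceSolvable_regular_right (a := max (R.hi σ α - ε) (R.lo σ α))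
    (max_lt (by linarith) hlt) (sqIntOn_opMat d p (le_max_right _ _) le_rfl fun j =>
      (hε j).mono (Ioo_subset_Ioo_left (le_max_left _ _)))
  simpa using this

/-- A pole occurs on the right of a λ-point exactly when the rank increases there. Otherwise the end
is regular and the matching map is onto, so the condition on the left end value is void. -/
theorem eventually_left (σ : Fin k) (α : Fin (R.n σ + 1)) :
    ∀ᶠ c in 𝓝[>] (R.lo σ α), PieceSolvable (R.lo σ α) c (opMat d p σ α) (R.Wlo σ α) ⊤
      (R.mlo σ α) := by
  refine Fin.cases ?_ (fun a => ?_) α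
  · exact eventually_left_regular d p fun j => by simpa using d.T_L2_left σ j
  · rw [BowRep.Wlo_succ, BowRep.mlo_succ]
    split_ifs with hlt
    · obtain ⟨ε, h0, hP⟩ := d.pole_up σ a hlt
      have hlh := R.lo_lt_hi σ a.succ
      -- Chosen so that (lo, c] lies both in the neighbourhood where the pole is described and in
      -- the open subinterval, where the data are Hermitian.
      set c := min (R.lam σ a + ε / 2) ((R.lo σ a.succ + R.hi σ a.succ) / 2)
      have hc1 : c ≤ R.lam σ a + ε / 2 := min_le_left _ _
      have hc2 : c ≤ (R.lo σ a.succ + R.hi σ a.succ) / 2 := min_le_right _ _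
      have hc3 : R.lo σ a.succ < c := lt_min (by rw [R.lo_succ]; linarith) (by linarith)
      have hsub : Ioc (R.lo σ a.succ) c ⊆ Ioo (R.lo σ a.succ) (R.hi σ a.succ) := fun s hs =>
        ⟨hs.1, by linarith [hs.2]⟩
      obtain ⟨ρ, hρ, hS⟩ := hP.exists_sqIntOn (sqIntOn_Ioc_of_Ioo (d.T0_L2 σ a.succ))
        (d.T0_herm σ a.succ) hlh (Or.inl rfl) (A' := Ioc (R.lo σ a.succ) c) measurableSet_Ioc
        (fun s hs => ⟨hs.1, by linarith [hs.2]⟩) (hsub.trans Ioo_subset_Ioc_self)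
      have h2 := sqIntOn_diracMat_pole (x₀ := R.lam σ a) measurableSet_Ioc
        ((sqIntOn_relT0 d p σ a.succ).mono (hsub.trans Ioo_subset_Ioc_self))
        (fun j => sqIntOn_Ioc_of_Ioo (sqIntOn_add_relT d p le_rfl (by linarith)
          ((hS j).mono Ioo_subset_Ioc_self)))
        (fun s hs => relT0_isHermitian d p (hsub hs))
        (fun j s hs => relT_isHermitian d p j (hsub hs))
      have h3 := eventually_pieceSolvable_pole (C := (R.kap σ a).conjTranspose)
        (by rw [Matrix.conjTranspose_conjTranspose, R.kap_up σ a hlt.le]) (by simpa using hlt)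
        hρ hc3 h2
      simp only [Matrix.conjTranspose_conjTranspose, Fintype.card_fin] at h3
      exact h3
    · rw [range_kronecker_eq_top (R.kap_down σ a (not_lt.1 hlt))]
      exact eventually_left_regular d p fun j => d.T_L2_lam_right σ a j (not_lt.1 hlt)

theorem eventually_right (σ : Fin k) (α : Fin (R.n σ + 1)) :
    ∀ᶠ c in 𝓝[<] (R.hi σ α), PieceSolvable c (R.hi σ α) (opMat d p σ α) ⊤ (R.Whi σ α)
      (R.mhi σ α) := by
  refine Fin.lastCases ?_ (fun a => ?_) α
  · rw [BowRep.Whi_last, BowRep.mhi_last]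
    exact eventually_right_regular d p fun j => by simpa using d.T_L2_right σ j
  · rw [BowRep.Whi_castSucc, BowRep.mhi_castSucc]
    split_ifs with hlt
    · obtain ⟨ε, h0, hP⟩ := d.pole_down σ a hlt
      have hlh := R.lo_lt_hi σ a.castSucc
      have hhi := R.hi_castSucc σ a
      set c := max (R.lam σ a - ε / 2) ((R.lo σ a.castSucc + R.hi σ a.castSucc) / 2)
      have hc1 : R.lam σ a - ε / 2 ≤ c := le_max_left _ _
      have hc2 : (R.lo σ a.castSucc + R.hi σ a.castSucc) / 2 ≤ c := le_max_right _ _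
      have hc3 : c < R.hi σ a.castSucc := max_lt (by rw [R.hi_castSucc]; linarith) (by linarith)
      have hsub : Ioo c (R.hi σ a.castSucc) ⊆ Ioo (R.lo σ a.castSucc) (R.hi σ a.castSucc) :=
        fun s hs => ⟨by linarith [hs.1], hs.2⟩
      obtain ⟨ρ, hρ, hS⟩ := hP.exists_sqIntOn (sqIntOn_Ioc_of_Ioo (d.T0_L2 σ a.castSucc))
        (d.T0_herm σ a.castSucc) hlh (Or.inr hhi.symm) (A' := Ioo c (R.hi σ a.castSucc))
        measurableSet_Ioo
        (fun s hs => ⟨by linarith [hs.1], by linarith [hs.2]⟩) (hsub.trans Ioo_subset_Ioc_self)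
      have h2 := sqIntOn_diracMat_pole (x₀ := R.lam σ a) measurableSet_Ioo
        ((sqIntOn_relT0 d p σ a.castSucc).mono (hsub.trans Ioo_subset_Ioc_self))
        (fun j => sqIntOn_add_relT d p (by linarith) le_rfl (hS j))
        (fun s hs => relT0_isHermitian d p (hsub hs))
        (fun j s hs => relT_isHermitian d p j (hsub hs))
      have h2' := sqIntOn_Ioc_of_Ioo h2
      rw [← hhi] at h2'
      have h3 := eventually_pieceSolvable_pole_right (C := R.kap σ a)
        (R.kap_down σ a hlt.le) (by simpa using hlt) hρ hc3 h2'
      simp only [Fintype.card_fin] at h3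
      exact h3
    · have := R.kap_up σ a (not_lt.1 hlt)
      rw [range_kronecker_eq_top (by rw [Matrix.conjTranspose_conjTranspose]; exact this)]
      refine eventually_right_regular d p fun j => ?_
      rw [R.hi_castSucc]
      exact d.T_L2_lam_left σ a j (not_lt.1 hlt)

/-- Choose the cuts on either side of the midpoint, close enough to the ends for the end pieces to
be solvable; the middle piece then needs only local square integrability. -/
theorem exists_strip (σ : Fin k) (α : Fin (R.n σ + 1)) :
    ∃ E₀ J : (Param (R.mlo σ α) (2 * R.rank σ α) (R.mhi σ α) ×
        LTwo (Fin 2 × Fin (R.rank σ α)) (R.lo σ α) (R.hi σ α)) →L[ℂ]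
        ((Fin 2 × Fin (R.rank σ α) → ℂ) × (Fin 2 × Fin (R.rank σ α) → ℂ)),
      IsStrip (R.lo σ α) (R.hi σ α) (opMat d p σ α) (R.Wlo σ α) (R.Whi σ α) E₀ J := by
  have hlt := R.lo_lt_hi σ α
  set x := (R.lo σ α + R.hi σ α) / 2
  have h1 : R.lo σ α < x := by simp only [x]; linarith
  have h2 : x < R.hi σ α := by simp only [x]; linarith
  obtain ⟨c₁, hp₁, hc₁⟩ := ((eventually_left d p σ α).and (Ioo_mem_nhdsGT h1)).exists
  obtain ⟨c₂, hp₂, hc₂⟩ := ((eventually_right d p σ α).and (Ioo_mem_nhdsLT h2)).exists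
  have h3 : c₁ < c₂ := hc₁.2.trans hc₂.1
  refine exists_isStrip hc₁.1 h3 hc₂.2 hp₁ ?_ hp₂
  have := pieceSolvable_regular h3 (sqIntOn_opMat d p hc₁.1.le hc₂.2.le fun j =>
    d.T_L2loc σ α j c₁ c₂ hc₁.1 hc₂.2)
  simpa using this

end Strips

end

section

/-! ### An index computation -/

section Index

variable {H : Type*} [NormedAddCommGroup H] [NormedSpace ℂ H]

/-- The orthogonal complement is the kernel of the adjoint matrix, whose rank equals that of the
matrix, and injectivity makes this rank |ζ|. -/
theorem finrank_orthogonal_range {τ ζ : Type*} [Fintype τ] [Fintype ζ] [DecidableEq ζ]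
    (L : (ζ → ℂ) →ₗ[ℂ] (τ → ℂ)) (hL : Function.Injective L) (K : Submodule ℂ (τ → ℂ))
    (hK : ∀ u, u ∈ K ↔ ∀ z, star (L z) ⬝ᵥ u = 0) :
    Module.finrank ℂ K + Fintype.card ζ = Fintype.card τ := by
  classical
  set M := LinearMap.toMatrix' L
  have hM : ∀ z, L z = M.mulVec z := fun z => by
    rw [← Matrix.toLin'_apply, Matrix.toLin'_toMatrix']
  have hKe : K = LinearMap.ker M.conjTranspose.mulVecLin := by
    ext u
    rw [hK, LinearMap.mem_ker, Matrix.mulVecLin_apply]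
    refine ⟨fun h => ?_, fun h z => ?_⟩
    · ext i
      have := h (Pi.single i 1)
      rw [hM, Matrix.star_mulVec, ← Matrix.dotProduct_mulVec] at this
      have e : star (Pi.single i 1 : ζ → ℂ) = Pi.single i 1 := by
        rw [Pi.star_single, star_one]
      rw [e, single_dotProduct, one_mul] at this
      exact this
    · rw [hM, Matrix.star_mulVec, ← Matrix.dotProduct_mulVec, h, dotProduct_zero]
  have h1 := LinearMap.finrank_range_add_finrank_ker M.conjTranspose.mulVecLin
  rw [← hKe, Module.finrank_fintype_fun_eq_card] at h1
  have h2 : Module.finrank ℂ (LinearMap.range M.conjTranspose.mulVecLin) = Fintype.card ζ := by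
    have h3 : M.conjTranspose.rank = M.rank := by
      open ComplexOrder in exact Matrix.rank_conjTranspose M
    have h4 : M.rank = Fintype.card ζ := by
      have : M.mulVecLin = L := LinearMap.ext fun z => (hM z).symm
      rw [Matrix.rank, this, LinearMap.finrank_range_of_inj hL, Module.finrank_fintype_fun_eq_card]
    exact h3.trans h4
  lia

/-- Lagrange multipliers: (χ, v) annihilates the constrained values exactly when some y makes ⟨g, χ⟩
+ ⟨D(z, g), v⟩ + ⟨J(z, g), y⟩ vanish without constraint. The part linear in z is a finite system for
(v, y), of full rank by the injectivity hypothesis; the part in g then determines χ by the Riesz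
property. Surjectivity of J makes y unique. -/
theorem finrank_annihilator_aux {τ η ζ : Type*} [Fintype τ] [Fintype η] [Fintype ζ] [DecidableEq ζ]
    (pH : H →ₗ⋆[ℂ] H →ₗ[ℂ] ℂ) (hnd : ∀ χ, (∀ g, pH g χ = 0) → χ = 0)
    (hriesz : ∀ l : H →L[ℂ] ℂ, ∃ χ, ∀ g, pH g χ = star (l g))
    (D : ((ζ → ℂ) × H) →L[ℂ] (τ → ℂ)) (J : ((ζ → ℂ) × H) →L[ℂ] (η → ℂ))
    (hJ : Function.Surjective J) (hinj : ∀ z, J (z, 0) = 0 → D (z, 0) = 0 → z = 0)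
    (S : Submodule ℂ (H × (τ → ℂ)))
    (hS : ∀ Ψ, Ψ ∈ S ↔ ∀ x, J x = 0 → pH x.2 Ψ.1 + star (D x) ⬝ᵥ Ψ.2 = 0) :
    Module.Finite ℂ S ∧
      Module.finrank ℂ S + Fintype.card ζ = Fintype.card τ + Fintype.card η := by
  -- The pairs (v, y) that satisfy the finite dimensional part of the multiplier equation, with g =
  -- 0.
  let K : Submodule ℂ (τ ⊕ η → ℂ) :=
    { carrier := {u | ∀ z, star (D (z, 0)) ⬝ᵥ (fun i => u (.inl i))
        + star (J (z, 0)) ⬝ᵥ (fun i => u (.inr i)) = 0}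
      zero_mem' := fun z => by
        change _ ⬝ᵥ (0 : τ → ℂ) + _ ⬝ᵥ (0 : η → ℂ) = 0
        simp
      add_mem' := fun {u v} hu hv z => by
        have e1 := hu z
        have e2 := hv z
        change _ ⬝ᵥ ((fun i => u (.inl i)) + fun i => v (.inl i))
          + _ ⬝ᵥ ((fun i => u (.inr i)) + fun i => v (.inr i)) = 0
        rw [dotProduct_add, dotProduct_add]
        linear_combination e1 + e2
      smul_mem' := fun c u hu z => by
        have e1 := hu z
        change _ ⬝ᵥ (c • fun i => u (.inl i)) + _ ⬝ᵥ (c • fun i => u (.inr i)) = 0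
        rw [dotProduct_smul, dotProduct_smul, smul_eq_mul, smul_eq_mul]
        linear_combination c * e1 }
  have hKc := finrank_orthogonal_range
    (LinearMap.pi fun i : τ ⊕ η => Sum.elim
      (fun i => (LinearMap.proj i ∘ₗ D.toLinearMap) ∘ₗ LinearMap.inl ℂ _ _)
      (fun i => (LinearMap.proj i ∘ₗ J.toLinearMap) ∘ₗ LinearMap.inl ℂ _ _) i)
    (by
      rw [← LinearMap.ker_eq_bot, LinearMap.ker_eq_bot']
      intro z hz
      refine hinj z ?_ ?_
      · ext i; exact congrFun hz (.inr i)
      · ext i; exact congrFun hz (.inl i)) K (fun u => by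
      refine forall_congr' fun z => ?_
      simp only [dotProduct, Fintype.sum_sum_type]
      rfl)
  rw [Fintype.card_sum] at hKc
  have key : ∀ Ψ : H × (τ → ℂ), Ψ ∈ S ↔ ∃ y : η → ℂ, ∀ x,
      pH x.2 Ψ.1 + star (D x) ⬝ᵥ Ψ.2 + star (J x) ⬝ᵥ y = 0 := by
    intro Ψ
    rw [hS]
    refine ⟨fun h => ?_, fun ⟨y, hy⟩ x hx => by simpa [hx] using hy x⟩
    obtain ⟨r, hr⟩ := J.toLinearMap.exists_rightInverse_of_surjective
      (LinearMap.range_eq_top.2 hJ)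
    have hr' : ∀ y, J (r y) = y := fun y => LinearMap.congr_fun hr y
    set φ : ((ζ → ℂ) × H) → ℂ := fun x => pH x.2 Ψ.1 + star (D x) ⬝ᵥ Ψ.2
    have φadd : ∀ x x', φ (x + x') = φ x + φ x' := fun x x' => by
      simp only [φ, Prod.snd_add, map_add, LinearMap.add_apply, star_add, add_dotProduct]
      ring
    have φsmul : ∀ (c : ℂ) x, φ (c • x) = star c * φ x := fun c x => by
      have e1 : D (c • x) = c • D x := map_smul D c x
      have e2 : pH (c • x).2 Ψ.1 = star c * pH x.2 Ψ.1 := by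
        rw [Prod.smul_snd, LinearMap.map_smulₛₗ]
        rfl
      simp only [φ, e1, e2, star_smul, smul_dotProduct, smul_eq_mul]
      ring
    classical
    -- The functional φ vanishes on ker J, hence factors through J; the multiplier is minus its
    -- values on lifts of the standard basis.
    refine ⟨fun i => -φ (r (Pi.single i 1)), fun x => ?_⟩
    have h1 : φ (x - r (J x)) = 0 := h _ (by rw [map_sub, hr', sub_self])
    have h2 : φ (r (J x)) = ∑ i, star (J x i) * φ (r (Pi.single i 1)) := by
      have hsum : ∀ (t : Finset η), φ (∑ i ∈ t, J x i • r (Pi.single i 1))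
          = ∑ i ∈ t, star (J x i) * φ (r (Pi.single i 1)) := by
        intro t
        induction t using Finset.induction_on with
        | empty =>
          rw [Finset.sum_empty, Finset.sum_empty]
          have := φsmul 0 0
          simpa using this
        | insert i t hi ih => rw [Finset.sum_insert hi, Finset.sum_insert hi, φadd, φsmul, ih]
      rw [← hsum]
      conv_lhs => rw [pi_eq_sum_univ' (J x), map_sum]
      simp only [map_smul]
    have h3 : φ x = φ (r (J x)) := by
      have := φadd (x - r (J x)) (r (J x))
      rw [sub_add_cancel, h1, zero_add] at this
      exact this
    change φ x + _ = 0
    rw [h3, h2]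
    simp [dotProduct]
  have hchi : ∀ u : τ ⊕ η → ℂ, ∃ χ, ∀ g, pH g χ + star (D (0, g)) ⬝ᵥ (fun i => u (.inl i))
      + star (J (0, g)) ⬝ᵥ (fun i => u (.inr i)) = 0 := by
    intro u
    obtain ⟨χ, hχ⟩ := hriesz (-((∑ i, star (u (.inl i)) •
        (ContinuousLinearMap.proj (R := ℂ) (φ := fun _ : τ => ℂ) i ∘L D ∘L .inr ℂ _ _))
      + ∑ i, star (u (.inr i)) •
        (ContinuousLinearMap.proj (R := ℂ) (φ := fun _ : η => ℂ) i ∘L J ∘L .inr ℂ _ _)))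
    refine ⟨χ, fun g => ?_⟩
    rw [hχ]
    simp [dotProduct, mul_comm]
  choose χ hχ using hchi
  have huniq : ∀ u c, (∀ g, pH g c + star (D (0, g)) ⬝ᵥ (fun i => u (.inl i))
      + star (J (0, g)) ⬝ᵥ (fun i => u (.inr i)) = 0) → c = χ u := fun u c hc => by
    rw [← sub_eq_zero]
    refine hnd _ fun g => ?_
    rw [map_sub]
    linear_combination hc g - hχ u g
  let Φ : (τ ⊕ η → ℂ) →ₗ[ℂ] H × (τ → ℂ) :=
    { toFun := fun u => (χ u, fun i => u (.inl i))
      map_add' := fun u v => by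
        refine Prod.ext (huniq _ _ fun g => ?_).symm rfl
        change pH g (χ u + χ v) + _ ⬝ᵥ ((fun i => u (.inl i)) + fun i => v (.inl i))
          + _ ⬝ᵥ ((fun i => u (.inr i)) + fun i => v (.inr i)) = 0
        simp only [map_add, dotProduct_add]
        linear_combination hχ u g + hχ v g
      map_smul' := fun c u => by
        refine Prod.ext (huniq _ _ fun g => ?_).symm rfl
        change pH g (c • χ u) + _ ⬝ᵥ (c • fun i => u (.inl i))
          + _ ⬝ᵥ (c • fun i => u (.inr i)) = 0
        simp only [map_smul, dotProduct_smul, smul_eq_mul]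
        linear_combination c * hχ u g }
  have hsplit : ∀ (z : ζ → ℂ) (g : H), ((z, g) : (ζ → ℂ) × H) = (z, 0) + (0, g) := by simp
  have hrange : S = K.map Φ := by
    ext Ψ
    rw [key]
    constructor
    · rintro ⟨y, hy⟩
      refine ⟨Sum.elim Ψ.2 y, fun z => ?_, ?_⟩
      · have := hy (z, 0)
        simp only [map_zero, LinearMap.zero_apply, zero_add] at this
        exact this
      · refine Prod.ext (huniq _ _ fun g => ?_).symm rfl
        exact hy (0, g)
    · rintro ⟨u, hu, rfl⟩
      refine ⟨fun i => u (.inr i), fun x => ?_⟩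
      obtain ⟨z, g⟩ := x
      have e1 := hu z
      have e2 := hχ u g
      rw [hsplit, map_add, map_add, star_add, star_add, add_dotProduct, add_dotProduct]
      simp only [Prod.snd_add, zero_add]
      change pH g (χ u) + (_ + _ ⬝ᵥ (fun i => u (.inl i))) + _ = 0
      linear_combination e1 + e2
  -- If χ and v vanish, the multiplier is orthogonal to the range of J, which is everything.
  have hΦ : Function.Injective (Φ ∘ₗ K.subtype) := by
    rw [← LinearMap.ker_eq_bot, LinearMap.ker_eq_bot']
    rintro ⟨u, hu⟩ h
    have h1 : χ u = 0 := congrArg Prod.fst h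
    have h2 : (fun i => u (.inl i)) = (0 : τ → ℂ) := congrArg Prod.snd h
    have h3 : ∀ x, star (J x) ⬝ᵥ (fun i => u (.inr i)) = 0 := by
      rintro ⟨z, g⟩
      have e1 := hu z
      have e2 := hχ u g
      rw [h2, dotProduct_zero] at e1 e2
      rw [h1, map_zero] at e2
      rw [hsplit, map_add, star_add, add_dotProduct]
      linear_combination e1 + e2
    have h4 : (fun i => u (.inr i)) = (0 : η → ℂ) := by
      obtain ⟨x, hx⟩ := hJ fun i => u (.inr i)
      have := h3 x
      rw [hx] at this
      open ComplexOrder in exact dotProduct_star_self_eq_zero.1 this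
    refine Subtype.ext (funext fun i => ?_)
    rcases i with i | i
    · exact congrFun h2 i
    · exact congrFun h4 i
  have hS' : S = LinearMap.range (Φ ∘ₗ K.subtype) := by
    rw [hrange, LinearMap.range_comp, Submodule.range_subtype]
  rw [hS']
  refine ⟨inferInstance, ?_⟩
  rw [LinearMap.finrank_range_of_inj hΦ]
  exact hKc

/-- The annihilator, with respect to a perfect pairing, of the values of `D` on the kernel of the
surjection `J`. -/
theorem finrank_annihilator {τ Z N F : Type*} [Fintype τ]
    [NormedAddCommGroup Z] [NormedSpace ℂ Z] [FiniteDimensional ℂ Z]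
    [NormedAddCommGroup N] [NormedSpace ℂ N] [FiniteDimensional ℂ N]
    [NormedAddCommGroup F] [NormedSpace ℂ F] (eF : F ≃L[ℂ] (τ → ℂ))
    (pH : H →ₗ⋆[ℂ] H →ₗ[ℂ] ℂ) (hnd : ∀ χ, (∀ g, pH g χ = 0) → χ = 0)
    (hriesz : ∀ l : H →L[ℂ] ℂ, ∃ χ, ∀ g, pH g χ = star (l g))
    (D : (Z × H) →L[ℂ] F) (J : (Z × H) →L[ℂ] N)
    (hJ : Function.Surjective J) (hinj : ∀ z, J (z, 0) = 0 → D (z, 0) = 0 → z = 0)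
    (S : Submodule ℂ (H × F))
    (hS : ∀ Ψ, Ψ ∈ S ↔ ∀ x, J x = 0 → pH x.2 Ψ.1 + star (eF (D x)) ⬝ᵥ eF Ψ.2 = 0) :
    Module.Finite ℂ S ∧ Module.finrank ℂ S + Module.finrank ℂ Z
      = Fintype.card τ + Module.finrank ℂ N := by
  let eZ : (Fin (Module.finrank ℂ Z) → ℂ) ≃L[ℂ] Z := ContinuousLinearEquiv.ofFinrankEq (by simp)
  let eN : N ≃L[ℂ] (Fin (Module.finrank ℂ N) → ℂ) := ContinuousLinearEquiv.ofFinrankEq (by simp)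
  let e : ((Fin (Module.finrank ℂ Z) → ℂ) × H) ≃L[ℂ] Z × H :=
    eZ.prodCongr (ContinuousLinearEquiv.refl ℂ H)
  let eT : (H × F) ≃ₗ[ℂ] (H × (τ → ℂ)) := (LinearEquiv.refl ℂ H).prodCongr eF.toLinearEquiv
  have e0 : ∀ z, e (z, 0) = (eZ z, 0) := fun z => rfl
  let D' : ((Fin (Module.finrank ℂ Z) → ℂ) × H) →L[ℂ] (τ → ℂ) :=
    eF.toContinuousLinearMap ∘L D ∘L e.toContinuousLinearMap
  let J' : ((Fin (Module.finrank ℂ Z) → ℂ) × H) →L[ℂ] (Fin (Module.finrank ℂ N) → ℂ) :=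
    eN.toContinuousLinearMap ∘L J ∘L e.toContinuousLinearMap
  have key := finrank_annihilator_aux pH hnd hriesz D' J'
    (eN.surjective.comp (hJ.comp e.surjective))
    (fun z h1 h2 => by
      have h1' : eN (J (eZ z, 0)) = 0 := h1
      have h2' : eF (D (eZ z, 0)) = 0 := h2
      have := hinj (eZ z) (by simpa using h1') (by simpa using h2')
      simpa using this)
    (S.map eT.toLinearMap) (fun Ψ => by
      constructor
      · rintro ⟨Ψ, hΨ, rfl⟩ x hx
        have hx' : eN (J (e x)) = 0 := hx
        exact (hS Ψ).1 hΨ (e x) (by simpa using hx')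
      · intro h
        refine ⟨eT.symm Ψ, (hS _).2 fun x hx => ?_, eT.apply_symm_apply Ψ⟩
        have h1 := h (e.symm x) (by
          change eN (J (e (e.symm x))) = 0
          rw [e.apply_symm_apply, hx, map_zero])
        have h2 : pH (e (e.symm x)).2 Ψ.1 + star (eF (D (e (e.symm x)))) ⬝ᵥ Ψ.2 = 0 := h1
        rw [e.apply_symm_apply] at h2
        change pH x.2 Ψ.1 + star (eF (D x)) ⬝ᵥ eF (eF.symm Ψ.2) = 0
        rw [eF.apply_symm_apply]
        exact h2)
  have hequiv := eT.submoduleMap S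
  obtain ⟨k1, k2⟩ := key
  refine ⟨Module.Finite.equiv hequiv.symm, ?_⟩
  rw [hequiv.finrank_eq]
  simpa using k2

end Index

end

section

/-! ### The `L²` pairing -/

section Pairing

variable {ι : Type*} [Fintype ι] {a b : ℝ}

theorem integrable_star_dotProduct {f g : ℝ → ι → ℂ} {μ : Measure ℝ} (hf : MemLp f 2 μ)
    (hg : MemLp g 2 μ) : Integrable (fun s => star (f s) ⬝ᵥ g s) μ := by
  refine integrable_finsetSum _ fun i _ => ?_
  have h1 : MemLp (fun s => star (f s i)) 2 μ := (memLp_pi_iff.1 hf i).star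
  exact h1.integrable_mul (memLp_pi_iff.1 hg i)

/-- The `L²` pairing. -/
def pairL (ι : Type*) [Fintype ι] (a b : ℝ) : LTwo ι a b →ₗ⋆[ℂ] LTwo ι a b →ₗ[ℂ] ℂ :=
  LinearMap.mk₂'ₛₗ (starRingEnd ℂ) (RingHom.id ℂ)
    (fun g χ => ∫ s in Ioc a b, star (g s) ⬝ᵥ χ s)
    (fun g g' χ => by
      rw [← integral_add (integrable_star_dotProduct (Lp.memLp g) (Lp.memLp χ))
        (integrable_star_dotProduct (Lp.memLp g') (Lp.memLp χ))]
      refine integral_congr_ae ?_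
      filter_upwards [Lp.coeFn_add g g'] with s hs
      rw [hs, Pi.add_apply, star_add, add_dotProduct])
    (fun c g χ => by
      rw [smul_eq_mul, ← integral_const_mul]
      refine integral_congr_ae ?_
      filter_upwards [Lp.coeFn_smul c g] with s hs
      rw [hs, Pi.smul_apply, star_smul, smul_dotProduct, smul_eq_mul]
      rfl)
    (fun g χ χ' => by
      rw [← integral_add (integrable_star_dotProduct (Lp.memLp g) (Lp.memLp χ))
        (integrable_star_dotProduct (Lp.memLp g) (Lp.memLp χ'))]
      refine integral_congr_ae ?_
      filter_upwards [Lp.coeFn_add χ χ'] with s hs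
      rw [hs, Pi.add_apply, dotProduct_add])
    (fun c g χ => by
      rw [smul_eq_mul, ← integral_const_mul]
      refine integral_congr_ae ?_
      filter_upwards [Lp.coeFn_smul c χ] with s hs
      rw [hs, Pi.smul_apply, dotProduct_smul, smul_eq_mul]
      rfl)

theorem pairL_apply (g χ : LTwo ι a b) : pairL ι a b g χ = ∫ s in Ioc a b, star (g s) ⬝ᵥ χ s :=
  rfl

theorem star_dotProduct_self (v : ι → ℂ) : star v ⬝ᵥ v = ((∑ i, ‖v i‖ ^ 2 : ℝ) : ℂ) := by
  simp only [dotProduct, Pi.star_apply, RCLike.star_def, Complex.conj_mul']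
  push_cast
  rfl

theorem eq_zero_of_pairL {χ : LTwo ι a b} (h : pairL ι a b χ χ = 0) : χ = 0 := by
  rw [pairL_apply] at h
  simp only [star_dotProduct_self] at h
  rw [integral_complex_ofReal, Complex.ofReal_eq_zero, integral_eq_zero_iff_of_nonneg] at h
  · rw [Lp.eq_zero_iff_ae_eq_zero]
    filter_upwards [h] with s hs
    ext i
    have := (Finset.sum_eq_zero_iff_of_nonneg fun i _ => sq_nonneg _).1 hs i (Finset.mem_univ i)
    simpa using this
  · intro s
    exact Finset.sum_nonneg fun i _ => sq_nonneg _
  · have := (integrable_star_dotProduct (Lp.memLp χ) (Lp.memLp χ)).re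
    simpa only [star_dotProduct_self, RCLike.re_to_complex, Complex.ofReal_re] using this

/-- The fibre `ι → ℂ` carries the supremum norm, so `LTwo` is not a Hilbert space for its own norm.
Transport the functional to L² functions with values in `EuclideanSpace ℂ ι` and use the Riesz
theorem there. -/
theorem pairL_riesz (l : LTwo ι a b →L[ℂ] ℂ) : ∃ χ, ∀ g, pairL ι a b g χ = star (l g) := by
  let μ := volume.restrict (Ioc a b)
  let e : EuclideanSpace ℂ ι ≃L[ℂ] (ι → ℂ) := EuclideanSpace.equiv ι ℂ
  let T : Lp (EuclideanSpace ℂ ι) 2 μ →L[ℂ] LTwo ι a b := e.toContinuousLinearMap.compLpL 2 μ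
  let T' : LTwo ι a b →L[ℂ] Lp (EuclideanSpace ℂ ι) 2 μ := e.symm.toContinuousLinearMap.compLpL 2 μ
  have hT : ∀ v, ∀ᵐ s ∂μ, T v s = e (v s) := fun v =>
    e.toContinuousLinearMap.coeFn_compLpL v
  have hT' : ∀ g, ∀ᵐ s ∂μ, T' g s = e.symm (g s) := fun g =>
    e.symm.toContinuousLinearMap.coeFn_compLpL g
  have hTT : ∀ g, T (T' g) = g := fun g => by
    refine Lp.ext ?_
    filter_upwards [hT (T' g), hT' g] with s h1 h2
    rw [h1, h2, e.apply_symm_apply]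
  let u := (InnerProductSpace.toDual ℂ _).symm (l ∘L T)
  have hu : ∀ v, inner ℂ u v = l (T v) := fun v => by
    rw [InnerProductSpace.toDual_symm_apply]
    rfl
  refine ⟨T u, fun g => ?_⟩
  rw [← hTT g, ← hu, hTT, pairL_apply, L2.inner_def, RCLike.star_def, ← integral_conj]
  refine integral_congr_ae ?_
  filter_upwards [hT u, hT' g] with s h1 h2
  rw [h1, h2, inner_conj_symm, EuclideanSpace.inner_eq_star_dotProduct, dotProduct_comm]
  rfl

end Pairing

/-! ### Finite sums of pairings -/

section PairingPi

variable {J : Type*} [Fintype J] {H : J → Type*} [∀ i, NormedAddCommGroup (H i)]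
  [∀ i, NormedSpace ℂ (H i)]

/-- The sum of a family of pairings. -/
def pairPi (P : ∀ i, H i →ₗ⋆[ℂ] H i →ₗ[ℂ] ℂ) : (∀ i, H i) →ₗ⋆[ℂ] (∀ i, H i) →ₗ[ℂ] ℂ :=
  LinearMap.mk₂'ₛₗ (starRingEnd ℂ) (RingHom.id ℂ) (fun g χ => ∑ i, P i (g i) (χ i))
    (fun g g' χ => by simp [Finset.sum_add_distrib])
    (fun c g χ => by simp [Finset.mul_sum])
    (fun g χ χ' => by simp [Finset.sum_add_distrib])
    (fun c g χ => by simp [Finset.mul_sum])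

theorem pairPi_apply (P : ∀ i, H i →ₗ⋆[ℂ] H i →ₗ[ℂ] ℂ) (g χ : ∀ i, H i) :
    pairPi P g χ = ∑ i, P i (g i) (χ i) := rfl

theorem pairPi_nondegenerate {P : ∀ i, H i →ₗ⋆[ℂ] H i →ₗ[ℂ] ℂ}
    (h : ∀ i χ, (∀ g, P i g χ = 0) → χ = 0) (χ : ∀ i, H i) (hχ : ∀ g, pairPi P g χ = 0) :
    χ = 0 := by
  classical
  ext1 i
  refine h i _ fun g => ?_
  have := hχ (Pi.single i g)
  rw [pairPi_apply, Finset.sum_eq_single i] at this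
  · simpa using this
  · intro j _ hj
    simp [Pi.single_eq_of_ne hj]
  · simp

theorem pairPi_riesz {P : ∀ i, H i →ₗ⋆[ℂ] H i →ₗ[ℂ] ℂ}
    (h : ∀ i, ∀ l : H i →L[ℂ] ℂ, ∃ χ, ∀ g, P i g χ = star (l g)) (l : (∀ i, H i) →L[ℂ] ℂ) :
    ∃ χ, ∀ g, pairPi P g χ = star (l g) := by
  classical
  choose χ hχ using fun i => h i (l ∘L ContinuousLinearMap.single ℂ H i)
  refine ⟨χ, fun g => ?_⟩
  rw [pairPi_apply, ← l.sum_comp_single, star_sum]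
  exact Finset.sum_congr rfl fun i _ => hχ i (g i)

end PairingPi

end

section

/-! ### The index of the twisted bow Dirac operator -/

variable {k : ℕ} [NeZero k] {B : Bow k} {R : BowRep B}

theorem card_lam0 (R : BowRep B) : Fintype.card R.Lam0 =
    ∑ σ, ∑ a : Fin (R.n σ), if R.rank σ a.castSucc = R.rank σ a.succ then 1 else 0 := by
  have : Fintype.card R.Lam0 = Fintype.card
      {a : Σ σ, Fin (R.n σ) // R.rank a.1 a.2.castSucc = R.rank a.1 a.2.succ} :=
    Fintype.card_congr (Equiv.refl _)
  rw [this, Fintype.card_subtype, Finset.card_filter, Fintype.sum_sigma]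

theorem finrank_Wlo_succ (R : BowRep B) (σ : Fin k) (a : Fin (R.n σ)) :
    Module.finrank ℂ (R.Wlo σ a.succ) = 2 * min (R.rank σ a.castSucc) (R.rank σ a.succ) := by
  rw [BowRep.Wlo_succ]
  rcases le_total (R.rank σ a.castSucc) (R.rank σ a.succ) with h | h
  · rw [LinearMap.finrank_range_of_inj]
    · simp [h]
    · refine Function.LeftInverse.injective (g := ((1 : Matrix (Fin 2) (Fin 2) ℂ) ⊗ₖ
        (R.kap σ a).conjTranspose).mulVec) fun v => ?_
      rw [Matrix.mulVecLin_apply, Matrix.mulVec_mulVec, ← Matrix.mul_kronecker_mul,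
        R.kap_up σ a h, one_mul, Matrix.one_kronecker_one, Matrix.one_mulVec]
  · rw [range_kronecker_eq_top (R.kap_down σ a h), finrank_top]
    simp [h]

/-- The terms of the edges cancel after reindexing rankR by σ ↦ σ + 1, leaving one identity for each
λ-point with left rank r and right rank r′: r + r′ + 2 min(r, r′) + [r = r′] equals the two adjacent
parameter counts plus 1. For r = r′ the unit comes from the component Q_λ, for r ≠ r′ from the
parameter lost at the Nahm pole. -/
theorem index_count (R : BowRep B) :
    (Fintype.card R.Lam0 + ∑ σ, R.rankR σ + ∑ σ, R.rankL σ)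
      + ((∑ σ, ∑ α, 4 * R.rank σ α)
        + ∑ σ, ∑ a : Fin (R.n σ), 2 * min (R.rank σ a.castSucc) (R.rank σ a.succ))
      = R.numLam + ∑ σ, ∑ α, (R.mlo σ α + (2 * R.rank σ α + R.mhi σ α)) := by
  have e1 : ∑ σ, R.rankR σ = ∑ σ, R.rank σ 0 :=
    Equiv.sum_comp (Equiv.addRight (1 : Fin k)) fun σ => R.rank σ 0
  rw [card_lam0, e1, BowRep.numLam]
  simp only [← Finset.sum_add_distrib]
  refine Finset.sum_congr rfl fun σ _ => ?_
  have h1 : ∑ α, R.mlo σ α = 2 * R.rank σ 0 + ∑ a : Fin (R.n σ), R.mlo σ a.succ := by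
    rw [Fin.sum_univ_succ, BowRep.mlo_zero]
  have h2 : ∑ α, R.mhi σ α = ∑ a : Fin (R.n σ), R.mhi σ a.castSucc + 2 * R.rank σ (Fin.last _) := by
    rw [Fin.sum_univ_castSucc, BowRep.mhi_last]
  have h3 : ∑ α, R.rank σ α = R.rank σ 0 + ∑ a : Fin (R.n σ), R.rank σ a.succ :=
    Fin.sum_univ_succ _
  have h4 : ∑ α, R.rank σ α = ∑ a : Fin (R.n σ), R.rank σ a.castSucc + R.rank σ (Fin.last _) :=
    Fin.sum_univ_castSucc _
  have h5 : (∑ a : Fin (R.n σ), R.rank σ a.succ) + (∑ a : Fin (R.n σ), R.rank σ a.castSucc)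
      + (∑ a : Fin (R.n σ), 2 * min (R.rank σ a.castSucc) (R.rank σ a.succ))
      + (∑ a : Fin (R.n σ), if R.rank σ a.castSucc = R.rank σ a.succ then 1 else 0)
      = (∑ a : Fin (R.n σ), R.mlo σ a.succ) + (∑ a : Fin (R.n σ), R.mhi σ a.castSucc)
        + R.n σ := by
    have : ∑ _a : Fin (R.n σ), 1 = R.n σ := by simp
    refine Eq.trans ?_ (congrArg ((∑ a : Fin (R.n σ), R.mlo σ a.succ)
      + (∑ a : Fin (R.n σ), R.mhi σ a.castSucc) + ·) this)
    simp only [← Finset.sum_add_distrib]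
    refine Finset.sum_congr rfl fun a _ => ?_
    rw [BowRep.mlo_succ, BowRep.mhi_castSucc]
    split_ifs <;> lia
  simp only [Finset.sum_add_distrib, ← Finset.mul_sum] at h5 ⊢
  rw [BowRep.rankL]
  lia

/-! ### The kernel of the adjoint as an annihilator -/

section KerDirac

/-- For end values in the allowed subspaces the two matching conditions at a λ-point are equivalent,
so a single jump is imposed there, with values in `Wlo`. -/
theorem kronecker_mulVec_of_eq {σ : Fin k} {a : Fin (R.n σ)}
    {v : Fin 2 × Fin (R.rank σ a.castSucc) → ℂ} {w : Fin 2 × Fin (R.rank σ a.succ) → ℂ}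
    (hv : v ∈ R.Whi σ a.castSucc)
    (h : ((1 : Matrix (Fin 2) (Fin 2) ℂ) ⊗ₖ R.kap σ a).mulVec v = w) :
    v = ((1 : Matrix (Fin 2) (Fin 2) ℂ) ⊗ₖ (R.kap σ a).conjTranspose).mulVec w := by
  rw [← h, Matrix.mulVec_mulVec, ← Matrix.mul_kronecker_mul, one_mul]
  rcases le_total (R.rank σ a.castSucc) (R.rank σ a.succ) with hr | hr
  · rw [R.kap_up σ a hr, Matrix.one_kronecker_one, Matrix.one_mulVec]
  · rw [BowRep.Whi_castSucc] at hv
    obtain ⟨u, rfl⟩ := hv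
    rw [Matrix.mulVecLin_apply, Matrix.mulVec_mulVec, ← Matrix.mul_kronecker_mul, one_mul,
      Matrix.mul_assoc, R.kap_down σ a hr, Matrix.mul_one]

namespace TermSection

variable (f : TermSection R)

theorem mem_Wlo (σ : Fin k) (α : Fin (R.n σ + 1)) : f.f σ α (R.lo σ α) ∈ R.Wlo σ α := by
  refine Fin.cases ?_ (fun a => ?_) α
  · exact Submodule.mem_top
  · exact ⟨_, (f.match_right σ a).symm⟩

theorem mem_Whi (σ : Fin k) (α : Fin (R.n σ + 1)) : f.f σ α (R.hi σ α) ∈ R.Whi σ α := by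
  refine Fin.lastCases ?_ (fun a => ?_) α
  · rw [BowRep.Whi_last]
    exact Submodule.mem_top
  · rw [BowRep.Whi_castSucc, BowRep.hi_castSucc]
    exact ⟨_, (f.match_left σ a).symm⟩

end TermSection

variable (R) in
/-- The values of a section at the ends of all subintervals. -/
abbrev Ends : Type :=
  ∀ σ (α : Fin (R.n σ + 1)), (Fin 2 × Fin (R.rank σ α) → ℂ) × (Fin 2 × Fin (R.rank σ α) → ℂ)

variable (R) in
/-- The finite dimensional part of the target of the Dirac operator. -/
abbrev FinTarget : Type :=
  (R.Lam0 → ℂ) × (∀ σ, Fin (R.rankR σ) → ℂ) × (∀ σ, Fin (R.rankL σ) → ℂ)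

variable (R) in
/-- The index set of a basis of the finite dimensional part of the target. -/
abbrev FinIndex : Type := R.Lam0 ⊕ (Σ σ, Fin (R.rankR σ)) ⊕ (Σ σ, Fin (R.rankL σ))

variable (R) in
/-- Coordinates on the finite dimensional part of the target. -/
def finEquiv : FinTarget R ≃L[ℂ] (FinIndex R → ℂ) :=
  LinearEquiv.toContinuousLinearEquiv
    { toFun := fun u => Sum.elim u.1 (Sum.elim (fun x => u.2.1 x.1 x.2) fun x => u.2.2 x.1 x.2)
      map_add' := fun u v => by
        ext i
        rcases i with i | i | i <;> rfl
      map_smul' := fun c u => by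
        ext i
        rcases i with i | i | i <;> rfl
      invFun := fun v => (fun l => v (.inl l), fun σ i => v (.inr (.inl ⟨σ, i⟩)),
        fun σ i => v (.inr (.inr ⟨σ, i⟩)))
      left_inv := fun u => rfl
      right_inv := fun v => by
        ext i
        rcases i with i | i | i <;> rfl }

theorem star_finEquiv_dotProduct (u v : FinTarget R) : star (finEquiv R u) ⬝ᵥ finEquiv R v =
    (∑ l, star (u.1 l) * v.1 l) + (∑ σ, star (u.2.1 σ) ⬝ᵥ v.2.1 σ)
      + ∑ σ, star (u.2.2 σ) ⬝ᵥ v.2.2 σ := by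
  simp only [dotProduct, Fintype.sum_sum_type, Fintype.sum_sigma, add_assoc]
  rfl

variable {ν : Fin k → Fin 3 → ℝ} (d : BowData R) (p : LevelSet B ν)

/-- The finite dimensional part of the Dirac operator, in terms of the values at the ends. -/
def finPart : Ends R →ₗ[ℂ] FinTarget R where
  toFun e := (fun l => -(star (d.Q l) ⬝ᵥ (e l.1.1 l.1.2.succ).1),
    fun σ => (d.Bif σ).conjTranspose.mulVec (e σ (Fin.last _)).2
      - fun i => ∑ a, star (p.b σ a) * (e (σ + 1) 0).1 (a, i),
    fun σ => (fun i => ∑ a, star (p.bc σ a) * (e σ (Fin.last _)).2 (a, i))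
      - (chargeConj (d.Bif σ)).conjTranspose.mulVec (e (σ + 1) 0).1)
  map_add' e e' := by
    refine Prod.ext (funext fun l => ?_) (Prod.ext (funext fun σ => ?_) (funext fun σ => ?_))
    · simp only [Pi.add_apply, Prod.fst_add, dotProduct_add]
      ring
    · ext i
      simp only [Pi.add_apply, Pi.sub_apply, Prod.fst_add, Prod.snd_add, Matrix.mulVec_add, mul_add,
        Finset.sum_add_distrib]
      ring
    · ext i
      simp only [Pi.add_apply, Pi.sub_apply, Prod.fst_add, Prod.snd_add, Matrix.mulVec_add, mul_add,
        Finset.sum_add_distrib]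
      ring
  map_smul' c e := by
    refine Prod.ext (funext fun l => ?_) (Prod.ext (funext fun σ => ?_) (funext fun σ => ?_))
    · simp only [Pi.smul_apply, Prod.smul_fst, dotProduct_smul, smul_eq_mul, RingHom.id_apply]
      ring
    · ext i
      simp only [Pi.smul_apply, Pi.sub_apply, Prod.smul_fst, Prod.smul_snd, Matrix.mulVec_smul,
        smul_eq_mul, RingHom.id_apply, mul_sub, Finset.mul_sum]
      simp only [mul_left_comm]
    · ext i
      simp only [Pi.smul_apply, Pi.sub_apply, Prod.smul_fst, Prod.smul_snd, Matrix.mulVec_smul,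
        smul_eq_mul, RingHom.id_apply, mul_sub, Finset.mul_sum]
      simp only [mul_left_comm]

theorem finPart_section (f : TermSection R) :
    finPart d p (fun σ α => (f.f σ α (R.lo σ α), f.f σ α (R.hi σ α))) =
      (diracLam d f, diracPlus d p f, diracMinus d p f) := by
  simp only [finPart, LinearMap.coe_mk, AddHom.coe_mk, BowRep.hi_last, BowRep.lo_zero,
    BowRep.lo_succ]
  rfl

/-- A solution of the boundary problem on all subintervals whose end values match. -/
theorem exists_section
    {f df : ∀ σ (α : Fin (R.n σ + 1)), ℝ → (Fin 2 × Fin (R.rank σ α) → ℂ)}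
    (h1 : ∀ σ α, IsH1 (R.lo σ α) (R.hi σ α) (f σ α) (df σ α))
    (hhi : ∀ σ α, f σ α (R.hi σ α) ∈ R.Whi σ α)
    (hj : ∀ σ a, ((1 : Matrix (Fin 2) (Fin 2) ℂ) ⊗ₖ R.kap σ a).mulVec
      (f σ a.castSucc (R.hi σ a.castSucc)) = f σ a.succ (R.lo σ a.succ)) :
    ∃ F : TermSection R, F.f = f ∧ F.df = df :=
  ⟨{ f := f
     df := df
     h1 := h1
     match_right := fun σ a => by
       have := hj σ a
       rw [BowRep.hi_castSucc] at this
       exact this.symm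
     match_left := fun σ a => by
       have := kronecker_mulVec_of_eq (hhi σ a.castSucc) (hj σ a)
       rw [BowRep.hi_castSucc] at this
       exact this }, rfl, rfl⟩

variable (R) in
/-- The parameters of the boundary problems on all subintervals. -/
abbrev Params : Type :=
  ∀ σ (α : Fin (R.n σ + 1)), Param (R.mlo σ α) (2 * R.rank σ α) (R.mhi σ α)

variable (R) in
/-- The square integrable sections. -/
abbrev BulkL2 : Type :=
  ∀ σ (α : Fin (R.n σ + 1)), LTwo (Fin 2 × Fin (R.rank σ α)) (R.lo σ α) (R.hi σ α)

variable (R) in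
/-- The jumps at the cuts and at the `λ`-points. -/
abbrev Jumps : Type := Ends R × (∀ σ (a : Fin (R.n σ)), R.Wlo σ a.succ)

variable (R) in
/-- The `L²` pairing of sections. -/
def bulkPair : BulkL2 R →ₗ⋆[ℂ] BulkL2 R →ₗ[ℂ] ℂ :=
  pairPi fun σ => pairPi fun α => pairL (Fin 2 × Fin (R.rank σ α)) (R.lo σ α) (R.hi σ α)

theorem bulkPair_apply (g χ : BulkL2 R) : bulkPair R g χ =
    ∑ σ, ∑ α, ∫ s in Ioc (R.lo σ α) (R.hi σ α), star (g σ α s) ⬝ᵥ χ σ α s := rfl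

theorem finrank_params : Module.finrank ℂ (Params R) =
    ∑ σ, ∑ α, (R.mlo σ α + (2 * R.rank σ α + R.mhi σ α)) := by
  simp only [Params, Param, Module.finrank_pi_fintype, Module.finrank_prod, Module.finrank_self,
    Finset.sum_const, Finset.card_univ, smul_eq_mul, mul_one, Fintype.card_fin]

theorem finrank_jumps : Module.finrank ℂ (Jumps R) = (∑ σ, ∑ α, 4 * R.rank σ α)
    + ∑ σ, ∑ a : Fin (R.n σ), 2 * min (R.rank σ a.castSucc) (R.rank σ a.succ) := by
  simp only [Jumps, Ends, Module.finrank_pi_fintype, Module.finrank_prod, Module.finrank_self,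
    Finset.sum_const, Finset.card_univ, smul_eq_mul, mul_one, Fintype.card_fin, Fintype.card_prod,
    finrank_Wlo_succ]
  congr 1
  refine Finset.sum_congr rfl fun σ _ => Finset.sum_congr rfl fun α _ => ?_
  ring

theorem card_finIndex : Fintype.card (FinIndex R) =
    Fintype.card R.Lam0 + ∑ σ, R.rankR σ + ∑ σ, R.rankL σ := by
  simp only [FinIndex, Fintype.card_sum, Fintype.card_sigma, Fintype.card_fin, add_assoc]

/-- Evaluation of a family with two indices. -/
def projTwo {I : Type*} {K : I → Type*} (H : ∀ i, K i → Type*)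
    [∀ i j, NormedAddCommGroup (H i j)] [∀ i j, NormedSpace ℂ (H i j)] (i : I) (j : K i) :
    (∀ i j, H i j) →L[ℂ] H i j where
  toFun g := g i j
  map_add' _ _ := rfl
  map_smul' _ _ := rfl
  cont := (continuous_apply j).comp (continuous_apply i)

/-- `finrank_annihilator` is applied to x = (parameters, g), with J collecting the jumps at the cuts
and at the λ-points and D the finite dimensional components of the Dirac operator as functions of
the end values. The constraint J x = 0 says that the local solutions fit together to a section f of
the domain, and (g, D x) is then the image of f under the Dirac operator. -/
theorem finrank_kerDiracAdj (hinj : ∀ f : TermSection R,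
      (∀ σ α, ∀ᵐ s ∂volume.restrict (Ioc (R.lo σ α) (R.hi σ α)), diracBulk d p f σ α s = 0) →
      diracLam d f = 0 → diracPlus d p f = 0 → diracMinus d p f = 0 →
      ∀ σ α, ∀ s ∈ Icc (R.lo σ α) (R.hi σ α), f.f σ α s = 0) :
    Module.Finite ℂ (kerDiracAdj d p) ∧ Module.finrank ℂ (kerDiracAdj d p) = R.numLam := by
  choose E₀ J₀ hst using fun σ α => exists_strip d p σ α
  let comp : ∀ σ α, (Params R × BulkL2 R) →L[ℂ]
      Param (R.mlo σ α) (2 * R.rank σ α) (R.mhi σ α) ×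
        LTwo (Fin 2 × Fin (R.rank σ α)) (R.lo σ α) (R.hi σ α) := fun σ α =>
    (projTwo (fun σ (α : Fin (R.n σ + 1)) => Param (R.mlo σ α) (2 * R.rank σ α) (R.mhi σ α))
      σ α ∘L ContinuousLinearMap.fst ℂ _ _).prod
    (projTwo (fun σ (α : Fin (R.n σ + 1)) =>
      LTwo (Fin 2 × Fin (R.rank σ α)) (R.lo σ α) (R.hi σ α)) σ α ∘L
      ContinuousLinearMap.snd ℂ _ _)
  have hcomp : ∀ σ α x, comp σ α x = (x.1 σ α, x.2 σ α) := fun _ _ _ => rfl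
  let Ee : (Params R × BulkL2 R) →L[ℂ] Ends R :=
    ContinuousLinearMap.pi fun σ => ContinuousLinearMap.pi fun α => E₀ σ α ∘L comp σ α
  let Je : (Params R × BulkL2 R) →L[ℂ] Ends R :=
    ContinuousLinearMap.pi fun σ => ContinuousLinearMap.pi fun α => J₀ σ α ∘L comp σ α
  have hEe : ∀ x σ α, Ee x σ α = E₀ σ α (x.1 σ α, x.2 σ α) := fun _ _ _ => rfl
  have hJe : ∀ x σ α, Je x σ α = J₀ σ α (x.1 σ α, x.2 σ α) := fun _ _ _ => rfl
  let jm : ∀ σ (a : Fin (R.n σ)), (Params R × BulkL2 R) →L[ℂ] R.Wlo σ a.succ := fun σ a =>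
    ((mulCLM ((1 : Matrix (Fin 2) (Fin 2) ℂ) ⊗ₖ R.kap σ a) ∘L
      ContinuousLinearMap.snd ℂ _ _ ∘L E₀ σ a.castSucc ∘L comp σ a.castSucc) -
      (ContinuousLinearMap.fst ℂ _ _ ∘L E₀ σ a.succ ∘L comp σ a.succ)).codRestrict _ fun x =>
        Submodule.sub_mem _ ⟨_, rfl⟩ ((hst σ a.succ).mem _).1
  have hjm : ∀ σ a x, (jm σ a x : Fin 2 × Fin (R.rank σ a.succ) → ℂ) =
      ((1 : Matrix (Fin 2) (Fin 2) ℂ) ⊗ₖ R.kap σ a).mulVec (Ee x σ a.castSucc).2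
        - (Ee x σ a.succ).1 := fun _ _ _ => rfl
  let D : (Params R × BulkL2 R) →L[ℂ] FinTarget R :=
    LinearMap.toContinuousLinearMap (finPart d p) ∘L Ee
  have hD : ∀ x, D x = finPart d p (Ee x) := fun _ => rfl
  let J : (Params R × BulkL2 R) →L[ℂ] Jumps R :=
    Je.prod (ContinuousLinearMap.pi fun σ => ContinuousLinearMap.pi fun a => jm σ a)
  have hJ0 : ∀ x, J x = 0 ↔ (∀ σ α, J₀ σ α (x.1 σ α, x.2 σ α) = 0) ∧
      ∀ σ a, ((1 : Matrix (Fin 2) (Fin 2) ℂ) ⊗ₖ R.kap σ a).mulVec (Ee x σ a.castSucc).2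
        = (Ee x σ a.succ).1 := by
    intro x
    constructor
    · intro h
      refine ⟨fun σ α => congrFun (congrFun (congrArg Prod.fst h) σ) α, fun σ a => ?_⟩
      have h1 : jm σ a x = 0 := congrFun (congrFun (congrArg Prod.snd h) σ) a
      rw [← sub_eq_zero, ← hjm, h1]
      rfl
    · rintro ⟨h1, h2⟩
      refine Prod.ext (funext fun σ => funext fun α => h1 σ α)
        (funext fun σ => funext fun a => Subtype.ext ?_)
      change (jm σ a x : Fin 2 × Fin (R.rank σ a.succ) → ℂ) = 0
      rw [hjm, h2, sub_self]
  have hsec : ∀ x, J x = 0 → ∃ F : TermSection R,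
      (∀ σ α, ∀ᵐ s ∂volume.restrict (Ioc (R.lo σ α) (R.hi σ α)),
        diracBulk d p F σ α s = x.2 σ α s) ∧
      D x = (diracLam d F, diracPlus d p F, diracMinus d p F) ∧
      ((∀ σ α, ∀ s ∈ Icc (R.lo σ α) (R.hi σ α), F.f σ α s = 0) → x.1 = 0) := by
    intro x hx
    obtain ⟨hx1, hx2⟩ := (hJ0 x).1 hx
    choose f df g1 g2 g3 g4 g5 g6 using fun σ α =>
      (hst σ α).exists_section (x.1 σ α, x.2 σ α) (hx1 σ α)
    have hE : Ee x = fun σ α => (f σ α (R.lo σ α), f σ α (R.hi σ α)) :=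
      funext fun σ => funext fun α => g5 σ α
    obtain ⟨F, rfl, rfl⟩ := exists_section g1 g3 fun σ a => by
      have := hx2 σ a
      rwa [hE] at this
    refine ⟨F, fun σ α => ?_, ?_, fun h => funext fun σ => funext fun α => g6 σ α (h σ α)⟩
    · filter_upwards [g4 σ α] with s hs
      rw [diracBulk_eq, hs]
      abel
    · rw [hD, hE, finPart_section]
  have main := finrank_annihilator (finEquiv R) (bulkPair R)
    (pairPi_nondegenerate fun σ => pairPi_nondegenerate fun α χ h => eq_zero_of_pairL (h χ))
    (pairPi_riesz fun σ => pairPi_riesz fun α => pairL_riesz) D J ?_ ?_ (kerDiracAdj d p) ?_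
  · refine ⟨main.1, ?_⟩
    have h1 := main.2
    rw [finrank_params, finrank_jumps, card_finIndex, index_count] at h1
    lia
  -- Surjectivity of J: prescribe value 0 at every right end and −t at the left end following each
  -- λ-point, together with the jumps y at the cuts.
  · rintro ⟨y, t⟩
    let v : ∀ σ (α : Fin (R.n σ + 1)), Fin 2 × Fin (R.rank σ α) → ℂ := fun σ α =>
      Fin.cases (motive := fun α => Fin 2 × Fin (R.rank σ α) → ℂ) 0
        (fun a => -(t σ a : Fin 2 × Fin (R.rank σ a.succ) → ℂ)) α
    have hv : ∀ σ α, v σ α ∈ R.Wlo σ α := fun σ α =>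
      Fin.cases (motive := fun α => v σ α ∈ R.Wlo σ α) (Submodule.zero_mem _)
        (fun a => Submodule.neg_mem _ (t σ a).2) α
    choose x hx1 hx2 using fun σ α =>
      (hst σ α).surj (v σ α) (hv σ α) 0 (Submodule.zero_mem _) (y σ α)
    refine ⟨(fun σ α => (x σ α).1, fun σ α => (x σ α).2), Prod.ext (funext fun σ =>
      funext fun α => hx2 σ α) (funext fun σ => funext fun a => Subtype.ext ?_)⟩
    refine (hjm σ a _).trans ?_
    rw [hEe, hEe]
    have e1 := hx1 σ a.castSucc
    have e2 := hx1 σ a.succ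
    rw [e1, e2, Matrix.mulVec_zero, zero_sub]
    exact neg_neg _
  -- With g = 0, a zero of J and D is a section in the kernel of the Dirac operator, hence zero, and
  -- so are its parameters.
  · intro z h1 h2
    obtain ⟨F, F1, F2, F3⟩ := hsec (z, 0) h1
    rw [h2] at F2
    refine F3 (hinj F (fun σ α => ?_) (congrArg Prod.fst F2).symm
      (congrArg (fun u => u.2.1) F2).symm (congrArg (fun u => u.2.2) F2).symm)
    filter_upwards [F1 σ α, Lp.coeFn_zero (Fin 2 × Fin (R.rank σ α) → ℂ) 2
      (volume.restrict (Ioc (R.lo σ α) (R.hi σ α)))] with s hs h0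
    rw [hs]
    exact h0
  · intro Ψ
    constructor
    · intro h x hx
      obtain ⟨F, F1, F2, -⟩ := hsec x hx
      have h1 := (h F).2
      rw [F2, star_finEquiv_dotProduct, bulkPair_apply]
      rw [diracPairing] at h1
      rw [← h1]
      have : ∀ σ α, (∫ s in Ioc (R.lo σ α) (R.hi σ α), star (x.2 σ α s) ⬝ᵥ Ψ.1 σ α s) =
          ∫ s in Ioc (R.lo σ α) (R.hi σ α), star (diracBulk d p F σ α s) ⬝ᵥ Ψ.1 σ α s := by
        intro σ α
        refine integral_congr_ae ?_
        filter_upwards [F1 σ α] with s hs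
        rw [hs]
      simp only [this]
      ring
    -- Conversely, every section F of the domain has a square integrable image and arises from some
    -- parameters with vanishing jumps.
    · intro h F
      have hm : ∀ σ α, MemLp (diracBulk d p F σ α) 2
          (volume.restrict (Ioc (R.lo σ α) (R.hi σ α))) := fun σ α => by
        have h1 := (hst σ α).memLp _ _ (F.h1 σ α) (F.mem_Wlo σ α) (F.mem_Whi σ α)
        exact ((F.h1 σ α).1.neg.sub h1).ae_eq (ae_of_all _ fun s => (diracBulk_eq d p F σ α s).symm)
      let g : BulkL2 R := fun σ α => (hm σ α).toLp
      have hg : ∀ σ α, ∀ᵐ s ∂volume.restrict (Ioc (R.lo σ α) (R.hi σ α)),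
          g σ α s = diracBulk d p F σ α s := fun σ α => (hm σ α).coeFn_toLp
      choose z hz1 hz2 using fun σ α => (hst σ α).exists_param _ _ (F.h1 σ α) (F.mem_Wlo σ α)
        (F.mem_Whi σ α) (g σ α) (by
          filter_upwards [hg σ α] with s hs
          rw [hs, diracBulk_eq]
          abel)
      have hE : Ee (z, g) = fun σ α => (F.f σ α (R.lo σ α), F.f σ α (R.hi σ α)) :=
        funext fun σ => funext fun α => hz2 σ α
      have h1 := h (z, g) ((hJ0 _).2 ⟨hz1, fun σ a => by
        rw [hE]
        simp only [BowRep.hi_castSucc, BowRep.lo_succ]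
        exact (F.match_right σ a).symm⟩)
      rw [hD, hE, finPart_section, star_finEquiv_dotProduct, bulkPair_apply] at h1
      refine ⟨fun σ α => integrable_star_dotProduct (hm σ α) (Lp.memLp _), ?_⟩
      have : ∀ σ α, (∫ s in Ioc (R.lo σ α) (R.hi σ α), star (g σ α s) ⬝ᵥ Ψ.1 σ α s) =
          ∫ s in Ioc (R.lo σ α) (R.hi σ α), star (diracBulk d p F σ α s) ⬝ᵥ Ψ.1 σ α s := by
        intro σ α
        refine integral_congr_ae ?_
        filter_upwards [hg σ α] with s hs
        rw [hs]
      simp only [this] at h1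
      rw [diracPairing, ← h1]
      ring

end KerDirac

end

section

/-! ### The Weitzenböck identity -/

section Weitzenboeck

variable {ι κ : Type*} {a b : ℝ}

theorem IsH1.const_mul {f f' : ℝ → ℂ} (h : IsH1 a b f f') (c : ℂ) :
    IsH1 a b (fun s => c * f s) (fun s => c * f' s) := by
  have h0 : IsH1 a b (fun _ : ℝ => c) (fun _ => (0 : ℂ)) :=
    isH1_iff.2 ⟨IsAC.const _, MemLp.zero'⟩
  simpa using h0.mul h

theorem MatH1.smul {U U' : ℝ → Matrix ι κ ℂ} (h : MatH1 a b U U') (c : ℂ) :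
    MatH1 a b (fun s => c • U s) (fun s => c • U' s) := fun i j => (h i j).const_mul c

theorem MatH1.imQuat {D D' : Fin 3 → ℝ → Matrix ι ι ℂ} (h : ∀ j, MatH1 a b (D j) (D' j)) :
    MatH1 a b (fun s => imQuat fun j => D j s) (fun s => imQuat fun j => D' j s) := fun x y => by
  simp only [BowIndex.imQuat, Matrix.sum_apply, Matrix.kroneckerMap_apply]
  exact IsH1.sum _ fun j => (h j x.2 y.2).const_mul _

theorem IsH1.replicateCol [Fintype ι] {f f' : ℝ → ι → ℂ} (h : IsH1 a b f f') :
    MatH1 a b (fun s => Matrix.replicateCol Unit (f s))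
      (fun s => Matrix.replicateCol Unit (f' s)) := fun i _ =>
  isH1_iff.2 ⟨isAC_pi_iff.1 h.isAC i, memLp_pi_iff.1 h.1 i⟩

/-- The integrand of the Weitzenböck identity. -/
def energy [Fintype ι] (D : Fin 3 → Matrix ι ι ℂ) (v : Fin 2 × ι → ℂ) : ℝ :=
  (∑ i, ‖(imQuat D).mulVec v i‖ ^ 2)
    + ∑ j, ∑ i, ‖((1 : Matrix (Fin 2) (Fin 2) ℂ) ⊗ₖ D j).mulVec v i‖ ^ 2

/-- The quadratic form `⟨v, i (∑ eⱼ Dⱼ) v⟩`. -/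
def quadForm [Fintype ι] (D : Fin 3 → Matrix ι ι ℂ) (v : Fin 2 × ι → ℂ) : ℂ :=
  star v ⬝ᵥ (Complex.I • imQuat D).mulVec v

theorem energy_nonneg [Fintype ι] (D : Fin 3 → Matrix ι ι ℂ) (v : Fin 2 × ι → ℂ) :
    0 ≤ energy D v := by
  unfold energy
  positivity

/-- The derivative of Fᴴ(iX)F, where F′ is given by the Dirac equation and iX′ = X² + S + [N, X].
The terms with N cancel, and the multiples of FᴴX²F add up to −FᴴX²F = (XF)ᴴ(XF) since X is
anti-Hermitian. -/
theorem weitzenboeck_algebra {V : Type*} [Fintype V] [DecidableEq V] {X N S : Matrix V V ℂ}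
    {F : Matrix V Unit ℂ} (hX : X.conjTranspose = -X) (hN : N.IsHermitian) {X' : Matrix V V ℂ}
    (hX' : X' = -(Complex.I • (X * X + S + (N * X - X * N)))) {F' : Matrix V Unit ℂ}
    (hF' : F' = -((Complex.I • (N - X)) * F)) :
    (F'.conjTranspose * (Complex.I • X) + F.conjTranspose * (Complex.I • X')) * F
        + F.conjTranspose * (Complex.I • X) * F'
      = (X * F).conjTranspose * (X * F) + F.conjTranspose * S * F := by
  have hI : Complex.I * Complex.I = -1 := Complex.I_mul_I
  have e1 : Complex.I • X' = X * X + S + (N * X - X * N) := by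
    rw [hX', smul_neg, smul_smul, hI, neg_smul, one_smul, neg_neg]
  have e2 : F'.conjTranspose = Complex.I • (F.conjTranspose * (N + X)) := by
    rw [hF', Matrix.conjTranspose_neg, Matrix.conjTranspose_mul, Matrix.conjTranspose_smul,
      Matrix.conjTranspose_sub, hX, hN.eq, Complex.star_def, Complex.conj_I, Matrix.mul_smul,
      neg_smul, neg_neg, sub_neg_eq_add]
  rw [e1, e2, hF', Matrix.conjTranspose_mul, hX]
  simp only [Matrix.smul_mul, Matrix.mul_smul, smul_smul, hI, Matrix.mul_add, Matrix.add_mul,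
    Matrix.mul_sub, Matrix.sub_mul, Matrix.mul_neg, Matrix.neg_mul, Matrix.mul_assoc,
    smul_sub, smul_add, neg_smul, one_smul]
  abel

theorem conjTranspose_mul_self_replicateCol [Fintype ι] (v : ι → ℂ) :
    ((Matrix.replicateCol Unit v).conjTranspose * Matrix.replicateCol Unit v) () ()
      = ((∑ i, ‖v i‖ ^ 2 : ℝ) : ℂ) := by
  rw [← star_dotProduct_self]
  rfl

theorem hermitian_energy [Fintype ι] [DecidableEq ι] {D : Fin 3 → Matrix ι ι ℂ}
    (hD : ∀ j, (D j).IsHermitian)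
    (v : Fin 2 × ι → ℂ) :
    ((imQuat D * Matrix.replicateCol Unit v).conjTranspose *
        (imQuat D * Matrix.replicateCol Unit v)
      + (Matrix.replicateCol Unit v).conjTranspose *
        ((1 : Matrix (Fin 2) (Fin 2) ℂ) ⊗ₖ ∑ j, D j * D j) * Matrix.replicateCol Unit v) () ()
      = ((energy D v : ℝ) : ℂ) := by
  have h1 : ∀ M : Matrix (Fin 2 × ι) (Fin 2 × ι) ℂ, M * Matrix.replicateCol Unit v
      = Matrix.replicateCol Unit (M.mulVec v) := fun M => rfl
  have h2 : (Matrix.replicateCol Unit v).conjTranspose *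
        ((1 : Matrix (Fin 2) (Fin 2) ℂ) ⊗ₖ ∑ j, D j * D j) * Matrix.replicateCol Unit v
      = ∑ j, (Matrix.replicateCol Unit (((1 : Matrix (Fin 2) (Fin 2) ℂ) ⊗ₖ D j).mulVec
          v)).conjTranspose *
        Matrix.replicateCol Unit (((1 : Matrix (Fin 2) (Fin 2) ℂ) ⊗ₖ D j).mulVec v) := by
    have : (1 : Matrix (Fin 2) (Fin 2) ℂ) ⊗ₖ ∑ j, D j * D j
        = ∑ j, ((1 : Matrix (Fin 2) (Fin 2) ℂ) ⊗ₖ D j).conjTranspose *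
          ((1 : Matrix (Fin 2) (Fin 2) ℂ) ⊗ₖ D j) := by
      simp only [Matrix.conjTranspose_kronecker, Matrix.conjTranspose_one, fun j => (hD j).eq,
        ← Matrix.mul_kronecker_mul, mul_one]
      simp only [Fin.sum_univ_three, Matrix.kronecker_add]
    rw [this, Matrix.mul_sum, Matrix.sum_mul]
    refine Finset.sum_congr rfl fun j _ => ?_
    rw [← h1, Matrix.conjTranspose_mul]
    simp only [Matrix.mul_assoc]
  rw [h2, h1, Matrix.add_apply, Matrix.sum_apply]
  simp only [conjTranspose_mul_self_replicateCol]
  rw [energy]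
  push_cast
  rfl

/-- With X = ∑ eⱼDⱼ, the identity `imQuat_sq` rewrites the commutators in the Nahm equations as X² +
∑ Dⱼ². Thus iX′ has the form required by `weitzenboeck_algebra`, with S = ∑ Dⱼ². -/
theorem weitzenboeck [Fintype ι] [DecidableEq ι] {D₀ : ℝ → Matrix ι ι ℂ}
    {D : Fin 3 → ℝ → Matrix ι ι ℂ} {f df : ℝ → Fin 2 × ι → ℂ} (hf : IsH1 a b f df)
    (hD : ∀ j, MatH1 a b (D j) fun s => -(Complex.I • (D (j + 1) s * D (j + 2) s
      - D (j + 2) s * D (j + 1) s + (D₀ s * D j s - D j s * D₀ s))))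
    (h₀ : ∀ s ∈ Ioc a b, (D₀ s).IsHermitian) (h : ∀ j, ∀ s ∈ Ioc a b, (D j s).IsHermitian)
    (hdf : ∀ᵐ s ∂volume.restrict (Ioc a b), df s = -(diracMat (D₀ s) fun j => D j s).mulVec (f s)) :
    IsAC a b (fun s => quadForm (fun j => D j s) (f s))
      (fun s => ((energy (fun j => D j s) (f s) : ℝ) : ℂ)) := by
  have hF := hf.replicateCol
  have h1 := ((hF.conjTranspose.mul ((MatH1.imQuat hD).smul Complex.I)).mul hF) () ()
  beta_reduce at h1
  refine h1.isAC.congr (fun s _ => ?_) ?_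
  · rw [quadForm, Matrix.mul_assoc]
    rfl
  · filter_upwards [hdf, ae_restrict_mem measurableSet_Ioc] with s hs hm
    rw [← hermitian_energy fun j => h j s hm]
    rw [weitzenboeck_algebra (N := (1 : Matrix (Fin 2) (Fin 2) ℂ) ⊗ₖ D₀ s)
      (S := (1 : Matrix (Fin 2) (Fin 2) ℂ) ⊗ₖ ∑ j, D j s * D j s)]
    · rw [imQuat_conjTranspose]
      simp only [fun j => (h j s hm).eq]
    · rw [Matrix.IsHermitian, Matrix.conjTranspose_kronecker, Matrix.conjTranspose_one,
        (h₀ s hm).eq]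
    · rw [imQuat_sq, kronecker_mul_imQuat, imQuat_mul_kronecker]
      have e1 : ∀ M : Fin 3 → Matrix ι ι ℂ, imQuat (fun j => -(Complex.I • M j))
          = -(Complex.I • imQuat M) := fun M => by
        have := imQuat_smul (-Complex.I) M
        simpa only [neg_smul] using this
      have e2 : ∀ M N : Fin 3 → Matrix ι ι ℂ, imQuat (fun j => M j - N j)
          = imQuat M - imQuat N := fun M N => by
        have e3 := imQuat_add M fun j => -N j
        have e4 := imQuat_smul (-1) N
        simp only [neg_smul, one_smul] at e4
        rw [e4] at e3
        simpa only [sub_eq_add_neg] using e3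
      rw [e1, imQuat_add, ← e2]
      congr 2
      abel
    · rw [hs, diracMat_eq (h₀ s hm) fun j => h j s hm]
      rfl

end Weitzenboeck

end

section

/-! ### The boundary terms of the Weitzenböck identity -/

section Edge

variable {ι κ : Type*}

/-- The two components of a homomorphism into `S ⊗ V`. -/
def comp (β : Matrix (Fin 2 × ι) κ ℂ) (a : Fin 2) : Matrix ι κ ℂ := fun i j => β (a, i) j

/-- The two components of an element of `S ⊗ V`. -/
def vcomp (v : Fin 2 × ι → ℂ) (a : Fin 2) : ι → ℂ := fun i => v (a, i)

/-- `b ⊗ 1`, for `b ∈ S`. -/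
def liftVec (ι : Type*) [DecidableEq ι] (b : Fin 2 → ℂ) : Matrix (Fin 2 × ι) ι ℂ :=
  fun x j => if x.2 = j then b x.1 else 0

/-- The squared norm, as a complex number. -/
def nsq [Fintype ι] (v : ι → ℂ) : ℂ := star v ⬝ᵥ v

theorem nsq_eq [Fintype ι] (v : ι → ℂ) : nsq v = ((∑ i, ‖v i‖ ^ 2 : ℝ) : ℂ) :=
  star_dotProduct_self v

theorem nsq_nonneg [Fintype ι] (v : ι → ℂ) : 0 ≤ (nsq v).re := by
  rw [nsq_eq, Complex.ofReal_re]
  positivity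

theorem eq_zero_of_nsq [Fintype ι] {v : ι → ℂ} (h : (nsq v).re ≤ 0) : v = 0 := by
  rw [nsq_eq, Complex.ofReal_re] at h
  have h0 := (Finset.sum_eq_zero_iff_of_nonneg fun i _ => sq_nonneg _).1
    (le_antisymm h (Finset.sum_nonneg fun i _ => sq_nonneg ‖v i‖))
  ext i
  simpa using h0 i (Finset.mem_univ i)

theorem nsq_neg [Fintype ι] (v : ι → ℂ) : nsq (-v) = nsq v := by simp [nsq]

theorem nsq_smul [Fintype ι] (c : ℂ) (v : ι → ℂ) : nsq (c • v) = star c * c * nsq v := by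
  simp only [nsq, star_smul, smul_dotProduct, dotProduct_smul, smul_eq_mul]
  ring

theorem conjTranspose_mulVec_eq [Fintype ι] (β : Matrix (Fin 2 × ι) κ ℂ) (v : Fin 2 × ι → ℂ) :
    β.conjTranspose.mulVec v = (comp β 0).conjTranspose.mulVec (vcomp v 0)
      + (comp β 1).conjTranspose.mulVec (vcomp v 1) := by
  ext j
  simp only [Matrix.mulVec, dotProduct, Fintype.sum_prod_type, Fin.sum_univ_two, Pi.add_apply]
  rfl

theorem dotProduct_eq_vcomp [Fintype ι] (v w : Fin 2 × ι → ℂ) :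
    v ⬝ᵥ w = vcomp v 0 ⬝ᵥ vcomp w 0 + vcomp v 1 ⬝ᵥ vcomp w 1 := by
  simp only [dotProduct, Fintype.sum_prod_type, Fin.sum_univ_two]
  rfl

theorem trSpin_mul_conjTranspose [Fintype κ] (β : Matrix (Fin 2 × ι) κ ℂ) :
    trSpin (β * β.conjTranspose) = comp β 0 * (comp β 0).conjTranspose
      + comp β 1 * (comp β 1).conjTranspose := by
  ext i j
  simp only [trSpin, Fin.sum_univ_two, Matrix.add_apply, Matrix.mul_apply]
  rfl

theorem vcomp_one_kronecker_mulVec [Fintype ι] (M : Matrix κ ι ℂ) (v : Fin 2 × ι → ℂ) (a : Fin 2) :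
    vcomp (((1 : Matrix (Fin 2) (Fin 2) ℂ) ⊗ₖ M).mulVec v) a = M.mulVec (vcomp v a) := by
  ext i
  simp only [vcomp, Matrix.mulVec, dotProduct, Fintype.sum_prod_type, Matrix.kroneckerMap_apply]
  rw [Finset.sum_eq_single a]
  · simp
  · intro b _ hb
    simp [Matrix.one_apply_ne hb.symm]
  · simp

theorem star_dotProduct_mul_conjTranspose [Fintype ι] [Fintype κ] (β : Matrix ι κ ℂ) (v : ι → ℂ) :
    star v ⬝ᵥ (β * β.conjTranspose).mulVec v = nsq (β.conjTranspose.mulVec v) := by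
  rw [nsq, Matrix.star_mulVec, Matrix.conjTranspose_conjTranspose, ← Matrix.dotProduct_mulVec,
    Matrix.mulVec_mulVec]

/-- The partial trace of ββᴴ is ∑ βₐβₐᴴ, acting equally on both spinor components of v; it
contributes the double sum of squares. -/
theorem quad_imPart [Fintype ι] [Fintype κ] (β : Matrix (Fin 2 × ι) κ ℂ) (v : Fin 2 × ι → ℂ) :
    star v ⬝ᵥ (imPart (β * β.conjTranspose)).mulVec v = nsq (β.conjTranspose.mulVec v)
      - 1 / 2 * ∑ a, ∑ c, nsq ((comp β a).conjTranspose.mulVec (vcomp v c)) := by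
  have h : ∀ c, vcomp (star v) c = star (vcomp v c) := fun c => rfl
  rw [imPart, Matrix.sub_mulVec, dotProduct_sub, star_dotProduct_mul_conjTranspose,
    Matrix.smul_mulVec, dotProduct_smul, dotProduct_eq_vcomp, vcomp_one_kronecker_mulVec,
    vcomp_one_kronecker_mulVec, trSpin_mul_conjTranspose]
  simp only [Matrix.add_mulVec, dotProduct_add, h, star_dotProduct_mul_conjTranspose,
    Fin.sum_univ_two, smul_eq_mul]
  ring

theorem imPart_smul (c : ℂ) (M : Matrix (Fin 2 × ι) (Fin 2 × ι) ℂ) :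
    imPart (c • M) = c • imPart M := by
  have : trSpin (c • M) = c • trSpin M := by
    ext i j
    simp [trSpin, mul_add]
  rw [imPart, this, imPart, Matrix.kronecker_smul, smul_sub, smul_comm]

theorem comp_liftVec [DecidableEq ι] (b : Fin 2 → ℂ) (a : Fin 2) :
    comp (liftVec ι b) a = b a • 1 := by
  ext i j
  simp [comp, liftVec, Matrix.one_apply]

theorem comp_chargeConj_zero (β : Matrix (Fin 2 × ι) κ ℂ) :
    comp (chargeConj β) 0 = -(comp β 1).conjTranspose := by
  ext i j
  simp [comp, chargeConj]

theorem comp_chargeConj_one (β : Matrix (Fin 2 × ι) κ ℂ) :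
    comp (chargeConj β) 1 = (comp β 0).conjTranspose := by
  ext i j
  simp [comp, chargeConj]

/-- Move every Bₐ to one side of the pairings; what remains is an identity between scalar products.
On the right, the first two squares are the two edge components of the Dirac operator, and only the
negative sum of squares survives when these vanish. -/
theorem edge_identity [Fintype ι] [Fintype κ] (B₀ B₁ : Matrix ι κ ℂ) (b₀ b₁ : ℂ) (u₀ u₁ : ι → ℂ)
    (w₀ w₁ : κ → ℂ) :
    (nsq (B₀.conjTranspose.mulVec u₀ + B₁.conjTranspose.mulVec u₁)
      - 1 / 2 * (nsq (B₀.conjTranspose.mulVec u₀) + nsq (B₀.conjTranspose.mulVec u₁)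
        + (nsq (B₁.conjTranspose.mulVec u₀) + nsq (B₁.conjTranspose.mulVec u₁))))
    - (nsq (star b₀ • u₀ + star b₁ • u₁)
      - 1 / 2 * (star b₀ * b₀ + star b₁ * b₁) * (nsq u₀ + nsq u₁))
    + (nsq (-B₁.mulVec w₀ + B₀.mulVec w₁)
      - 1 / 2 * (nsq (B₁.mulVec w₀) + nsq (B₁.mulVec w₁)
        + (nsq (B₀.mulVec w₀) + nsq (B₀.mulVec w₁))))
    - (nsq (-(b₁ • w₀) + b₀ • w₁)
      - 1 / 2 * (star b₀ * b₀ + star b₁ * b₁) * (nsq w₀ + nsq w₁))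
    = nsq (B₀.conjTranspose.mulVec u₀ + B₁.conjTranspose.mulVec u₁ - (star b₀ • w₀ + star b₁ • w₁))
      + nsq (-(b₁ • u₀) + b₀ • u₁ - (-B₁.mulVec w₀ + B₀.mulVec w₁))
      - 1 / 2 * (nsq (B₀.conjTranspose.mulVec u₀ - star b₀ • w₀)
        + nsq (B₀.conjTranspose.mulVec u₁ - star b₀ • w₁)
        + nsq (B₁.conjTranspose.mulVec u₀ - star b₁ • w₀)
        + nsq (B₁.conjTranspose.mulVec u₁ - star b₁ • w₁)
        + nsq (B₀.mulVec w₀ - b₀ • u₀) + nsq (B₀.mulVec w₁ - b₀ • u₁)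
        + nsq (B₁.mulVec w₀ - b₁ • u₀) + nsq (B₁.mulVec w₁ - b₁ • u₁)) := by
  have h1 : ∀ (M : Matrix ι κ ℂ) (u : ι → ℂ) (w : κ → ℂ),
      star u ⬝ᵥ M.mulVec w = star (M.conjTranspose.mulVec u) ⬝ᵥ w := fun M u w => by
    rw [Matrix.star_mulVec, Matrix.conjTranspose_conjTranspose, Matrix.dotProduct_mulVec]
  have h2 : ∀ (M : Matrix ι κ ℂ) (u : ι → ℂ) (w : κ → ℂ),
      star (M.mulVec w) ⬝ᵥ u = star w ⬝ᵥ M.conjTranspose.mulVec u := fun M u w => by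
    rw [Matrix.star_mulVec, Matrix.dotProduct_mulVec]
  simp only [nsq, star_add, star_sub, star_neg, star_smul, star_star, add_dotProduct, sub_dotProduct,
    neg_dotProduct, smul_dotProduct, dotProduct_add, dotProduct_sub, dotProduct_neg, dotProduct_smul,
    smul_eq_mul]
  simp only [h2 _ u₀, h2 _ u₁, h1 _ u₀, h1 _ u₁]
  ring

end Edge

end

section

/-! ### Monotonicity along the subintervals -/

theorem tendsto_quad {V : Type*} [Fintype V] {l : Filter ℝ} {X : ℝ → Matrix V V ℂ} {v : ℝ → V → ℂ}
    {X₀ : Matrix V V ℂ} {v₀ : V → ℂ} (hX : Tendsto X l (𝓝 X₀)) (hv : Tendsto v l (𝓝 v₀)) :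
    Tendsto (fun s => star (v s) ⬝ᵥ (Complex.I • X s).mulVec (v s)) l
      (𝓝 (star v₀ ⬝ᵥ (Complex.I • X₀).mulVec v₀)) := by
  have h1 : ∀ i, Tendsto (fun s => v s i) l (𝓝 (v₀ i)) := tendsto_pi_nhds.1 hv
  have h2 : ∀ i j, Tendsto (fun s => X s i j) l (𝓝 (X₀ i j)) := fun i =>
    tendsto_pi_nhds.1 (tendsto_pi_nhds.1 hX i)
  exact tendsto_finsetSum _ fun i _ => (h1 i).star.mul
    (tendsto_finsetSum _ fun j _ => ((h2 i j).const_mul Complex.I).mul (h1 j))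

theorem continuousOn_energy {ι : Type*} [Fintype ι] {D : Fin 3 → ℝ → Matrix ι ι ℂ}
    {v : ℝ → Fin 2 × ι → ℂ} {A : Set ℝ} (hD : ∀ j, ContinuousOn (D j) A) (hv : ContinuousOn v A) :
    ContinuousOn (fun s => energy (fun j => D j s) (v s)) A := by
  have h1 : ∀ i, ContinuousOn (fun s => v s i) A := continuousOn_pi.1 hv
  have h2 : ∀ j i i', ContinuousOn (fun s => D j s i i') A := fun j i =>
    continuousOn_pi.1 (continuousOn_pi.1 (hD j) i)
  unfold energy
  simp only [imQuat, Matrix.mulVec, dotProduct, Matrix.sum_apply, Matrix.kroneckerMap_apply]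
  refine (continuousOn_finsetSum _ fun i _ => ?_).add
    (continuousOn_finsetSum _ fun j _ => continuousOn_finsetSum _ fun i _ => ?_)
  · exact (continuousOn_finsetSum _ fun i' _ => (continuousOn_finsetSum _ fun j _ =>
      continuousOn_const.mul (h2 j i.2 i'.2)).mul (h1 i')).norm.pow 2
  · exact (continuousOn_finsetSum _ fun i' _ =>
      (continuousOn_const.mul (h2 j i.2 i'.2)).mul (h1 i')).norm.pow 2

/-- For a monotone function, control along some sequence tending to the end point suffices. At a
Nahm pole nothing more is available. -/
theorem le_of_frequently_left {a b γ : ℝ} {G : ℝ → ℝ} (hG : MonotoneOn G (Ioo a b))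
    (h : ∀ ε > 0, ∃ᶠ s in 𝓝[>] a, γ - ε < G s) {s : ℝ} (hs : s ∈ Ioo a b) : γ ≤ G s := by
  refine le_of_forall_pos_sub_le fun ε hε => ?_
  obtain ⟨x, hx, hm⟩ := ((h ε hε).and_eventually (Ioo_mem_nhdsGT hs.1)).exists
  exact hx.le.trans (hG ⟨hm.1, hm.2.trans hs.2⟩ hs hm.2.le)

theorem le_of_frequently_right {a b γ : ℝ} {G : ℝ → ℝ} (hG : MonotoneOn G (Ioo a b))
    (h : ∀ ε > 0, ∃ᶠ s in 𝓝[<] b, G s < γ + ε) {s : ℝ} (hs : s ∈ Ioo a b) : G s ≤ γ := by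
  refine le_of_forall_pos_le_add fun ε hε => ?_
  obtain ⟨x, hx, hm⟩ := ((h ε hε).and_eventually (Ioo_mem_nhdsLT hs.2)).exists
  exact (hG hs ⟨hs.1.trans hm.1, hm.2⟩ hm.1.le).trans hx.le

theorem frequently_of_tendsto_left {a γ : ℝ} {G : ℝ → ℝ} (h : Tendsto G (𝓝[>] a) (𝓝 γ)) :
    ∀ ε > 0, ∃ᶠ s in 𝓝[>] a, γ - ε < G s := fun ε hε =>
  (h.eventually (lt_mem_nhds (by linarith))).frequently

theorem frequently_of_tendsto_right {b γ : ℝ} {G : ℝ → ℝ} (h : Tendsto G (𝓝[<] b) (𝓝 γ)) :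
    ∀ ε > 0, ∃ᶠ s in 𝓝[<] b, G s < γ + ε := fun ε hε =>
  (h.eventually (gt_mem_nhds (by linarith))).frequently

variable {k : ℕ} [NeZero k] {B : Bow k} {R : BowRep B} {ν : Fin k → Fin 3 → ℝ}

theorem integrableOn_mul_apply {ι κ μ : Type*} [Fintype κ] {A : Set ℝ} {F : ℝ → Matrix ι κ ℂ}
    {G : ℝ → Matrix κ μ ℂ} (hF : SqIntOn F A) (hG : SqIntOn G A) (i : ι) (j : μ) :
    IntegrableOn (fun s => (F s * G s) i j) A := by
  simp only [Matrix.mul_apply]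
  exact integrable_finsetSum _ fun l _ => (hF i l).integrable_mul (hG l j)

section Strip

variable {d : BowData R} {p : LevelSet B ν}

/-- The scalars tⱼ and t₀ drop out of all commutators, and tⱼ is constant, so the differences Tⱼ −
tⱼ satisfy the same Nahm equations. -/
theorem matH1_relT (hd : d.IsSolution ν) (p : LevelSet B ν) (σ : Fin k) (α : Fin (R.n σ + 1)) (j : Fin 3) {c e : ℝ}
    (hc : R.lo σ α < c) (he : e < R.hi σ α) :
    MatH1 c e (relT d p σ α j) fun s => -(Complex.I • (relT d p σ α (j + 1) s *
      relT d p σ α (j + 2) s - relT d p σ α (j + 2) s * relT d p σ α (j + 1) s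
      + (relT0 d p σ α s * relT d p σ α j s - relT d p σ α j s * relT0 d p σ α s))) := by
  rcases lt_or_ge e c with hec | hce
  · intro i i'
    refine ⟨by simp [Ioc_eq_empty (not_lt.2 hec.le)], fun x hx => absurd (hx.1.trans hx.2)
      (not_le.2 hec)⟩
  have hT : ∀ j, SqIntOn (d.T σ α j) (Ioc c e) := fun j =>
    sqIntOn_Ioc_of_Ioo (d.T_L2loc σ α j c e hc he)
  have hT0 : SqIntOn (d.T0 σ α) (Ioc c e) :=
    (sqIntOn_Ioc_of_Ioo (d.T0_L2 σ α)).mono (Ioc_subset_Ioc hc.le he.le)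
  have hmem : ∀ x ∈ Icc c e, x ∈ Ioo (R.lo σ α) (R.hi σ α) := fun x hx =>
    ⟨hc.trans_le hx.1, hx.2.trans_lt he⟩
  have hcm := hmem c (left_mem_Icc.2 hce)
  have e1 : ∀ (M N : Matrix (Fin (R.rank σ α)) (Fin (R.rank σ α)) ℂ) (x y : ℂ),
      (M - x • 1) * (N - y • 1) - (N - y • 1) * (M - x • 1) = M * N - N * M := fun M N x y => by
    simp only [sub_mul, mul_sub, Matrix.smul_mul, Matrix.mul_smul, one_mul, mul_one]
    rw [smul_comm x y]
    abel
  have e2 : (fun s => -(Complex.I • (relT d p σ α (j + 1) s *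
      relT d p σ α (j + 2) s - relT d p σ α (j + 2) s * relT d p σ α (j + 1) s
      + (relT0 d p σ α s * relT d p σ α j s - relT d p σ α j s * relT0 d p σ α s))))
      = fun s => -(Complex.I • (d.T σ α (j + 1) s * d.T σ α (j + 2) s
        - d.T σ α (j + 2) s * d.T σ α (j + 1) s
        + (d.T0 σ α s * d.T σ α j s - d.T σ α j s * d.T0 σ α s))) := by
    funext s
    simp only [relT, relT0, e1]
  rw [e2]
  have hAC : ∀ j i i', IsAC c e (fun s => d.T σ α j s i i') (fun s =>
      (-(Complex.I • (d.T σ α (j + 1) s * d.T σ α (j + 2) s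
        - d.T σ α (j + 2) s * d.T σ α (j + 1) s
        + (d.T0 σ α s * d.T σ α j s - d.T σ α j s * d.T0 σ α s)))) i i') := by
    intro j i i'
    have hi : IntegrableOn (fun s => (d.T σ α (j + 1) s * d.T σ α (j + 2) s
        - d.T σ α (j + 2) s * d.T σ α (j + 1) s
        + (d.T0 σ α s * d.T σ α j s - d.T σ α j s * d.T0 σ α s)) i i') (Ioc c e) :=
      (((integrableOn_mul_apply (hT _) (hT _) i i').sub
        (integrableOn_mul_apply (hT _) (hT _) i i')).add
        ((integrableOn_mul_apply hT0 (hT _) i i').sub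
        (integrableOn_mul_apply (hT _) hT0 i i')))
    refine IsAC.of_sub_eq (hi.const_mul Complex.I).neg fun x hx => ?_
    have h1 := hd.nahm σ α j c hcm x (hmem x hx) i i'
    simp only [Matrix.neg_apply, Matrix.smul_apply, smul_eq_mul]
    rw [intervalIntegral.integral_neg, intervalIntegral.integral_const_mul, ← h1, ← mul_assoc,
      Complex.I_mul_I]
    ring
  -- Bootstrap: the integrated equation first gives absolute continuity with an integrable
  -- derivative; the Tⱼ being therefore continuous, the derivative is even square integrable.
  have hc' : ∀ j, ContinuousOn (d.T σ α j) (Icc c e) := fun j =>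
    continuousOn_pi.2 fun i => continuousOn_pi.2 fun i' => (hAC j i i').continuousOn
  have hL2 : SqIntOn (fun s => -(Complex.I • (d.T σ α (j + 1) s * d.T σ α (j + 2) s
        - d.T σ α (j + 2) s * d.T σ α (j + 1) s
        + (d.T0 σ α s * d.T σ α j s - d.T σ α j s * d.T0 σ α s)))) (Ioc c e) := by
    have hm := measurableSet_Ioc (a := c) (b := e)
    have hs := Ioc_subset_Icc_self (a := c) (b := e)
    have := ((((hT (j + 1)).mul_continuousOn hm hs (hc' (j + 2))).sub
      ((hT (j + 2)).mul_continuousOn hm hs (hc' (j + 1)))).add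
      ((hT0.mul_continuousOn hm hs (hc' j)).sub
        (hT0.continuousOn_mul hm hs (hc' j)))).const_smul (-Complex.I)
    simpa only [neg_smul] using this
  intro i i'
  refine isH1_iff.2 ⟨?_, hL2 i i'⟩
  have h2 := (hAC j i i').sub (IsAC.const ((p.t σ j c • (1 : Matrix (Fin (R.rank σ α))
    (Fin (R.rank σ α)) ℂ)) i i'))
  simp only [sub_zero] at h2
  refine h2.congr (fun x hx => ?_) (ae_of_all _ fun _ => rfl)
  rw [relT, p.t_eq σ j (mem_Ioo_len hcm) (mem_Ioo_len (hmem x hx))]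
  rfl

variable {f : TermSection R}

variable (d p f) in
/-- The real valued quadratic form along a section. -/
def gRe (σ : Fin k) (α : Fin (R.n σ + 1)) (s : ℝ) : ℝ :=
  (quadForm (fun j => relT d p σ α j s) (f.f σ α s)).re

theorem isAC_quadForm (hd : d.IsSolution ν)
    (hb : ∀ σ α, ∀ᵐ s ∂volume.restrict (Ioc (R.lo σ α) (R.hi σ α)), diracBulk d p f σ α s = 0)
    (σ : Fin k) (α : Fin (R.n σ + 1)) {c e : ℝ}
    (hc : R.lo σ α < c) (he : e < R.hi σ α) :
    IsAC c e (fun s => quadForm (fun j => relT d p σ α j s) (f.f σ α s))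
      (fun s => ((energy (fun j => relT d p σ α j s) (f.f σ α s) : ℝ) : ℂ)) := by
  have hsub : Ioc c e ⊆ Ioo (R.lo σ α) (R.hi σ α) := fun s hs =>
    ⟨hc.trans hs.1, hs.2.trans_lt he⟩
  refine weitzenboeck (D₀ := relT0 d p σ α) ((f.h1 σ α).mono hc.le he.le)
    (fun j => matH1_relT hd p σ α j hc he)
    (fun s hs => relT0_isHermitian d p (hsub hs)) (fun j s hs => relT_isHermitian d p j (hsub hs)) ?_
  refine ae_restrict_of_ae_restrict_of_subset (Ioc_subset_Ioc hc.le he.le) ?_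
  filter_upwards [hb σ α] with s hs
  rw [diracBulk_eq, sub_eq_zero] at hs
  rw [← neg_neg (f.df σ α s), hs]
  rfl

theorem gRe_sub (hd : d.IsSolution ν)
    (hb : ∀ σ α, ∀ᵐ s ∂volume.restrict (Ioc (R.lo σ α) (R.hi σ α)), diracBulk d p f σ α s = 0)
    (σ : Fin k) (α : Fin (R.n σ + 1)) {x y : ℝ}
    (hx : x ∈ Ioo (R.lo σ α) (R.hi σ α)) (hy : y ∈ Ioo (R.lo σ α) (R.hi σ α)) (hxy : x ≤ y) :
    gRe d p f σ α y - gRe d p f σ α x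
      = ∫ s in x..y, energy (fun j => relT d p σ α j s) (f.f σ α s) := by
  have h := (isAC_quadForm hd hb σ α hx.1 hy.2).sub_eq (left_mem_Icc.2 hxy) (right_mem_Icc.2 hxy)
  rw [intervalIntegral.integral_ofReal] at h
  rw [gRe, gRe, ← Complex.sub_re, h, Complex.ofReal_re]

theorem gRe_monotoneOn (hd : d.IsSolution ν)
    (hb : ∀ σ α, ∀ᵐ s ∂volume.restrict (Ioc (R.lo σ α) (R.hi σ α)), diracBulk d p f σ α s = 0)
    (σ : Fin k) (α : Fin (R.n σ + 1)) :
    MonotoneOn (gRe d p f σ α) (Ioo (R.lo σ α) (R.hi σ α)) := fun x hx y hy hxy => by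
  rw [← sub_nonneg, gRe_sub hd hb σ α hx hy hxy]
  exact intervalIntegral.integral_nonneg hxy fun s _ => energy_nonneg _ _

/-- The hypothesis makes G constant, so the integral of the continuous non-negative energy over any
compact part vanishes. -/
theorem energy_eq_zero (hd : d.IsSolution ν)
    (hb : ∀ σ α, ∀ᵐ s ∂volume.restrict (Ioc (R.lo σ α) (R.hi σ α)), diracBulk d p f σ α s = 0)
    (σ : Fin k) (α : Fin (R.n σ + 1))
    (h : ∀ x ∈ Ioo (R.lo σ α) (R.hi σ α), ∀ y ∈ Ioo (R.lo σ α) (R.hi σ α),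
      gRe d p f σ α x ≤ gRe d p f σ α y) {s : ℝ} (hs : s ∈ Ioo (R.lo σ α) (R.hi σ α)) :
    energy (fun j => relT d p σ α j s) (f.f σ α s) = 0 := by
  obtain ⟨c, hc1, hc2⟩ := exists_between hs.1
  obtain ⟨e, he1, he2⟩ := exists_between hs.2
  have hce : c < e := hc2.trans he1
  have hmem : ∀ x ∈ Icc c e, x ∈ Ioo (R.lo σ α) (R.hi σ α) := fun x hx =>
    ⟨hc1.trans_le hx.1, hx.2.trans_lt he2⟩
  have hcont : ContinuousOn (fun s => energy (fun j => relT d p σ α j s) (f.f σ α s))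
      (Icc c e) := by
    have h1 : ∀ j, ContinuousOn (relT d p σ α j) (Icc c e) := fun j =>
      (matH1_relT hd p σ α j hc1 he2).continuousOn
    have h2 : ContinuousOn (f.f σ α) (Icc c e) := ((f.h1 σ α).mono hc1.le he2.le).isAC.continuousOn
    exact continuousOn_energy h1 h2
  have h0 : ∫ s in c..e, energy (fun j => relT d p σ α j s) (f.f σ α s) = 0 := by
    rw [← gRe_sub hd hb σ α (hmem c (left_mem_Icc.2 hce.le)) (hmem e (right_mem_Icc.2 hce.le))
      hce.le, sub_eq_zero]
    exact le_antisymm (h _ (hmem e (right_mem_Icc.2 hce.le)) _ (hmem c (left_mem_Icc.2 hce.le)))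
      (h _ (hmem c (left_mem_Icc.2 hce.le)) _ (hmem e (right_mem_Icc.2 hce.le)))
  by_contra hne
  have hpos := intervalIntegral.integral_pos hce hcont (fun s _ => energy_nonneg _ _)
    ⟨s, ⟨hc2.le, he1.le⟩, lt_of_le_of_ne (energy_nonneg _ _) (Ne.symm hne)⟩
  exact hpos.ne' h0

end Strip

end

section

/-! ### The boundary conditions at the edges -/

section EdgeForm

variable {ι κ : Type*}

/-- The imaginary part of `i b b†`, for `b ∈ S`. -/
def spinIm (b : Fin 2 → ℂ) : Matrix (Fin 2) (Fin 2) ℂ := fun a a' =>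
  Complex.I * (b a * star (b a')) - 1 / 2 * ((1 : Matrix (Fin 2) (Fin 2) ℂ) a a' *
    (Complex.I * (b 0 * star (b 0) + b 1 * star (b 1))))

theorem imPart_liftVec [Fintype ι] [DecidableEq ι] (b : Fin 2 → ℂ) :
    imPart (Complex.I • (liftVec ι b * (liftVec ι b).conjTranspose)) = spinIm b ⊗ₖ 1 := by
  have h : ∀ x y, (liftVec ι b * (liftVec ι b).conjTranspose) x y
      = (b x.1 * star (b y.1)) * (1 : Matrix ι ι ℂ) x.2 y.2 := fun x y => by
    simp only [Matrix.mul_apply, liftVec, Matrix.conjTranspose_apply, Matrix.one_apply]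
    rw [Finset.sum_eq_single x.2]
    · by_cases hxy : x.2 = y.2
      · simp [hxy]
      · simp [hxy, Ne.symm hxy]
    · intro z _ hz
      simp [hz.symm]
    · simp
  ext x y
  simp only [imPart, Matrix.sub_apply, Matrix.smul_apply, smul_eq_mul, Matrix.kroneckerMap_apply,
    trSpin, h, Fin.sum_univ_two, spinIm]
  ring

theorem imQuat_smul_one [DecidableEq ι] (c : Fin 3 → ℂ) :
    imQuat (fun j => c j • (1 : Matrix ι ι ℂ)) = (∑ j, c j • quat j) ⊗ₖ 1 := by
  ext x y
  simp only [imQuat, Matrix.sum_apply, Matrix.kroneckerMap_apply, Matrix.smul_apply, smul_eq_mul,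
    Finset.sum_mul]
  exact Finset.sum_congr rfl fun j _ => by ring

theorem sub_kronecker_one [DecidableEq ι] (M N : Matrix (Fin 2) (Fin 2) ℂ) :
    (M - N) ⊗ₖ (1 : Matrix ι ι ℂ) = M ⊗ₖ 1 - N ⊗ₖ 1 := by
  ext x y
  simp [sub_mul]

theorem sum_smul_quat_injective {c c' : Fin 3 → ℂ}
    (h : ∑ j, c j • quat j = ∑ j, c' j • quat j) : c = c' := by
  have h00 := congrFun (congrFun h 0) 0
  have h01 := congrFun (congrFun h 0) 1
  have h10 := congrFun (congrFun h 1) 0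
  simp only [Fin.sum_univ_three, Matrix.add_apply, Matrix.smul_apply, quat, smul_eq_mul] at h00 h01 h10
  simp at h00 h01 h10
  have hI := Complex.I_ne_zero
  funext j
  fin_cases j
  · exact h00
  · change c 1 = c' 1
    linear_combination (h10 - h01) / 2
  · change c 2 = c' 2
    refine mul_right_cancel₀ hI ?_
    linear_combination -(h10 + h01) / 2

theorem spinIm_zero : spinIm 0 = 0 := by
  ext a a'
  simp [spinIm]

/-- The vectors b and b^c are orthogonal of equal length, so bb† + b^c(b^c)† is a multiple of the
identity, whose imaginary part is zero. -/
theorem spinIm_add_conj (b : Fin 2 → ℂ) :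
    spinIm b + spinIm ![-star (b 1), star (b 0)] = 0 := by
  ext a a'
  fin_cases a <;> fin_cases a' <;> simp [spinIm] <;> ring

/-- The vanishing of the squares in the boundary terms at an edge. -/
def EdgeLinked [Fintype ι] [Fintype κ] (β : Matrix (Fin 2 × ι) κ ℂ) (b : Fin 2 → ℂ)
    (u : Fin 2 × ι → ℂ) (w : Fin 2 × κ → ℂ) : Prop :=
  ∀ a c, (comp β a).conjTranspose.mulVec (vcomp u c) = star (b a) • vcomp w c ∧
    (comp β a).mulVec (vcomp w c) = b a • vcomp u c

/-- The sum of squares in the boundary terms at an edge. -/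
def edgeDefect [Fintype ι] [Fintype κ] (β : Matrix (Fin 2 × ι) κ ℂ) (b : Fin 2 → ℂ)
    (u : Fin 2 × ι → ℂ) (w : Fin 2 × κ → ℂ) : ℂ :=
  ∑ a, ∑ c, (nsq ((comp β a).conjTranspose.mulVec (vcomp u c) - star (b a) • vcomp w c)
    + nsq ((comp β a).mulVec (vcomp w c) - b a • vcomp u c))

theorem edgeDefect_nonneg [Fintype ι] [Fintype κ] (β : Matrix (Fin 2 × ι) κ ℂ) (b : Fin 2 → ℂ)
    (u : Fin 2 × ι → ℂ) (w : Fin 2 × κ → ℂ) : 0 ≤ (edgeDefect β b u w).re := by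
  simp only [edgeDefect, Complex.re_sum, Complex.add_re]
  exact Finset.sum_nonneg fun a _ => Finset.sum_nonneg fun c _ =>
    add_nonneg (nsq_nonneg _) (nsq_nonneg _)

theorem edgeLinked_of_edgeDefect [Fintype ι] [Fintype κ] {β : Matrix (Fin 2 × ι) κ ℂ}
    {b : Fin 2 → ℂ} {u : Fin 2 × ι → ℂ} {w : Fin 2 × κ → ℂ} (h : (edgeDefect β b u w).re ≤ 0) :
    EdgeLinked β b u w := by
  have h0 := le_antisymm h (edgeDefect_nonneg β b u w)
  simp only [edgeDefect, Complex.re_sum, Complex.add_re] at h0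
  have h1 := fun a => (Finset.sum_eq_zero_iff_of_nonneg fun a _ => Finset.sum_nonneg fun c _ =>
    add_nonneg (nsq_nonneg _) (nsq_nonneg _)).1 h0 a (Finset.mem_univ a)
  intro a c
  have h2 := (Finset.sum_eq_zero_iff_of_nonneg fun c _ =>
    add_nonneg (nsq_nonneg _) (nsq_nonneg _)).1 (h1 a) c (Finset.mem_univ c)
  have h3 := nsq_nonneg ((comp β a).conjTranspose.mulVec (vcomp u c) - star (b a) • vcomp w c)
  have h4 := nsq_nonneg ((comp β a).mulVec (vcomp w c) - b a • vcomp u c)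
  exact ⟨sub_eq_zero.1 (eq_zero_of_nsq (by linarith)),
    sub_eq_zero.1 (eq_zero_of_nsq (by linarith))⟩

theorem quad_I_imPart [Fintype ι] {μ : Type*} [Fintype μ] [Fintype κ] (β : Matrix (Fin 2 × ι) κ ℂ)
    (γ : Matrix (Fin 2 × ι) μ ℂ) (u : Fin 2 × ι → ℂ) :
    star u ⬝ᵥ (Complex.I • (imPart (Complex.I • (β * β.conjTranspose))
      - imPart (Complex.I • (γ * γ.conjTranspose)))).mulVec u
    = star u ⬝ᵥ (imPart (γ * γ.conjTranspose)).mulVec u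
      - star u ⬝ᵥ (imPart (β * β.conjTranspose)).mulVec u := by
  rw [imPart_smul, imPart_smul, ← smul_sub, smul_smul, Complex.I_mul_I, neg_smul, one_smul,
    neg_sub, Matrix.sub_mulVec, dotProduct_sub]

/-- The two terms on the left are the limits of the quadratic form at p_σ− and p_σ+. When both edge
components of the Dirac operator vanish, `edge_identity` leaves minus half a sum of squares, so the
form cannot decrease across the edge. -/
theorem edge_quad [Fintype ι] [DecidableEq ι] [Fintype κ] [DecidableEq κ]
    (β : Matrix (Fin 2 × ι) κ ℂ) (b : Fin 2 → ℂ) (u : Fin 2 × ι → ℂ) (w : Fin 2 × κ → ℂ)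
    (h1 : β.conjTranspose.mulVec u = fun i => ∑ a, star (b a) * w (a, i))
    (h2 : (fun i => ∑ a, star ((![-star (b 1), star (b 0)] : Fin 2 → ℂ) a) * u (a, i))
      = (chargeConj β).conjTranspose.mulVec w) :
    star u ⬝ᵥ (Complex.I • (imPart (Complex.I • (liftVec ι b * (liftVec ι b).conjTranspose))
      - imPart (Complex.I • (β * β.conjTranspose)))).mulVec u
    - star w ⬝ᵥ (Complex.I • (imPart (Complex.I • (chargeConj β * (chargeConj β).conjTranspose))
      - imPart (Complex.I • (liftVec κ ![-star (b 1), star (b 0)]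
        * (liftVec κ ![-star (b 1), star (b 0)]).conjTranspose)))).mulVec w
      = -(1 / 2) * edgeDefect β b u w := by
  have e := edge_identity (comp β 0) (comp β 1) (b 0) (b 1) (vcomp u 0) (vcomp u 1)
    (vcomp w 0) (vcomp w 1)
  have k1 : (comp β 0).conjTranspose.mulVec (vcomp u 0) + (comp β 1).conjTranspose.mulVec (vcomp u 1)
      - (star (b 0) • vcomp w 0 + star (b 1) • vcomp w 1) = 0 := by
    rw [← conjTranspose_mulVec_eq, h1, sub_eq_zero]
    ext i
    simp [vcomp, Fin.sum_univ_two]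
  have k2 : -(b 1 • vcomp u 0) + b 0 • vcomp u 1
      - (-(comp β 1).mulVec (vcomp w 0) + (comp β 0).mulVec (vcomp w 1)) = 0 := by
    rw [conjTranspose_mulVec_eq, comp_chargeConj_zero, comp_chargeConj_one,
      Matrix.conjTranspose_neg, Matrix.conjTranspose_conjTranspose,
      Matrix.conjTranspose_conjTranspose, Matrix.neg_mulVec] at h2
    rw [← h2, sub_eq_zero]
    ext i
    simp [vcomp, Fin.sum_univ_two]
  rw [k1, k2] at e
  rw [quad_I_imPart, quad_I_imPart]
  simp only [quad_imPart, conjTranspose_mulVec_eq, comp_liftVec,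
    comp_chargeConj_zero, comp_chargeConj_one, Fin.sum_univ_two, edgeDefect,
    Matrix.conjTranspose_smul, Matrix.conjTranspose_neg, Matrix.conjTranspose_conjTranspose,
    Matrix.conjTranspose_one, Matrix.smul_mulVec, Matrix.neg_mulVec, Matrix.one_mulVec, nsq_smul,
    nsq_neg, Matrix.cons_val_zero, Matrix.cons_val_one, star_neg, star_star, neg_smul,
    neg_mul_neg] at e ⊢
  have n0 : nsq (0 : ι → ℂ) = 0 := by simp [nsq]
  have n1 : nsq (0 : κ → ℂ) = 0 := by simp [nsq]
  rw [n0, n1] at e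
  linear_combination e

end EdgeForm

theorem Fin.cyclic_induction {k : ℕ} [NeZero k] {P : Fin k → Prop} (h0 : P 0)
    (h : ∀ σ, P σ → P (σ + 1)) (σ : Fin k) : P σ := by
  have : ∀ n : ℕ, P (Fin.ofNat k n) := by
    intro n
    induction n with
    | zero => exact h0
    | succ n ih =>
      have := h _ ih
      convert this using 1
      simp [Fin.ext_iff, Fin.val_add]
  simpa using this σ.val

variable {k : ℕ} [NeZero k] {B : Bow k} {R : BowRep B} {ν : Fin k → Fin 3 → ℝ}

/-! ### Constancy of t around the circle and the zeros of b -/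

namespace LevelSet

variable (p : LevelSet B ν)

/-- The constant value of `tⱼ` on `I_σ`. -/
def tc (σ : Fin k) (j : Fin 3) : ℂ := p.t σ j (B.len σ / 2)

theorem t_eq_tc (σ : Fin k) (j : Fin 3) {s : ℝ} (hs : s ∈ Ioo 0 (B.len σ)) :
    p.t σ j s = p.tc σ j :=
  p.t_eq σ j ⟨half_pos (B.len_pos σ), half_lt_self (B.len_pos σ)⟩ hs

theorem bc_eq (σ : Fin k) : p.bc σ = ![-star (p.b σ 1), star (p.b σ 0)] := by
  ext a
  fin_cases a <;> simp [bc, chargeConj, b]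

theorem liftVec_b (σ : Fin k) : liftVec (Fin 1) (p.b σ) = p.1.Bif σ := by
  ext x j
  obtain ⟨a, i⟩ := x
  have hi : i = 0 := Subsingleton.elim _ _
  have hj : j = 0 := Subsingleton.elim _ _
  subst hi hj
  rfl

theorem liftVec_bc (σ : Fin k) : liftVec (Fin 1) (p.bc σ) = chargeConj (p.1.Bif σ) := by
  ext x j
  obtain ⟨a, i⟩ := x
  have hi : i = 0 := Subsingleton.elim _ _
  have hj : j = 0 := Subsingleton.elim _ _
  subst hi hj
  rfl

theorem Tim_eq (σ : Fin k) {s : ℝ} (hs : s ∈ Ioo 0 (B.len σ)) :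
    p.1.Tim σ (0 : Fin 1) s = imQuat fun j => p.tc σ j • (1 : Matrix (Fin 1) (Fin 1) ℂ) := by
  refine congrArg imQuat (funext fun j => ?_)
  ext i i'
  have hi : i = (0 : Fin 1) := Subsingleton.elim (α := Fin 1) _ _
  have hj : i' = (0 : Fin 1) := Subsingleton.elim (α := Fin 1) _ _
  subst hi hj
  rw [Matrix.smul_apply, Matrix.one_apply_eq, smul_eq_mul, mul_one]
  exact p.t_eq_tc σ j hs

theorem kronecker_one_injective {M N : Matrix (Fin 2) (Fin 2) ℂ}
    (h : M ⊗ₖ (1 : Matrix (Fin 1) (Fin 1) ℂ) = N ⊗ₖ 1) : M = N := by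
  ext a a'
  have := congrFun (congrFun h (a, 0)) (a', 0)
  simpa using this

theorem quat_tc_left (σ : Fin k) : ∑ j, p.tc σ j • quat j
    = ∑ j, ((ν σ j : ℝ) : ℂ) • quat j - spinIm (p.b σ) := by
  have h1 : Tendsto (p.1.Tim σ (0 : Fin 1)) (𝓝[<] (B.len σ))
      (𝓝 (imQuat (fun j => ((ν σ j : ℝ) : ℂ) • (1 : Matrix (Fin 1) (Fin 1) ℂ))
        - imPart (Complex.I • (liftVec (Fin 1) (p.b σ) * (liftVec (Fin 1) (p.b σ)).conjTranspose)))) := by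
    rw [liftVec_b]
    exact p.2.end_left σ
  have h2 : Tendsto (p.1.Tim σ (0 : Fin 1)) (𝓝[<] (B.len σ))
      (𝓝 (imQuat fun j => p.tc σ j • (1 : Matrix (Fin 1) (Fin 1) ℂ))) := by
    refine tendsto_const_nhds.congr' ?_
    filter_upwards [Ioo_mem_nhdsLT (B.len_pos σ)] with s hs
    exact (p.Tim_eq σ hs).symm
  have h3 : imQuat (fun j => p.tc σ j • (1 : Matrix (Fin 1) (Fin 1) ℂ))
      = imQuat (fun j => ((ν σ j : ℝ) : ℂ) • (1 : Matrix (Fin 1) (Fin 1) ℂ))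
        - imPart (Complex.I • (liftVec (Fin 1) (p.b σ) * (liftVec (Fin 1) (p.b σ)).conjTranspose)) := by
    have h := tendsto_nhds_unique h2 h1
    exact h
  rw [imPart_liftVec, imQuat_smul_one, imQuat_smul_one, ← sub_kronecker_one] at h3
  exact kronecker_one_injective h3

theorem quat_tc_right (σ : Fin k) : ∑ j, p.tc (σ + 1) j • quat j
    = ∑ j, ((ν σ j : ℝ) : ℂ) • quat j + spinIm (p.bc σ) := by
  have h1 : Tendsto (p.1.Tim (σ + 1) (0 : Fin 1)) (𝓝[>] 0)
      (𝓝 (imQuat (fun j => ((ν σ j : ℝ) : ℂ) • (1 : Matrix (Fin 1) (Fin 1) ℂ))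
        + imPart (Complex.I • (liftVec (Fin 1) (p.bc σ) * (liftVec (Fin 1) (p.bc σ)).conjTranspose)))) := by
    rw [liftVec_bc]
    exact p.2.end_right σ
  have h2 : Tendsto (p.1.Tim (σ + 1) (0 : Fin 1)) (𝓝[>] 0)
      (𝓝 (imQuat fun j => p.tc (σ + 1) j • (1 : Matrix (Fin 1) (Fin 1) ℂ))) := by
    refine tendsto_const_nhds.congr' ?_
    filter_upwards [Ioo_mem_nhdsGT (B.len_pos (σ + 1))] with s hs
    exact (p.Tim_eq (σ + 1) hs).symm
  have h3 : imQuat (fun j => p.tc (σ + 1) j • (1 : Matrix (Fin 1) (Fin 1) ℂ))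
      = imQuat (fun j => ((ν σ j : ℝ) : ℂ) • (1 : Matrix (Fin 1) (Fin 1) ℂ))
        + imPart (Complex.I • (liftVec (Fin 1) (p.bc σ) * (liftVec (Fin 1) (p.bc σ)).conjTranspose)) := by
    have h := tendsto_nhds_unique h2 h1
    exact h
  rw [imPart_liftVec, imQuat_smul_one, imQuat_smul_one, ← Matrix.add_kronecker] at h3
  exact kronecker_one_injective h3

/-- The two moment map conditions at p_σ differ by Im i bb† + Im i b^c(b^c)† = 0. -/
theorem tc_succ (σ : Fin k) : p.tc (σ + 1) = p.tc σ := by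
  refine sum_smul_quat_injective ?_
  have := spinIm_add_conj (p.b σ)
  rw [p.quat_tc_left σ, p.quat_tc_right σ, bc_eq, eq_neg_of_add_eq_zero_left this, sub_neg_eq_add]

theorem tc_eq (σ τ : Fin k) : p.tc σ = p.tc τ := by
  have h : ∀ σ, p.tc σ = p.tc 0 :=
    Fin.cyclic_induction rfl fun σ h => (p.tc_succ σ).trans h
  rw [h σ, h τ]

/-- At most one of the `b_σ` vanishes. -/
theorem eq_of_b_eq_zero (hν : Function.Injective ν) {σ τ : Fin k} (hσ : p.b σ = 0)
    (hτ : p.b τ = 0) : σ = τ := by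
  have h : ∀ σ, p.b σ = 0 → p.tc σ = fun j => ((ν σ j : ℝ) : ℂ) := fun σ h0 => by
    refine sum_smul_quat_injective ?_
    rw [quat_tc_left, h0, spinIm_zero, sub_zero]
  refine hν (funext fun j => ?_)
  have := congrFun ((h σ hσ).symm.trans ((p.tc_eq σ τ).trans (h τ hτ))) j
  exact_mod_cast this

end LevelSet

/-! ### The quadratic form across the edges -/

section EdgeLe

variable {d : BowData R} {p : LevelSet B ν} {f : TermSection R}

theorem imQuat_relT (d : BowData R) (p : LevelSet B ν) {σ : Fin k} {α : Fin (R.n σ + 1)} {s : ℝ}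
    (hs : s ∈ Ioo (R.lo σ α) (R.hi σ α)) :
    imQuat (fun j => relT d p σ α j s) = d.Tim σ α s - imQuat fun j => p.tc σ j • 1 := by
  rw [eq_sub_iff_add_eq, BowData.Tim, ← imQuat_add]
  refine congrArg imQuat (funext fun j => ?_)
  rw [relT, p.t_eq_tc σ j (mem_Ioo_len hs), sub_add_cancel]

/-- Both sets of data have the same level ν_σ, which cancels in the difference and leaves only the
contributions of b_σ and B_σ. -/
theorem tendsto_imQuat_relT_left (hd : d.IsSolution ν) (p : LevelSet B ν) (σ : Fin k) :
    Tendsto (fun s => imQuat fun j => relT d p σ (Fin.last _) j s) (𝓝[<] (B.len σ))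
      (𝓝 (imPart (Complex.I • (liftVec (Fin (R.rankL σ)) (p.b σ) * (liftVec (Fin (R.rankL σ)) (p.b σ)).conjTranspose))
        - imPart (Complex.I • (d.Bif σ * (d.Bif σ).conjTranspose)))) := by
  have h1 := (hd.end_left σ).sub_const (imQuat fun j => p.tc σ j • 1)
  have h2 : imQuat (fun j => ((ν σ j : ℝ) : ℂ) • 1)
      - imPart (Complex.I • (d.Bif σ * (d.Bif σ).conjTranspose)) - imQuat (fun j => p.tc σ j • 1)
      = imPart (Complex.I • (liftVec (Fin (R.rankL σ)) (p.b σ) * (liftVec (Fin (R.rankL σ)) (p.b σ)).conjTranspose))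
        - imPart (Complex.I • (d.Bif σ * (d.Bif σ).conjTranspose)) := by
    rw [imPart_liftVec, imQuat_smul_one, imQuat_smul_one, p.quat_tc_left, sub_kronecker_one]
    abel
  rw [h2] at h1
  refine h1.congr' ?_
  have h3 : R.lo σ (Fin.last _) < B.len σ := by simpa using R.lo_lt_hi σ (Fin.last _)
  filter_upwards [Ioo_mem_nhdsLT h3] with s hs
  exact (imQuat_relT d p (by simpa using hs)).symm

theorem tendsto_imQuat_relT_right (hd : d.IsSolution ν) (p : LevelSet B ν) (σ : Fin k) :
    Tendsto (fun s => imQuat fun j => relT d p (σ + 1) 0 j s) (𝓝[>] 0)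
      (𝓝 (imPart (Complex.I • (chargeConj (d.Bif σ) * (chargeConj (d.Bif σ)).conjTranspose))
        - imPart (Complex.I • (liftVec (Fin (R.rankR σ)) (p.bc σ) * (liftVec (Fin (R.rankR σ)) (p.bc σ)).conjTranspose)))) := by
  have h1 := (hd.end_right σ).sub_const (imQuat fun j => p.tc (σ + 1) j • 1)
  have h2 : imQuat (fun j => ((ν σ j : ℝ) : ℂ) • 1)
      + imPart (Complex.I • (chargeConj (d.Bif σ) * (chargeConj (d.Bif σ)).conjTranspose))
        - imQuat (fun j => p.tc (σ + 1) j • 1)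
      = imPart (Complex.I • (chargeConj (d.Bif σ) * (chargeConj (d.Bif σ)).conjTranspose))
        - imPart (Complex.I • (liftVec (Fin (R.rankR σ)) (p.bc σ) * (liftVec (Fin (R.rankR σ)) (p.bc σ)).conjTranspose)) := by
    rw [imPart_liftVec, imQuat_smul_one, imQuat_smul_one, p.quat_tc_right, Matrix.add_kronecker]
    abel
  rw [h2] at h1
  refine h1.congr' ?_
  filter_upwards [Ioo_mem_nhdsGT (R.lo_lt_hi (σ + 1) 0)] with s hs
  exact (imQuat_relT d p hs).symm

theorem tendsto_f_left (f : TermSection R) (σ : Fin k) (α : Fin (R.n σ + 1)) :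
    Tendsto (f.f σ α) (𝓝[>] (R.lo σ α)) (𝓝 (f.f σ α (R.lo σ α))) :=
  ((f.h1 σ α).isAC.continuousOn _ (left_mem_Icc.2 (R.lo_lt_hi σ α).le)).mono_left
    (nhdsWithin_le_of_mem (Icc_mem_nhdsGT (R.lo_lt_hi σ α)))

theorem tendsto_f_right (f : TermSection R) (σ : Fin k) (α : Fin (R.n σ + 1)) :
    Tendsto (f.f σ α) (𝓝[<] (R.hi σ α)) (𝓝 (f.f σ α (R.hi σ α))) :=
  ((f.h1 σ α).isAC.continuousOn _ (right_mem_Icc.2 (R.lo_lt_hi σ α).le)).mono_left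
    (nhdsWithin_le_of_mem (Icc_mem_nhdsLT (R.lo_lt_hi σ α)))

variable (d p f) in
/-- The quadratic form on one subinterval is bounded by that on another one. -/
def GLe (σ : Fin k) (α : Fin (R.n σ + 1)) (τ : Fin k) (β : Fin (R.n τ + 1)) : Prop :=
  ∀ s ∈ Ioo (R.lo σ α) (R.hi σ α), ∀ s' ∈ Ioo (R.lo τ β) (R.hi τ β),
    gRe d p f σ α s ≤ gRe d p f τ β s'

theorem GLe.trans {σ τ υ : Fin k} {α : Fin (R.n σ + 1)} {β : Fin (R.n τ + 1)} {γ : Fin (R.n υ + 1)}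
    (h : GLe d p f σ α τ β) (h' : GLe d p f τ β υ γ) : GLe d p f σ α υ γ := fun s hs s' hs' => by
  obtain ⟨x, hx⟩ := exists_between (R.lo_lt_hi τ β)
  exact (h s hs x hx).trans (h' x hx s' hs')

/-- The limits at an edge of the quadratic forms on the adjacent intervals. -/
theorem exists_edge_limits (hd : d.IsSolution ν)
    (hb : ∀ σ α, ∀ᵐ s ∂volume.restrict (Ioc (R.lo σ α) (R.hi σ α)), diracBulk d p f σ α s = 0)
    (hp : diracPlus d p f = 0) (hm : diracMinus d p f = 0) (σ : Fin k) :
    ∃ x y : ℝ, (∀ s ∈ Ioo (R.lo σ (Fin.last _)) (R.hi σ (Fin.last _)),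
        gRe d p f σ (Fin.last _) s ≤ x) ∧
      (∀ s ∈ Ioo (R.lo (σ + 1) 0) (R.hi (σ + 1) 0), y ≤ gRe d p f (σ + 1) 0 s) ∧
      Tendsto (gRe d p f σ (Fin.last _)) (𝓝[<] (B.len σ)) (𝓝 x) ∧
      Tendsto (gRe d p f (σ + 1) 0) (𝓝[>] 0) (𝓝 y) ∧
      x - y = -(1 / 2) * (edgeDefect (d.Bif σ) (p.b σ) (f.f σ (Fin.last _) (B.len σ))
        (f.f (σ + 1) 0 0)).re := by
  have hf1 := tendsto_f_right f σ (Fin.last _)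
  rw [R.hi_last] at hf1
  have h1 := (Complex.continuous_re.tendsto _).comp
    (tendsto_quad (tendsto_imQuat_relT_left hd p σ) hf1)
  have h2 := (Complex.continuous_re.tendsto _).comp
    (tendsto_quad (tendsto_imQuat_relT_right hd p σ) (tendsto_f_left f (σ + 1) 0))
  refine ⟨_, _, ?_, ?_, h1, h2, ?_⟩
  · intro s hs
    refine le_of_frequently_right (gRe_monotoneOn hd hb σ _) (frequently_of_tendsto_right ?_) hs
    rw [R.hi_last]
    exact h1
  · intro s hs
    exact le_of_frequently_left (gRe_monotoneOn hd hb (σ + 1) 0) (frequently_of_tendsto_left h2) hs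
  · have hp' := congrFun hp σ
    have hm' := congrFun hm σ
    rw [diracPlus, Pi.zero_apply, sub_eq_zero] at hp'
    rw [diracMinus, Pi.zero_apply, sub_eq_zero, p.bc_eq] at hm'
    have h3 := congrArg Complex.re (edge_quad (d.Bif σ) (p.b σ) _ _ hp' hm')
    rw [Complex.sub_re] at h3
    rw [p.bc_eq]
    refine h3.trans ?_
    rw [show (-(1 / 2) : ℂ) = ((-(1 / 2) : ℝ) : ℂ) by push_cast; rfl, Complex.re_ofReal_mul]

theorem gLe_edge (hd : d.IsSolution ν)
    (hb : ∀ σ α, ∀ᵐ s ∂volume.restrict (Ioc (R.lo σ α) (R.hi σ α)), diracBulk d p f σ α s = 0)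
    (hp : diracPlus d p f = 0) (hm : diracMinus d p f = 0) (σ : Fin k) :
    GLe d p f σ (Fin.last _) (σ + 1) 0 := fun s hs s' hs' => by
  obtain ⟨x, y, hx, hy, -, -, hxy⟩ := exists_edge_limits hd hb hp hm σ
  have := edgeDefect_nonneg (d.Bif σ) (p.b σ) (f.f σ (Fin.last _) (B.len σ)) (f.f (σ + 1) 0 0)
  linarith [hx s hs, hy s' hs']

/-- The form increases across the edge by half the defect, so the reverse inequality forces every
square in the defect to vanish. -/
theorem edgeLinked_of_gLe (hd : d.IsSolution ν)
    (hb : ∀ σ α, ∀ᵐ s ∂volume.restrict (Ioc (R.lo σ α) (R.hi σ α)), diracBulk d p f σ α s = 0)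
    (hp : diracPlus d p f = 0) (hm : diracMinus d p f = 0) (σ : Fin k)
    (h : GLe d p f (σ + 1) 0 σ (Fin.last _)) :
    EdgeLinked (d.Bif σ) (p.b σ) (f.f σ (Fin.last _) (B.len σ)) (f.f (σ + 1) 0 0) := by
  obtain ⟨x, y, hx, hy, -, -, hxy⟩ := exists_edge_limits hd hb hp hm σ
  obtain ⟨s, hs⟩ := exists_between (R.lo_lt_hi σ (Fin.last _))
  obtain ⟨s', hs'⟩ := exists_between (R.lo_lt_hi (σ + 1) 0)
  refine edgeLinked_of_edgeDefect ?_
  linarith [hx s hs, hy s' hs', h s' hs' s hs]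

end EdgeLe

end

/-! ### The matching conditions at the `λ`-points -/

section Pole

theorem not_integrableOn_inv_sub_left {a b : ℝ} (hab : a < b) :
    ¬ IntegrableOn (fun s => (s - a)⁻¹) (Ioc a b) := fun h => by
  have := intervalIntegrable_sub_inv_iff.1 ((intervalIntegrable_iff_integrableOn_Ioc_of_le hab.le).2 h)
  exact this.elim hab.ne fun h => h left_mem_uIcc

theorem not_integrableOn_inv_sub_right {a b : ℝ} (hab : a < b) :
    ¬ IntegrableOn (fun s => (s - b)⁻¹) (Ioc a b) := fun h => by
  have := intervalIntegrable_sub_inv_iff.1 ((intervalIntegrable_iff_integrableOn_Ioc_of_le hab.le).2 h)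
  exact this.elim hab.ne fun h => h right_mem_uIcc

theorem integrableOn_inv_of_le {a b x₀ ε : ℝ} (hε : 0 < ε) {r : ℝ → ℝ}
    (h : IntegrableOn (fun s => (s - x₀)⁻¹ * r s) (Ioc a b)) (hr : ∀ s ∈ Ioo a b, ε ≤ |r s|) :
    IntegrableOn (fun s => (s - x₀)⁻¹) (Ioc a b) := by
  refine (h.norm.const_mul ε⁻¹).mono' ((measurable_id.sub_const x₀).inv.aestronglyMeasurable) ?_
  refine ae_Ioc_of_forall_Ioo fun s hs => ?_
  rw [norm_mul, mul_left_comm, Real.norm_eq_abs (r s)]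
  refine le_mul_of_one_le_right (norm_nonneg _) ?_
  rw [inv_mul_eq_div, one_le_div hε]
  exact hr s hs

/-- If |r| ≥ ε held near a, then 1/(s − a) would be integrable there. This gives smallness along a
sequence, not a limit. -/
theorem frequently_abs_lt_left {a b ε : ℝ} (hab : a < b) (hε : 0 < ε) {r : ℝ → ℝ}
    (h : IntegrableOn (fun s => (s - a)⁻¹ * r s) (Ioc a b)) : ∃ᶠ s in 𝓝[>] a, |r s| < ε := by
  intro hn
  have h1 : ∀ᶠ s in 𝓝[>] a, ε ≤ |r s| := hn.mono fun s hs => not_lt.1 hs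
  obtain ⟨c, hc, hsub⟩ := (mem_nhdsGT_iff_exists_Ioo_subset' hab).1 h1
  have hac : a < min c b := lt_min hc hab
  exact not_integrableOn_inv_sub_left hac (integrableOn_inv_of_le hε
    (h.mono_set (Ioc_subset_Ioc_right (min_le_right _ _))) fun s hs =>
      hsub ⟨hs.1, hs.2.trans_le (min_le_left _ _)⟩)

theorem frequently_abs_lt_right {a b ε : ℝ} (hab : a < b) (hε : 0 < ε) {r : ℝ → ℝ}
    (h : IntegrableOn (fun s => (s - b)⁻¹ * r s) (Ioc a b)) : ∃ᶠ s in 𝓝[<] b, |r s| < ε := by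
  intro hn
  have h1 : ∀ᶠ s in 𝓝[<] b, ε ≤ |r s| := hn.mono fun s hs => not_lt.1 hs
  obtain ⟨c, hc, hsub⟩ := (mem_nhdsLT_iff_exists_Ioo_subset' hab).1 h1
  have hac : max c a < b := max_lt hc hab
  exact not_integrableOn_inv_sub_right hac (integrableOn_inv_of_le hε
    (h.mono_set (Ioc_subset_Ioc_left (le_max_right _ _))) fun s hs =>
      hsub ⟨(le_max_left _ _).trans_lt hs.1, hs.2⟩)

theorem kronecker_imQuat_kronecker {ι κ : Type*} [Fintype ι] [Fintype κ] (C : Matrix κ ι ℂ)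
    (D : Fin 3 → Matrix ι ι ℂ) :
    ((1 : Matrix (Fin 2) (Fin 2) ℂ) ⊗ₖ C) * imQuat D
        * ((1 : Matrix (Fin 2) (Fin 2) ℂ) ⊗ₖ C.conjTranspose)
      = imQuat fun j => C * D j * C.conjTranspose := by
  simp only [imQuat, Matrix.mul_sum, Matrix.sum_mul, ← Matrix.mul_kronecker_mul,
    one_mul, mul_one]

theorem star_dotProduct_conj {V : Type*} [Fintype V] {Y : Matrix V V ℂ} (hY : Y.IsHermitian)
    (u v : V → ℂ) : star v ⬝ᵥ Y.mulVec u = star (star u ⬝ᵥ Y.mulVec v) := by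
  rw [Matrix.star_dotProduct, Matrix.star_mulVec, hY.eq, Matrix.dotProduct_mulVec]

theorem isHermitian_I_imQuat {ι : Type*} {D : Fin 3 → Matrix ι ι ℂ} (hD : ∀ j, (D j).IsHermitian) :
    (Complex.I • imQuat D).IsHermitian := by
  rw [Matrix.IsHermitian, Matrix.conjTranspose_smul, imQuat_conjTranspose, Complex.star_def,
    Complex.conj_I, neg_smul, smul_neg, neg_neg]
  simp only [fun j => (hD j).eq]

/-- For Hermitian Y one has Re⟨v, Yv⟩ − Re⟨q, Yq⟩ = Re⟨v − q, Y(v + q)⟩. With q the continuing part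
of v, the pole enters only through a product with the terminating part v − q. -/
theorem quadForm_re_split {ι κ : Type*} [Fintype ι] [Fintype κ] {D : Fin 3 → Matrix ι ι ℂ}
    (hD : ∀ j, (D j).IsHermitian) (C : Matrix κ ι ℂ) (v : Fin 2 × ι → ℂ) (g : Fin 2 × κ → ℂ) {q : Fin 2 × ι → ℂ}
    (hq : ((1 : Matrix (Fin 2) (Fin 2) ℂ) ⊗ₖ C.conjTranspose).mulVec g = q) :
    (quadForm D v).re = (quadForm (fun j => C * D j * C.conjTranspose) g).re
      + (star (v - q) ⬝ᵥ ((Complex.I • imQuat D).mulVec v + (Complex.I • imQuat D).mulVec q)).re := by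
  have h1 : quadForm (fun j => C * D j * C.conjTranspose) g
      = star q ⬝ᵥ (Complex.I • imQuat D).mulVec q := by
    rw [quadForm, ← kronecker_imQuat_kronecker, ← hq, Matrix.star_mulVec,
      Matrix.conjTranspose_kronecker, Matrix.conjTranspose_conjTranspose, Matrix.conjTranspose_one,
      ← Matrix.dotProduct_mulVec, Matrix.mulVec_mulVec, Matrix.mulVec_mulVec, Matrix.mul_smul,
      Matrix.smul_mul]
  have h2 : (star q ⬝ᵥ (Complex.I • imQuat D).mulVec v).re
      = (star v ⬝ᵥ (Complex.I • imQuat D).mulVec q).re := by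
    rw [star_dotProduct_conj (isHermitian_I_imQuat hD) v q, Complex.star_def, Complex.conj_re]
  rw [h1, quadForm, star_sub, sub_dotProduct, dotProduct_add, dotProduct_add, Complex.sub_re,
    Complex.add_re, Complex.add_re, h2]
  ring

/-- Write Pf for the continuing part of f and X = ∑ eⱼDⱼ. The remainder is r = Re⟨f − Pf, iXf +
iXPf⟩. Here (f − Pf)/(s − x₀) is square integrable by hypothesis, and both terms on the right of the
pairing are square integrable although X has a pole. Hence r/(s − x₀) is integrable. -/
theorem exists_pole_remainder {ι κ : Type*} [Fintype ι] [Fintype κ] {a b x₀ : ℝ}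
    {f f' : ℝ → Fin 2 × ι → ℂ} (hf : IsH1 a b f f') {D₀ : ℝ → Matrix ι ι ℂ}
    {D : Fin 3 → ℝ → Matrix ι ι ℂ} {C : Matrix κ ι ℂ} {ρ : Fin 3 → Matrix ι ι ℂ}
    (hf' : ∀ᵐ s ∂volume.restrict (Ioc a b), f' s = -(diracMat (D₀ s) fun j => D j s).mulVec (f s))
    (hD₀ : SqIntOn D₀ (Ioc a b)) (hh₀ : ∀ s ∈ Ioo a b, (D₀ s).IsHermitian)
    (hh : ∀ j, ∀ s ∈ Ioo a b, (D j s).IsHermitian) (hρ : ∀ j, ρ j * C.conjTranspose = 0)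
    (hS : ∀ j, SqIntOn (fun s => D j s + (Complex.I / (2 * ((s - x₀ : ℝ) : ℂ))) • ρ j) (Ioc a b))
    (hdiv : MemLp (fun s => (s - x₀)⁻¹ • (f s
      - ((1 : Matrix (Fin 2) (Fin 2) ℂ) ⊗ₖ C.conjTranspose).mulVec
        (((1 : Matrix (Fin 2) (Fin 2) ℂ) ⊗ₖ C).mulVec (f s)))) 2 (volume.restrict (Ioc a b))) :
    ∃ r : ℝ → ℝ, IntegrableOn (fun s => (s - x₀)⁻¹ * r s) (Ioc a b) ∧
      ∀ s ∈ Ioo a b, (quadForm (fun j => D j s) (f s)).re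
        = (quadForm (fun j => C * D j s * C.conjTranspose)
          (((1 : Matrix (Fin 2) (Fin 2) ℂ) ⊗ₖ C).mulVec (f s))).re + r s := by
  set P := (1 : Matrix (Fin 2) (Fin 2) ℂ) ⊗ₖ C.conjTranspose with hP
  set G := (1 : Matrix (Fin 2) (Fin 2) ℂ) ⊗ₖ C with hG
  refine ⟨fun s => (star (f s - P.mulVec (G.mulVec (f s))) ⬝ᵥ
    ((Complex.I • imQuat fun j => D j s).mulVec (f s)
      + (Complex.I • imQuat fun j => D j s).mulVec (P.mulVec (G.mulVec (f s))))).re, ?_,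
    fun s hs => quadForm_re_split (fun j => hh j s hs) C (f s) _ rfl⟩
  have hc : ContinuousOn f (Icc a b) := hf.isAC.continuousOn
  have hcg : ContinuousOn (fun s => G.mulVec (f s)) (Icc a b) :=
    (mulCLM G).continuous.comp_continuousOn hc
  have m1 : MemLp (fun s => ((1 : Matrix (Fin 2) (Fin 2) ℂ) ⊗ₖ D₀ s).mulVec (f s)) 2
      (volume.restrict (Ioc a b)) :=
    (hD₀.kronecker 1).mulVec measurableSet_Ioc Ioc_subset_Icc_self hc
  have hk : ∀ s, imQuat (fun j => D j s + (Complex.I / (2 * ((s - x₀ : ℝ) : ℂ))) • ρ j) * P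
      = imQuat (fun j => D j s) * P := fun s => by
    have h0 : imQuat ρ * P = 0 := by
      rw [hP, imQuat, Matrix.sum_mul]
      simp only [← Matrix.mul_kronecker_mul, hρ, Matrix.kronecker_zero, Finset.sum_const_zero]
    rw [imQuat_add, Matrix.add_mul, imQuat_smul, Matrix.smul_mul, h0, smul_zero, add_zero]
  -- The polar part annihilates the continuing subspace, so XP is square integrable.
  have m2 : MemLp (fun s => (imQuat (fun j => D j s) * P).mulVec (G.mulVec (f s))) 2
      (volume.restrict (Ioc a b)) := by
    refine SqIntOn.mulVec ?_ measurableSet_Ioc Ioc_subset_Icc_self hcg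
    have := (SqIntOn.imQuat hS).mul_continuousOn (G := fun _ => P) measurableSet_Ioc
      Ioc_subset_Icc_self continuousOn_const
    simpa only [hk] using this
  have m3 := (hf.1.add (m1.const_smul Complex.I)).add (m2.const_smul Complex.I)
  have m4 := (integrable_star_dotProduct hdiv m3).re
  refine m4.congr ?_
  filter_upwards [hf', ae_Ioc_of_forall_Ioo (p := fun s => s ∈ Ioo a b) fun s hs => hs]
    with s hs hm
  -- The Dirac equation expresses the apparently singular iXf through f′ and D₀f, both square
  -- integrable.
  have e1 : f' s + Complex.I • ((1 : Matrix (Fin 2) (Fin 2) ℂ) ⊗ₖ D₀ s).mulVec (f s)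
      = (Complex.I • imQuat fun j => D j s).mulVec (f s) := by
    rw [hs, diracMat_eq (hh₀ s hm) fun j => hh j s hm, smul_sub, Matrix.sub_mulVec,
      Matrix.smul_mulVec, Matrix.smul_mulVec]
    abel
  have e2 : Complex.I • (imQuat (fun j => D j s) * P).mulVec (G.mulVec (f s))
      = (Complex.I • imQuat fun j => D j s).mulVec (P.mulVec (G.mulVec (f s))) := by
    rw [Matrix.smul_mulVec, ← Matrix.mulVec_mulVec]
  simp only [Pi.add_apply, Pi.smul_apply, e1, e2]
  have e3 : ∀ (c : ℝ) (u v : Fin 2 × ι → ℂ), star (c • u) ⬝ᵥ v = (c : ℂ) * (star u ⬝ᵥ v) := by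
    intro c u v
    rw [show c • u = (c : ℂ) • u from rfl, star_smul, smul_dotProduct, Complex.star_def,
      Complex.conj_ofReal, smul_eq_mul]
  rw [e3]
  exact Complex.re_ofReal_mul _ _

end Pole

section

/-! ### Monotonicity across the `λ`-points -/

theorem tendsto_quadForm_re {ι : Type*} [Fintype ι] {l : Filter ℝ} {M : Fin 3 → ℝ → Matrix ι ι ℂ}
    {L : Fin 3 → Matrix ι ι ℂ} {v : ℝ → Fin 2 × ι → ℂ} {v₀ : Fin 2 × ι → ℂ}
    (hM : ∀ j, Tendsto (M j) l (𝓝 (L j))) (hv : Tendsto v l (𝓝 v₀)) :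
    Tendsto (fun s => (quadForm (fun j => M j s) (v s)).re) l (𝓝 (quadForm L v₀).re) := by
  have h1 : ∀ i, Tendsto (fun s => v s i) l (𝓝 (v₀ i)) := tendsto_pi_nhds.1 hv
  have h2 : ∀ j i i', Tendsto (fun s => M j s i i') l (𝓝 (L j i i')) := fun j i =>
    tendsto_pi_nhds.1 (tendsto_pi_nhds.1 (hM j) i)
  refine (Complex.continuous_re.tendsto _).comp ?_
  simp only [quadForm, imQuat, Matrix.mulVec, dotProduct, Matrix.smul_apply, Matrix.sum_apply,
    Matrix.kroneckerMap_apply]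
  exact tendsto_finsetSum _ fun i _ => (h1 i).star.mul (tendsto_finsetSum _ fun i' _ =>
    ((tendsto_finsetSum _ fun j _ => (h2 j i.2 i'.2).const_mul _).const_smul Complex.I).mul (h1 i'))

theorem frequently_lt_add_of_tendsto {l : Filter ℝ} {x r : ℝ → ℝ} {γ : ℝ} (hx : Tendsto x l (𝓝 γ))
    (hr : ∀ ε > 0, ∃ᶠ s in l, |r s| < ε) {ε : ℝ} (hε : 0 < ε) :
    ∃ᶠ s in l, γ - ε < x s + r s ∧ x s + r s < γ + ε := by
  have h1 : ∀ᶠ s in l, |x s - γ| < ε / 2 := by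
    simpa only [Real.dist_eq] using Metric.tendsto_nhds.1 hx _ (half_pos hε)
  refine ((hr _ (half_pos hε)).and_eventually h1).mono fun s hs => ?_
  have h2 := abs_lt.1 hs.1
  have h3 := abs_lt.1 hs.2
  exact ⟨by linarith, by linarith⟩

variable {k : ℕ} [NeZero k] {B : Bow k} {R : BowRep B} {ν : Fin k → Fin 3 → ℝ}
  {d : BowData R} {p : LevelSet B ν} {f : TermSection R}

theorem tendsto_relT {σ : Fin k} {α : Fin (R.n σ + 1)} {l : Filter ℝ}
    (hl : Ioo (R.lo σ α) (R.hi σ α) ∈ l) {κ : Type*} [DecidableEq κ]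
    {C : Matrix κ (Fin (R.rank σ α)) ℂ} (hC : C * C.conjTranspose = 1) {j : Fin 3}
    {L : Matrix κ κ ℂ} (h : Tendsto (fun s => C * d.T σ α j s * C.conjTranspose) l (𝓝 L)) :
    Tendsto (fun s => C * relT d p σ α j s * C.conjTranspose) l (𝓝 (L - p.tc σ j • 1)) := by
  refine (h.sub_const (p.tc σ j • 1)).congr' ?_
  filter_upwards [hl] with s hs
  rw [relT, p.t_eq_tc σ j (mem_Ioo_len hs), Matrix.mul_sub, Matrix.sub_mul, Matrix.mul_smul,
    Matrix.smul_mul, Matrix.mul_one, hC]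

theorem tendsto_relT' {σ : Fin k} {α : Fin (R.n σ + 1)} {l : Filter ℝ}
    (hl : Ioo (R.lo σ α) (R.hi σ α) ∈ l) {j : Fin 3} {L : Matrix _ _ ℂ}
    (h : Tendsto (d.T σ α j) l (𝓝 L)) :
    Tendsto (relT d p σ α j) l (𝓝 (L - p.tc σ j • 1)) := by
  have h1 := tendsto_relT (p := p) hl (C := 1) (j := j) (L := L) (d := d) (by simp) (by simpa using h)
  simpa using h1

theorem df_eq (hb : ∀ σ α, ∀ᵐ s ∂volume.restrict (Ioc (R.lo σ α) (R.hi σ α)),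
      diracBulk d p f σ α s = 0) (σ : Fin k) (α : Fin (R.n σ + 1)) :
    ∀ᵐ s ∂volume.restrict (Ioc (R.lo σ α) (R.hi σ α)),
      f.df σ α s = -(diracMat (relT0 d p σ α s) fun j => relT d p σ α j s).mulVec (f.f σ α s) := by
  filter_upwards [hb σ α] with s hs
  rw [diracBulk_eq, sub_eq_zero] at hs
  rw [← neg_neg (f.df σ α s), hs]
  rfl

theorem isH1_terminating {ι κ : Type*} [Fintype ι] [Fintype κ] {a b : ℝ}
    {f f' : ℝ → Fin 2 × ι → ℂ} (hf : IsH1 a b f f') (C : Matrix κ ι ℂ) :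
    ∃ g', IsH1 a b (fun s => f s - ((1 : Matrix (Fin 2) (Fin 2) ℂ) ⊗ₖ C.conjTranspose).mulVec
        (((1 : Matrix (Fin 2) (Fin 2) ℂ) ⊗ₖ C).mulVec (f s))) g' := by
  have h := IsSpectral.isH1_clm (ContinuousLinearMap.id ℂ (Fin 2 × ι → ℂ)
    - (mulCLM ((1 : Matrix (Fin 2) (Fin 2) ℂ) ⊗ₖ C.conjTranspose)).comp
      (mulCLM ((1 : Matrix (Fin 2) (Fin 2) ℂ) ⊗ₖ C))) hf
  exact ⟨_, h⟩

/-- On the smaller side the form has a limit. On the larger side it is the form of the continuing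
block, which has the same limit by the matching conditions, plus a remainder that is small along a
sequence. Monotonicity on each side turns this into inequalities at every point. -/
theorem gLe_up (hd : d.IsSolution ν)
    (hb : ∀ σ α, ∀ᵐ s ∂volume.restrict (Ioc (R.lo σ α) (R.hi σ α)), diracBulk d p f σ α s = 0)
    (σ : Fin k) (a : Fin (R.n σ)) (hlt : R.rank σ a.castSucc < R.rank σ a.succ) :
    GLe d p f σ a.castSucc σ a.succ := by
  obtain ⟨ε, h0, hP⟩ := d.pole_up σ a hlt
  have hlh := R.lo_lt_hi σ a.succ
  set c := min (R.lam σ a + ε / 2) ((R.lo σ a.succ + R.hi σ a.succ) / 2)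
  have hc1 : c ≤ R.lam σ a + ε / 2 := min_le_left _ _
  have hc2 : c ≤ (R.lo σ a.succ + R.hi σ a.succ) / 2 := min_le_right _ _
  have hc3 : R.lo σ a.succ < c := lt_min (by rw [R.lo_succ]; linarith) (by linarith)
  have hsub : Ioc (R.lo σ a.succ) c ⊆ Ioo (R.lo σ a.succ) (R.hi σ a.succ) := fun s hs =>
    ⟨hs.1, by linarith [hs.2]⟩
  have hsub' : Ioc (R.lo σ a.succ) c ⊆ Ioc (R.lo σ a.succ) (R.hi σ a.succ) :=
    hsub.trans Ioo_subset_Ioc_self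
  obtain ⟨ρ, hρ, hS⟩ := hP.exists_sqIntOn (sqIntOn_Ioc_of_Ioo (d.T0_L2 σ a.succ))
    (d.T0_herm σ a.succ) hlh (Or.inl rfl) (A' := Ioc (R.lo σ a.succ) c) measurableSet_Ioc
    (fun s hs => ⟨hs.1, by linarith [hs.2]⟩) hsub'
  have hK : (R.kap σ a).conjTranspose * (R.kap σ a).conjTranspose.conjTranspose = 1 := by
    rw [Matrix.conjTranspose_conjTranspose, R.kap_up σ a hlt.le]
  have hf := (f.h1 σ a.succ).mono le_rfl (by linarith : c ≤ R.hi σ a.succ)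
  obtain ⟨g', hg⟩ := isH1_terminating hf (R.kap σ a).conjTranspose
  have hm := f.match_right σ a
  have hm' := f.match_left σ a
  obtain ⟨r, hr, hr'⟩ := exists_pole_remainder (x₀ := R.lam σ a) hf
    (ae_restrict_of_ae_restrict_of_subset hsub' (df_eq hb σ a.succ))
    ((sqIntOn_relT0 d p σ a.succ).mono hsub')
    (fun s hs => relT0_isHermitian d p (hsub (Ioo_subset_Ioc_self hs)))
    (fun j s hs => relT_isHermitian d p j (hsub (Ioo_subset_Ioc_self hs)))
    hρ.cont
    (fun j => sqIntOn_Ioc_of_Ioo (sqIntOn_add_relT d p le_rfl (by linarith)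
          ((hS j).mono Ioo_subset_Ioc_self)))
    (hg.memLp_div (by
      rw [R.lo_succ, ← hm', Matrix.conjTranspose_conjTranspose, ← hm, sub_self]))
  choose L hL1 hL2 using hd.cont_up σ a hlt
  have hl1 : Ioo (R.lo σ a.castSucc) (R.hi σ a.castSucc) ∈ 𝓝[<] (R.lam σ a) := by
    rw [R.hi_castSucc]
    exact Ioo_mem_nhdsLT (by simpa using R.lo_lt_hi σ a.castSucc)
  have hl2 : Ioo (R.lo σ a.succ) (R.hi σ a.succ) ∈ 𝓝[>] (R.lam σ a) := Ioo_mem_nhdsGT hlh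
  have ht1 := tendsto_f_right f σ a.castSucc
  have ht2 := tendsto_f_left f σ a.succ
  rw [R.hi_castSucc, hm'] at ht1
  have q1 := tendsto_quadForm_re (fun j => tendsto_relT' (p := p) hl1 (hL1 j)) ht1
  have q2 := tendsto_quadForm_re (fun j => tendsto_relT (p := p) hl2 hK
    (by simpa only [Matrix.conjTranspose_conjTranspose] using hL2 j))
    (((mulCLM ((1 : Matrix (Fin 2) (Fin 2) ℂ) ⊗ₖ (R.kap σ a).conjTranspose)).continuous.tendsto
      _).comp ht2)
  intro s hs s' hs'
  refine le_trans (b := (quadForm (fun j => L j - p.tc σ j • 1)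
      (((1 : Matrix (Fin 2) (Fin 2) ℂ) ⊗ₖ (R.kap σ a).conjTranspose).mulVec
        (f.f σ a.succ (R.lam σ a)))).re)
    (le_of_frequently_right (gRe_monotoneOn hd hb σ _) (frequently_of_tendsto_right ?_) hs)
    (le_of_frequently_left (gRe_monotoneOn hd hb σ a.succ) (fun ε hε => ?_) hs')
  · rw [R.hi_castSucc]
    exact q1
  · have h2 := frequently_lt_add_of_tendsto q2
      (fun ε hε => frequently_abs_lt_left hc3 hε hr) hε
    refine (h2.and_eventually (Ioo_mem_nhdsGT hc3)).mono fun x hx => ?_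
    rw [gRe, hr' x hx.2]
    exact hx.1.1

theorem gLe_down (hd : d.IsSolution ν)
    (hb : ∀ σ α, ∀ᵐ s ∂volume.restrict (Ioc (R.lo σ α) (R.hi σ α)), diracBulk d p f σ α s = 0)
    (σ : Fin k) (a : Fin (R.n σ)) (hlt : R.rank σ a.succ < R.rank σ a.castSucc) :
    GLe d p f σ a.castSucc σ a.succ := by
  obtain ⟨ε, h0, hP⟩ := d.pole_down σ a hlt
  have hlh := R.lo_lt_hi σ a.castSucc
  have hhi := R.hi_castSucc σ a
  set c := max (R.lam σ a - ε / 2) ((R.lo σ a.castSucc + R.hi σ a.castSucc) / 2)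
  have hc1 : R.lam σ a - ε / 2 ≤ c := le_max_left _ _
  have hc2 : (R.lo σ a.castSucc + R.hi σ a.castSucc) / 2 ≤ c := le_max_right _ _
  have hc3 : c < R.hi σ a.castSucc := max_lt (by rw [R.hi_castSucc]; linarith) (by linarith)
  have hsub : Ioo c (R.hi σ a.castSucc) ⊆ Ioo (R.lo σ a.castSucc) (R.hi σ a.castSucc) :=
    fun s hs => ⟨by linarith [hs.1], hs.2⟩
  have hsub' : Ioc c (R.hi σ a.castSucc) ⊆ Ioc (R.lo σ a.castSucc) (R.hi σ a.castSucc) :=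
    Ioc_subset_Ioc_left (by linarith)
  obtain ⟨ρ, hρ, hS⟩ := hP.exists_sqIntOn (sqIntOn_Ioc_of_Ioo (d.T0_L2 σ a.castSucc))
    (d.T0_herm σ a.castSucc) hlh (Or.inr hhi.symm) (A' := Ioo c (R.hi σ a.castSucc))
    measurableSet_Ioo
    (fun s hs => ⟨by linarith [hs.1], by linarith [hs.2]⟩) (hsub.trans Ioo_subset_Ioc_self)
  have hK := R.kap_down σ a hlt.le
  have hf := (f.h1 σ a.castSucc).mono (by linarith : R.lo σ a.castSucc ≤ c) le_rfl
  obtain ⟨g', hg⟩ := isH1_terminating hf (R.kap σ a)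
  have hm := f.match_right σ a
  have hm' := f.match_left σ a
  have hdiv := hg.memLp_div_right (by rw [hhi, ← hm, ← hm', sub_self])
  rw [hhi] at hdiv
  obtain ⟨r, hr, hr'⟩ := exists_pole_remainder (x₀ := R.lam σ a) hf
    (ae_restrict_of_ae_restrict_of_subset hsub' (df_eq hb σ a.castSucc))
    ((sqIntOn_relT0 d p σ a.castSucc).mono hsub')
    (fun s hs => relT0_isHermitian d p (hsub hs))
    (fun j s hs => relT_isHermitian d p j (hsub hs))
    hρ.cont
    (fun j => sqIntOn_Ioc_of_Ioo (sqIntOn_add_relT d p (by linarith) le_rfl (hS j)))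
    (by rw [hhi]; exact hdiv)
  choose L hL1 hL2 using hd.cont_down σ a hlt
  have hl1 : Ioo (R.lo σ a.castSucc) (R.hi σ a.castSucc) ∈ 𝓝[<] (R.lam σ a) := by
    rw [R.hi_castSucc]
    exact Ioo_mem_nhdsLT (by simpa using R.lo_lt_hi σ a.castSucc)
  have hl2 : Ioo (R.lo σ a.succ) (R.hi σ a.succ) ∈ 𝓝[>] (R.lam σ a) :=
    Ioo_mem_nhdsGT (R.lo_lt_hi σ a.succ)
  have ht1 := tendsto_f_right f σ a.castSucc
  have ht2 := tendsto_f_left f σ a.succ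
  rw [R.lo_succ, hm] at ht2
  rw [hhi] at ht1 hr hc3
  have q2 := tendsto_quadForm_re (fun j => tendsto_relT' (p := p) hl2 (hL1 j)) ht2
  have q1 := tendsto_quadForm_re (fun j => tendsto_relT (p := p) hl1 hK (hL2 j))
    (((mulCLM ((1 : Matrix (Fin 2) (Fin 2) ℂ) ⊗ₖ R.kap σ a)).continuous.tendsto _).comp ht1)
  intro s hs s' hs'
  refine le_trans (b := (quadForm (fun j => L j - p.tc σ j • 1)
      (((1 : Matrix (Fin 2) (Fin 2) ℂ) ⊗ₖ R.kap σ a).mulVec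
        (f.f σ a.castSucc (R.lam σ a)))).re)
    (le_of_frequently_right (gRe_monotoneOn hd hb σ _) (fun ε hε => ?_) hs)
    (le_of_frequently_left (gRe_monotoneOn hd hb σ a.succ) (frequently_of_tendsto_left ?_) hs')
  · have h2 := frequently_lt_add_of_tendsto q1
      (fun ε hε => frequently_abs_lt_right hc3 hε hr) hε
    rw [hhi]
    refine (h2.and_eventually (Ioo_mem_nhdsLT hc3)).mono fun x hx => ?_
    rw [gRe, hr' x (by rw [hhi]; exact hx.2)]
    exact hx.1.2
  · exact q2

/-- The form jumps by ⟨w, i Im(i qq†) w⟩ with w = f(λ+). Of its two parts the negative one is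
−|q†w|², which vanishes by the Q-component of the Dirac equation; the trace part is a non-negative
sum of squares. -/
theorem gLe_eq (hd : d.IsSolution ν)
    (hb : ∀ σ α, ∀ᵐ s ∂volume.restrict (Ioc (R.lo σ α) (R.hi σ α)), diracBulk d p f σ α s = 0)
    (hQ : diracLam d f = 0) (σ : Fin k) (a : Fin (R.n σ))
    (heq : R.rank σ a.castSucc = R.rank σ a.succ) : GLe d p f σ a.castSucc σ a.succ := by
  set K := (1 : Matrix (Fin 2) (Fin 2) ℂ) ⊗ₖ R.kap σ a with hKdef
  obtain ⟨L, h1, h2⟩ := hd.jump ⟨⟨σ, a⟩, heq⟩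
  set q := d.Q ⟨⟨σ, a⟩, heq⟩
  have hq : star q ⬝ᵥ f.f σ a.succ (R.lam σ a) = 0 :=
    neg_eq_zero.1 (congrFun hQ ⟨⟨σ, a⟩, heq⟩)
  have hK : R.kap σ a * (R.kap σ a).conjTranspose = 1 := R.kap_down σ a heq.ge
  have hm := f.match_right σ a
  have hm' := f.match_left σ a
  have hKh : K.conjTranspose = (1 : Matrix (Fin 2) (Fin 2) ℂ) ⊗ₖ (R.kap σ a).conjTranspose := by
    rw [hKdef, Matrix.conjTranspose_kronecker, Matrix.conjTranspose_one]
  rw [← hKh] at hm'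
  rw [← hKdef] at hm
  have hl1 : Ioo (R.lo σ a.castSucc) (R.hi σ a.castSucc) ∈ 𝓝[<] (R.lam σ a) := by
    rw [R.hi_castSucc]
    exact Ioo_mem_nhdsLT (by simpa using R.lo_lt_hi σ a.castSucc)
  have hl2 : Ioo (R.lo σ a.succ) (R.hi σ a.succ) ∈ 𝓝[>] (R.lam σ a) :=
    Ioo_mem_nhdsGT (R.lo_lt_hi σ a.succ)
  have X1 : Tendsto (fun s => imQuat fun j => relT d p σ a.castSucc j s) (𝓝[<] (R.lam σ a))
      (𝓝 (L - imQuat fun j => p.tc σ j • 1)) := by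
    refine (h1.sub_const _).congr' ?_
    filter_upwards [hl1] with s hs
    exact (imQuat_relT d p hs).symm
  have X2 : Tendsto (fun s => imQuat fun j => relT d p σ a.succ j s) (𝓝[>] (R.lam σ a))
      (𝓝 (K * L * K.conjTranspose + imPart (Complex.I • Matrix.vecMulVec q (star q))
        - imQuat fun j => p.tc σ j • 1)) := by
    refine (h2.sub_const _).congr' ?_
    filter_upwards [hl2] with s hs
    exact (imQuat_relT d p hs).symm
  have ht1 := tendsto_f_right f σ a.castSucc
  have ht2 := tendsto_f_left f σ a.succ
  rw [R.hi_castSucc] at ht1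
  have q1 := (Complex.continuous_re.tendsto _).comp (tendsto_quad X1 ht1)
  have q2 := (Complex.continuous_re.tendsto _).comp (tendsto_quad X2 ht2)
  intro s hs s' hs'
  have le1 := le_of_frequently_right (gRe_monotoneOn hd hb σ a.castSucc)
    (frequently_of_tendsto_right (by rw [R.hi_castSucc]; exact q1)) hs
  have le2 := le_of_frequently_left (gRe_monotoneOn hd hb σ a.succ)
    (frequently_of_tendsto_left q2) hs'
  refine le1.trans (le_trans ?_ le2)
  rw [R.lo_succ]
  set u := f.f σ a.castSucc (R.lam σ a)
  set w := f.f σ a.succ (R.lam σ a)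
  have hvec : Matrix.vecMulVec q (star q)
      = Matrix.replicateCol Unit q * (Matrix.replicateCol Unit q).conjTranspose := by
    ext x y
    simp [Matrix.vecMulVec_apply, Matrix.mul_apply]
  have hz : (Matrix.replicateCol Unit q).conjTranspose.mulVec w = 0 := by
    ext i
    exact hq
  set J₀ := imQuat fun j => p.tc σ j • (1 : Matrix (Fin (R.rank σ a.castSucc))
    (Fin (R.rank σ a.castSucc)) ℂ)
  set J₁ := imQuat fun j => p.tc σ j • (1 : Matrix (Fin (R.rank σ a.succ))
    (Fin (R.rank σ a.succ)) ℂ)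
  set N := imPart (Complex.I • Matrix.vecMulVec q (star q)) with hN
  have hI : K * J₀ * K.conjTranspose = J₁ := by
    rw [hKh, hKdef, kronecker_imQuat_kronecker]
    refine congrArg imQuat (funext fun j => ?_)
    rw [Matrix.mul_smul, Matrix.smul_mul, Matrix.mul_one, hK]
  have e1 : star w ⬝ᵥ (Complex.I • (K * L * K.conjTranspose + N - J₁)).mulVec w
      = star u ⬝ᵥ (Complex.I • (L - J₀)).mulVec u
        + 1 / 2 * ∑ x, ∑ c, nsq ((comp (Matrix.replicateCol Unit q) x).conjTranspose.mulVec
          (vcomp w c)) := by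
    have e2 : K * L * K.conjTranspose + N - J₁ = K * (L - J₀) * K.conjTranspose + N := by
      rw [Matrix.mul_sub, Matrix.sub_mul, hI]
      abel
    have e3 : star w ⬝ᵥ (Complex.I • (K * (L - J₀) * K.conjTranspose)).mulVec w
        = star u ⬝ᵥ (Complex.I • (L - J₀)).mulVec u := by
      rw [hm', Matrix.star_mulVec, Matrix.conjTranspose_conjTranspose, ← Matrix.dotProduct_mulVec,
        Matrix.mulVec_mulVec, Matrix.mulVec_mulVec, Matrix.mul_smul, Matrix.smul_mul]
    rw [e2, smul_add, Matrix.add_mulVec, dotProduct_add, e3, hN, imPart_smul, smul_smul,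
      Complex.I_mul_I, neg_smul, one_smul, Matrix.neg_mulVec, dotProduct_neg, hvec, quad_imPart, hz]
    simp [nsq]
  rw [e1, Complex.add_re]
  have e4 : (0 : ℝ) ≤ (1 / 2 * ∑ x, ∑ c, nsq ((comp (Matrix.replicateCol Unit q) x).conjTranspose.mulVec
          (vcomp w c))).re := by
    rw [show (1 / 2 : ℂ) = ((1 / 2 : ℝ) : ℂ) by push_cast; rfl, Complex.re_ofReal_mul]
    simp only [Complex.re_sum]
    exact mul_nonneg (by norm_num) (Finset.sum_nonneg fun x _ => Finset.sum_nonneg fun c _ =>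
      nsq_nonneg _)
  linarith

theorem gLe_lam (hd : d.IsSolution ν)
    (hb : ∀ σ α, ∀ᵐ s ∂volume.restrict (Ioc (R.lo σ α) (R.hi σ α)), diracBulk d p f σ α s = 0)
    (hQ : diracLam d f = 0) (σ : Fin k) (a : Fin (R.n σ)) :
    GLe d p f σ a.castSucc σ a.succ := by
  rcases lt_trichotomy (R.rank σ a.castSucc) (R.rank σ a.succ) with h | h | h
  · exact gLe_up hd hb σ a h
  · exact gLe_eq hd hb hQ σ a h
  · exact gLe_down hd hb σ a h

end

section

/-! ### Solutions of the Dirac equation are parallel -/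

theorem IsAC.cexp {a b : ℝ} {F F' : ℝ → ℂ} (h : IsAC a b F F') (hab : a ≤ b) :
    IsAC a b (fun s => Complex.exp (F s)) (fun s => Complex.exp (F s) * F' s) := by
  obtain ⟨M, hM0, hM⟩ := h.exists_bound
  have hc : ContinuousOn (fun s => Complex.exp (F s)) (Icc a b) :=
    Complex.continuous_exp.comp_continuousOn h.continuousOn
  refine of_absolutelyContinuous hab ?_ ?_ ?_
  · refine absolutelyContinuousOnInterval_of_norm_sub_le hab (C := Real.exp M) h.1.norm
      fun x y hx hxy hy => ?_
    have h1 : ‖Complex.exp (F y) - Complex.exp (F x)‖ ≤ Real.exp M * ‖F y - F x‖ := by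
      refine Convex.norm_image_sub_le_of_norm_deriv_le (s := Metric.closedBall 0 M)
        (fun z _ => Complex.differentiableAt_exp) (fun z hz => ?_) (convex_closedBall _ _)
        (mem_closedBall_zero_iff.2 (hM x ⟨hx, hxy.trans hy⟩))
        (mem_closedBall_zero_iff.2 (hM y ⟨hx.trans hxy, hy⟩))
      rw [Complex.deriv_exp]
      exact (Complex.norm_exp_le_exp_norm z).trans (Real.exp_le_exp.2 (mem_closedBall_zero_iff.1 hz))
    exact h1.trans (mul_le_mul_of_nonneg_left (h.norm_sub_le hx hxy hy) (Real.exp_pos _).le)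
  · rw [← integrableOn_Icc_iff_integrableOn_Ioc]
    exact ((integrableOn_Icc_iff_integrableOn_Ioc).2 h.1).continuousOn_mul hc isCompact_Icc
  · filter_upwards [h.ae_hasDerivAt] with x hx hxm
    exact (hx hxm).cexp

theorem Fin.cyclic_induction_of {k : ℕ} [NeZero k] {P : Fin k → Prop} {σ₀ : Fin k} (h0 : P σ₀)
    (h : ∀ σ, P σ → P (σ + 1)) (σ : Fin k) : P σ := by
  have := Fin.cyclic_induction (P := fun τ => P (σ₀ + τ)) (by simpa using h0)
    (fun τ hτ => by rw [← add_assoc]; exact h _ hτ) (σ - σ₀)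
  simpa using this

/-- A property which is passed along all edges of a cycle but one holds everywhere. -/
theorem Fin.cyclic_propagate {k : ℕ} [NeZero k] {P bad : Fin k → Prop}
    (hbad : ∀ σ τ, bad σ → bad τ → σ = τ) (h : ∀ σ, ¬ bad σ → (P σ ↔ P (σ + 1)))
    {σ₁ : Fin k} (h1 : P σ₁) (σ : Fin k) : P σ := by
  by_cases hex : ∃ τ, bad τ
  -- Open the cycle at the bad edge and walk from τ + 1; the k − 1 remaining edges all transmit the
  -- property in both directions.
  · obtain ⟨τ, hτ⟩ := hex
    have key : ∀ m : ℕ, m < k → (P (τ + 1 + Fin.ofNat k m) ↔ P (τ + 1)) := by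
      intro m
      induction m with
      | zero => intro _; simp
      | succ m ih =>
        intro hm
        have e : τ + 1 + Fin.ofNat k (m + 1) = τ + 1 + Fin.ofNat k m + 1 := by
          rw [add_assoc (τ + 1)]
          congr 1
          simp [Fin.ext_iff, Fin.val_add]
        rw [e, ← h _ fun hb => ?_]
        · exact ih (by lia)
        · have h2 := hbad _ _ hb hτ
          rw [add_assoc, add_eq_left] at h2
          have h3 := congrArg Fin.val h2
          rw [add_comm] at h3
          simp [Fin.val_add] at h3
          rw [Nat.mod_eq_of_lt hm] at h3
          lia
    have key' : ∀ σ, P σ ↔ P (τ + 1) := fun σ => by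
      have := key (σ - (τ + 1)).val (σ - (τ + 1)).isLt
      simpa using this
    exact (key' σ).2 ((key' σ₁).1 h1)
  · push Not at hex
    exact Fin.cyclic_induction_of h1 (fun σ => (h σ (hex σ)).1) σ

variable {k : ℕ} [NeZero k] {B : Bow k} {R : BowRep B} {ν : Fin k → Fin 3 → ℝ}
  {d : BowData R} {p : LevelSet B ν} {f : TermSection R}

/-- Compose the inequalities at the λ-points and at the edges while going around the circle. In
particular each subinterval is compared with itself after a full turn, which makes the form
constant. -/
theorem gLe_all (hd : d.IsSolution ν)
    (hb : ∀ σ α, ∀ᵐ s ∂volume.restrict (Ioc (R.lo σ α) (R.hi σ α)), diracBulk d p f σ α s = 0)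
    (hQ : diracLam d f = 0) (hp : diracPlus d p f = 0) (hm : diracMinus d p f = 0)
    (σ : Fin k) (α : Fin (R.n σ + 1)) (τ : Fin k) (β : Fin (R.n τ + 1)) : GLe d p f σ α τ β := by
  have h1 : ∀ σ α, GLe d p f σ α (σ + 1) 0 := fun σ α => by
    induction α using Fin.reverseInduction with
    | last => exact gLe_edge hd hb hp hm σ
    | cast a ih => exact (gLe_lam hd hb hQ σ a).trans ih
  have h2 : ∀ τ, GLe d p f σ α τ 0 :=
    Fin.cyclic_induction_of (P := fun τ => GLe d p f σ α τ 0) (h1 σ α) fun τ h => h.trans (h1 τ 0)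
  induction β using Fin.induction with
  | zero => exact h2 τ
  | succ a ih => exact ih.trans (gLe_lam hd hb hQ τ a)

/-- Constancy of the quadratic form means zero energy, and the energy is the sum of the squared
norms of exactly these vectors. -/
theorem relT_mulVec_eq_zero (hd : d.IsSolution ν)
    (hb : ∀ σ α, ∀ᵐ s ∂volume.restrict (Ioc (R.lo σ α) (R.hi σ α)), diracBulk d p f σ α s = 0)
    (hQ : diracLam d f = 0) (hp : diracPlus d p f = 0) (hm : diracMinus d p f = 0)
    {σ : Fin k} {α : Fin (R.n σ + 1)} {s : ℝ} (hs : s ∈ Ioo (R.lo σ α) (R.hi σ α)) :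
    (imQuat fun j => relT d p σ α j s).mulVec (f.f σ α s) = 0 ∧
      ∀ j c, (relT d p σ α j s).mulVec (vcomp (f.f σ α s) c) = 0 := by
  have h := energy_eq_zero hd hb σ α (fun x hx y hy => gLe_all hd hb hQ hp hm σ α σ α x hx y hy) hs
  have n1 : 0 ≤ ∑ i, ‖(imQuat fun j => relT d p σ α j s).mulVec (f.f σ α s) i‖ ^ 2 :=
    Finset.sum_nonneg fun i _ => sq_nonneg _
  have n2 : ∀ j, 0 ≤ ∑ i, ‖((1 : Matrix (Fin 2) (Fin 2) ℂ) ⊗ₖ relT d p σ α j s).mulVec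
      (f.f σ α s) i‖ ^ 2 := fun j => Finset.sum_nonneg fun i _ => sq_nonneg _
  have n3 := Finset.sum_nonneg fun j (_ : j ∈ Finset.univ) => n2 j
  rw [energy] at h
  have hz : ∀ {V : Type} [Fintype V] (v : V → ℂ), ∑ i, ‖v i‖ ^ 2 = 0 → v = 0 := by
    intro V _ v hv
    have := (Finset.sum_eq_zero_iff_of_nonneg fun i _ => sq_nonneg ‖v i‖).1 hv
    ext i
    simpa using this i (Finset.mem_univ i)
  refine ⟨hz _ (by linarith), fun j c => ?_⟩
  have h2 := (Finset.sum_eq_zero_iff_of_nonneg fun j _ => n2 j).1 (by linarith) j (Finset.mem_univ j)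
  rw [← vcomp_one_kronecker_mulVec, hz _ h2]
  rfl

theorem vcomp_df_eq (hd : d.IsSolution ν)
    (hb : ∀ σ α, ∀ᵐ s ∂volume.restrict (Ioc (R.lo σ α) (R.hi σ α)), diracBulk d p f σ α s = 0)
    (hQ : diracLam d f = 0) (hp : diracPlus d p f = 0) (hm : diracMinus d p f = 0)
    (σ : Fin k) (α : Fin (R.n σ + 1)) (c : Fin 2) :
    ∀ᵐ s ∂volume.restrict (Ioc (R.lo σ α) (R.hi σ α)), vcomp (f.df σ α s) c
      = -(Complex.I • (relT0 d p σ α s).mulVec (vcomp (f.f σ α s) c)) := by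
  filter_upwards [df_eq hb σ α, ae_Ioc_of_forall_Ioo
    (p := fun s => s ∈ Ioo (R.lo σ α) (R.hi σ α)) fun s hs => hs] with s hs hm'
  rw [hs, diracMat_eq (relT0_isHermitian d p hm') fun j => relT_isHermitian d p j hm',
    Matrix.smul_mulVec, Matrix.sub_mulVec, (relT_mulVec_eq_zero hd hb hQ hp hm hm').1, sub_zero,
    ← vcomp_one_kronecker_mulVec]
  rfl

/-- The parallel phase factor on `I_σ` for the connection of the small representation. -/
def LevelSet.phase (p : LevelSet B ν) (σ : Fin k) (s : ℝ) : ℂ :=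
  Complex.exp (∫ x in (0 : ℝ)..s, -(Complex.I * p.t0 σ x))

theorem LevelSet.isAC_phase (p : LevelSet B ν) (σ : Fin k) : IsAC 0 (B.len σ) (p.phase σ)
    fun s => p.phase σ s * -(Complex.I * p.t0 σ s) := by
  have h1 : IntegrableOn (p.t0 σ) (Ioc 0 (B.len σ)) :=
    (p.t0_memLp σ).integrable (by norm_num)
  have h2 : IsAC 0 (B.len σ) (fun s => ∫ x in (0 : ℝ)..s, -(Complex.I * p.t0 σ x))
      fun s => -(Complex.I * p.t0 σ s) := ⟨(h1.const_mul _).neg, fun x _ => by simp⟩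
  exact h2.cexp (B.len_pos σ).le

theorem LevelSet.phase_ne_zero (p : LevelSet B ν) (σ : Fin k) (s : ℝ) : p.phase σ s ≠ 0 :=
  Complex.exp_ne_zero _

/-- The frame over `I_σ` spanned by a component of a solution of the Dirac equation. -/
def frame (p : LevelSet B ν) (f : TermSection R) (c : Fin 2) (σ : Fin k) (α : Fin (R.n σ + 1))
    (s : ℝ) : Matrix (Fin (R.rank σ α)) (Fin 1) ℂ :=
  fun i _ => p.phase σ s * vcomp (f.f σ α s) c i

theorem mul_frame (p : LevelSet B ν) (f : TermSection R) (c : Fin 2) (σ : Fin k)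
    (α : Fin (R.n σ + 1)) (s : ℝ) {m : Type*} (M : Matrix m (Fin (R.rank σ α)) ℂ) (i : m) (j : Fin 1) :
    (M * frame p f c σ α s) i j = p.phase σ s * M.mulVec (vcomp (f.f σ α s) c) i := by
  simp only [Matrix.mul_apply, frame, Matrix.mulVec, dotProduct, Finset.mul_sum]
  exact Finset.sum_congr rfl fun _ _ => by ring

/-- The components of f are parallel for T₀ − t₀ and the phase is parallel for t₀, so their product
is parallel for T₀. -/
theorem isParallel_frame (hd : d.IsSolution ν)
    (hb : ∀ σ α, ∀ᵐ s ∂volume.restrict (Ioc (R.lo σ α) (R.hi σ α)), diracBulk d p f σ α s = 0)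
    (hQ : diracLam d f = 0) (hp : diracPlus d p f = 0) (hm : diracMinus d p f = 0)
    (c : Fin 2) (σ : Fin k) (α : Fin (R.n σ + 1)) :
    IsParallel (d.T0 σ α) (R.lo σ α) (R.hi σ α) (frame p f c σ α) := by
  have hph := (p.isAC_phase σ).mono (R.lo_nonneg σ α) (R.hi_le σ α)
  have hw : ∀ i, IsAC (R.lo σ α) (R.hi σ α) (fun s => vcomp (f.f σ α s) c i)
      (fun s => vcomp (f.df σ α s) c i) := fun i => isAC_pi_iff.1 (f.h1 σ α).isAC (c, i)
  have hA : ∀ i j, IsAC (R.lo σ α) (R.hi σ α) (fun s => frame p f c σ α s i j)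
      (fun s => -(Complex.I * (d.T0 σ α s * frame p f c σ α s) i j)) := fun i j => by
    refine (hph.mul (hw i)).congr (fun _ _ => rfl) ?_
    filter_upwards [vcomp_df_eq hd hb hQ hp hm σ α c] with s hs
    rw [hs, mul_frame, relT0, Matrix.sub_mulVec, Matrix.smul_mulVec, Matrix.one_mulVec]
    simp only [Pi.neg_apply, Pi.smul_apply, Pi.sub_apply, smul_eq_mul]
    ring
  refine ⟨continuousOn_pi.2 fun i => continuousOn_pi.2 fun j => (hA i j).continuousOn,
    fun x hx i j => ?_⟩
  refine ((hA i j).2 x hx).trans ?_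
  rw [intervalIntegral.integral_neg, intervalIntegral.integral_const_mul, sub_eq_add_neg]

theorem frame_eq_zero {c : Fin 2} {σ : Fin k} {α : Fin (R.n σ + 1)} {s : ℝ} :
    frame p f c σ α s = 0 ↔ vcomp (f.f σ α s) c = 0 := by
  constructor
  · intro h
    ext i
    exact (mul_eq_zero.1 (congrFun (congrFun h i) 0)).resolve_left (p.phase_ne_zero σ s)
  · intro h
    ext i j
    rw [frame, h]
    exact mul_zero _

open scoped ComplexOrder in
/-- A parallel section vanishing at a point vanishes on the whole interval `I_σ`. -/
theorem vcomp_eq_zero_iff (hd : d.IsSolution ν)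
    (hb : ∀ σ α, ∀ᵐ s ∂volume.restrict (Ioc (R.lo σ α) (R.hi σ α)), diracBulk d p f σ α s = 0)
    (hQ : diracLam d f = 0) (hp : diracPlus d p f = 0) (hm : diracMinus d p f = 0)
    (c : Fin 2) (σ : Fin k) (α : Fin (R.n σ + 1)) {s : ℝ} (hs : s ∈ Icc (R.lo σ α) (R.hi σ α)) :
    vcomp (f.f σ α s) c = 0 ↔ vcomp (f.f σ 0 0) c = 0 := by
  have h1 : ∀ α, ∀ x ∈ Icc (R.lo σ α) (R.hi σ α), ∀ y ∈ Icc (R.lo σ α) (R.hi σ α),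
      vcomp (f.f σ α x) c = 0 → vcomp (f.f σ α y) c = 0 := fun α x hx y hy h => by
    rw [← frame_eq_zero (p := p)] at h ⊢
    -- The norm of a parallel section is constant, so a zero at one point gives zeros over the whole
    -- subinterval.
    have := (isParallel_frame hd hb hQ hp hm c σ α).conjTranspose_mul_self
      (sqIntOn_Ioc_of_Ioo (d.T0_L2 σ α)) (d.T0_herm σ α) hx hy
    rw [h, Matrix.mul_zero, Matrix.conjTranspose_mul_self_eq_zero] at this
    exact this
  have hl : ∀ α, R.lo σ α ∈ Icc (R.lo σ α) (R.hi σ α) := fun α =>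
    left_mem_Icc.2 (R.lo_lt_hi σ α).le
  have hr : ∀ α, R.hi σ α ∈ Icc (R.lo σ α) (R.hi σ α) := fun α =>
    right_mem_Icc.2 (R.lo_lt_hi σ α).le
  have h2 : ∀ α, vcomp (f.f σ α (R.lo σ α)) c = 0 ↔ vcomp (f.f σ 0 0) c = 0 := fun α => by
    induction α using Fin.induction with
    | zero => rw [R.lo_zero]
    | succ a ih =>
      rw [← ih, R.lo_succ]
      have e1 := congrArg (fun v => vcomp v c) (f.match_right σ a)
      have e2 := congrArg (fun v => vcomp v c) (f.match_left σ a)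
      simp only [vcomp_one_kronecker_mulVec] at e1 e2
      constructor
      · intro h
        refine h1 _ _ (hr _) _ (hl _) ?_
        rw [R.hi_castSucc, e2, h, Matrix.mulVec_zero]
      · intro h
        have h3 := h1 _ _ (hl _) _ (hr _) h
        rw [R.hi_castSucc] at h3
        rw [e1, h3, Matrix.mulVec_zero]
  rw [← h2 α]
  exact ⟨h1 α _ hs _ (hl α), h1 α _ (hl α) _ hs⟩

end

section

/-! ### The vanishing theorem -/

variable {k : ℕ} [NeZero k] {B : Bow k} {R : BowRep B} {ν : Fin k → Fin 3 → ℝ}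
  {d : BowData R} {p : LevelSet B ν} {f : TermSection R}

/-- A component that vanishes over no interval spans a line subbundle: it is parallel after
multiplication by the phase, Tⱼ acts on it by the constant scalar tⱼ, and the matching conditions of
f make it continuous within the continuing subspaces. -/
theorem hasAbelianFactor_of_ne_zero (hd : d.IsSolution ν)
    (hb : ∀ σ α, ∀ᵐ s ∂volume.restrict (Ioc (R.lo σ α) (R.hi σ α)), diracBulk d p f σ α s = 0)
    (hQ : diracLam d f = 0) (hp : diracPlus d p f = 0) (hm : diracMinus d p f = 0)
    {c : Fin 2} (hne : ∀ σ, vcomp (f.f σ 0 0) c ≠ 0) : d.HasAbelianFactor := by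
  refine ⟨fun _ => 1, frame p f c, fun σ j => p.tc σ j • 1, fun _ => one_pos,
    isParallel_frame hd hb hQ hp hm c, ?_, ?_, fun σ i j => ?_, fun σ a => ?_⟩
  · intro σ α s hs v w hvw
    have h1 : frame p f c σ α s ≠ 0 := fun h => hne σ
      ((vcomp_eq_zero_iff hd hb hQ hp hm c σ α hs).1 (frame_eq_zero.1 h))
    obtain ⟨i, hi⟩ : ∃ i, frame p f c σ α s i 0 ≠ 0 := by
      by_contra! h
      refine h1 ?_
      ext i j
      rw [Subsingleton.elim j 0]
      exact h i
    have h2 := congrFun hvw i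
    simp only [Matrix.mulVec, dotProduct, Finset.univ_unique, Finset.sum_singleton,
      Fin.default_eq_zero] at h2
    ext j
    rw [Subsingleton.elim j 0]
    exact mul_left_cancel₀ hi h2
  · intro σ α j s hs
    have h1 := (relT_mulVec_eq_zero hd hb hQ hp hm hs).2 j c
    rw [relT, p.t_eq_tc σ j (mem_Ioo_len hs), Matrix.sub_mulVec, Matrix.smul_mulVec,
      Matrix.one_mulVec, sub_eq_zero] at h1
    ext i i'
    rw [mul_frame, h1, Matrix.mul_smul, Matrix.mul_one]
    simp only [Matrix.smul_apply, Pi.smul_apply, frame, smul_eq_mul]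
    ring
  · exact ((Commute.one_left _).smul_left _).smul_right _
  · have e1 := congrArg (fun v => vcomp v c) (f.match_right σ a)
    have e2 := congrArg (fun v => vcomp v c) (f.match_left σ a)
    simp only [vcomp_one_kronecker_mulVec] at e1 e2
    constructor
    · ext i j
      rw [mul_frame, ← e1]
      rfl
    · ext i j
      rw [mul_frame, ← e2]
      rfl

/-- By the vanishing of the edge defect, Bₐ†u_c = b̄ₐw_c and Bₐw_c = bₐu_c. For an index a with bₐ ≠
0 each of u_c, w_c determines the other. -/
theorem vcomp_eq_zero_edge (hd : d.IsSolution ν)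
    (hb : ∀ σ α, ∀ᵐ s ∂volume.restrict (Ioc (R.lo σ α) (R.hi σ α)), diracBulk d p f σ α s = 0)
    (hQ : diracLam d f = 0) (hp : diracPlus d p f = 0) (hm : diracMinus d p f = 0)
    (c : Fin 2) (σ : Fin k) (hbσ : p.b σ ≠ 0) :
    vcomp (f.f σ 0 0) c = 0 ↔ vcomp (f.f (σ + 1) 0 0) c = 0 := by
  have hl : B.len σ ∈ Icc (R.lo σ (Fin.last _)) (R.hi σ (Fin.last _)) := by
    rw [← R.hi_last σ]
    exact right_mem_Icc.2 (R.lo_lt_hi σ _).le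
  rw [← vcomp_eq_zero_iff hd hb hQ hp hm c σ (Fin.last _) hl]
  have hE := edgeLinked_of_gLe hd hb hp hm σ (gLe_all hd hb hQ hp hm _ _ _ _)
  obtain ⟨a, ha⟩ := Function.ne_iff.1 hbσ
  obtain ⟨h1, h2⟩ := hE a c
  constructor
  · intro h
    rw [h, Matrix.mulVec_zero] at h1
    exact (smul_eq_zero.1 h1.symm).resolve_left (star_ne_zero.2 ha)
  · intro h
    rw [h, Matrix.mulVec_zero] at h2
    exact (smul_eq_zero.1 h2.symm).resolve_left ha

/-- Without abelian factors, the twisted Dirac operator is injective. -/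
theorem dirac_injective (hν : Function.Injective ν) (hd : d.IsSolution ν) (hWAF : d.WAF)
    (hb : ∀ σ α, ∀ᵐ s ∂volume.restrict (Ioc (R.lo σ α) (R.hi σ α)), diracBulk d p f σ α s = 0)
    (hQ : diracLam d f = 0) (hp : diracPlus d p f = 0) (hm : diracMinus d p f = 0)
    (σ : Fin k) (α : Fin (R.n σ + 1)) {s : ℝ} (hs : s ∈ Icc (R.lo σ α) (R.hi σ α)) :
    f.f σ α s = 0 := by
  have h : ∀ c, vcomp (f.f σ 0 0) c = 0 := fun c => by
    -- The two spinor components are treated separately; otherwise the component would span an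
    -- abelian factor.
    obtain ⟨τ, hτ⟩ : ∃ τ, vcomp (f.f τ 0 0) c = 0 := by
      by_contra! h
      exact hWAF (hasAbelianFactor_of_ne_zero hd hb hQ hp hm h)
    exact Fin.cyclic_propagate (P := fun σ => vcomp (f.f σ 0 0) c = 0)
      (bad := fun σ => p.b σ = 0) (fun σ τ => p.eq_of_b_eq_zero hν)
      (fun σ hσ => vcomp_eq_zero_edge hd hb hQ hp hm c σ hσ) hτ σ
  ext ⟨c, i⟩
  exact congrFun ((vcomp_eq_zero_iff hd hb hQ hp hm c σ α hs).2 (h c)) i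

/-- The index theorem for the twisted Dirac operator. -/
theorem finrank_kerDiracAdj_eq (hν : Function.Injective ν) (hd : d.IsSolution ν) (hWAF : d.WAF)
    (p : LevelSet B ν) : Module.Finite ℂ (kerDiracAdj d p) ∧
      Module.finrank ℂ (kerDiracAdj d p) = R.numLam :=
  finrank_kerDiracAdj d p fun _ hb hQ hp hm σ α _ hs =>
    dirac_injective hν hd hWAF hb hQ hp hm σ α hs

end

section

/-! ### Descent to the quotient by the gauge group -/

variable {k : ℕ} [NeZero k] {B : Bow k} {R : BowRep B} {ν : Fin k → Fin 3 → ℝ}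

theorem IsH1.star {a b : ℝ} {f f' : ℝ → ℂ} (h : IsH1 a b f f') :
    IsH1 a b (fun s => star (f s)) fun s => star (f' s) :=
  isH1_iff.2 ⟨h.isAC.clm (Complex.conjCLE : ℂ →L[ℝ] ℂ), h.1.star⟩

theorem IsH1.smul {ι : Type*} [Fintype ι] {a b : ℝ} {g g' : ℝ → ℂ} {f f' : ℝ → ι → ℂ}
    (hg : IsH1 a b g g') (hf : IsH1 a b f f') :
    IsH1 a b (fun s => g s • f s) (fun s => g' s • f s + g s • f' s) :=
  isH1_iff.2 ⟨hg.isAC.smul hf.isAC,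
    (memLp_smul_continuousOn measurableSet_Ioc Ioc_subset_Icc_self hg.1 hf.isAC.continuousOn).add
    (memLp_smul_of_continuousOn measurableSet_Ioc Ioc_subset_Icc_self hg.isAC.continuousOn hf.1)⟩

namespace SmallGauge

theorem star_mul_self (g : SmallGauge B) {σ : Fin k} {s : ℝ} (hs : s ∈ Icc 0 (B.len σ)) :
    star (g.g σ s) * g.g σ s = 1 := by
  rw [Complex.star_def, Complex.conj_mul', g.unitary σ s hs]
  simp

theorem mul_star_self (g : SmallGauge B) {σ : Fin k} {s : ℝ} (hs : s ∈ Icc 0 (B.len σ)) :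
    g.g σ s * star (g.g σ s) = 1 := by rw [mul_comm, g.star_mul_self hs]

theorem ne_zero (g : SmallGauge B) {σ : Fin k} {s : ℝ} (hs : s ∈ Icc 0 (B.len σ)) :
    g.g σ s ≠ 0 := right_ne_zero_of_mul_eq_one (g.star_mul_self hs)

theorem inv_eq (g : SmallGauge B) {σ : Fin k} {s : ℝ} (hs : s ∈ Icc 0 (B.len σ)) :
    (g.g σ s)⁻¹ = star (g.g σ s) := inv_eq_of_mul_eq_one_right (g.mul_star_self hs)

/-- The trivial gauge transformation. -/
def one (B : Bow k) : SmallGauge B where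
  g := fun _ _ => 1
  dg := fun _ _ => 0
  h1 := fun _ => isH1_iff.2 ⟨IsAC.const _, MemLp.zero'⟩
  unitary := fun _ _ _ => norm_one
  based := rfl

/-- The product of gauge transformations. -/
def mul (g h : SmallGauge B) : SmallGauge B where
  g := fun σ s => g.g σ s * h.g σ s
  dg := fun σ s => g.dg σ s * h.g σ s + g.g σ s * h.dg σ s
  h1 := fun σ => (g.h1 σ).mul (h.h1 σ)
  unitary := fun σ s hs => by rw [norm_mul, g.unitary σ s hs, h.unitary σ s hs, mul_one]
  based := by rw [g.based, h.based, mul_one]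

/-- The inverse gauge transformation. -/
def inv (g : SmallGauge B) : SmallGauge B where
  g := fun σ s => star (g.g σ s)
  dg := fun σ s => star (g.dg σ s)
  h1 := fun σ => (g.h1 σ).star
  unitary := fun σ s hs => by rw [norm_star, g.unitary σ s hs]
  based := by rw [g.based, star_one]

end SmallGauge

theorem left_mem_len (σ : Fin k) : (0 : ℝ) ∈ Icc 0 (B.len σ) := left_mem_Icc.2 (B.len_pos σ).le

theorem right_mem_len (σ : Fin k) : B.len σ ∈ Icc 0 (B.len σ) := right_mem_Icc.2 (B.len_pos σ).le

variable {p p' p'' : LevelSet B ν} {g h : SmallGauge B}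

/-- The transformation law of t₀, read as a linear differential equation for g whose coefficient
depends only on the two points p and p′. -/
theorem IsGaugeImage.ae_dg (hg : IsGaugeImage g p p') (σ : Fin k) :
    ∀ᵐ s ∂volume.restrict (Ioc 0 (B.len σ)), s ∈ Icc 0 (B.len σ) ∧
      g.dg σ s = -(Complex.I * (p.t0 σ s - p'.t0 σ s)) * g.g σ s ∧
      star (g.dg σ s) = Complex.I * (p.t0 σ s - p'.t0 σ s) * star (g.g σ s) ∧
      star (p.t0 σ s - p'.t0 σ s) = p.t0 σ s - p'.t0 σ s := by
  filter_upwards [hg.1 σ, ae_Ioc_of_forall_Ioo (p := fun s => s ∈ Ioo 0 (B.len σ))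
    fun s hs => hs] with s hs hm
  have hm' := Ioo_subset_Icc_self hm
  have h0 := g.ne_zero hm'
  have h1 : g.dg σ s = -(Complex.I * (p.t0 σ s - p'.t0 σ s)) * g.g σ s := by
    have h3 : (g.g σ s)⁻¹ * g.dg σ s * g.g σ s = g.dg σ s := by field_simp
    rw [hs]
    linear_combination -h3 + (g.g σ s)⁻¹ * g.dg σ s * g.g σ s * Complex.I_mul_I
  have h2 : star (p.t0 σ s - p'.t0 σ s) = p.t0 σ s - p'.t0 σ s := by
    rw [star_sub, p.star_t0 σ hm, p'.star_t0 σ hm]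
  refine ⟨hm', h1, ?_, h2⟩
  rw [h1, star_mul', star_neg, star_mul', h2, Complex.star_def, Complex.conj_I]
  ring

theorem isGaugeImage_one (p : LevelSet B ν) : IsGaugeImage (SmallGauge.one B) p p := by
  refine ⟨fun σ => ae_of_all _ fun s => ?_, fun σ j => ae_of_all _ fun s => rfl, fun σ a => ?_⟩
  · simp [SmallGauge.one]
  · simp [SmallGauge.one]

theorem IsGaugeImage.mul (hg : IsGaugeImage g p p') (hh : IsGaugeImage h p' p'') :
    IsGaugeImage (g.mul h) p p'' := by
  refine ⟨fun σ => ?_, fun σ j => ?_, fun σ a => ?_⟩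
  · filter_upwards [hg.1 σ, hh.1 σ, hg.ae_dg σ] with s h1 h2 h3
    have e1 := g.ne_zero h3.1
    have e2 := h.ne_zero h3.1
    rw [h2, h1, SmallGauge.mul]
    field_simp
    ring
  · filter_upwards [hg.2.1 σ j, hh.2.1 σ j] with s h1 h2
    rw [h2, h1]
  · rw [hh.2.2 σ a, hg.2.2 σ a, SmallGauge.mul]
    simp only [mul_inv]
    ring

theorem IsGaugeImage.inv (hg : IsGaugeImage g p p') : IsGaugeImage g.inv p' p := by
  refine ⟨fun σ => ?_, fun σ j => ?_, fun σ a => ?_⟩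
  · filter_upwards [hg.ae_dg σ] with s hs
    have h0 : star (g.g σ s) ≠ 0 := star_ne_zero.2 (g.ne_zero hs.1)
    simp only [SmallGauge.inv]
    rw [hs.2.2.1]
    field_simp
    linear_combination (p.t0 σ s - p'.t0 σ s) * Complex.I_sq
  · filter_upwards [hg.2.1 σ j] with s h1
    exact h1.symm
  · have e1 := g.ne_zero (right_mem_len σ)
    have e2 := g.ne_zero (left_mem_len (σ + 1))
    rw [hg.2.2 σ a, SmallGauge.inv]
    simp only [← g.inv_eq (right_mem_len σ), ← g.inv_eq (left_mem_len (σ + 1))]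
    field_simp

/-- The based gauge group acts freely. -/
theorem IsGaugeImage.unique (hν : Function.Injective ν) (hg : IsGaugeImage g p p')
    (hh : IsGaugeImage h p p') (σ : Fin k) {s : ℝ} (hs : s ∈ Icc 0 (B.len σ)) :
    g.g σ s = h.g σ s := by
  -- Both transformations solve the same equation, so g h̄ is constant on each interval.
  have hc : ∀ σ, ∀ x ∈ Icc 0 (B.len σ), ∀ y ∈ Icc 0 (B.len σ),
      g.g σ y * star (h.g σ y) = g.g σ x * star (h.g σ x) := fun σ x hx y hy => by
    have hA := ((g.h1 σ).mul (h.h1 σ).star).isAC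
    rw [← sub_eq_zero, hA.sub_eq hx hy]
    refine intervalIntegral.integral_zero_ae ?_
    have := (hg.ae_dg σ).and (hh.ae_dg σ)
    rw [ae_restrict_iff' measurableSet_Ioc] at this
    filter_upwards [this] with s hs hm
    obtain ⟨h1, h2⟩ := hs ⟨(le_min hx.1 hy.1).trans_lt hm.1, hm.2.trans (max_le hx.2 hy.2)⟩
    rw [h1.2.1, h2.2.2.1]
    ring
  -- The value is 1 on the interval of the base point, and an edge with b_σ ≠ 0 transports it,
  -- because b_σ fixes the product g(p_σ−)⁻¹ g(p_σ+). At most one edge fails to do so.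
  have key : ∀ σ, g.g σ 0 * star (h.g σ 0) = 1 := by
    refine Fin.cyclic_propagate (bad := fun σ => p.b σ = 0) (σ₁ := 0)
      (fun σ τ => p.eq_of_b_eq_zero hν) (fun σ hσ => ?_) ?_
    · obtain ⟨a, ha⟩ := Function.ne_iff.1 hσ
      have hr := right_mem_len (B := B) σ
      have hl := left_mem_len (B := B) (σ + 1)
      have e := (hg.2.2 σ a).symm.trans (hh.2.2 σ a)
      rw [g.inv_eq hr, h.inv_eq hr] at e
      have e' : star (g.g σ (B.len σ)) * g.g (σ + 1) 0
          = star (h.g σ (B.len σ)) * h.g (σ + 1) 0 := by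
        refine mul_left_cancel₀ ha ?_
        linear_combination e
      rw [hc σ (B.len σ) hr 0 (left_mem_len σ)]
      have g1 := g.mul_star_self hr
      have g2 := h.mul_star_self hl
      have e3 : g.g (σ + 1) 0 * star (h.g (σ + 1) 0)
          = g.g σ (B.len σ) * star (h.g σ (B.len σ)) := by
        linear_combination (-(g.g (σ + 1) 0 * star (h.g (σ + 1) 0))) * g1
          + g.g σ (B.len σ) * star (h.g (σ + 1) 0) * e'
          + g.g σ (B.len σ) * star (h.g σ (B.len σ)) * g2
      rw [e3]
    · rw [hc 0 B.origin (Ioo_subset_Icc_self B.origin_mem) 0 (left_mem_len 0), g.based, h.based,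
        star_one, mul_one]
  have h1 := (hc σ 0 (left_mem_len σ) s hs).trans (key σ)
  have h2 := h.star_mul_self hs
  linear_combination h.g σ s * h1 - g.g σ s * h2

theorem isGaugeImage_equivalence :
    Equivalence fun p p' : LevelSet B ν => ∃ g, IsGaugeImage g p p' where
  refl p := ⟨_, isGaugeImage_one p⟩
  symm := fun ⟨_, hg⟩ => ⟨_, hg.inv⟩
  trans := fun ⟨_, hg⟩ ⟨_, hh⟩ => ⟨_, hg.mul hh⟩

theorem mem_Icc_len {σ : Fin k} {α : Fin (R.n σ + 1)} {s : ℝ}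
    (hs : s ∈ Icc (R.lo σ α) (R.hi σ α)) : s ∈ Icc 0 (B.len σ) :=
  ⟨(R.lo_nonneg σ α).trans hs.1, hs.2.trans (R.hi_le σ α)⟩

/-- The action of a gauge transformation on the target of the Dirac operator. -/
theorem exists_isGaugeImageOf (g : SmallGauge B) (Ψ : Target R) : ∃ Ψ', IsGaugeImageOf g Ψ Ψ' := by
  have hm : ∀ σ (α : Fin (R.n σ + 1)), MemLp (fun s => g.g σ s • Ψ.1 σ α s) 2
      (volume.restrict (Ioc (R.lo σ α) (R.hi σ α))) := fun σ α =>
    memLp_smul_of_continuousOn measurableSet_Ioc Ioc_subset_Icc_self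
      ((g.h1 σ).mono (R.lo_nonneg σ α) (R.hi_le σ α)).isAC.continuousOn (Lp.memLp _)
  exact ⟨(fun σ α => (hm σ α).toLp, fun l => g.g l.1.1 (R.lam l.1.1 l.1.2) * Ψ.2.1 l,
    fun σ => g.g σ (B.len σ) • Ψ.2.2.1 σ, fun σ => g.g (σ + 1) 0 • Ψ.2.2.2 σ),
    fun σ α => (hm σ α).coeFn_toLp, fun _ => rfl, fun _ => rfl, fun _ => rfl⟩

theorem lam_mem_len (R : BowRep B) (σ : Fin k) (a : Fin (R.n σ)) : R.lam σ a ∈ Icc 0 (B.len σ) :=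
  Ioo_subset_Icc_self (R.lam_mem σ a)

theorem IsGaugeImageOf.mul {Ψ Ψ' Ψ'' : Target R} (hg : IsGaugeImageOf g Ψ Ψ')
    (hgh : IsGaugeImageOf (g.mul h) Ψ Ψ'') : IsGaugeImageOf h Ψ' Ψ'' := by
  refine ⟨fun σ α => ?_, fun l => ?_, fun σ => ?_, fun σ => ?_⟩
  · filter_upwards [hg.1 σ α, hgh.1 σ α] with s h1 h2
    rw [h1, h2, smul_smul, mul_comm (h.g σ s)]
    rfl
  · rw [hg.2.1, hgh.2.1, ← mul_assoc, mul_comm (h.g _ _)]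
    rfl
  · rw [hg.2.2.1, hgh.2.2.1, smul_smul, mul_comm (h.g _ _)]
    rfl
  · rw [hg.2.2.2, hgh.2.2.2, smul_smul, mul_comm (h.g _ _)]
    rfl

theorem IsGaugeImageOf.congr {Ψ Ψ' : Target R} (hg : IsGaugeImageOf g Ψ Ψ')
    (hgh : ∀ σ, ∀ s ∈ Icc 0 (B.len σ), g.g σ s = h.g σ s) : IsGaugeImageOf h Ψ Ψ' := by
  refine ⟨fun σ α => ?_, fun l => ?_, fun σ => ?_, fun σ => ?_⟩
  · filter_upwards [hg.1 σ α, ae_restrict_mem measurableSet_Ioc] with s h1 h2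
    rw [h1, hgh σ s (mem_Icc_len (Ioc_subset_Icc_self h2))]
  · rw [hg.2.1, hgh _ _ (lam_mem_len R _ _)]
  · rw [hg.2.2.1, hgh _ _ (right_mem_len σ)]
  · rw [hg.2.2.2, hgh _ _ (left_mem_len _)]

theorem IsGaugeImageOf.unique {Ψ Ψ' Ψ'' : Target R} (hg : IsGaugeImageOf g Ψ Ψ')
    (hh : IsGaugeImageOf g Ψ Ψ'') : Ψ' = Ψ'' := by
  refine Prod.ext (funext fun σ => funext fun α => Lp.ext ?_) (Prod.ext (funext fun l => ?_)
    (Prod.ext (funext fun σ => ?_) (funext fun σ => ?_)))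
  · filter_upwards [hg.1 σ α, hh.1 σ α] with s h1 h2
    rw [h1, h2]
  · rw [hg.2.1, hh.2.1]
  · rw [hg.2.2.1, hh.2.2.1]
  · rw [hg.2.2.2, hh.2.2.2]

theorem isGaugeImageOf_one (Ψ : Target R) : IsGaugeImageOf (SmallGauge.one B) Ψ Ψ := by
  refine ⟨fun σ α => ae_of_all _ fun s => ?_, fun l => ?_, fun σ => ?_, fun σ => ?_⟩ <;>
  simp [SmallGauge.one]

theorem isGaugeImageOf_zero (R : BowRep B) (g : SmallGauge B) :
    IsGaugeImageOf g (0 : Target R) 0 := by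
  refine ⟨fun σ α => ?_, fun l => ?_, fun σ => ?_, fun σ => ?_⟩
  · filter_upwards [Lp.coeFn_zero (Fin 2 × Fin (R.rank σ α) → ℂ) 2
        (volume.restrict (Ioc (R.lo σ α) (R.hi σ α)))] with s hs
    have : (0 : Target R).1 σ α s = 0 := hs
    rw [this, smul_zero]
  all_goals simp

end

section

/-! ### Equivariance of the kernel of the adjoint Dirac operator -/

variable {k : ℕ} [NeZero k] {B : Bow k} {R : BowRep B} {ν : Fin k → Fin 3 → ℝ}
  {d : BowData R} {p p' : LevelSet B ν} {g : SmallGauge B}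

/-- The action of the inverse of a gauge transformation on the domain of the Dirac operator. -/
def TermSection.untwist (f : TermSection R) (g : SmallGauge B) : TermSection R where
  f := fun σ α s => star (g.g σ s) • f.f σ α s
  df := fun σ α s => star (g.dg σ s) • f.f σ α s + star (g.g σ s) • f.df σ α s
  h1 := fun σ α => ((g.h1 σ).star.mono (R.lo_nonneg σ α) (R.hi_le σ α)).smul (f.h1 σ α)
  match_right := fun σ a => by rw [f.match_right, Matrix.mulVec_smul]
  match_left := fun σ a => by rw [f.match_left, Matrix.mulVec_smul]

/-- The derivative falling on ḡ produces exactly the change of t₀: the operator at p′ is g ∘ D ∘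
g⁻¹. -/
theorem diracBulk_untwist (hg : IsGaugeImage g p p') (f : TermSection R) (σ : Fin k)
    (α : Fin (R.n σ + 1)) : ∀ᵐ s ∂volume.restrict (Ioc (R.lo σ α) (R.hi σ α)),
      diracBulk d p' f σ α s = g.g σ s • diracBulk d p (f.untwist g) σ α s := by
  have hsub : Ioc (R.lo σ α) (R.hi σ α) ⊆ Ioc 0 (B.len σ) :=
    Ioc_subset_Ioc (R.lo_nonneg σ α) (R.hi_le σ α)
  filter_upwards [ae_restrict_of_ae_restrict_of_subset hsub (hg.ae_dg σ),
    ae_restrict_of_ae_restrict_of_subset hsub (ae_all_iff.2 fun j => hg.2.1 σ j)] with s h1 h2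
  have e1 : twistT d p' σ α s = twistT d p σ α s + (p.t0 σ s - p'.t0 σ s) • 1 := by
    simp only [twistT, h2]
    have : d.T0 σ α s - p'.t0 σ s • (1 : Matrix (Fin (R.rank σ α)) (Fin (R.rank σ α)) ℂ)
        = (d.T0 σ α s - p.t0 σ s • 1) + (p.t0 σ s - p'.t0 σ s) • 1 := by
      rw [sub_smul]
      abel
    rw [this, Matrix.kronecker_add, Matrix.kronecker_smul, Matrix.one_kronecker_one]
    abel
  have hu := g.mul_star_self h1.1
  have e2 : g.g σ s * star (g.dg σ s) = Complex.I * (p.t0 σ s - p'.t0 σ s) := by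
    rw [h1.2.2.1]
    linear_combination Complex.I * (p.t0 σ s - p'.t0 σ s) * hu
  simp only [diracBulk, TermSection.untwist, e1, Matrix.conjTranspose_add,
    Matrix.conjTranspose_smul, h1.2.2.2, Matrix.conjTranspose_one, Matrix.add_mulVec,
    Matrix.smul_mulVec, Matrix.one_mulVec, Matrix.mulVec_smul, smul_sub, smul_neg, smul_add,
    smul_smul, e2, hu, mul_left_comm (g.g σ s) Complex.I, mul_one, one_smul]
  abel

theorem diracLam_untwist (d : BowData R) (g : SmallGauge B) (f : TermSection R) (l : R.Lam0) :
    diracLam d f l = g.g l.1.1 (R.lam l.1.1 l.1.2) * diracLam d (f.untwist g) l := by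
  have hu := g.mul_star_self (lam_mem_len R l.1.1 l.1.2)
  simp only [diracLam, TermSection.untwist, dotProduct_smul, smul_eq_mul]
  linear_combination (star (d.Q l) ⬝ᵥ f.f l.1.1 l.1.2.succ (R.lam l.1.1 l.1.2)) * hu

theorem IsGaugeImage.star_b (hg : IsGaugeImage g p p') (σ : Fin k) (a : Fin 2) :
    star (p'.b σ a) = g.g σ (B.len σ) * star (p.b σ a) * star (g.g (σ + 1) 0) := by
  rw [hg.2.2, g.inv_eq (right_mem_len σ), star_mul', star_mul', star_star]

theorem IsGaugeImage.star_bc (hg : IsGaugeImage g p p') (σ : Fin k) (a : Fin 2) :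
    star (p'.bc σ a) = star (g.g σ (B.len σ)) * star (p.bc σ a) * g.g (σ + 1) 0 := by
  have h := hg.2.2 σ
  rw [g.inv_eq (right_mem_len σ)] at h
  rw [p.bc_eq, p'.bc_eq]
  fin_cases a
  · simp only [Fin.zero_eta, Matrix.cons_val_zero, star_neg, star_star, h]
    ring
  · simp only [Fin.mk_one, Matrix.cons_val_one, Matrix.cons_val_fin_one, star_star, h]

theorem diracPlus_untwist (hg : IsGaugeImage g p p') (f : TermSection R) (σ : Fin k) :
    diracPlus d p' f σ = g.g σ (B.len σ) • diracPlus d p (f.untwist g) σ := by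
  have hu := g.mul_star_self (right_mem_len σ)
  simp only [diracPlus, TermSection.untwist, Matrix.mulVec_smul, smul_sub, smul_smul, hu, one_smul]
  congr 1
  ext i
  simp only [Pi.smul_apply, smul_eq_mul, hg.star_b, Finset.mul_sum]
  exact Finset.sum_congr rfl fun a _ => by ring

theorem diracMinus_untwist (hg : IsGaugeImage g p p') (f : TermSection R) (σ : Fin k) :
    diracMinus d p' f σ = g.g (σ + 1) 0 • diracMinus d p (f.untwist g) σ := by
  have hu := g.mul_star_self (left_mem_len (σ + 1))
  simp only [diracMinus, TermSection.untwist, Matrix.mulVec_smul, smul_sub, smul_smul, hu, one_smul]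
  congr 1
  ext i
  simp only [Pi.smul_apply, smul_eq_mul, hg.star_bc, Finset.mul_sum]
  exact Finset.sum_congr rfl fun a _ => by ring

theorem star_smul_dotProduct_smul {ι : Type*} [Fintype ι] {z : ℂ} (hz : star z * z = 1)
    (u v : ι → ℂ) : star (z • u) ⬝ᵥ (z • v) = star u ⬝ᵥ v := by
  rw [star_smul, smul_dotProduct, dotProduct_smul, smul_smul, hz, one_smul]

/-- The kernel of the adjoint Dirac operator is equivariant under gauge transformations. -/
theorem IsGaugeImage.mem_kerDiracAdj (hg : IsGaugeImage g p p') {Ψ Ψ' : Target R}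
    (hΨ : IsGaugeImageOf g Ψ Ψ') (h : Ψ ∈ kerDiracAdj d p) : Ψ' ∈ kerDiracAdj d p' := by
  intro f
  obtain ⟨h1, h2⟩ := h (f.untwist g)
  have e : ∀ σ α, (fun s => star (diracBulk d p (f.untwist g) σ α s) ⬝ᵥ Ψ.1 σ α s)
      =ᵐ[volume.restrict (Ioc (R.lo σ α) (R.hi σ α))]
      fun s => star (diracBulk d p' f σ α s) ⬝ᵥ Ψ'.1 σ α s := fun σ α => by
    filter_upwards [diracBulk_untwist (d := d) hg f σ α, hΨ.1 σ α,
      ae_restrict_mem measurableSet_Ioc] with s h3 h4 h5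
    rw [h3, h4, star_smul_dotProduct_smul (g.star_mul_self (mem_Icc_len (Ioc_subset_Icc_self h5)))]
  refine ⟨fun σ α => (h1 σ α).congr (e σ α), ?_⟩
  rw [← h2]
  unfold diracPairing
  refine congrArg₂ (· + ·) (congrArg₂ (· + ·) (congrArg₂ (· + ·) ?_ ?_) ?_) ?_
  · exact Finset.sum_congr rfl fun σ _ => Finset.sum_congr rfl fun α _ =>
      (integral_congr_ae (e σ α)).symm
  · refine Finset.sum_congr rfl fun l _ => ?_
    have hu := g.star_mul_self (lam_mem_len R l.1.1 l.1.2)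
    rw [diracLam_untwist d g, hΨ.2.1, star_mul']
    linear_combination (star (diracLam d (f.untwist g) l) * Ψ.2.1 l) * hu
  · refine Finset.sum_congr rfl fun σ _ => ?_
    rw [diracPlus_untwist hg, hΨ.2.2.1, star_smul_dotProduct_smul (g.star_mul_self (right_mem_len σ))]
  · refine Finset.sum_congr rfl fun σ _ => ?_
    rw [diracMinus_untwist hg, hΨ.2.2.2,
      star_smul_dotProduct_smul (g.star_mul_self (left_mem_len (σ + 1)))]

/-- Evaluation at a point of the gauge orbit. -/
def instantonEval (d : BowData R) (p : LevelSet B ν) :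
    instantonFibre d (Quot.mk _ p : TaubNUT B ν) →ₗ[ℂ] kerDiracAdj d p where
  toFun v := ⟨v.1 ⟨p, rfl⟩, v.2.1 ⟨p, rfl⟩⟩
  map_add' _ _ := rfl
  map_smul' _ _ := rfl

theorem exists_gauge_of_mk_eq {p q : LevelSet B ν}
    (h : (Quot.mk _ q : TaubNUT B ν) = Quot.mk _ p) : ∃ g, IsGaugeImage g p q :=
  isGaugeImage_equivalence.eqvGen_iff.1 (Quot.eqvGen_exact h.symm)

/-- Equivariance determines a family from its value at p. Conversely, a vector of the kernel at p is
transported along the orbit, and the freeness of the based action makes the result equivariant. -/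
theorem instantonEval_bijective (hν : Function.Injective ν) (d : BowData R) (p : LevelSet B ν) :
    Function.Bijective (instantonEval d p) := by
  constructor
  · rw [injective_iff_map_eq_zero]
    intro v hv
    have h0 : v.1 ⟨p, rfl⟩ = 0 := congrArg Subtype.val hv
    refine Subtype.ext (funext fun q => ?_)
    obtain ⟨g, hg⟩ := exists_gauge_of_mk_eq q.2
    have h1 := v.2.2 ⟨p, rfl⟩ q g hg
    rw [h0] at h1
    exact h1.unique (isGaugeImageOf_zero R g)
  · intro Ψ
    choose g hg using fun q : {q : LevelSet B ν // (Quot.mk _ q : TaubNUT B ν) = Quot.mk _ p} =>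
      exists_gauge_of_mk_eq q.2
    choose v hv using fun q => exists_isGaugeImageOf (g q) Ψ.1
    refine ⟨⟨v, fun q => (hg q).mem_kerDiracAdj (hv q) Ψ.2, fun q q' h hh => ?_⟩, ?_⟩
    -- The transformation chosen for q′ and the one for q followed by h have the same effect on p,
    -- hence agree.
    · refine (hv q).mul ((hv q').congr fun σ s hs => ?_)
      exact (hg q').unique hν ((hg q).mul hh) σ hs
    · refine Subtype.ext ?_
      refine (hv ⟨p, rfl⟩).unique ((isGaugeImageOf_one Ψ.1).congr fun σ s hs => ?_)
      exact (isGaugeImage_one p).unique hν (hg ⟨p, rfl⟩) σ hs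

theorem finrank_instantonFibre (hν : Function.Injective ν) (hd : d.IsSolution ν) (hWAF : d.WAF)
    (x : TaubNUT B ν) : Module.Finite ℂ (instantonFibre d x) ∧
      Module.finrank ℂ (instantonFibre d x) = R.numLam := by
  induction x using Quot.ind with
  | mk p =>
    have e := LinearEquiv.ofBijective (instantonEval d p) (instantonEval_bijective hν d p)
    obtain ⟨h1, h2⟩ := finrank_kerDiracAdj_eq hν hd hWAF p
    exact ⟨Module.Finite.equiv e.symm, e.finrank_eq.trans h2⟩

end

end BowIndex

end

theorem theorem3p6 {k : ℕ} [NeZero k] (B : BowIndex.Bow k) (R : BowIndex.BowRep B)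
    (ν : Fin k → Fin 3 → ℝ) (hν : Function.Injective ν)
    (d : BowIndex.BowData R) (hd : d.IsSolution ν) (hWAF : d.WAF) :
    (∀ p : BowIndex.LevelSet B ν,
      Module.Finite ℂ (BowIndex.kerDiracAdj d p) ∧
        Module.finrank ℂ (BowIndex.kerDiracAdj d p) = R.numLam) ∧
    (∀ x : BowIndex.TaubNUT B ν,
      Module.Finite ℂ (BowIndex.instantonFibre d x) ∧
        Module.finrank ℂ (BowIndex.instantonFibre d x) = R.numLam) := by
  exact ⟨BowIndex.finrank_kerDiracAdj_eq hν hd hWAF,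
    BowIndex.finrank_instantonFibre hν hd hWAF⟩
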